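/- **Setting.** Let $\rho_0=\rho$ and $\rho_1=\sigma$ be states on $\mathbb C^d$ (hypotheses $H_0$, $H_1$) with priors $\eta_0,\eta_1>0$, $\eta_0+\eta_1=1$. A measurement (POVM) $K$ on blocks of $\ell$ copies has outcome distributions $p_K^\ell$ under $\rho^{\otimes\ell}$ and $q_K^\ell$ under $\sigma^{\otimes \ell}$. Block-sampling with $K$ applies $K$ to consecutive blocks of $\ell$ fresh copies and runs Wald's sequential probability ratio test (SPRT) on the outcomes, stopping after the first block at which one of the hypotheses may be accepted. Two criteria are considered. *Strong*: $H_\nu$ is accepted when its posterior probability is at least $1-\epsilon_\nu$. *Weak*: with $\epsilon_0=\beta$ and $\epsilon_1=\alpha$ the prescribed bounds on the type II and type I errors, $H_0$ is accepted when the likelihood ratio $q/p$ is at most $\beta$, and $H_1$ when it is at least $1/\alpha$. Let $\langle N\rangle_\nu$ be the mean number of copies under $H_\nu$, and write $D_0=D(\rho\|\sigma)$, $D_1=D(\sigma\|\rho)$. A relation $\langle N\rangle_\nu\sim-\log\epsilon_\nu/D$ means $\langle N\rangle_\nu/(-\log\epsilon_\nu)\to 1/D\in[0,\infty]$. For a sequence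 of measurements on blocks of length $\ell$, we say that it *attains* $-\log\epsilon_\nu/D$ if this holds, for both criteria and all priors, whenever $\epsilon_0,\epsilon_1\to0$ (independently of each other) and $\ell\to\infty$ with $\ell=o(-\log\epsilon_\nu)$. **Theorem.** 1. Under the weak criterion the errors satisfy $P(\hat H_1|\rho)\le\alpha$ and $P(\hat H_0|\sigma)\le\beta$. 2. For every fixed $\ell\ge1$ and $K$, as $\epsilon_0,\epsilon_1\to0$, $\langle N\rangle_0\sim-\ell\log\epsilon_0/D(p^\ell_K\|q^\ell_K)$, and $\inf_K\langle N\rangle_0\sim\ell\inf_K\frac{-\log\epsilon_0}{D(p^\ell_K\|q^\ell_K)}$. Moreover $\inf_K \ell/D(p^\ell_K\|q^\ell_K)\to1/D(\rho\|\sigma)$ as $\ell\to\infty$, and the infimum of $\langle N\rangle_0$ over all $\ell\geq 1$ and $K$ satisfies $\inf_{\ell,K}\langle N\rangle_0\sim-\log\epsilon_0/D(\rho\|\sigma)$. The same holds for $\langle N\rangle_1$ with the roles of $\rho$ and $\sigma$ exchanged. 3. For every state $\sigma$ there are measurements on blocks of $\ell$ copies, $\ell=1,2,\dots$, depending only on $\sigma$,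 that attain $\langle N\rangle_0\sim-\log\epsilon_0/D(\rho\|\sigma)$ for every $\rho$; likewise for $\langle N\rangle_1$ with measurements that depend only on $\rho$. (This is the leading order of the converse lower bound for that hypothesis.) 4. Let $\rho\ne\sigma$ and let $D_0$, $D_1$ be not both infinite. For all $\epsilon_0,\epsilon_1\in(0,1)$ the limit $$G(\epsilon_0,\epsilon_1)=\lim_{\ell\to\infty}\inf_K\Big(\frac{-\ell\,\eta_0\log\epsilon_0}{D(p_K^\ell\|q_K^\ell)}+\frac{-\ell\,\eta_1\log\epsilon_1}{D(q_K^\ell\|p_K^\ell)}\Big)$$ exists, and, for each $\ell_0\ge1$ and each criterion, the infimum of $\eta_0\langle N\rangle_0+\eta_1\langle N\rangle_1$ over block-sampling strategies with block length $\ell\ge\ell_0$ is $\sim G(\epsilon_0,\epsilon_1)$ as $\epsilon_0,\epsilon_1\to0$. 5. If $\rho$ and $\sigma$ commute, one sequence of measurements attains both $\langle N\rangle_0\sim-\log\epsilon_0/D(\rho\|\sigma)$ and $\langle N\rangle_1\sim-\log\epsilon_1/D(\sigma\|\rho)$. 6. If $\operatorname{supp}\sigma\not\subseteq\operatorname{supp}\rho$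 (in particular if $\operatorname{supp}\sigma\cap\ker\rho\ne0$), then $D(\sigma\|\rho)=\infty$ and there are a sequence of measurements, a single-copy measurement $E$ and a constant $C$ such that (a) block-sampling attains $\langle N\rangle_0\sim-\log\epsilon_0/D(\rho\|\sigma)$ while $\langle N\rangle_1\le C\ell$ for all $\ell$ and all error bounds $\epsilon_0,\epsilon_1>0$, so that $\langle N\rangle_1=O(1)$ for each block length; (b) if the block-sampling is preceded by $\ell$ measurements of $E$ on single copies (with stopping allowed after each of them), the same relation for $\langle N\rangle_0$ is attained while $\langle N\rangle_1\le C$ for all $\ell$ and all $\epsilon_0,\epsilon_1>0$. The same holds with the roles of the hypotheses exchanged. 7. (Qubits.) Let $\rho=\frac12(\mathbb 1+r_0\,\vec u\cdot\vec\sigma)$ and $\sigma=\frac12(\mathbb 1+r_1\,\vec v\cdot\vec\sigma)$ with $r_0,r_1\in[0,1]$ and unit vectors $\vec u,\vec v$ at an angle $\theta$. Let $M_\sigma$ be the simultaneous measurement on $\ell$ qubits of $J^2$ and of the component of the total angular momentum along $\vec v$, with outcome distributions $p^\ell$ (for $\rho$) and $q^\ell$ (for $\sigma$). Then $\frac1\ell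 D(p^\ell\|q^\ell)\to D(\rho\|\sigma)$ and $$\tfrac1\ell D(q^\ell\|p^\ell)\to D_{M_\sigma}(\sigma\|\rho)=\tfrac12(1-r_1)\log\frac{1-r_1^2}{1-r_0^2}+r_1\log\frac{1+r_1}{1+r_0\cos\theta},$$ where $0\log 0=0\log\frac00=0$ and the value is $\infty$ if $r_0=1>r_1$, or if $r_0\cos\theta=-1$. For $r_0<1$ it equals $D(\lambda_1\|\lambda_0)+r_1\log\frac{1+r_0}{1+r_0\cos\theta}$, where $D(\lambda_1\|\lambda_0)$ is the relative entropy of the spectra of $\sigma$ and $\rho$. Block-sampling with $M_\sigma$ attains $\langle N\rangle_0\sim-\log\epsilon_0/D(\rho\|\sigma)$ and $\langle N\rangle_1\sim-\log\epsilon_1/D_{M_\sigma}(\sigma\|\rho)$; under the weak criterion these read $-\log\beta/D(\rho\|\sigma)$ and $-\log\alpha/D_{M_\sigma}(\sigma\|\rho)$. -/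

import Mathlib

open MeasureTheory Filter Topology
open scoped ENNReal NNReal Matrix ComplexOrder

namespace SeqQHT

noncomputable section

/-! ### States, relative entropy, collective measurements -/

/-- A quantum state on `ℂ^d`: a positive semidefinite matrix of trace one. -/
structure State (d : ℕ) where
  mat : Matrix (Fin d) (Fin d) ℂ
  posSemidef : mat.PosSemidef
  trace_eq_one : mat.trace = 1

/-- The support of a state, i.e. the range of its matrix. -/
def State.supp {d : ℕ} (ρ : State d) : Submodule ℂ (Fin d → ℂ) :=
  LinearMap.range ρ.mat.mulVecLin

open scoped Classical in
/-- The quantum relative entropy `D(ρ‖σ) = tr ρ (log ρ - log σ)`, with value `∞` unless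
`supp ρ ⊆ supp σ`. The logarithm is the functional calculus of `Real.log` (with `log 0 = 0`, so
that it is the logarithm on the support); the real number inside `ENNReal.ofReal` is nonnegative
for all states with `supp ρ ⊆ supp σ`. -/
def relEntropy {d : ℕ} (ρ σ : State d) : ℝ≥0∞ :=
  if ρ.supp ≤ σ.supp then
    ENNReal.ofReal (ρ.mat * (cfc Real.log ρ.mat - cfc Real.log σ.mat)).trace.re
  else ∞

/-- The `ℓ`-fold tensor power of a matrix, in the product basis indexed by `Fin ℓ → Fin d`. -/
def tensorPower {d : ℕ} (ℓ : ℕ) (X : Matrix (Fin d) (Fin d) ℂ) :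
    Matrix (Fin ℓ → Fin d) (Fin ℓ → Fin d) ℂ :=
  Matrix.of fun x y => ∏ i, X (x i) (y i)

/-- A collective measurement (POVM with finitely many outcomes) on a block of `ℓ` copies. -/
structure BlockPOVM (d ℓ : ℕ) where
  outcomes : ℕ
  effect : Fin outcomes → Matrix (Fin ℓ → Fin d) (Fin ℓ → Fin d) ℂ
  posSemidef : ∀ x, (effect x).PosSemidef
  sum_effect : ∑ x, effect x = 1

/-- Born rule: the probability `tr (E_x ρ^{⊗ℓ})` of the outcome `x`. -/
def BlockPOVM.prob {d ℓ : ℕ} (K : BlockPOVM d ℓ) (ρ : State d) (x : Fin K.outcomes) : ℝ :=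
  (K.effect x * tensorPower ℓ ρ.mat).trace.re

/-- The distribution of the outcome of `K` on `ρ^{⊗ℓ}`, as a measure. -/
def BlockPOVM.law {d ℓ : ℕ} (K : BlockPOVM d ℓ) (ρ : State d) : Measure (Fin K.outcomes) :=
  Measure.sum fun x => ENNReal.ofReal (K.prob ρ x) • Measure.dirac x

/-- The relative entropy `D(p‖q)` of the distributions of the outcomes of `K` on `ρ^{⊗ℓ}` and on
`σ^{⊗ℓ}`. -/
def BlockPOVM.relEntropy {d ℓ : ℕ} (K : BlockPOVM d ℓ) (ρ σ : State d) : ℝ≥0∞ :=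
  InformationTheory.klDiv (K.law ρ) (K.law σ)

theorem tensorPower_posSemidef {d : ℕ} (ℓ : ℕ) {X : Matrix (Fin d) (Fin d) ℂ}
    (hX : X.PosSemidef) : (tensorPower ℓ X).PosSemidef := by
  obtain ⟨B, rfl⟩ : ∃ B : Matrix (Fin d) (Fin d) ℂ, X = Bᴴ * B := by
    open scoped MatrixOrder in
    exact CStarAlgebra.nonneg_iff_eq_star_mul_self.mp hX.nonneg
  have h : tensorPower ℓ (Bᴴ * B) = (tensorPower ℓ B)ᴴ * tensorPower ℓ B := by
    ext x y
    simp only [tensorPower, Matrix.of_apply, Matrix.mul_apply, Matrix.conjTranspose_apply]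
    rw [Finset.prod_univ_sum]
    simp [Finset.prod_mul_distrib]
  rw [h]
  exact Matrix.posSemidef_conjTranspose_mul_self _

theorem trace_tensorPower {d : ℕ} (ℓ : ℕ) (X : Matrix (Fin d) (Fin d) ℂ) :
    (tensorPower ℓ X).trace = X.trace ^ ℓ := by
  have h := Finset.prod_univ_sum (fun _ : Fin ℓ => (Finset.univ : Finset (Fin d)))
    (fun _ a => X a a)
  simp only [Finset.prod_const, Finset.card_univ, Fintype.card_fin, Fintype.piFinset_univ] at h
  simp [tensorPower, Matrix.trace, h]

theorem BlockPOVM.prob_nonneg {d ℓ : ℕ} (K : BlockPOVM d ℓ) (ρ : State d) (x : Fin K.outcomes) :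
    0 ≤ K.prob ρ x := by
  obtain ⟨B, hB⟩ : ∃ B, tensorPower ℓ ρ.mat = star B * B := by
    open scoped MatrixOrder in
    exact CStarAlgebra.nonneg_iff_eq_star_mul_self.mp
      (tensorPower_posSemidef ℓ ρ.posSemidef).nonneg
  have h : (K.effect x * (star B * B)).trace = (B * K.effect x * star B).trace := by
    rw [← mul_assoc, Matrix.trace_mul_comm, ← mul_assoc]
  rw [BlockPOVM.prob, hB, h]
  exact (Complex.le_def.mp ((K.posSemidef x).mul_mul_conjTranspose_same B).trace_nonneg).1

theorem BlockPOVM.sum_prob {d ℓ : ℕ} (K : BlockPOVM d ℓ) (ρ : State d) :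
    ∑ x, K.prob ρ x = 1 := by
  simp only [BlockPOVM.prob]
  rw [← Complex.re_sum, ← Matrix.trace_sum, ← Finset.sum_mul, K.sum_effect, one_mul,
    trace_tensorPower, ρ.trace_eq_one]
  simp

instance {d ℓ : ℕ} (K : BlockPOVM d ℓ) (ρ : State d) : IsProbabilityMeasure (K.law ρ) where
  measure_univ := by
    simp only [BlockPOVM.law, Measure.sum_apply _ MeasurableSet.univ, Measure.smul_apply,
      measure_univ, smul_eq_mul, mul_one, tsum_fintype]
    rw [← ENNReal.ofReal_sum_of_nonneg fun x _ => K.prob_nonneg ρ x, K.sum_prob,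
      ENNReal.ofReal_one]

/-! ### Sequential probability ratio tests -/

/-- A measurement schedule: at stage `k = 0, 1, 2, …` fresh copies are taken, `(S k).1` of them,
and the collective measurement `(S k).2` is performed on them. -/
abbrev Schedule (d : ℕ) : Type := ℕ → Σ ℓ, BlockPOVM d ℓ

/-- Block-sampling: the same collective measurement on consecutive blocks of `ℓ` copies. -/
def blockSampling {d ℓ : ℕ} (K : BlockPOVM d ℓ) : Schedule d := fun _ => ⟨ℓ, K⟩

/-- Block-sampling with `K`, preceded by `t` stages in which `E` is measured on one copy each. -/
def prefixedSampling {d ℓ : ℕ} (t : ℕ) (E : BlockPOVM d 1) (K : BlockPOVM d ℓ) : Schedule d :=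
  fun k => if k < t then ⟨1, E⟩ else ⟨ℓ, K⟩

/-- Infinite records of outcomes. -/
abbrev Record {d : ℕ} (S : Schedule d) : Type := ∀ k, Fin (S k).2.outcomes

/-- The distribution of the record when all copies are in the state `ρ`: the outcomes of different
stages are independent. -/
def recordLaw {d : ℕ} (S : Schedule d) (ρ : State d) : Measure (Record S) :=
  Measure.infinitePi fun k => (S k).2.law ρ

/-- The probability under `ρ` of the first `n` outcomes of the record `ω`. -/
def likelihood {d : ℕ} (S : Schedule d) (ρ : State d) (n : ℕ) (ω : Record S) : ℝ :=
  ∏ k ∈ Finset.range n, (S k).2.prob ρ (ω k)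

/-- The two ways of constraining the errors: the strong conditions (posterior probability of the
accepted hypothesis at least `1 - ε_ν`), and prescribed bounds on the type I and type II errors. -/
inductive Criterion
  | strong
  | weak

/-- `Accepts c η e L ν`: the hypothesis `ν ∈ {0, 1}` is accepted when the likelihoods of the record
under the two hypotheses are `L 0` and `L 1`.

* Strong criterion, priors `η`, `e = (ε₀, ε₁)`: the posterior probability of `ν` is at least
  `1 - ε_ν`.
* Weak criterion, `e 0 = β` (bound on the type II error, accepting `0` wrongly) and `e 1 = α`
  (bound on the type I error, accepting `1` wrongly): Wald's test with the thresholds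
  `L 1 / L 0 ≤ β` for accepting `0` and `L 1 / L 0 ≥ 1 / α` for accepting `1`. -/
def Accepts (c : Criterion) (η e L : Fin 2 → ℝ) (ν : Fin 2) : Prop :=
  match c with
  | .strong => 1 - e ν ≤ η ν * L ν / (η 0 * L 0 + η 1 * L 1)
  | .weak => 0 < L ν ∧ L (1 - ν) ≤ e ν * L ν

/-- The data of a test: states `s 0 = ρ` and `s 1 = σ` of the two hypotheses, priors, criterion,
error bounds and measurement schedule. -/
structure SPRT (d : ℕ) where
  states : Fin 2 → State d
  prior : Fin 2 → ℝ
  criterion : Criterion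
  error : Fin 2 → ℝ
  schedule : Schedule d

namespace SPRT

variable {d : ℕ}

/-- After `n` stages the condition for accepting `ν` holds. -/
def AcceptsAt (T : SPRT d) (ν : Fin 2) (n : ℕ) (ω : Record T.schedule) : Prop :=
  Accepts T.criterion T.prior T.error (fun i => likelihood T.schedule (T.states i) n ω) ν

/-- The number `M` of stages at the stopping time: the first `n ≥ 1` such that one of the
hypotheses can be accepted after `n` stages (`∞` if there is none). -/
def stages (T : SPRT d) (ω : Record T.schedule) : ℕ∞ :=
  ⨅ (n : ℕ) (_ : 1 ≤ n ∧ ∃ ν, T.AcceptsAt ν n ω), (n : ℕ∞)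

/-- The number `N` of copies used up to the stopping time. -/
def copies (T : SPRT d) (ω : Record T.schedule) : ℝ≥0∞ :=
  open scoped Classical in
  ∑' k : ℕ, if (k : ℕ∞) < T.stages ω then ((T.schedule k).1 : ℝ≥0∞) else 0

/-- The mean number of copies `⟨N⟩_ν` when hypothesis `ν` is true. -/
def meanCopies (T : SPRT d) (ν : Fin 2) : ℝ≥0∞ :=
  ∫⁻ ω, T.copies ω ∂(recordLaw T.schedule (T.states ν))

/-- The probability of accepting `ν` when the other hypothesis is true: type II error for `ν = 0`,
type I error for `ν = 1`. -/
def errorProb (T : SPRT d) (ν : Fin 2) : ℝ≥0∞ :=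
  recordLaw T.schedule (T.states (1 - ν))
    {ω | ∃ n : ℕ, T.stages ω = n ∧ T.AcceptsAt ν n ω}

end SPRT

/-- Priors: `η 0, η 1 > 0` and `η 0 + η 1 = 1`. -/
def IsPrior (η : Fin 2 → ℝ) : Prop := (∀ ν, 0 < η ν) ∧ η 0 + η 1 = 1

/-- `-log x`, as an extended nonnegative number; used for `0 < x < 1`. -/
def negLog (x : ℝ) : ℝ≥0∞ := ENNReal.ofReal (-Real.log x)

/-- The two error bounds tend to zero from above, independently of each other. -/
def smallErrors : Filter (Fin 2 → ℝ) := Filter.pi fun _ => 𝓝[>] 0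

/-- `AttainsRate s S ν D`: the sequential probability ratio tests with the schedules `S ℓ` satisfy
`⟨N⟩_ν ∼ -log ε_ν / D`, for both criteria and all priors, whenever the error bounds tend to zero and
`ℓ → ∞` with `ℓ = o(-log ε_ν)`. The relation is written as `⟨N⟩_ν / (-log ε_ν) → 1 / D`, which also
makes sense for `D = ∞` (the ratio tends to `0`) and `D = 0` (it tends to `∞`). -/
def AttainsRate {d : ℕ} (s : Fin 2 → State d) (S : ℕ → Schedule d) (ν : Fin 2) (D : ℝ≥0∞) : Prop :=
  ∀ (c : Criterion) (η : Fin 2 → ℝ), IsPrior η → ∀ (ℓ : ℕ → ℕ) (e : ℕ → Fin 2 → ℝ),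
    Tendsto ℓ atTop atTop → Tendsto e atTop smallErrors →
    Tendsto (fun n => (ℓ n : ℝ) / -Real.log (e n ν)) atTop (𝓝 0) →
    Tendsto (fun n => (SPRT.mk s η c (e n) (S (ℓ n))).meanCopies ν / negLog (e n ν)) atTop (𝓝 D⁻¹)

/-- The Bayesian mean number of copies `η₀ ⟨N⟩_0 + η₁ ⟨N⟩_1`. -/
def SPRT.bayesMean {d : ℕ} (T : SPRT d) : ℝ≥0∞ :=
  ∑ ν, ENNReal.ofReal (T.prior ν) * T.meanCopies ν

/-- `inf_K (-ℓ η₀ log ε₀ / D(p_K‖q_K) - ℓ η₁ log ε₁ / D(q_K‖p_K))` over the measurements `K` on `ℓ`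
copies. -/
def blockRate {d : ℕ} (s : Fin 2 → State d) (η e : Fin 2 → ℝ) (ℓ : ℕ) : ℝ≥0∞ :=
  ⨅ K : BlockPOVM d ℓ, ∑ ν : Fin 2,
    ENNReal.ofReal (η ν) * (ℓ * negLog (e ν) / K.relEntropy (s ν) (s (1 - ν)))

/-! ### Qubits and angular momentum -/

/-- The Pauli matrices. -/
def pauli : Fin 3 → Matrix (Fin 2) (Fin 2) ℂ :=
  ![!![0, 1; 1, 0], !![0, -Complex.I; Complex.I, 0], !![1, 0; 0, -1]]

/-- `ρ = (1 + r u·σ) / 2`: the qubit state of purity `r` along the axis `u`. -/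
def IsBloch (ρ : State 2) (r : ℝ) (u : EuclideanSpace ℝ (Fin 3)) : Prop :=
  ρ.mat = (1 / 2 : ℂ) • (1 + (r : ℂ) • ∑ a, (u a : ℂ) • pauli a)

/-- The operator `X` acting on the `i`-th of `ℓ` qubits. -/
def siteOp {ℓ : ℕ} (i : Fin ℓ) (X : Matrix (Fin 2) (Fin 2) ℂ) :
    Matrix (Fin ℓ → Fin 2) (Fin ℓ → Fin 2) ℂ :=
  open scoped Classical in
  Matrix.of fun x y => if ∀ j, j ≠ i → x j = y j then X (x i) (y i) else 0

/-- The component `J_a` of the total angular momentum of `ℓ` spins one half. -/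
def angMom (ℓ : ℕ) (a : Fin 3) : Matrix (Fin ℓ → Fin 2) (Fin ℓ → Fin 2) ℂ :=
  (1 / 2 : ℂ) • ∑ i, siteOp i (pauli a)

/-- The total angular momentum `J² = J_x² + J_y² + J_z²`. -/
def angMomSq (ℓ : ℕ) : Matrix (Fin ℓ → Fin 2) (Fin ℓ → Fin 2) ℂ :=
  ∑ a, angMom ℓ a * angMom ℓ a

/-- The component of the total angular momentum along the axis `v`. -/
def angMomAlong (ℓ : ℕ) (v : EuclideanSpace ℝ (Fin 3)) :
    Matrix (Fin ℓ → Fin 2) (Fin ℓ → Fin 2) ℂ :=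
  ∑ a, (v a : ℂ) • angMom ℓ a

/-- `K` is the simultaneous measurement of `J²` and of the component of `J` along `v`: the outcomes
are labelled by distinct pairs `(j, m)`, and the effect of an outcome is the orthogonal projector
onto the joint eigenspace for the eigenvalues `j (j + 1)` and `m`. -/
def IsAngMomMeasurement {ℓ : ℕ} (v : EuclideanSpace ℝ (Fin 3)) (K : BlockPOVM 2 ℓ) : Prop :=
  ∃ j m : Fin K.outcomes → ℝ, (∀ x, 0 ≤ j x) ∧ Function.Injective (fun x => (j x, m x)) ∧
    ∀ x, K.effect x * K.effect x = K.effect x ∧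
      ∀ w, K.effect x *ᵥ w = w ↔
        angMomSq ℓ *ᵥ w = ((j x * (j x + 1) : ℝ) : ℂ) • w ∧ angMomAlong ℓ v *ᵥ w = (m x : ℂ) • w

/-- The explicit rate
`(1 - r₁)/2 log ((1 - r₁²)/(1 - r₀²)) + r₁ log ((1 + r₁)/(1 + r₀ cos θ))`, with the convention
`0 log 0 = 0`; it is infinite if one of the logarithms is infinite and has a nonzero coefficient. -/
def qubitRate (r₀ r₁ θ : ℝ) : ℝ≥0∞ :=
  open scoped Classical in
  if (r₀ < 1 ∨ r₁ = 1) ∧ -1 < r₀ * Real.cos θ then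
    ENNReal.ofReal (1 / 2 * (1 - r₁) * Real.log ((1 - r₁ ^ 2) / (1 - r₀ ^ 2))
      + r₁ * Real.log ((1 + r₁) / (1 + r₀ * Real.cos θ)))
  else ∞

/-- The relative entropy of the spectra `((1 + r) / 2, (1 - r) / 2)` and `((1 + t) / 2, (1 - t) / 2)`
of qubit states of purities `r` and `t`. -/
def spectralEntropy (r t : ℝ) : ℝ :=
  1 / 2 * (1 + r) * Real.log ((1 + r) / (1 + t)) + 1 / 2 * (1 - r) * Real.log ((1 - r) / (1 - t))

end

end SeqQHT

open SeqQHT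

namespace SeqQHT

noncomputable section

/-! ### Relative entropy of finite distributions -/

/-! The classical half is Wald's analysis of the test by its log-likelihood ratio in favour of the
true hypothesis, stopped when the test stops. The decision to perform a stage depends only on
earlier outcomes, so the mean of the stopped ratio is the sum over stages of (probability that the
stage is performed) times (relative entropy of that stage): `SPRT.integral_stoppedLLR`. If every
stage yields `D` per copy, this sum is `D` times the mean number of copies, and only the size of the
stopped ratio is left to estimate. Before the last stage it lies below the threshold, and one stage
adds at most a constant `B`, which gives the upper bound `SPRT.meanCopies_le`. For the lower bound,
correct acceptance means that the ratio has reached the threshold, wrong acceptance is rare by a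
change of measure, and elsewhere the ratio is at least `-exp (-ratio)`, whose mean is at least `-1`:
`SPRT.div_le_meanCopies`. If the relative entropy is infinite, some outcome excludes the other
hypothesis outright, and waiting for it takes a geometric time. The strong criterion is the weak one
with thresholds whose logarithms are asymptotically the same. `tendsto_meanCopies` collects these
facts.

The quantum half determines how much relative entropy per copy a measurement on a block can yield.
At most `D(ρ‖σ)`: `BlockPOVM.relEntropy_le` compares outcome distributions with the pair `a_i |⟨u_i,
v_j⟩|²`, `b_j |⟨u_i, v_j⟩|²` built from the two eigenbases, whose classical relative entropy is the
quantum one. The comparison is made for the quadratic divergences `∑ p² / (q + s p)`, where it is a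
completed square, and is then integrated over `s`. Conversely, take a resolution of the identity
into as many orthogonal projectors as possible that commute with all permutations of the copies and
with `σ^{⊗ℓ}`. Its length is at most `(ℓ + 1)^(d * d)`, because the commutant of the permutations
has polynomial dimension. By maximality every `ρ^{⊗ℓ}` compresses to a scalar on each projector
(`IsResolution.exists_smul_eq`), so the loss is at most the logarithm of the number of outcomes
(`BlockPOVM.IsSharp.mul_relEntropy_le`) and vanishes per copy. The measurement depends on `σ` alone;
for commuting states one resolution serves both. If the supports are not nested, one extra copy per
block is reserved for detecting the excluded hypothesis.

For the Bayesian mean, repeating a measurement on parts of a longer block shows that the limit over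
`ℓ` is the infimum over all blocks. Uniformity in the ratio of the two logarithms comes from
compactness of the normalized weights.

For qubits, the outcomes of the spin measurement are weight spaces of ladders. After a rotation, the
other state factors as lower triangular times diagonal times upper triangular, and the tensor power
of the triangular factor is the exponential of a ladder operator. Its compression to a weight space
is therefore an explicit sum (`ladderSum`). The leading term `a^p d^q` of this sum gives the rate.
The rest costs a factor controlled by the distance to the top of the ladder, whose mean is at most
`√ℓ` (`IsSpinLaw.sum_depth_le`). -/

/-- The sum `∑ p log (p / q)`. -/
def klSum {α : Type*} [Fintype α] (p q : α → ℝ) : ℝ := ∑ x, p x * Real.log (p x / q x)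

theorem sub_le_mul_log {a b : ℝ} (ha : 0 ≤ a) (hb : 0 ≤ b) (hab : b = 0 → a = 0) :
    a - b ≤ a * Real.log (a / b) := by
  rcases ha.eq_or_lt with rfl | ha
  · simpa using hb
  have hb' : 0 < b := hb.lt_of_ne fun h => ha.ne' (hab h.symm)
  have h := Real.one_sub_inv_le_log_of_pos (div_pos ha hb')
  calc a - b = a * (1 - (a / b)⁻¹) := by field_simp
    _ ≤ _ := mul_le_mul_of_nonneg_left h ha.le

theorem klSum_nonneg {α : Type*} [Fintype α] {p q : α → ℝ} (hp : ∀ x, 0 ≤ p x) (hq : ∀ x, 0 ≤ q x)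
    (hsum : ∑ x, q x ≤ ∑ x, p x) (hac : ∀ x, q x = 0 → p x = 0) : 0 ≤ klSum p q := by
  have h : ∑ x, (p x - q x) ≤ klSum p q :=
    Finset.sum_le_sum fun x _ => sub_le_mul_log (hp x) (hq x) (hac x)
  rw [Finset.sum_sub_distrib] at h
  linarith

theorem klSum_prod {α β : Type*} [Fintype α] [Fintype β] {p q : α → ℝ} {p' q' : β → ℝ}
    (hp : ∑ x, p x = 1) (hp' : ∑ x, p' x = 1)
    (hac : ∀ x, q x = 0 → p x = 0) (hac' : ∀ x, q' x = 0 → p' x = 0) :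
    klSum (fun z : α × β => p z.1 * p' z.2) (fun z => q z.1 * q' z.2) = klSum p q + klSum p' q' := by
  have key : ∀ x y, p x * p' y * Real.log (p x * p' y / (q x * q' y)) =
      p x * Real.log (p x / q x) * p' y + p x * (p' y * Real.log (p' y / q' y)) := by
    intro x y
    by_cases h1 : p x = 0
    · simp [h1]
    by_cases h2 : p' y = 0
    · simp [h2]
    have h3 : q x ≠ 0 := fun h => h1 (hac x h)
    have h4 : q' y ≠ 0 := fun h => h2 (hac' y h)
    rw [mul_div_mul_comm, Real.log_mul (div_ne_zero h1 h3) (div_ne_zero h2 h4)]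
    ring
  simp only [klSum, Fintype.sum_prod_type, key, Finset.sum_add_distrib, ← Finset.mul_sum]
  simp only [hp', mul_one, ← Finset.sum_mul, hp, one_mul]

theorem klSum_comp_equiv {α β : Type*} [Fintype α] [Fintype β] (e : α ≃ β) (p q : β → ℝ) :
    klSum (p ∘ e) (q ∘ e) = klSum p q :=
  e.sum_comp fun x => p x * Real.log (p x / q x)

/-- The relative entropy of independent repetitions. -/
theorem klSum_pi {α : Type*} [Fintype α] {p q : α → ℝ}
    (hp : ∑ x, p x = 1) (hac : ∀ x, q x = 0 → p x = 0) (ℓ : ℕ) :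
    klSum (fun x : Fin ℓ → α => ∏ i, p (x i)) (fun x => ∏ i, q (x i)) = ℓ * klSum p q := by
  induction ℓ with
  | zero => simp [klSum]
  | succ ℓ ih =>
    have hs : ∑ x : Fin ℓ → α, ∏ i, p (x i) = 1 := by
      classical
      have := Finset.prod_univ_sum (fun _ : Fin ℓ => (Finset.univ : Finset α)) (fun _ a => p a)
      simp only [Fintype.piFinset_univ] at this
      simp [← this, hp]
    have hac' : ∀ x : Fin ℓ → α, ∏ i, q (x i) = 0 → ∏ i, p (x i) = 0 := by
      intro x hx
      obtain ⟨i, -, hi⟩ := Finset.prod_eq_zero_iff.mp hx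
      exact Finset.prod_eq_zero (Finset.mem_univ i) (hac _ hi)
    have h := klSum_prod hp hs hac hac'
    rw [ih] at h
    rw [← klSum_comp_equiv (Fin.consEquiv fun _ => α)]
    have e1 : ∀ f : α → ℝ, (fun x : Fin (ℓ + 1) → α => ∏ i, f (x i)) ∘ (Fin.consEquiv fun _ => α) =
        fun z : α × (Fin ℓ → α) => f z.1 * ∏ i, f (z.2 i) := by
      intro f
      ext z
      simp [Fin.consEquiv, Fin.prod_univ_succ]
    rw [e1, e1, h]
    push_cast
    ring

/-- If the family of divergences `∑ p² / (q + s p)`, `s > 0`, is smaller for one pair of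
distributions, then so is the relative entropy. -/
theorem klSum_le_of_forall_pos {α β : Type*} [Fintype α] [Fintype β] {p q : α → ℝ} {P Q : β → ℝ}
    (hp : ∀ x, 0 ≤ p x) (hq : ∀ x, 0 ≤ q x) (hP : ∀ x, 0 ≤ P x) (hQ : ∀ x, 0 ≤ Q x)
    (hac : ∀ x, q x = 0 → p x = 0) (hAC : ∀ x, Q x = 0 → P x = 0)
    (hsum : ∑ x, p x = ∑ x, P x)
    (h : ∀ s : ℝ, 0 < s → ∑ x, p x ^ 2 / (q x + s * p x) ≤ ∑ x, P x ^ 2 / (Q x + s * P x)) :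
    klSum p q ≤ klSum P Q := by
  have pos : ∀ {a b : ℝ}, 0 ≤ a → 0 ≤ b → (b = 0 → a = 0) → a ≠ 0 → ∀ s : ℝ, 0 ≤ s →
      0 < b + s * a := by
    intro a b ha hb hab ha0 s hs
    have : 0 < b := hb.lt_of_ne fun h => ha0 (hab h.symm)
    positivity
  have der : ∀ {a b : ℝ}, 0 ≤ a → 0 ≤ b → (b = 0 → a = 0) → ∀ s : ℝ, 0 ≤ s →
      HasDerivAt (fun s => a * Real.log (b + s * a)) (a ^ 2 / (b + s * a)) s := by
    intro a b ha hb hab s hs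
    by_cases ha0 : a = 0
    · simpa [ha0] using hasDerivAt_const s (0 : ℝ)
    have h1 : HasDerivAt (fun s => b + s * a) a s := by
      simpa using ((hasDerivAt_id s).mul_const a).const_add b
    exact ((h1.log (pos ha hb hab ha0 s hs).ne').const_mul a).congr_deriv (by ring)
  have lim : ∀ {a b : ℝ}, 0 ≤ a → 0 ≤ b → (b = 0 → a = 0) →
      Tendsto (fun s : ℝ => a * Real.log (b + s * a) - a * Real.log s) atTop
        (𝓝 (a * Real.log a)) := by
    intro a b ha hb hab
    by_cases ha0 : a = 0
    · simp [ha0]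
    have h1 : Tendsto (fun s : ℝ => b / s + a) atTop (𝓝 a) := by
      simpa using (tendsto_const_nhds.div_atTop tendsto_id).add_const a
    have h2 := ((Real.continuousAt_log ha0).tendsto.comp h1).const_mul a
    refine h2.congr' ?_
    filter_upwards [eventually_gt_atTop 0] with s hs
    have h3 : b / s + a = (b + s * a) / s := by field_simp
    rw [Function.comp, h3, Real.log_div (pos ha hb hab ha0 s hs.le).ne' hs.ne']
    ring
  -- The derivative of `g` is the difference of the two quadratic divergences, so `g` is increasing.
  -- At `0` it gives the cross terms `∑ P log Q - ∑ p log q`, at infinity the entropy terms. The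
  -- divergent parts `log s` cancel because the total masses agree.
  let g : ℝ → ℝ := fun s => ∑ x, P x * Real.log (Q x + s * P x) - ∑ x, p x * Real.log (q x + s * p x)
  have hg : ∀ s : ℝ, 0 ≤ s → HasDerivAt g
      (∑ x, P x ^ 2 / (Q x + s * P x) - ∑ x, p x ^ 2 / (q x + s * p x)) s := fun s hs =>
    (HasDerivAt.fun_sum fun x _ => der (hP x) (hQ x) (hAC x) s hs).sub
      (HasDerivAt.fun_sum fun x _ => der (hp x) (hq x) (hac x) s hs)
  have hmono : MonotoneOn g (Set.Ici 0) := by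
    refine monotoneOn_of_deriv_nonneg (convex_Ici 0)
      (fun s hs => (hg s hs).continuousAt.continuousWithinAt) ?_ ?_
    · intro s hs
      rw [interior_Ici] at hs
      exact (hg s (le_of_lt hs)).differentiableAt.differentiableWithinAt
    · intro s hs
      rw [interior_Ici] at hs
      rw [(hg s (le_of_lt hs)).deriv]
      exact sub_nonneg.mpr (h s hs)
  have hlim : Tendsto g atTop (𝓝 (∑ x, P x * Real.log (P x) - ∑ x, p x * Real.log (p x))) := by
    have h1 := (tendsto_finsetSum Finset.univ fun x _ => lim (hP x) (hQ x) (hAC x)).sub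
      (tendsto_finsetSum Finset.univ fun x _ => lim (hp x) (hq x) (hac x))
    refine h1.congr fun s => ?_
    simp only [g, Finset.sum_sub_distrib, ← Finset.sum_mul, hsum]
    ring
  have h0 : g 0 ≤ ∑ x, P x * Real.log (P x) - ∑ x, p x * Real.log (p x) :=
    ge_of_tendsto hlim <| (eventually_ge_atTop 0).mono fun s hs =>
      hmono (Set.mem_Ici.mpr le_rfl) (Set.mem_Ici.mpr hs) hs
  have split : ∀ {a b : ℝ}, (b = 0 → a = 0) →
      a * Real.log (a / b) = a * Real.log a - a * Real.log b := by
    intro a b hab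
    by_cases ha0 : a = 0
    · simp [ha0]
    rw [Real.log_div ha0 fun h => ha0 (hab h)]
    ring
  simp only [g, zero_mul, add_zero] at h0
  simp only [klSum, fun x => split (hac x), fun x => split (hAC x), Finset.sum_sub_distrib]
  linarith

/-! ### The distributions of the outcomes -/

namespace BlockPOVM

variable {d ℓ : ℕ} (K : BlockPOVM d ℓ) (ρ σ : State d)

theorem law_singleton (x : Fin K.outcomes) : K.law ρ {x} = ENNReal.ofReal (K.prob ρ x) := by
  rw [law, Measure.sum_apply _ (measurableSet_singleton x), tsum_fintype,
    Finset.sum_eq_single x]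
  · simp
  · intro y _ hy
    simp [hy]
  · simp

theorem law_real_singleton (x : Fin K.outcomes) : (K.law ρ).real {x} = K.prob ρ x := by
  rw [Measure.real, law_singleton, ENNReal.toReal_ofReal (K.prob_nonneg ρ x)]

theorem integral_law (f : Fin K.outcomes → ℝ) : ∫ x, f x ∂(K.law ρ) = ∑ x, K.prob ρ x * f x := by
  rw [integral_fintype Integrable.of_finite]
  simp [law_real_singleton]

theorem law_absolutelyContinuous_iff :
    K.law ρ ≪ K.law σ ↔ ∀ x, K.prob σ x = 0 → K.prob ρ x = 0 := by
  constructor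
  · intro h x hx
    have h1 : K.law ρ {x} = 0 := h (by rw [law_singleton, hx, ENNReal.ofReal_zero])
    rw [law_singleton, ENNReal.ofReal_eq_zero] at h1
    exact le_antisymm h1 (K.prob_nonneg ρ x)
  · intro h s hs
    have h1 : ∀ x ∈ s, K.law ρ {x} = 0 := by
      intro x hx
      have h2 : K.law σ {x} = 0 := measure_mono_null (Set.singleton_subset_iff.mpr hx) hs
      rw [law_singleton, ENNReal.ofReal_eq_zero] at h2
      rw [law_singleton, h x (le_antisymm h2 (K.prob_nonneg σ x)), ENNReal.ofReal_zero]
    rw [← Set.biUnion_of_singleton s]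
    exact (measure_biUnion_null_iff (Set.to_countable s)).mpr h1

theorem relEntropy_eq_top {x : Fin K.outcomes} (hx : K.prob σ x = 0) (hx' : K.prob ρ x ≠ 0) :
    K.relEntropy ρ σ = ∞ :=
  InformationTheory.klDiv_of_not_ac fun h =>
    hx' ((K.law_absolutelyContinuous_iff ρ σ).mp h x hx)

variable {ρ σ}

theorem klSum_nonneg (hac : ∀ x, K.prob σ x = 0 → K.prob ρ x = 0) :
    0 ≤ klSum (K.prob ρ) (K.prob σ) :=
  SeqQHT.klSum_nonneg (K.prob_nonneg ρ) (K.prob_nonneg σ) (by rw [K.sum_prob, K.sum_prob]) hac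

theorem relEntropy_eq (hac : ∀ x, K.prob σ x = 0 → K.prob ρ x = 0) :
    K.relEntropy ρ σ = ENNReal.ofReal (klSum (K.prob ρ) (K.prob σ)) := by
  have h := (K.law_absolutelyContinuous_iff ρ σ).mpr hac
  have hwd : K.law ρ = (K.law σ).withDensity
      fun x => ENNReal.ofReal (K.prob ρ x / K.prob σ x) := by
    refine Measure.ext_of_singleton fun x => ?_
    rw [withDensity_apply _ (measurableSet_singleton x), lintegral_singleton, law_singleton,
      law_singleton, ← ENNReal.ofReal_mul (div_nonneg (K.prob_nonneg _ x) (K.prob_nonneg _ x))]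
    by_cases hx : K.prob σ x = 0
    · simp [hx, hac x hx]
    · rw [div_mul_cancel₀ _ hx]
  have hrn : (K.law ρ).rnDeriv (K.law σ) =ᵐ[K.law σ]
      fun x => ENNReal.ofReal (K.prob ρ x / K.prob σ x) := by
    conv_lhs => rw [hwd]
    exact Measure.rnDeriv_withDensity _ (measurable_of_finite _)
  have hllr : llr (K.law ρ) (K.law σ) =ᵐ[K.law ρ]
      fun x => Real.log (K.prob ρ x / K.prob σ x) := by
    filter_upwards [h.ae_eq hrn] with x hx
    rw [llr, hx, ENNReal.toReal_ofReal (div_nonneg (K.prob_nonneg _ x) (K.prob_nonneg _ x))]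
  rw [relEntropy, InformationTheory.klDiv_of_ac_of_integrable h Integrable.of_finite,
    integral_congr_ae hllr, integral_law]
  simp [klSum]

theorem relEntropy_ne_top_iff :
    K.relEntropy ρ σ ≠ ∞ ↔ ∀ x, K.prob σ x = 0 → K.prob ρ x = 0 := by
  constructor
  · intro h x hx
    by_contra hx'
    exact h (K.relEntropy_eq_top ρ σ hx hx')
  · intro h
    rw [K.relEntropy_eq h]
    exact ENNReal.ofReal_ne_top

theorem relEntropy_eq_zero_iff : K.relEntropy ρ σ = 0 ↔ K.prob ρ = K.prob σ := by
  rw [relEntropy, InformationTheory.klDiv_eq_zero_iff]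
  constructor
  · intro h
    ext x
    rw [← law_real_singleton, ← law_real_singleton, h]
  · intro h
    exact Measure.ext_of_singleton fun x => by rw [law_singleton, law_singleton, h]

end BlockPOVM

/-! ### The record of outcomes -/

section Record

variable {d : ℕ} (S : Schedule d) (ρ σ : State d)

instance : IsProbabilityMeasure (recordLaw S ρ) := by
  unfold recordLaw
  infer_instance

theorem nonempty_record (S : Schedule d) (ρ : State d) : Nonempty (Record S) := nonempty_of_isProbabilityMeasure (recordLaw S ρ)

variable {S}

/-- Each stage has finitely many outcomes, so a function of the first `n` of them factors through a
finite space, where everything is measurable and bounded. -/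
theorem measurable_of_dependsOn {β : Type*} [Nonempty β] [MeasurableSpace β] {n : ℕ}
    {g : Record S → β} (hg : DependsOn g (Set.Iio n)) : Measurable g := by
  obtain ⟨G, rfl⟩ := (Function.factorsThrough_iff (f := (Finset.range n).restrict) g).mp
    fun x y h => hg fun i hi => congrFun h ⟨i, Finset.mem_range.mpr hi⟩
  exact (measurable_of_finite G).comp (Finset.measurable_restrict _)

theorem measurableSet_of_dependsOn {n : ℕ} {B : Set (Record S)}
    (hB : DependsOn (· ∈ B) (Set.Iio n)) : MeasurableSet B :=
  measurableSet_setOfPred.mpr (measurable_of_dependsOn hB)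

/-- The same `G` serves for all states `ρ`. This is what turns a change of measure into a termwise
comparison of finite sums. -/
theorem integral_record_of_dependsOn {n : ℕ} {g : Record S → ℝ} (hg : DependsOn g (Set.Iio n)) :
    ∃ G : (∀ i : Finset.range n, Fin (S i).2.outcomes) → ℝ,
      (∀ ω, g ω = G ((Finset.range n).restrict ω)) ∧ ∀ ρ : State d,
        ∫ ω, g ω ∂(recordLaw S ρ) = ∑ a, (∏ i : Finset.range n, (S i).2.prob ρ (a i)) * G a := by
  obtain ⟨G, rfl⟩ := (Function.factorsThrough_iff (f := (Finset.range n).restrict) g).mp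
    fun x y h => hg fun i hi => congrFun h ⟨i, Finset.mem_range.mpr hi⟩
  refine ⟨G, fun ω => rfl, fun ρ => ?_⟩
  have h := integral_restrict_infinitePi (μ := fun k => (S k).2.law ρ)
    (s := Finset.range n) (f := G) (Measurable.aestronglyMeasurable (measurable_of_finite G))
  refine Eq.trans h ?_
  rw [integral_fintype Integrable.of_finite]
  refine Finset.sum_congr rfl fun a _ => ?_
  rw [Measure.real, Measure.pi_singleton, ENNReal.toReal_prod, smul_eq_mul]
  simp only [← Measure.real_def, BlockPOVM.law_real_singleton]

theorem integrable_record_of_dependsOn {n : ℕ} {g : Record S → ℝ} (hg : DependsOn g (Set.Iio n)) :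
    Integrable g (recordLaw S ρ) := by
  have hm := measurable_of_dependsOn hg
  obtain ⟨G, hG, -⟩ := integral_record_of_dependsOn hg
  refine Integrable.of_bound hm.aestronglyMeasurable (∑ a, |G a|) (ae_of_all _ fun ω => ?_)
  rw [hG, Real.norm_eq_abs]
  exact Finset.single_le_sum (f := fun a => |G a|) (fun a _ => abs_nonneg _) (Finset.mem_univ _)

/-- Outcome `n` is independent of the earlier ones. This one-step factorization replaces conditional
expectations and martingales throughout. -/
theorem integral_mul_next {n : ℕ} {g : Record S → ℝ} (hg : DependsOn g (Set.Iio n))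
    (h : Fin (S n).2.outcomes → ℝ) :
    ∫ ω, g ω * h (ω n) ∂(recordLaw S ρ) =
      (∫ ω, g ω ∂(recordLaw S ρ)) * ∑ x, (S n).2.prob ρ x * h x := by
  have hind : ProbabilityTheory.iIndepFun (fun i (ω : Record S) => ω i) (recordLaw S ρ) :=
    ProbabilityTheory.iIndepFun_infinitePi (P := fun k => (S k).2.law ρ) (X := fun _ x => x)
      fun _ => measurable_id
  have h2 := hind.indepFun_finset (Finset.range n) {n} (by simp) fun i => measurable_pi_apply i
  obtain ⟨G, hG, -⟩ := integral_record_of_dependsOn hg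
  have h3 : ProbabilityTheory.IndepFun g (fun ω : Record S => h (ω n)) (recordLaw S ρ) := by
    have h4 := h2.comp (φ := G) (ψ := fun a => h (a ⟨n, Finset.mem_singleton_self n⟩))
      (measurable_of_finite G)
      (measurable_of_finite _)
    have h5 : g = G ∘ fun (a : Record S) (i : Finset.range n) => a i := funext hG
    rw [h5]
    exact h4
  have hmap : (recordLaw S ρ).map (fun ω => ω n) = (S n).2.law ρ :=
    Measure.infinitePi_map_eval (fun k => (S k).2.law ρ) n
  rw [h3.integral_fun_mul_eq_mul_integral (measurable_of_dependsOn hg).aestronglyMeasurable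
    ((measurable_of_finite h).comp (measurable_pi_apply n)).aestronglyMeasurable]
  congr 1
  rw [← BlockPOVM.integral_law, ← hmap, integral_map (measurable_pi_apply n).aemeasurable
    (measurable_of_finite h).aestronglyMeasurable]

theorem ae_prob_pos : ∀ᵐ ω ∂(recordLaw S ρ), ∀ k, 0 < (S k).2.prob ρ (ω k) := by
  rw [ae_all_iff]
  intro k
  have hmap : (recordLaw S ρ).map (fun ω => ω k) = (S k).2.law ρ :=
    Measure.infinitePi_map_eval (fun k => (S k).2.law ρ) k
  have h : ∀ᵐ x ∂((S k).2.law ρ), 0 < (S k).2.prob ρ x := by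
    rw [ae_iff_of_countable]
    intro x hx
    rw [BlockPOVM.law_singleton, ne_eq, ENNReal.ofReal_eq_zero, not_le] at hx
    exact hx
  rw [← hmap] at h
  exact ae_of_ae_map (measurable_pi_apply k).aemeasurable h

theorem likelihood_congr {n : ℕ} {ω ω' : Record S} (h : ∀ i < n, ω i = ω' i) :
    likelihood S ρ n ω = likelihood S ρ n ω' :=
  Finset.prod_congr rfl fun i hi => by rw [h i (Finset.mem_range.mp hi)]

theorem likelihood_nonneg (n : ℕ) (ω : Record S) : 0 ≤ likelihood S ρ n ω :=
  Finset.prod_nonneg fun k _ => (S k).2.prob_nonneg ρ (ω k)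

/-- Change of measure on an event that is decided by the first `n` outcomes. -/
theorem recordLaw_real_le_mul {n : ℕ} {B : Set (Record S)} (hB : DependsOn (· ∈ B) (Set.Iio n))
    {δ : ℝ} (h : ∀ ω ∈ B, likelihood S σ n ω ≤ δ * likelihood S ρ n ω) :
    (recordLaw S σ).real B ≤ δ * (recordLaw S ρ).real B := by
  classical
  have hg : DependsOn (B.indicator fun _ => (1 : ℝ)) (Set.Iio n) := by
    intro x y hxy
    have := hB hxy
    simp only [Set.indicator_apply]
    exact if_congr (iff_of_eq this) rfl rfl
  obtain ⟨G, hG, hsum⟩ := integral_record_of_dependsOn hg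
  have hm := measurableSet_of_dependsOn hB
  have h1 : ∀ ρ, (recordLaw S ρ).real B = ∑ a, (∏ i : Finset.range n, (S i).2.prob ρ (a i)) * G a := by
    intro ρ
    rw [← hsum, integral_indicator hm, setIntegral_const, smul_eq_mul, mul_one]
  rw [h1, h1, Finset.mul_sum]
  obtain ⟨ω₀⟩ := nonempty_record S ρ
  refine Finset.sum_le_sum fun a _ => ?_
  -- The hypothesis `h` speaks of infinite records, so the finite record `a` is continued
  -- arbitrarily. Neither `B` nor the likelihoods see the continuation.
  let ω : Record S := fun i => if hi : i ∈ Finset.range n then a ⟨i, hi⟩ else ω₀ i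
  have hω : (Finset.range n).restrict ω = a := by
    ext i
    simp only [Finset.restrict, ω]
    rw [dif_pos i.2]
  have hl : ∀ ρ, likelihood S ρ n ω = ∏ i : Finset.range n, (S i).2.prob ρ (a i) := by
    intro ρ
    rw [likelihood, ← Finset.prod_coe_sort]
    refine Finset.prod_congr rfl fun i _ => ?_
    rw [← hω]
    rfl
  rw [← hl, ← hl, ← hω, ← hG, ← mul_assoc]
  by_cases hb : ω ∈ B
  · rw [Set.indicator_of_mem hb, mul_one, mul_one]
    exact h ω hb
  · rw [Set.indicator_of_notMem hb, mul_zero, mul_zero]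

end Record

/-! ### The stopping time -/

namespace SPRT

variable {d : ℕ} (T : SPRT d)

theorem acceptsAt_congr {ν : Fin 2} {n : ℕ} {ω ω' : Record T.schedule}
    (h : ∀ i < n, ω i = ω' i) : T.AcceptsAt ν n ω = T.AcceptsAt ν n ω' := by
  unfold AcceptsAt
  simp only [fun i => likelihood_congr (T.states i) h]

theorem stages_le {ω : Record T.schedule} {n : ℕ} {ν : Fin 2} (hn : 1 ≤ n)
    (h : T.AcceptsAt ν n ω) : T.stages ω ≤ n :=
  iInf₂_le n ⟨hn, ν, h⟩

/-- Stages are numbered from `0`: stage `k` is performed unless the test accepts after some `n`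
outcomes with `1 ≤ n ≤ k`. In particular stage `0` is always performed. -/
theorem lt_stages_iff {k : ℕ} {ω : Record T.schedule} :
    (k : ℕ∞) < T.stages ω ↔ ∀ n, 1 ≤ n → n ≤ k → ∀ ν, ¬ T.AcceptsAt ν n ω := by
  constructor
  · intro h n hn hk ν ha
    exact absurd (h.trans_le (T.stages_le hn ha)) (by simpa using hk)
  · intro h
    refine lt_of_lt_of_le (b := ((k + 1 : ℕ) : ℕ∞)) (by exact_mod_cast Nat.lt_succ_self k) ?_
    refine le_iInf₂ fun n hn => ?_
    obtain ⟨hn1, ν, hν⟩ := hn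
    have : ¬ n ≤ k := fun hk => h n hn1 hk ν hν
    exact_mod_cast (by omega : k + 1 ≤ n)

theorem exists_of_not_lt_stages {k : ℕ} {ω : Record T.schedule} (h : ¬ (k : ℕ∞) < T.stages ω) :
    ∃ n ν, 1 ≤ n ∧ n ≤ k ∧ T.stages ω = n ∧ T.AcceptsAt ν n ω := by
  classical
  rw [lt_stages_iff] at h
  push Not at h
  have hex : ∃ n, 1 ≤ n ∧ ∃ ν, T.AcceptsAt ν n ω := by
    obtain ⟨n, h1, -, ν, h3⟩ := h
    exact ⟨n, h1, ν, h3⟩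
  obtain ⟨h1, ν, h2⟩ := Nat.find_spec hex
  obtain ⟨n, g1, g2, ν', g3⟩ := h
  refine ⟨Nat.find hex, ν, h1, (Nat.find_min' hex ⟨g1, ν', g3⟩).trans g2,
    le_antisymm (T.stages_le h1 h2) (le_iInf₂ fun m hm => ?_), h2⟩
  exact_mod_cast Nat.find_min' hex hm

/-- Whether stage `k` is performed is decided before its outcome is known. Wald's identity rests on
this predictability. -/
theorem lt_stages_congr {k : ℕ} {ω ω' : Record T.schedule} (h : ∀ i < k, ω i = ω' i) :
    ((k : ℕ∞) < T.stages ω) = ((k : ℕ∞) < T.stages ω') := by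
  rw [lt_stages_iff, lt_stages_iff]
  refine propext (forall₃_congr fun n _ hn => forall_congr' fun ν => ?_)
  rw [T.acceptsAt_congr fun i hi => h i (hi.trans_le hn)]

theorem stages_eq_congr {n : ℕ} {ω ω' : Record T.schedule} (h : ∀ i < n, ω i = ω' i) :
    (T.stages ω = n) = (T.stages ω' = n) := by
  have key : ∀ ω : Record T.schedule, T.stages ω = n ↔
      ¬ (n : ℕ∞) < T.stages ω ∧ ∀ k < n, (k : ℕ∞) < T.stages ω := by
    intro ω
    constructor
    · intro hn
      rw [hn]
      exact ⟨lt_irrefl _, fun k hk => by exact_mod_cast hk⟩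
    · rintro ⟨h1, h2⟩
      obtain ⟨m, -, -, hm, hs, -⟩ := T.exists_of_not_lt_stages h1
      rcases hm.eq_or_lt with rfl | hlt
      · exact hs
      · exact absurd (h2 m hlt) (by rw [hs]; exact lt_irrefl _)
  rw [propext (key ω), propext (key ω'), T.lt_stages_congr h]
  congr 1
  refine propext (forall₂_congr fun k hk => ?_)
  rw [T.lt_stages_congr fun i hi => h i (hi.trans hk)]

/-- The probability under `ρ` that stage `k` is performed. -/
def survival (ρ : State d) (k : ℕ) : ℝ :=
  (recordLaw T.schedule ρ).real {ω | (k : ℕ∞) < T.stages ω}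

theorem dependsOn_lt_stages (k : ℕ) :
    DependsOn (· ∈ {ω | (k : ℕ∞) < T.stages ω}) (Set.Iio k) := fun _ _ h =>
  T.lt_stages_congr h

theorem dependsOn_accept (ν : Fin 2) (n : ℕ) :
    DependsOn (· ∈ {ω | T.stages ω = n ∧ T.AcceptsAt ν n ω}) (Set.Iio n) := fun x y h => by
  simp only [Set.mem_ofPred_eq]
  rw [T.stages_eq_congr h, T.acceptsAt_congr h]

theorem survival_nonneg (ρ : State d) (k : ℕ) : 0 ≤ T.survival ρ k := measureReal_nonneg

theorem survival_le_one (ρ : State d) (k : ℕ) : T.survival ρ k ≤ 1 := measureReal_le_one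

/-- The tail-sum formula for an expectation, by Tonelli: stage `k` contributes its copies whenever
it is performed. -/
theorem meanCopies_eq (ν : Fin 2) : T.meanCopies ν =
    ∑' k, ((T.schedule k).1 : ℝ≥0∞) * ENNReal.ofReal (T.survival (T.states ν) k) := by
  classical
  have hm : ∀ k : ℕ, MeasurableSet {ω : Record T.schedule | (k : ℕ∞) < T.stages ω} :=
    fun k => measurableSet_of_dependsOn (T.dependsOn_lt_stages k)
  have h1 : ∀ ω : Record T.schedule, T.copies ω = ∑' k : ℕ,
      {ω : Record T.schedule | (k : ℕ∞) < T.stages ω}.indicator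
        (fun _ => ((T.schedule k).1 : ℝ≥0∞)) ω := by
    intro ω
    unfold copies
    refine tsum_congr fun k => ?_
    simp only [Set.indicator_apply, Set.mem_ofPred_eq]
  unfold meanCopies
  simp only [h1]
  rw [lintegral_tsum fun k => (measurable_const.indicator (hm k)).aemeasurable]
  refine tsum_congr fun k => ?_
  rw [lintegral_indicator (hm k), setLIntegral_const, survival, ofReal_measureReal]

/-- On the event of stopping after `n` stages with `ν` accepted, the likelihood under the wrong
hypothesis is at most `e ν` times the other one. These events are disjoint, so their probabilities
under `ν` add up to at most `1`. -/
theorem errorProb_le (s : Fin 2 → State d) (η e : Fin 2 → ℝ) (S : Schedule d) (ν : Fin 2) :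
    (SPRT.mk s η .weak e S).errorProb ν ≤ ENNReal.ofReal (e ν) := by
  set T : SPRT d := SPRT.mk s η .weak e S
  let B : ℕ → Set (Record S) := fun n => {ω | T.stages ω = n ∧ T.AcceptsAt ν n ω}
  have hm : ∀ n, MeasurableSet (B n) := fun n =>
    measurableSet_of_dependsOn (T.dependsOn_accept ν n)
  have hdisj : Pairwise (Function.onFun Disjoint B) := by
    intro m n hmn
    refine Set.disjoint_left.mpr fun ω h1 h2 => hmn ?_
    have := h1.1.symm.trans h2.1
    exact_mod_cast this
  have hU : {ω : Record S | ∃ n : ℕ, T.stages ω = n ∧ T.AcceptsAt ν n ω} = ⋃ n, B n := by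
    ext ω
    simp [B]
  have hle : ∀ n, recordLaw S (s (1 - ν)) (B n) ≤
      ENNReal.ofReal (e ν) * recordLaw S (s ν) (B n) := by
    intro n
    have h := recordLaw_real_le_mul (s ν) (s (1 - ν)) (T.dependsOn_accept ν n) (δ := e ν)
      (fun ω hω => hω.2.2)
    rw [← ofReal_measureReal (μ := recordLaw S (s (1 - ν))),
      ← ofReal_measureReal (μ := recordLaw S (s ν)), ← ENNReal.ofReal_mul' measureReal_nonneg]
    exact ENNReal.ofReal_le_ofReal h
  calc T.errorProb ν = ∑' n, recordLaw S (s (1 - ν)) (B n) := by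
        rw [← measure_iUnion hdisj hm, ← hU]
        rfl
    _ ≤ ∑' n, ENNReal.ofReal (e ν) * recordLaw S (s ν) (B n) := ENNReal.tsum_le_tsum hle
    _ = ENNReal.ofReal (e ν) * recordLaw S (s ν) (⋃ n, B n) := by
        rw [ENNReal.tsum_mul_left, measure_iUnion hdisj hm]
    _ ≤ ENNReal.ofReal (e ν) * 1 := by gcongr; exact prob_le_one
    _ = _ := mul_one _

end SPRT

/-! ### Bounds for the mean number of copies -/

theorem one_sub_one_sub (ν : Fin 2) : 1 - (1 - ν) = ν := sub_sub_cancel 1 ν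

theorem eq_one_sub_of_ne {μ ν : Fin 2} (h : μ ≠ ν) : μ = 1 - ν := by
  revert μ ν
  decide

namespace SPRT

variable {d : ℕ} (T : SPRT d)

theorem acceptsAt_weak (hw : T.criterion = .weak) {ν : Fin 2} {n : ℕ} {ω : Record T.schedule} :
    T.AcceptsAt ν n ω ↔ 0 < likelihood T.schedule (T.states ν) n ω ∧
      likelihood T.schedule (T.states (1 - ν)) n ω ≤
        T.error ν * likelihood T.schedule (T.states ν) n ω := by
  simp only [AcceptsAt, Accepts, hw]

/-- The indicator of the event that stage `k` is performed. -/
def alive (k : ℕ) : Record T.schedule → ℝ :=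
  {ω | (k : ℕ∞) < T.stages ω}.indicator fun _ => 1

variable {T} in
theorem alive_of_lt {k : ℕ} {ω : Record T.schedule} (h : (k : ℕ∞) < T.stages ω) :
    T.alive k ω = 1 := Set.indicator_of_mem (by simpa using h) _

variable {T} in
theorem alive_of_not_lt {k : ℕ} {ω : Record T.schedule} (h : ¬ (k : ℕ∞) < T.stages ω) :
    T.alive k ω = 0 := Set.indicator_of_notMem (by simpa using h) _

theorem alive_nonneg (k : ℕ) (ω : Record T.schedule) : 0 ≤ T.alive k ω := by
  by_cases h : (k : ℕ∞) < T.stages ω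
  · rw [alive_of_lt h]; exact zero_le_one
  · rw [alive_of_not_lt h]

theorem alive_le_one (k : ℕ) (ω : Record T.schedule) : T.alive k ω ≤ 1 := by
  by_cases h : (k : ℕ∞) < T.stages ω
  · rw [alive_of_lt h]
  · rw [alive_of_not_lt h]; exact zero_le_one

theorem dependsOn_alive (k : ℕ) : DependsOn (T.alive k) (Set.Iio k) := by
  classical
  intro x y h
  simp only [alive, Set.indicator_apply]
  exact if_congr (iff_of_eq (T.dependsOn_lt_stages k h)) rfl rfl

theorem integral_alive (ρ : State d) (k : ℕ) :
    ∫ ω, T.alive k ω ∂(recordLaw T.schedule ρ) = T.survival ρ k := by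
  rw [alive, integral_indicator (measurableSet_of_dependsOn (T.dependsOn_lt_stages k)),
    setIntegral_const, smul_eq_mul, mul_one, survival]

/-- The log-likelihood ratio of an outcome of stage `k`. -/
def stageLLR (ν : Fin 2) (k : ℕ) (x : Fin (T.schedule k).2.outcomes) : ℝ :=
  Real.log ((T.schedule k).2.prob (T.states ν) x / (T.schedule k).2.prob (T.states (1 - ν)) x)

/-- The relative entropy of the outcomes of stage `k`. -/
def stageKL (ν : Fin 2) (k : ℕ) : ℝ :=
  klSum ((T.schedule k).2.prob (T.states ν)) ((T.schedule k).2.prob (T.states (1 - ν)))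

/-- The log-likelihood ratio after `n` stages or at the stopping time, whichever is first. -/
def stoppedLLR (ν : Fin 2) (n : ℕ) (ω : Record T.schedule) : ℝ :=
  ∑ k ∈ Finset.range n, T.alive k ω * T.stageLLR ν k (ω k)

theorem dependsOn_mul_next {S : Schedule d} {n : ℕ} {g : Record S → ℝ}
    (hg : DependsOn g (Set.Iio n)) (h : Fin (S n).2.outcomes → ℝ) :
    DependsOn (fun ω => g ω * h (ω n)) (Set.Iio (n + 1)) := by
  intro x y hxy
  simp only
  rw [hg fun i hi => hxy i (Set.mem_Iio.mpr ((Set.mem_Iio.mp hi).trans n.lt_succ_self)),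
    hxy n (Set.mem_Iio.mpr n.lt_succ_self)]

theorem integrable_stoppedLLR (ν : Fin 2) (n : ℕ) (ρ : State d) :
    Integrable (T.stoppedLLR ν n) (recordLaw T.schedule ρ) :=
  integrable_finsetSum _ fun k _ =>
    integrable_record_of_dependsOn ρ (dependsOn_mul_next (T.dependsOn_alive k) _)

/-- Wald's identity: the factor `alive k` depends only on the outcomes before stage `k` and is
independent of the increment at stage `k`. -/
theorem integral_stoppedLLR (ν : Fin 2) (n : ℕ) :
    ∫ ω, T.stoppedLLR ν n ω ∂(recordLaw T.schedule (T.states ν)) =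
      ∑ k ∈ Finset.range n, T.survival (T.states ν) k * T.stageKL ν k := by
  unfold stoppedLLR
  rw [integral_finsetSum _ fun k _ =>
    integrable_record_of_dependsOn _ (dependsOn_mul_next (T.dependsOn_alive k) _)]
  refine Finset.sum_congr rfl fun k _ => ?_
  rw [integral_mul_next _ (T.dependsOn_alive k), integral_alive]
  rfl

theorem stoppedLLR_eq_log {ν : Fin 2} {n : ℕ} {ω : Record T.schedule}
    (h : ∀ k < n, (k : ℕ∞) < T.stages ω)
    (hp : ∀ k, 0 < (T.schedule k).2.prob (T.states ν) (ω k))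
    (hq : ∀ k, 0 < (T.schedule k).2.prob (T.states (1 - ν)) (ω k)) :
    T.stoppedLLR ν n ω = Real.log (likelihood T.schedule (T.states ν) n ω /
      likelihood T.schedule (T.states (1 - ν)) n ω) := by
  unfold likelihood
  rw [← Finset.prod_div_distrib, Real.log_prod fun k _ => (div_pos (hp k) (hq k)).ne']
  refine Finset.sum_congr rfl fun k hk => ?_
  rw [alive_of_lt (h k (Finset.mem_range.mp hk)), one_mul]
  rfl

/-- While the test runs, `ν` has not been accepted, so the ratio is still below the threshold. Only
the last stage can exceed it, by at most `B`. -/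
theorem stoppedLLR_le (hw : T.criterion = .weak) {ν : Fin 2} {B : ℝ} (hB : 0 ≤ B)
    (he : 0 < T.error ν) (he1 : T.error ν ≤ 1)
    (hstep : ∀ k x, (T.schedule k).2.prob (T.states ν) x ≤
      Real.exp B * (T.schedule k).2.prob (T.states (1 - ν)) x) {ω : Record T.schedule}
    (hp : ∀ k, 0 < (T.schedule k).2.prob (T.states ν) (ω k)) (n : ℕ) :
    T.stoppedLLR ν n ω ≤ -Real.log (T.error ν) + B := by
  have hq : ∀ k, 0 < (T.schedule k).2.prob (T.states (1 - ν)) (ω k) := fun k =>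
    pos_of_mul_pos_right ((hp k).trans_le (hstep k _)) (Real.exp_pos B).le
  have hlog : 0 ≤ -Real.log (T.error ν) := neg_nonneg.mpr (Real.log_nonpos he.le he1)
  induction n with
  | zero => simpa [stoppedLLR] using add_nonneg hlog hB
  | succ n ih =>
    have hs : T.stoppedLLR ν (n + 1) ω =
        T.stoppedLLR ν n ω + T.alive n ω * T.stageLLR ν n (ω n) := Finset.sum_range_succ _ _
    rw [hs]
    by_cases hn : (n : ℕ∞) < T.stages ω
    · have h1 : T.stageLLR ν n (ω n) ≤ B := by
        rw [stageLLR, Real.log_le_iff_le_exp (div_pos (hp n) (hq n)), div_le_iff₀ (hq n)]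
        exact hstep n _
      have h2 : T.stoppedLLR ν n ω ≤ -Real.log (T.error ν) := by
        rcases Nat.eq_zero_or_pos n with rfl | hpos
        · simpa [stoppedLLR] using hlog
        have hLp : 0 < likelihood T.schedule (T.states ν) n ω := Finset.prod_pos fun k _ => hp k
        have hLq : 0 < likelihood T.schedule (T.states (1 - ν)) n ω :=
          Finset.prod_pos fun k _ => hq k
        rw [T.stoppedLLR_eq_log (fun k hk => lt_trans (by exact_mod_cast hk) hn) hp hq,
          ← Real.log_inv]
        refine Real.log_le_log (div_pos hLp hLq) ?_
        have h3 := (T.lt_stages_iff.mp hn) n hpos le_rfl ν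
        rw [T.acceptsAt_weak hw] at h3
        push Not at h3
        rw [div_le_iff₀ hLq, inv_mul_eq_div, le_div_iff₀ he]
        linarith [h3 hLp]
      rw [alive_of_lt hn, one_mul]
      linarith
    · rw [alive_of_not_lt hn, zero_mul, add_zero]
      exact ih

theorem sum_survival_mul_stageKL_le (hw : T.criterion = .weak) {ν : Fin 2} {B : ℝ} (hB : 0 ≤ B)
    (he : 0 < T.error ν) (he1 : T.error ν ≤ 1)
    (hstep : ∀ k x, (T.schedule k).2.prob (T.states ν) x ≤
      Real.exp B * (T.schedule k).2.prob (T.states (1 - ν)) x) (n : ℕ) :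
    ∑ k ∈ Finset.range n, T.survival (T.states ν) k * T.stageKL ν k ≤
      -Real.log (T.error ν) + B := by
  rw [← integral_stoppedLLR]
  have h : ∫ ω, T.stoppedLLR ν n ω ∂(recordLaw T.schedule (T.states ν)) ≤
      ∫ _, (-Real.log (T.error ν) + B) ∂(recordLaw T.schedule (T.states ν)) := by
    refine integral_mono_ae (T.integrable_stoppedLLR ν n _) (integrable_const _) ?_
    filter_upwards [ae_prob_pos (T.states ν)] with ω hω
    exact T.stoppedLLR_le hw hB he he1 hstep hω n
  simpa using h

/-- The likelihood ratio after `n` stages or at the stopping time, whichever is first. -/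
def stoppedRatio (ν : Fin 2) : ℕ → Record T.schedule → ℝ
  | 0, _ => 1
  | n + 1, ω => stoppedRatio ν n ω * (1 - T.alive n ω) + stoppedRatio ν n ω * T.alive n ω *
      ((T.schedule n).2.prob (T.states (1 - ν)) (ω n) / (T.schedule n).2.prob (T.states ν) (ω n))

theorem stoppedRatio_nonneg (ν : Fin 2) (n : ℕ) (ω : Record T.schedule) :
    0 ≤ T.stoppedRatio ν n ω := by
  induction n with
  | zero => exact zero_le_one
  | succ n ih =>
    have h1 := T.alive_nonneg n ω
    have h2 := sub_nonneg.mpr (T.alive_le_one n ω)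
    have h3 := div_nonneg ((T.schedule n).2.prob_nonneg (T.states (1 - ν)) (ω n))
      ((T.schedule n).2.prob_nonneg (T.states ν) (ω n))
    exact add_nonneg (mul_nonneg ih h2) (mul_nonneg (mul_nonneg ih h1) h3)

theorem dependsOn_stoppedRatio (ν : Fin 2) (n : ℕ) :
    DependsOn (T.stoppedRatio ν n) (Set.Iio n) := by
  induction n with
  | zero => intro x y _; rfl
  | succ n ih =>
    intro x y h
    have h1 : ∀ i ∈ Set.Iio n, x i = y i := fun i hi =>
      h i (Set.mem_Iio.mpr ((Set.mem_Iio.mp hi).trans n.lt_succ_self))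
    simp only [stoppedRatio]
    rw [ih h1, T.dependsOn_alive n h1, h n (Set.mem_Iio.mpr n.lt_succ_self)]

/-- A supermartingale bound: each new factor has mean at most `1` under `ν`. The mean can be smaller
than `1`, since outcomes that are possible only under the other hypothesis are lost. -/
theorem integral_stoppedRatio_le (ν : Fin 2) (n : ℕ) :
    ∫ ω, T.stoppedRatio ν n ω ∂(recordLaw T.schedule (T.states ν)) ≤ 1 := by
  induction n with
  | zero => simp [stoppedRatio]
  | succ n ih =>
    have hd1 : DependsOn (fun ω => T.stoppedRatio ν n ω * (1 - T.alive n ω)) (Set.Iio n) := by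
      intro x y h
      simp only
      rw [T.dependsOn_stoppedRatio ν n h, T.dependsOn_alive n h]
    have hd2 : DependsOn (fun ω => T.stoppedRatio ν n ω * T.alive n ω) (Set.Iio n) := by
      intro x y h
      simp only
      rw [T.dependsOn_stoppedRatio ν n h, T.dependsOn_alive n h]
    refine le_trans ?_ ih
    simp only [stoppedRatio]
    rw [integral_add (integrable_record_of_dependsOn _ hd1)
      (integrable_record_of_dependsOn _ (dependsOn_mul_next hd2 fun x =>
        (T.schedule n).2.prob (T.states (1 - ν)) x / (T.schedule n).2.prob (T.states ν) x)),
      integral_mul_next _ hd2 fun x =>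
        (T.schedule n).2.prob (T.states (1 - ν)) x / (T.schedule n).2.prob (T.states ν) x]
    have h1 : ∑ x, (T.schedule n).2.prob (T.states ν) x *
        ((T.schedule n).2.prob (T.states (1 - ν)) x / (T.schedule n).2.prob (T.states ν) x) ≤ 1 := by
      rw [← (T.schedule n).2.sum_prob (T.states (1 - ν))]
      refine Finset.sum_le_sum fun x _ => ?_
      by_cases hx : (T.schedule n).2.prob (T.states ν) x = 0
      · rw [hx, zero_mul]
        exact (T.schedule n).2.prob_nonneg _ _
      · rw [mul_div_cancel₀ _ hx]
    have h2 : 0 ≤ ∫ ω, T.stoppedRatio ν n ω * T.alive n ω ∂(recordLaw T.schedule (T.states ν)) :=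
      integral_nonneg fun ω => mul_nonneg (T.stoppedRatio_nonneg ν n ω) (T.alive_nonneg n ω)
    have h3 : ∫ ω, T.stoppedRatio ν n ω ∂(recordLaw T.schedule (T.states ν)) =
        ∫ ω, T.stoppedRatio ν n ω * (1 - T.alive n ω) ∂(recordLaw T.schedule (T.states ν)) +
          ∫ ω, T.stoppedRatio ν n ω * T.alive n ω ∂(recordLaw T.schedule (T.states ν)) := by
      rw [← integral_add (integrable_record_of_dependsOn _ hd1)
        (integrable_record_of_dependsOn _ hd2)]
      congr 1
      ext ω
      ring
    rw [h3]
    linarith [mul_le_of_le_one_right h2 h1]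

theorem exp_neg_stoppedLLR {ν : Fin 2} {ω : Record T.schedule}
    (hp : ∀ k, 0 < (T.schedule k).2.prob (T.states ν) (ω k))
    (hq : ∀ k, 0 < (T.schedule k).2.prob (T.states (1 - ν)) (ω k)) (n : ℕ) :
    Real.exp (-T.stoppedLLR ν n ω) = T.stoppedRatio ν n ω := by
  induction n with
  | zero => simp [stoppedLLR, stoppedRatio]
  | succ n ih =>
    have hs : T.stoppedLLR ν (n + 1) ω =
        T.stoppedLLR ν n ω + T.alive n ω * T.stageLLR ν n (ω n) := Finset.sum_range_succ _ _
    rw [hs, neg_add, Real.exp_add, ih, stoppedRatio]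
    by_cases hn : (n : ℕ∞) < T.stages ω
    · rw [alive_of_lt hn, one_mul, stageLLR, ← Real.log_inv, inv_div,
        Real.exp_log (div_pos (hq n) (hp n))]
      ring
    · rw [alive_of_not_lt hn]
      simp

/-- By Wald's identity the right side is the mean of the stopped log-likelihood ratio. The ratio is
at least `-log (error ν)` where `ν` has been accepted. The complement consists of records still
running and of wrong acceptances, and there the ratio costs at most `1` in the mean. -/
theorem le_sum_survival_mul_stageKL (hw : T.criterion = .weak) {ν : Fin 2}
    (he : ∀ i, 0 < T.error i) (he1 : T.error ν ≤ 1)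
    (hac : ∀ k x, (T.schedule k).2.prob (T.states (1 - ν)) x = 0 →
      (T.schedule k).2.prob (T.states ν) x = 0) (n : ℕ) :
    (1 - T.error (1 - ν) - T.survival (T.states ν) n) * -Real.log (T.error ν) - 1 ≤
      ∑ k ∈ Finset.range n, T.survival (T.states ν) k * T.stageKL ν k := by
  set P := recordLaw T.schedule (T.states ν) with hP
  have hlog : 0 ≤ -Real.log (T.error ν) := neg_nonneg.mpr (Real.log_nonpos (he ν).le he1)
  let A : Set (Record T.schedule) :=
    ⋃ m ∈ Finset.range (n + 1), {ω | T.stages ω = m ∧ T.AcceptsAt ν m ω}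
  have hA : MeasurableSet A := Finset.measurableSet_biUnion _ fun m _ =>
    measurableSet_of_dependsOn (T.dependsOn_accept ν m)
  let F : Set (Record T.schedule) :=
    {ω | ∃ m : ℕ, T.stages ω = m ∧ T.AcceptsAt (1 - ν) m ω}
  have hF : P.real F ≤ T.error (1 - ν) := by
    have h := errorProb_le T.states T.prior T.error T.schedule (1 - ν)
    rw [← hw] at h
    unfold errorProb at h
    simp only [one_sub_one_sub] at h
    exact ENNReal.toReal_le_of_le_ofReal (he _).le h
  have hcover : 1 ≤ P.real A + (T.survival (T.states ν) n + P.real F) := by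
    have hsub : (Set.univ : Set (Record T.schedule)) ⊆
        A ∪ ({ω | (n : ℕ∞) < T.stages ω} ∪ F) := by
      intro ω _
      by_cases hn : (n : ℕ∞) < T.stages ω
      · exact Or.inr (Or.inl hn)
      · obtain ⟨m, μ, -, hm, hs, ha⟩ := T.exists_of_not_lt_stages hn
        by_cases hμ : μ = ν
        · subst hμ
          refine Or.inl (Set.mem_biUnion (x := m) ?_ ⟨hs, ha⟩)
          simpa using Nat.lt_succ_of_le hm
        · have : μ = 1 - ν := eq_one_sub_of_ne hμ
          subst this
          exact Or.inr (Or.inr ⟨m, hs, ha⟩)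
    calc (1 : ℝ) = P.real Set.univ := by simp
      _ ≤ P.real (A ∪ ({ω | (n : ℕ∞) < T.stages ω} ∪ F)) := measureReal_mono hsub
      _ ≤ _ := (measureReal_union_le _ _).trans (by
        gcongr
        exact measureReal_union_le _ _)
  -- Outside `A` this is `x ≥ -exp (-x)` for the stopped ratio `x`. On `A` the subtracted likelihood
  -- ratio is nonnegative and may be included for free. Its mean is at most `1`.
  have hint : ∫ ω, (A.indicator (fun _ => -Real.log (T.error ν)) ω - T.stoppedRatio ν n ω) ∂P ≤
      ∫ ω, T.stoppedLLR ν n ω ∂P := by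
    refine integral_mono_ae (((integrable_const _).indicator hA).sub
      (integrable_record_of_dependsOn _ (T.dependsOn_stoppedRatio ν n)))
      (T.integrable_stoppedLLR ν n _) ?_
    filter_upwards [ae_prob_pos (T.states ν)] with ω hp
    have hq : ∀ k, 0 < (T.schedule k).2.prob (T.states (1 - ν)) (ω k) := fun k =>
      ((T.schedule k).2.prob_nonneg _ _).lt_of_ne fun h => (hp k).ne' (hac k _ h.symm)
    by_cases hω : ω ∈ A
    · rw [Set.indicator_of_mem hω]
      obtain ⟨m, hm, hs, ha⟩ := Set.mem_iUnion₂.mp hω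
      rw [Finset.mem_range] at hm
      have hmn : T.stoppedLLR ν n ω = T.stoppedLLR ν m ω := by
        refine (Finset.sum_subset (Finset.range_subset_range.mpr (by omega)) fun k _ hk => ?_).symm
        rw [alive_of_not_lt, zero_mul]
        rw [hs]
        rw [Finset.mem_range] at hk
        exact_mod_cast hk
      have hLq : 0 < likelihood T.schedule (T.states (1 - ν)) m ω :=
        Finset.prod_pos fun k _ => hq k
      have h1 : -Real.log (T.error ν) ≤ T.stoppedLLR ν m ω := by
        rw [T.stoppedLLR_eq_log (fun k hk => by rw [hs]; exact_mod_cast hk) hp hq, ← Real.log_inv]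
        refine Real.log_le_log (inv_pos.mpr (he ν)) ?_
        rw [T.acceptsAt_weak hw] at ha
        rw [le_div_iff₀ hLq, inv_mul_eq_div, div_le_iff₀ (he ν)]
        linarith [ha.2]
      have := T.stoppedRatio_nonneg ν n ω
      linarith
    · rw [Set.indicator_of_notMem hω, ← T.exp_neg_stoppedLLR hp hq]
      linarith [Real.add_one_le_exp (-T.stoppedLLR ν n ω)]
  rw [integral_sub ((integrable_const _).indicator hA)
    (integrable_record_of_dependsOn _ (T.dependsOn_stoppedRatio ν n)), integral_indicator hA,
    setIntegral_const, smul_eq_mul, hP, integral_stoppedLLR] at hint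
  have h1 := T.integral_stoppedRatio_le ν n
  have h2 : (1 - T.error (1 - ν) - T.survival (T.states ν) n) * -Real.log (T.error ν) ≤
      P.real A * -Real.log (T.error ν) := mul_le_mul_of_nonneg_right (by linarith) hlog
  linarith

end SPRT

theorem BlockPOVM.hitProb_aux {d ℓ : ℕ} (K : BlockPOVM d ℓ) (ρ σ : State d) :
    ∑ x, K.prob ρ x * (if K.prob σ x = 0 then 0 else 1) =
      1 - ∑ x, if K.prob σ x = 0 then K.prob ρ x else 0 := by
  rw [eq_sub_iff_add_eq, ← Finset.sum_add_distrib]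
  refine Eq.trans (Finset.sum_congr rfl fun x _ => ?_) (K.sum_prob ρ)
  split_ifs <;> simp

/-- The probability under `ρ` of the outcomes that are impossible under `σ`. -/
def BlockPOVM.hitProb {d ℓ : ℕ} (K : BlockPOVM d ℓ) (ρ σ : State d) : ℝ :=
  ∑ x, if K.prob σ x = 0 then K.prob ρ x else 0

theorem BlockPOVM.hitProb_nonneg {d ℓ : ℕ} (K : BlockPOVM d ℓ) (ρ σ : State d) :
    0 ≤ K.hitProb ρ σ := by
  refine Finset.sum_nonneg fun x _ => ?_
  split_ifs
  · exact K.prob_nonneg ρ x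
  · exact le_rfl

theorem BlockPOVM.hitProb_le_one {d ℓ : ℕ} (K : BlockPOVM d ℓ) (ρ σ : State d) :
    K.hitProb ρ σ ≤ 1 := by
  rw [← K.sum_prob ρ]
  refine Finset.sum_le_sum fun x _ => ?_
  split_ifs
  · exact le_rfl
  · exact K.prob_nonneg ρ x

theorem BlockPOVM.prob_le_hitProb {d ℓ : ℕ} (K : BlockPOVM d ℓ) {ρ σ : State d}
    {x : Fin K.outcomes} (hx : K.prob σ x = 0) : K.prob ρ x ≤ K.hitProb ρ σ := by
  have h := Finset.single_le_sum (f := fun x => if K.prob σ x = 0 then K.prob ρ x else 0)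
    (fun y _ => by
      split_ifs
      · exact K.prob_nonneg ρ y
      · exact le_rfl) (Finset.mem_univ x)
  rw [if_pos hx] at h
  exact h

theorem BlockPOVM.relEntropy_eq_top_iff {d ℓ : ℕ} (K : BlockPOVM d ℓ) {ρ σ : State d} :
    K.relEntropy ρ σ = ∞ ↔ 0 < K.hitProb ρ σ := by
  constructor
  · intro h
    by_contra hne
    refine absurd h (K.relEntropy_ne_top_iff.mpr fun x hx => ?_)
    exact le_antisymm ((K.prob_le_hitProb hx).trans (not_lt.mp hne)) (K.prob_nonneg ρ x)
  · intro h
    obtain ⟨x, -, hx⟩ := Finset.exists_ne_zero_of_sum_ne_zero h.ne'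
    split_ifs at hx with h0
    · exact K.relEntropy_eq_top ρ σ h0 hx
    · exact absurd rfl hx

/-- A finite outcome set has a largest likelihood ratio. It bounds the overshoot when the
measurement stays fixed while the errors tend to zero. -/
theorem BlockPOVM.exists_exp_bound {d ℓ : ℕ} (K : BlockPOVM d ℓ) {ρ σ : State d}
    (hac : ∀ x, K.prob σ x = 0 → K.prob ρ x = 0) :
    ∃ B : ℝ, 0 ≤ B ∧ ∀ x, K.prob ρ x ≤ Real.exp B * K.prob σ x := by
  have hnn : ∀ x, 0 ≤ K.prob ρ x / K.prob σ x := fun x =>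
    div_nonneg (K.prob_nonneg _ _) (K.prob_nonneg _ _)
  have hs : 0 ≤ ∑ x, K.prob ρ x / K.prob σ x := Finset.sum_nonneg fun x _ => hnn x
  refine ⟨Real.log (1 + ∑ x, K.prob ρ x / K.prob σ x), Real.log_nonneg (by linarith), fun x => ?_⟩
  rw [Real.exp_log (by linarith)]
  by_cases hx : K.prob σ x = 0
  · rw [hx, hac x hx, mul_zero]
  have h1 := Finset.single_le_sum (f := fun x => K.prob ρ x / K.prob σ x) (fun y _ => hnn y)
    (Finset.mem_univ x)
  calc K.prob ρ x = K.prob ρ x / K.prob σ x * K.prob σ x := (div_mul_cancel₀ _ hx).symm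
    _ ≤ _ := mul_le_mul_of_nonneg_right (h1.trans (by linarith)) (K.prob_nonneg _ _)

namespace SPRT

variable {d : ℕ} (T : SPRT d)

theorem relEntropy_eq_ofReal_stageKL {ν : Fin 2} {k : ℕ}
    (hac : ∀ x, (T.schedule k).2.prob (T.states (1 - ν)) x = 0 →
      (T.schedule k).2.prob (T.states ν) x = 0) :
    (T.schedule k).2.relEntropy (T.states ν) (T.states (1 - ν)) =
      ENNReal.ofReal (T.stageKL ν k) :=
  (T.schedule k).2.relEntropy_eq hac

theorem ofReal_sum_survival_mul_stageKL {ν : Fin 2}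
    (hac : ∀ k x, (T.schedule k).2.prob (T.states (1 - ν)) x = 0 →
      (T.schedule k).2.prob (T.states ν) x = 0) (n : ℕ) :
    ENNReal.ofReal (∑ k ∈ Finset.range n, T.survival (T.states ν) k * T.stageKL ν k) =
      ∑ k ∈ Finset.range n, (T.schedule k).2.relEntropy (T.states ν) (T.states (1 - ν)) *
        ENNReal.ofReal (T.survival (T.states ν) k) := by
  have hnn : ∀ k, 0 ≤ T.stageKL ν k := fun k => (T.schedule k).2.klSum_nonneg (hac k)
  rw [ENNReal.ofReal_sum_of_nonneg fun k _ => mul_nonneg (T.survival_nonneg _ k) (hnn k)]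
  refine Finset.sum_congr rfl fun k _ => ?_
  rw [T.relEntropy_eq_ofReal_stageKL (hac k), ENNReal.ofReal_mul (T.survival_nonneg _ k), mul_comm]

/-- The converse bound: if no stage yields more than `c` of relative entropy per copy, then
`⟨N⟩_ν` is at least about `-log e_ν / c`. -/
theorem div_le_meanCopies (hw : T.criterion = .weak) {ν : Fin 2}
    (he : ∀ i, 0 < T.error i) (he1 : T.error ν ≤ 1) {c : ℝ≥0∞}
    (hc : ∀ k, (T.schedule k).2.relEntropy (T.states ν) (T.states (1 - ν)) ≤
      c * ((T.schedule k).1 : ℝ≥0∞))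
    (hinf : ∑' k, ((T.schedule k).1 : ℝ≥0∞) = ∞) :
    ENNReal.ofReal ((1 - T.error (1 - ν)) * -Real.log (T.error ν) - 1) / c ≤ T.meanCopies ν := by
  by_cases hctop : c = ∞
  · simp [hctop]
  by_cases hm : T.meanCopies ν = ∞
  · simp [hm]
  have hac : ∀ k x, (T.schedule k).2.prob (T.states (1 - ν)) x = 0 →
      (T.schedule k).2.prob (T.states ν) x = 0 := fun k =>
    (T.schedule k).2.relEntropy_ne_top_iff.mp
      (ne_top_of_le_ne_top (ENNReal.mul_ne_top hctop (ENNReal.natCast_ne_top _)) (hc k))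
  have hlog : 0 ≤ -Real.log (T.error ν) := neg_nonneg.mpr (Real.log_nonpos (he ν).le he1)
  -- If the survival probability stayed above `ε`, an infinite supply of copies would be used with
  -- that probability and the mean would be infinite.
  have hsurv : ∀ ε : ℝ, 0 < ε → ∃ n, T.survival (T.states ν) n < ε := by
    intro ε hε
    by_contra! hcon
    refine hm (top_le_iff.mp ?_)
    rw [meanCopies_eq]
    calc ∞ = (∑' k, ((T.schedule k).1 : ℝ≥0∞)) * ENNReal.ofReal ε := by
          rw [hinf, ENNReal.top_mul (ENNReal.ofReal_pos.mpr hε).ne']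
      _ = ∑' k, ((T.schedule k).1 : ℝ≥0∞) * ENNReal.ofReal ε := ENNReal.tsum_mul_right.symm
      _ ≤ _ := ENNReal.tsum_le_tsum fun k => by
          gcongr
          exact hcon k
  refine ENNReal.div_le_of_le_mul ?_
  have hfin : T.meanCopies ν * c ≠ ∞ := ENNReal.mul_ne_top hm hctop
  rw [← ENNReal.ofReal_toReal hfin]
  refine ENNReal.ofReal_le_ofReal (le_of_forall_pos_le_add fun ε hε => ?_)
  -- The denominator exceeds both `0` and `-log (error ν)`, so the survival term of the lower bound
  -- costs at most `ε`.
  obtain ⟨n, hn⟩ := hsurv (ε / (1 - Real.log (T.error ν))) (div_pos hε (by linarith))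
  have h1 := T.le_sum_survival_mul_stageKL hw he he1 hac n
  have h2 : ∑ k ∈ Finset.range n, T.survival (T.states ν) k * T.stageKL ν k ≤
      (T.meanCopies ν * c).toReal := by
    rw [← ENNReal.ofReal_le_iff_le_toReal hfin, T.ofReal_sum_survival_mul_stageKL hac,
      meanCopies_eq, mul_comm, ← ENNReal.tsum_mul_left]
    refine le_trans (Finset.sum_le_sum fun k _ => ?_) (ENNReal.sum_le_tsum (Finset.range n))
    rw [← mul_assoc]
    gcongr
    exact hc k
  have h3 : T.survival (T.states ν) n * -Real.log (T.error ν) ≤ ε := by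
    rw [lt_div_iff₀ (by linarith)] at hn
    nlinarith [T.survival_nonneg (T.states ν) n]
  nlinarith

/-- The achievability bound: if the stages from `t` on yield at least `c` of relative entropy per
copy and the likelihood ratios of all stages are bounded by `exp B`, then `⟨N⟩_ν` is at most about
`-log e_ν / c`. -/
theorem meanCopies_le (hw : T.criterion = .weak) {ν : Fin 2} {B : ℝ} (hB : 0 ≤ B)
    (he : 0 < T.error ν) (he1 : T.error ν ≤ 1)
    (hstep : ∀ k x, (T.schedule k).2.prob (T.states ν) x ≤
      Real.exp B * (T.schedule k).2.prob (T.states (1 - ν)) x) {c : ℝ≥0∞} (hc0 : c ≠ 0)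
    (hctop : c ≠ ∞) {t : ℕ} (hc : ∀ k, t ≤ k → c * ((T.schedule k).1 : ℝ≥0∞) ≤
      (T.schedule k).2.relEntropy (T.states ν) (T.states (1 - ν))) :
    T.meanCopies ν ≤ ∑ k ∈ Finset.range t, ((T.schedule k).1 : ℝ≥0∞) +
      ENNReal.ofReal (-Real.log (T.error ν) + B) / c := by
  have hac : ∀ k x, (T.schedule k).2.prob (T.states (1 - ν)) x = 0 →
      (T.schedule k).2.prob (T.states ν) x = 0 := fun k x hx =>
    le_antisymm ((hstep k x).trans_eq (by rw [hx, mul_zero])) ((T.schedule k).2.prob_nonneg _ _)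
  rw [meanCopies_eq]
  refine ENNReal.tsum_le_of_sum_range_le fun n => ?_
  have h1 : ∀ k, ((T.schedule k).1 : ℝ≥0∞) * ENNReal.ofReal (T.survival (T.states ν) k) ≤
      (if k < t then ((T.schedule k).1 : ℝ≥0∞) else 0) +
        (T.schedule k).2.relEntropy (T.states ν) (T.states (1 - ν)) *
          ENNReal.ofReal (T.survival (T.states ν) k) * c⁻¹ := by
    intro k
    by_cases hk : k < t
    · rw [if_pos hk]
      refine le_add_right (mul_le_of_le_one_right zero_le ?_)
      rw [← ENNReal.ofReal_one]
      exact ENNReal.ofReal_le_ofReal (T.survival_le_one _ k)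
    · rw [if_neg hk, zero_add, mul_right_comm]
      gcongr
      rw [← div_eq_mul_inv, ENNReal.le_div_iff_mul_le (Or.inl hc0) (Or.inl hctop), mul_comm]
      exact hc k (not_lt.mp hk)
  refine (Finset.sum_le_sum fun k _ => h1 k).trans ?_
  rw [Finset.sum_add_distrib, ← Finset.sum_mul]
  refine add_le_add ?_ ?_
  · rw [← Finset.sum_filter]
    refine Finset.sum_le_sum_of_subset fun k hk => ?_
    rw [Finset.mem_filter] at hk
    exact Finset.mem_range.mpr hk.2
  · rw [div_eq_mul_inv]
    gcongr
    rw [← T.ofReal_sum_survival_mul_stageKL hac]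
    exact ENNReal.ofReal_le_ofReal (T.sum_survival_mul_stageKL_le hw hB he he1 hstep n)

/-- An outcome that is impossible under the other hypothesis stops the test. -/
theorem survival_le_prod (hη : ∀ i, 0 < T.prior i) (he : ∀ i, 0 < T.error i) (ν : Fin 2) (k : ℕ) :
    T.survival (T.states ν) k ≤ ∏ i ∈ Finset.range k,
      (1 - (T.schedule i).2.hitProb (T.states ν) (T.states (1 - ν))) := by
  let h : ∀ i, Fin (T.schedule i).2.outcomes → ℝ := fun i x =>
    if (T.schedule i).2.prob (T.states (1 - ν)) x = 0 then 0 else 1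
  have hnn : ∀ i x, 0 ≤ h i x := fun i x => by
    simp only [h]
    split_ifs <;> norm_num
  let g : ℕ → Record T.schedule → ℝ := fun k ω => ∏ i ∈ Finset.range k, h i (ω i)
  have hgd : ∀ k, DependsOn (g k) (Set.Iio k) := fun k x y hxy =>
    Finset.prod_congr rfl fun i hi => by rw [hxy i (Finset.mem_range.mp hi)]
  have hg : ∀ k, ∫ ω, g k ω ∂(recordLaw T.schedule (T.states ν)) = ∏ i ∈ Finset.range k,
      (1 - (T.schedule i).2.hitProb (T.states ν) (T.states (1 - ν))) := by
    intro k
    induction k with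
    | zero => simp [g]
    | succ k ih =>
      have : g (k + 1) = fun ω => g k ω * h k (ω k) := by
        ext ω
        exact Finset.prod_range_succ _ _
      rw [this, integral_mul_next _ (hgd k), ih, Finset.prod_range_succ]
      congr 1
      exact (T.schedule k).2.hitProb_aux _ _
  rw [← hg, ← integral_alive]
  refine integral_mono_ae (integrable_record_of_dependsOn _ (T.dependsOn_alive k))
    (integrable_record_of_dependsOn _ (hgd k)) ?_
  filter_upwards [ae_prob_pos (T.states ν)] with ω hp
  by_cases hk : (k : ℕ∞) < T.stages ω
  -- A surviving record contains no excluding outcome: the first one would make the other likelihood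
  -- vanish and `ν` acceptable immediately.
  · have : g k ω = 1 := by
      refine Finset.prod_eq_one fun i hi => ?_
      rw [Finset.mem_range] at hi
      simp only [h]
      rw [if_neg]
      intro h0
      have hLq : likelihood T.schedule (T.states (1 - ν)) (i + 1) ω = 0 :=
        Finset.prod_eq_zero (Finset.mem_range.mpr i.lt_succ_self) h0
      have hLp : 0 < likelihood T.schedule (T.states ν) (i + 1) ω :=
        Finset.prod_pos fun k _ => hp k
      refine T.lt_stages_iff.mp hk (i + 1) (by omega) (by omega) ν ?_
      unfold AcceptsAt Accepts
      cases T.criterion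
      -- For the strong criterion, a vanishing likelihood of the other hypothesis makes the
      -- posterior probability of `ν` equal to `1`.
      · have hs : T.prior 0 * likelihood T.schedule (T.states 0) (i + 1) ω +
            T.prior 1 * likelihood T.schedule (T.states 1) (i + 1) ω =
            T.prior ν * likelihood T.schedule (T.states ν) (i + 1) ω := by
          fin_cases ν
          · have : likelihood T.schedule (T.states 1) (i + 1) ω = 0 := hLq
            simp [this]
          · have : likelihood T.schedule (T.states 0) (i + 1) ω = 0 := hLq
            simp [this]
        simp only [hs]
        rw [div_self (mul_pos (hη ν) hLp).ne']
        linarith [he ν]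
      · exact ⟨hLp, by simpa [hLq] using mul_nonneg (he ν).le hLp.le⟩
    rw [this]
    exact T.alive_le_one k ω
  · rw [alive_of_not_lt hk]
    exact Finset.prod_nonneg fun i _ => hnn i _

theorem survival_le_pow (hη : ∀ i, 0 < T.prior i) (he : ∀ i, 0 < T.error i) {ν : Fin 2} {κ : ℝ}
    (hκ : ∀ i, κ ≤ (T.schedule i).2.hitProb (T.states ν) (T.states (1 - ν))) (k : ℕ) :
    ENNReal.ofReal (T.survival (T.states ν) k) ≤ ENNReal.ofReal (1 - κ) ^ k := by
  have h1 : κ ≤ 1 := (hκ 0).trans ((T.schedule 0).2.hitProb_le_one _ _)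
  rw [← ENNReal.ofReal_pow (by linarith)]
  refine ENNReal.ofReal_le_ofReal ((T.survival_le_prod hη he ν k).trans ?_)
  calc ∏ i ∈ Finset.range k, (1 - (T.schedule i).2.hitProb (T.states ν) (T.states (1 - ν)))
      ≤ ∏ _i ∈ Finset.range k, (1 - κ) := Finset.prod_le_prod
        (fun i _ => sub_nonneg.mpr ((T.schedule i).2.hitProb_le_one _ _))
        fun i _ => by linarith [hκ i]
    _ = (1 - κ) ^ k := by simp

end SPRT

theorem one_sub_ofReal_one_sub {κ : ℝ} (hκ : 0 < κ) (hκ1 : κ ≤ 1) :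
    (1 - ENNReal.ofReal (1 - κ))⁻¹ = ENNReal.ofReal κ⁻¹ := by
  rw [← ENNReal.ofReal_one, ← ENNReal.ofReal_sub _ (by linarith), ENNReal.ofReal_inv_of_pos hκ]
  congr 2
  ring

/-- Each block excludes the other hypothesis with probability at least `κ`, so the number of blocks
is dominated by a geometric variable of mean `1 / κ`, whatever the error bounds are. -/
theorem meanCopies_blockSampling_le {d ℓ : ℕ} (s : Fin 2 → State d) (c : Criterion)
    {η e : Fin 2 → ℝ} (hη : ∀ i, 0 < η i) (he : ∀ i, 0 < e i) (K : BlockPOVM d ℓ) {ν : Fin 2}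
    {κ : ℝ} (hκ0 : 0 < κ) (hκ : κ ≤ K.hitProb (s ν) (s (1 - ν))) :
    (SPRT.mk s η c e (blockSampling K)).meanCopies ν ≤ ENNReal.ofReal κ⁻¹ * ℓ := by
  have hκ1 : κ ≤ 1 := hκ.trans (K.hitProb_le_one _ _)
  rw [SPRT.meanCopies_eq, ← one_sub_ofReal_one_sub hκ0 hκ1, ← ENNReal.tsum_geometric,
    ← ENNReal.tsum_mul_right]
  refine ENNReal.tsum_le_tsum fun k => ?_
  rw [mul_comm]
  exact mul_le_mul_left ((SPRT.mk s η c e (blockSampling K)).survival_le_pow hη he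
    (fun _ => hκ) k) _

theorem prefixedSampling_of_lt {d ℓ t k : ℕ} (E : BlockPOVM d 1) (K : BlockPOVM d ℓ) (h : k < t) :
    prefixedSampling t E K k = ⟨1, E⟩ := if_pos h

theorem prefixedSampling_of_le {d ℓ t k : ℕ} (E : BlockPOVM d 1) (K : BlockPOVM d ℓ) (h : t ≤ k) :
    prefixedSampling t E K k = ⟨ℓ, K⟩ := if_neg (not_lt.mpr h)

/-- The single-copy stages cost at most `1 / κ` in the mean. The blocks are reached with probability
at most `(1 - κ)^ℓ`, and `ℓ (1 - κ)^ℓ` is below the geometric sum `1 / κ`. This cancels the block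
length, so the bound does not depend on `ℓ`. -/
theorem meanCopies_prefixedSampling_le {d ℓ : ℕ} (s : Fin 2 → State d) (c : Criterion)
    {η e : Fin 2 → ℝ} (hη : ∀ i, 0 < η i) (he : ∀ i, 0 < e i) (E : BlockPOVM d 1)
    (K : BlockPOVM d ℓ) {ν : Fin 2}
    {κ : ℝ} (hκ0 : 0 < κ) (hE : κ ≤ E.hitProb (s ν) (s (1 - ν)))
    (hκ : κ ≤ K.hitProb (s ν) (s (1 - ν))) :
    (SPRT.mk s η c e (prefixedSampling ℓ E K)).meanCopies ν ≤
      ENNReal.ofReal κ⁻¹ + ENNReal.ofReal κ⁻¹ * ENNReal.ofReal κ⁻¹ := by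
  have hκ1 : κ ≤ 1 := hκ.trans (K.hitProb_le_one _ _)
  set T := SPRT.mk s η c e (prefixedSampling ℓ E K) with hT
  set r := ENNReal.ofReal (1 - κ) with hr
  have hr1 : r ≤ 1 := by
    rw [hr, ← ENNReal.ofReal_one]
    exact ENNReal.ofReal_le_ofReal (by linarith)
  have hhit : ∀ i, κ ≤ (T.schedule i).2.hitProb (T.states ν) (T.states (1 - ν)) := by
    intro i
    change κ ≤ (T.schedule i).2.hitProb (s ν) (s (1 - ν))
    by_cases hi : i < ℓ
    · rw [show T.schedule i = ⟨1, E⟩ from prefixedSampling_of_lt E K hi]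
      exact hE
    · rw [show T.schedule i = ⟨ℓ, K⟩ from prefixedSampling_of_le E K (not_lt.mp hi)]
      exact hκ
  have hs : ∀ k, ENNReal.ofReal (T.survival (T.states ν) k) ≤ r ^ k :=
    T.survival_le_pow hη he hhit
  have hgeo : ∑' k, r ^ k = ENNReal.ofReal κ⁻¹ := by
    rw [ENNReal.tsum_geometric, one_sub_ofReal_one_sub hκ0 hκ1]
  have h1 : ∀ k, k < ℓ → (T.schedule k).1 = 1 := fun k hk =>
    congrArg Sigma.fst (prefixedSampling_of_lt E K hk)
  have h2 : ∀ k, (T.schedule (k + ℓ)).1 = ℓ := fun k =>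
    congrArg Sigma.fst (prefixedSampling_of_le E K (Nat.le_add_left ℓ k))
  rw [SPRT.meanCopies_eq, ← ENNReal.summable.sum_add_tsum_nat_add' (k := ℓ)]
  refine add_le_add ?_ ?_
  · rw [← hgeo]
    refine le_trans (Finset.sum_le_sum fun k hk => ?_) (ENNReal.sum_le_tsum (Finset.range ℓ))
    rw [h1 k (Finset.mem_range.mp hk), Nat.cast_one, one_mul]
    exact hs k
  · have h3 : (ℓ : ℝ≥0∞) * r ^ ℓ ≤ ENNReal.ofReal κ⁻¹ := by
      rw [← hgeo]
      calc (ℓ : ℝ≥0∞) * r ^ ℓ = ∑ _k ∈ Finset.range ℓ, r ^ ℓ := by simp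
        _ ≤ ∑ k ∈ Finset.range ℓ, r ^ k := Finset.sum_le_sum fun k hk =>
          pow_le_pow_of_le_one zero_le hr1 (Finset.mem_range.mp hk).le
        _ ≤ _ := ENNReal.sum_le_tsum (Finset.range ℓ)
    calc ∑' k, ((T.schedule (k + ℓ)).1 : ℝ≥0∞) * ENNReal.ofReal (T.survival (T.states ν) (k + ℓ))
        ≤ ∑' k, (ℓ : ℝ≥0∞) * r ^ ℓ * r ^ k := ENNReal.tsum_le_tsum fun k => by
          rw [h2, mul_assoc, ← pow_add, add_comm ℓ k]
          gcongr
          exact hs _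
      _ = (ℓ : ℝ≥0∞) * r ^ ℓ * ENNReal.ofReal κ⁻¹ := by rw [ENNReal.tsum_mul_left, hgeo]
      _ ≤ _ := by gcongr

/-! ### Asymptotics of the mean number of copies -/

/-- The thresholds of the likelihood ratio test that is equivalent to a criterion. -/
def threshold (c : Criterion) (η e : Fin 2 → ℝ) (ν : Fin 2) : ℝ :=
  match c with
  | .strong => e ν * η ν / (η (1 - ν) * (1 - e ν))
  | .weak => e ν

/-- Solving the condition on the posterior for the likelihood ratio gives the threshold. If `L ν =
0`, the posterior is `0` (also in the case `0 / 0`) and neither test accepts. -/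
theorem accepts_iff_threshold {c : Criterion} {η e L : Fin 2 → ℝ} (hη : ∀ i, 0 < η i)
    (he : ∀ i, e i < 1) (hL : ∀ i, 0 ≤ L i) (ν : Fin 2) :
    Accepts c η e L ν ↔ Accepts .weak η (threshold c η e) L ν := by
  cases c
  · simp only [Accepts, threshold]
    have hs : η 0 * L 0 + η 1 * L 1 = η ν * L ν + η (1 - ν) * L (1 - ν) := by
      fin_cases ν
      · rfl
      · exact add_comm _ _
    rw [hs]
    have h1 : 0 < 1 - e ν := by linarith [he ν]
    have h2 : 0 ≤ η (1 - ν) * L (1 - ν) := mul_nonneg (hη _).le (hL _)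
    rcases (hL ν).eq_or_lt with h0 | h0
    · rw [← h0]
      simp [he ν]
    · have h3 : 0 < η ν * L ν := mul_pos (hη ν) h0
      rw [le_div_iff₀ (by linarith), div_mul_eq_mul_div, le_div_iff₀ (mul_pos (hη _) h1)]
      constructor
      · intro h
        exact ⟨h0, by nlinarith⟩
      · rintro ⟨-, h⟩
        nlinarith
  · exact Iff.rfl

theorem meanCopies_eq_threshold {d : ℕ} (s : Fin 2 → State d) (c : Criterion) {η e : Fin 2 → ℝ}
    (hη : ∀ i, 0 < η i) (he : ∀ i, e i < 1) (S : Schedule d) (ν : Fin 2) :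
    (SPRT.mk s η c e S).meanCopies ν =
      (SPRT.mk s η .weak (threshold c η e) S).meanCopies ν := by
  have h1 : (SPRT.mk s η c e S).stages = (SPRT.mk s η .weak (threshold c η e) S).stages := by
    ext1 ω
    unfold SPRT.stages
    congr! 6 with n ν
    exact accepts_iff_threshold hη he (fun i => likelihood_nonneg _ _ _) _
  unfold SPRT.meanCopies SPRT.copies
  rw [h1]

theorem tendsto_smallErrors (ν : Fin 2) :
    Tendsto (fun e : Fin 2 → ℝ => e ν) smallErrors (𝓝[>] 0) := tendsto_eval_pi _ ν

theorem tendsto_threshold {c : Criterion} {η : Fin 2 → ℝ} (hη : ∀ i, 0 < η i) (ν : Fin 2) :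
    Tendsto (fun e => threshold c η e ν) smallErrors (𝓝[>] 0) := by
  cases c
  · have h1 := tendsto_smallErrors ν
    have h2 : Tendsto (fun e : Fin 2 → ℝ => e ν) smallErrors (𝓝 0) :=
      h1.mono_right nhdsWithin_le_nhds
    refine tendsto_nhdsWithin_iff.mpr ⟨?_, ?_⟩
    · have h3 : Tendsto (fun e : Fin 2 → ℝ => e ν * η ν / (η (1 - ν) * (1 - e ν))) smallErrors
          (𝓝 (0 * η ν / (η (1 - ν) * (1 - 0)))) :=
        (h2.mul_const _).div ((h2.const_sub 1).const_mul _) (by simpa using (hη _).ne')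
      simpa [threshold] using h3
    · filter_upwards [h1.eventually self_mem_nhdsWithin, h2.eventually (gt_mem_nhds one_pos)]
        with e h3 h4
      have h5 : 0 < 1 - e ν := by linarith
      exact div_pos (mul_pos h3 (hη ν)) (mul_pos (hη _) h5)
  · exact tendsto_smallErrors ν

theorem tendsto_neg_log_atTop {α : Type*} {l : Filter α} {f : α → ℝ} (hf : Tendsto f l (𝓝[>] 0)) :
    Tendsto (fun a => -Real.log (f a)) l atTop :=
  tendsto_neg_atBot_atTop.comp (Real.tendsto_log_nhdsGT_zero.comp hf)

/-- The priors and the factor `1 - e ν` change the logarithm of the threshold only by a bounded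
amount. -/
theorem tendsto_log_threshold_div {c : Criterion} {η : Fin 2 → ℝ} (hη : ∀ i, 0 < η i) (ν : Fin 2) :
    Tendsto (fun e => -Real.log (threshold c η e ν) / -Real.log (e ν)) smallErrors (𝓝 1) := by
  have h1 := tendsto_smallErrors ν
  have h2 : Tendsto (fun e : Fin 2 → ℝ => e ν) smallErrors (𝓝 0) :=
    h1.mono_right nhdsWithin_le_nhds
  have hlog := tendsto_neg_log_atTop h1
  cases c
  · have h3 : Tendsto (fun e : Fin 2 → ℝ => Real.log (η (1 - ν)) + Real.log (1 - e ν) -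
        Real.log (η ν)) smallErrors (𝓝 (Real.log (η (1 - ν)) + Real.log (1 - 0) -
          Real.log (η ν))) :=
      (((h2.const_sub 1).log (by norm_num)).const_add _).sub_const _
    have h4 := (h3.div_atTop hlog).const_add 1
    rw [add_zero] at h4
    refine h4.congr' ?_
    filter_upwards [h1.eventually self_mem_nhdsWithin, h2.eventually (gt_mem_nhds one_pos),
      hlog.eventually_gt_atTop 0] with e h5 h6 h7
    have h5' : 0 < e ν := h5
    have h8 : 0 < 1 - e ν := by linarith
    simp only [threshold]
    rw [Real.log_div (mul_pos h5' (hη ν)).ne' (mul_pos (hη _) h8).ne',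
      Real.log_mul h5'.ne' (hη ν).ne', Real.log_mul (hη _).ne' h8.ne', eq_div_iff h7.ne', add_mul,
      div_mul_cancel₀ _ h7.ne']
    ring
  · refine tendsto_const_nhds.congr' ?_
    filter_upwards [hlog.eventually_gt_atTop 0] with e h7
    exact (div_self h7.ne').symm

/-- Error bounds, and the corresponding thresholds, between `0` and `1`. -/
def SmallEnough (c : Criterion) (η e : Fin 2 → ℝ) : Prop :=
  ∀ i, (0 < e i ∧ e i < 1) ∧ (0 < threshold c η e i ∧ threshold c η e i < 1)

theorem eventually_smallEnough {c : Criterion} {η : Fin 2 → ℝ} (hη : ∀ i, 0 < η i) :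
    ∀ᶠ e in smallErrors, SmallEnough c η e := by
  have h : ∀ᶠ x : ℝ in 𝓝[>] 0, 0 < x ∧ x < 1 :=
    (eventually_mem_nhdsWithin).and (mem_nhdsWithin_of_mem_nhds (gt_mem_nhds one_pos))
  exact eventually_all.mpr fun i => ((tendsto_smallErrors i).eventually h).and
    ((tendsto_threshold hη i).eventually h)

theorem SmallEnough.neg_log_pos {c : Criterion} {η e : Fin 2 → ℝ} (h : SmallEnough c η e)
    (ν : Fin 2) : 0 < -Real.log (e ν) :=
  neg_pos.mpr (Real.log_neg (h ν).1.1 (h ν).1.2)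

theorem SmallEnough.negLog_ne_zero {c : Criterion} {η e : Fin 2 → ℝ} (h : SmallEnough c η e)
    (ν : Fin 2) : negLog (e ν) ≠ 0 := (ENNReal.ofReal_pos.mpr (h.neg_log_pos ν)).ne'

theorem negLog_ne_top (x : ℝ) : negLog x ≠ ∞ := ENNReal.ofReal_ne_top

/-- The factor by which the converse bound for `⟨N⟩_ν` differs from its leading order. -/
def lowerFactor (c : Criterion) (η : Fin 2 → ℝ) (ν : Fin 2) (e : Fin 2 → ℝ) : ℝ≥0∞ :=
  ENNReal.ofReal ((1 - threshold c η e (1 - ν)) * -Real.log (threshold c η e ν) - 1) /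
    negLog (e ν)

theorem tendsto_ofReal_div_negLog {α : Type*} {l : Filter α} {e : α → Fin 2 → ℝ}
    (he : Tendsto e l smallErrors) {ν : Fin 2} {f : α → ℝ} {r : ℝ}
    (h : Tendsto (fun a => f a / -Real.log (e a ν)) l (𝓝 r)) :
    Tendsto (fun a => ENNReal.ofReal (f a) / negLog (e a ν)) l (𝓝 (ENNReal.ofReal r)) := by
  refine (ENNReal.tendsto_ofReal h).congr' ?_
  filter_upwards [(tendsto_neg_log_atTop ((tendsto_smallErrors ν).comp he)).eventually_gt_atTop 0]
    with a ha
  exact ENNReal.ofReal_div_of_pos ha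

theorem tendsto_lowerFactor {c : Criterion} {η : Fin 2 → ℝ} (hη : ∀ i, 0 < η i) (ν : Fin 2) :
    Tendsto (lowerFactor c η ν) smallErrors (𝓝 1) := by
  rw [← ENNReal.ofReal_one]
  refine tendsto_ofReal_div_negLog tendsto_id ?_
  have h1 : Tendsto (fun e => threshold c η e (1 - ν)) smallErrors (𝓝 0) :=
    (tendsto_threshold hη (1 - ν)).mono_right nhdsWithin_le_nhds
  have h2 := ((h1.const_sub 1).mul (tendsto_log_threshold_div (c := c) hη ν)).sub
    ((tendsto_const_nhds (x := (1 : ℝ))).div_atTop (tendsto_neg_log_atTop (tendsto_smallErrors ν)))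
  simp only [sub_zero, mul_one] at h2
  refine h2.congr fun e => ?_
  simp only [id]
  ring

theorem lowerFactor_mul_inv_le {d : ℕ} {s : Fin 2 → State d} {c : Criterion} {η e : Fin 2 → ℝ}
    (hη : ∀ i, 0 < η i) (he : SmallEnough c η e) {S : Schedule d} {ν : Fin 2} {κ : ℝ≥0∞}
    (hκ : ∀ k, (S k).2.relEntropy (s ν) (s (1 - ν)) ≤ κ * ((S k).1 : ℝ≥0∞))
    (hinf : ∑' k, ((S k).1 : ℝ≥0∞) = ∞) :
    lowerFactor c η ν e * κ⁻¹ ≤ (SPRT.mk s η c e S).meanCopies ν / negLog (e ν) := by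
  rw [meanCopies_eq_threshold s c hη fun i => (he i).1.2]
  have h := (SPRT.mk s η .weak (threshold c η e) S).div_le_meanCopies rfl (ν := ν)
    (fun i => (he i).2.1) (he ν).2.2.le hκ hinf
  calc lowerFactor c η ν e * κ⁻¹ = ENNReal.ofReal ((1 - threshold c η e (1 - ν)) *
        -Real.log (threshold c η e ν) - 1) / κ / negLog (e ν) := by
        rw [lowerFactor, div_eq_mul_inv, div_eq_mul_inv, div_eq_mul_inv, mul_right_comm]
    _ ≤ _ := ENNReal.div_le_div_right h _

theorem meanCopies_div_negLog_le {d : ℕ} {s : Fin 2 → State d} {c : Criterion} {η e : Fin 2 → ℝ}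
    (hη : ∀ i, 0 < η i) (he : SmallEnough c η e) {S : Schedule d} {ν : Fin 2} {κ : ℝ≥0∞}
    (hκ0 : κ ≠ 0) (hκtop : κ ≠ ∞) {t : ℕ} {B : ℝ} (hB : 0 ≤ B)
    (hκ : ∀ k, t ≤ k → κ * ((S k).1 : ℝ≥0∞) ≤ (S k).2.relEntropy (s ν) (s (1 - ν)))
    (hstep : ∀ k x, (S k).2.prob (s ν) x ≤ Real.exp B * (S k).2.prob (s (1 - ν)) x) :
    (SPRT.mk s η c e S).meanCopies ν / negLog (e ν) ≤
      (∑ k ∈ Finset.range t, ((S k).1 : ℝ≥0∞)) / negLog (e ν) +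
        (ENNReal.ofReal (-Real.log (threshold c η e ν) + B) / negLog (e ν)) * κ⁻¹ := by
  rw [meanCopies_eq_threshold s c hη fun i => (he i).1.2]
  have h := (SPRT.mk s η .weak (threshold c η e) S).meanCopies_le rfl (ν := ν) hB
    (he ν).2.1 (he ν).2.2.le hstep hκ0 hκtop hκ
  refine (ENNReal.div_le_div_right h _).trans_eq ?_
  rw [ENNReal.add_div]
  congr 1
  rw [div_eq_mul_inv, div_eq_mul_inv, div_eq_mul_inv, mul_right_comm]

/-- The converse and achievability bounds squeeze the mean, for schedules that vary together with
the errors. The first `t a` stages are allowed to yield less as long as their copies are negligible,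
and the overshoot `B a` may grow more slowly than `-log ε`. If `D = 0`, the lower bound alone
already diverges. -/
theorem tendsto_meanCopies {d : ℕ} {s : Fin 2 → State d} {c : Criterion} {η : Fin 2 → ℝ}
    (hη : ∀ i, 0 < η i) {α : Type*} {l : Filter α} {e : α → Fin 2 → ℝ}
    (he : Tendsto e l smallErrors) {S : α → Schedule d} {ν : Fin 2} {D : ℝ≥0∞} (hD : D ≠ ∞)
    {κ κ' : α → ℝ≥0∞} (hκD : Tendsto κ l (𝓝 D)) (hκD' : Tendsto κ' l (𝓝 D))
    (hκ : ∀ᶠ a in l, ∀ k, (S a k).2.relEntropy (s ν) (s (1 - ν)) ≤ κ a * ((S a k).1 : ℝ≥0∞))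
    (hinf : ∀ᶠ a in l, ∑' k, ((S a k).1 : ℝ≥0∞) = ∞) {t : α → ℕ}
    (hκ' : ∀ᶠ a in l, ∀ k, t a ≤ k →
      κ' a * ((S a k).1 : ℝ≥0∞) ≤ (S a k).2.relEntropy (s ν) (s (1 - ν))) {B : α → ℝ}
    (hB : ∀ a, 0 ≤ B a) (hBe : Tendsto (fun a => B a / -Real.log (e a ν)) l (𝓝 0))
    (hstep : ∀ᶠ a in l, ∀ k x, (S a k).2.prob (s ν) x ≤
      Real.exp (B a) * (S a k).2.prob (s (1 - ν)) x)
    (ht : Tendsto (fun a => (∑ k ∈ Finset.range (t a), ((S a k).1 : ℝ≥0∞)) / negLog (e a ν)) l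
      (𝓝 0)) :
    Tendsto (fun a => (SPRT.mk s η c (e a) (S a)).meanCopies ν / negLog (e a ν)) l (𝓝 D⁻¹) := by
  have hsmall := he.eventually (eventually_smallEnough (c := c) hη)
  have hlow : Tendsto (fun a => lowerFactor c η ν (e a) * (κ a)⁻¹) l (𝓝 D⁻¹) := by
    have h := ENNReal.Tendsto.mul ((tendsto_lowerFactor (c := c) hη ν).comp he)
      (Or.inl one_ne_zero) (tendsto_inv_iff.mpr hκD) (Or.inr ENNReal.one_ne_top)
    simpa using h
  have hle : ∀ᶠ a in l, lowerFactor c η ν (e a) * (κ a)⁻¹ ≤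
      (SPRT.mk s η c (e a) (S a)).meanCopies ν / negLog (e a ν) := by
    filter_upwards [hsmall, hκ, hinf] with a h1 h2 h3
    exact lowerFactor_mul_inv_le hη h1 h2 h3
  by_cases hD0 : D = 0
  · rw [hD0, ENNReal.inv_zero] at hlow ⊢
    exact tendsto_nhds_top_mono hlow hle
  refine tendsto_of_tendsto_of_tendsto_of_le_of_le' hlow (h := fun a =>
    (∑ k ∈ Finset.range (t a), ((S a k).1 : ℝ≥0∞)) / negLog (e a ν) +
      (ENNReal.ofReal (-Real.log (threshold c η (e a) ν) + B a) / negLog (e a ν)) * (κ' a)⁻¹)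
    ?_ hle ?_
  · have h1 : Tendsto (fun a => ENNReal.ofReal (-Real.log (threshold c η (e a) ν) + B a) /
        negLog (e a ν)) l (𝓝 1) := by
      rw [← ENNReal.ofReal_one]
      refine tendsto_ofReal_div_negLog he ?_
      have h2 := ((tendsto_log_threshold_div (c := c) hη ν).comp he).add hBe
      rw [add_zero] at h2
      refine h2.congr fun a => ?_
      rw [add_div]
      rfl
    have h3 := ht.add (ENNReal.Tendsto.mul h1 (Or.inl one_ne_zero) (tendsto_inv_iff.mpr hκD')
      (Or.inr ENNReal.one_ne_top))
    simpa using h3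
  · filter_upwards [hsmall, hκ', hstep, hκD'.eventually_ne hD0, hκD'.eventually_ne hD]
      with a h1 h2 h3 h4 h5
    exact meanCopies_div_negLog_le hη h1 h4 h5 (hB a) h2 h3

theorem tsum_blockSampling {d ℓ : ℕ} (hℓ : ℓ ≠ 0) (K : BlockPOVM d ℓ) :
    ∑' k, (((blockSampling K) k).1 : ℝ≥0∞) = ∞ :=
  ENNReal.tsum_const_eq_top_of_ne_zero (Nat.cast_ne_zero.mpr hℓ)

theorem tendsto_const_div_negLog {α : Type*} {l : Filter α} {e : α → Fin 2 → ℝ}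
    (he : Tendsto e l smallErrors) (ν : Fin 2) {C : ℝ≥0∞} (hC : C ≠ ∞) :
    Tendsto (fun a => C / negLog (e a ν)) l (𝓝 0) := by
  have h1 : Tendsto (fun a => negLog (e a ν)) l (𝓝 ∞) :=
    ENNReal.tendsto_ofReal_atTop.comp (tendsto_neg_log_atTop ((tendsto_smallErrors ν).comp he))
  have h2 := ENNReal.Tendsto.const_div h1 (Or.inr hC)
  rwa [ENNReal.div_top] at h2

/-- Block-sampling with a fixed measurement. -/
theorem tendsto_meanCopies_blockSampling {d : ℕ} (s : Fin 2 → State d) (c : Criterion)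
    {η : Fin 2 → ℝ} (hη : ∀ i, 0 < η i) (ν : Fin 2) {ℓ : ℕ} (hℓ : 1 ≤ ℓ) (K : BlockPOVM d ℓ) :
    Tendsto (fun e => (SPRT.mk s η c e (blockSampling K)).meanCopies ν / negLog (e ν)) smallErrors
      (𝓝 (ℓ / K.relEntropy (s ν) (s (1 - ν)))) := by
  have hℓ0 : (ℓ : ℝ≥0∞) ≠ 0 := Nat.cast_ne_zero.mpr (by omega)
  have hℓtop : (ℓ : ℝ≥0∞) ≠ ∞ := ENNReal.natCast_ne_top ℓ
  by_cases hD : K.relEntropy (s ν) (s (1 - ν)) = ∞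
  · rw [hD, ENNReal.div_top]
    -- An infinite relative entropy means a positive probability of an excluding outcome. The mean
    -- is then bounded, hence negligible against `-log ε`.
    have hκ := K.relEntropy_eq_top_iff.mp hD
    refine tendsto_of_tendsto_of_tendsto_of_le_of_le' tendsto_const_nhds
      (tendsto_const_div_negLog (l := smallErrors) tendsto_id ν
        (C := ENNReal.ofReal (K.hitProb (s ν) (s (1 - ν)))⁻¹ * ℓ)
        (ENNReal.mul_ne_top ENNReal.ofReal_ne_top hℓtop))
      (Eventually.of_forall fun _ => zero_le) ?_
    filter_upwards [eventually_smallEnough (c := c) hη] with e he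
    exact ENNReal.div_le_div_right
      (meanCopies_blockSampling_le s c hη (fun i => (he i).1.1) K hκ le_rfl) _
  · have hac := K.relEntropy_ne_top_iff.mp hD
    obtain ⟨B, hB, hstep⟩ := K.exists_exp_bound hac
    have hfin : K.relEntropy (s ν) (s (1 - ν)) / ℓ ≠ ∞ := ENNReal.div_ne_top hD hℓ0
    have hmul : K.relEntropy (s ν) (s (1 - ν)) / ℓ * ℓ = K.relEntropy (s ν) (s (1 - ν)) :=
      ENNReal.div_mul_cancel hℓ0 hℓtop
    rw [← ENNReal.inv_div (Or.inl hℓtop) (Or.inl hℓ0)]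
    refine tendsto_meanCopies hη tendsto_id hfin tendsto_const_nhds tendsto_const_nhds
      (Eventually.of_forall fun _ _ => hmul.ge)
      (Eventually.of_forall fun _ => tsum_blockSampling (by omega) K) (t := fun _ => 0)
      (Eventually.of_forall fun _ _ _ => hmul.le) (B := fun _ => B) (fun _ => hB)
      (tendsto_const_nhds.div_atTop (tendsto_neg_log_atTop (tendsto_smallErrors ν)))
      (Eventually.of_forall fun _ _ => hstep) (by simpa using tendsto_const_nhds)

theorem lowerFactor_mul_div_le {d : ℕ} {s : Fin 2 → State d} {c : Criterion} {η e : Fin 2 → ℝ}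
    (hη : ∀ i, 0 < η i) (he : SmallEnough c η e) {ν : Fin 2} {ℓ : ℕ} (hℓ : 1 ≤ ℓ)
    (K : BlockPOVM d ℓ) :
    lowerFactor c η ν e * (ℓ / K.relEntropy (s ν) (s (1 - ν))) ≤
      (SPRT.mk s η c e (blockSampling K)).meanCopies ν / negLog (e ν) := by
  have hℓ0 : (ℓ : ℝ≥0∞) ≠ 0 := Nat.cast_ne_zero.mpr (by omega)
  have hℓtop : (ℓ : ℝ≥0∞) ≠ ∞ := ENNReal.natCast_ne_top ℓ
  rw [← ENNReal.inv_div (Or.inl hℓtop) (Or.inl hℓ0)]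
  exact lowerFactor_mul_inv_le hη he (fun _ => (ENNReal.div_mul_cancel hℓ0 hℓtop).ge)
    (tsum_blockSampling (by omega) K)

/-- Pointwise limits do not pass to an infimum by themselves. The lower bound is uniform in `i`, and
for the upper bound a single nearly optimal `i` suffices. -/
theorem tendsto_iInf_div {α ι : Type*} {l : Filter α} {f : α → ι → ℝ≥0∞} {n lo : α → ℝ≥0∞}
    {r : ι → ℝ≥0∞} {I : ℝ≥0∞} (hn : ∀ᶠ a in l, n a ≠ 0 ∧ n a ≠ ∞)
    (hr : ∀ i, Tendsto (fun a => f a i / n a) l (𝓝 (r i))) (hlo : Tendsto lo l (𝓝 1))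
    (hle : ∀ᶠ a in l, ∀ i, lo a * I ≤ f a i / n a) (hI : ⨅ i, r i ≤ I) :
    Tendsto (fun a => (⨅ i, f a i) / n a) l (𝓝 I) := by
  have hlow : ∀ᶠ a in l, lo a * I ≤ (⨅ i, f a i) / n a := by
    filter_upwards [hn, hle] with a h1 h2
    rw [ENNReal.le_div_iff_mul_le (Or.inl h1.1) (Or.inl h1.2)]
    refine le_iInf fun i => ?_
    rw [← ENNReal.le_div_iff_mul_le (Or.inl h1.1) (Or.inl h1.2)]
    exact h2 i
  have hlim : Tendsto (fun a => lo a * I) l (𝓝 I) := by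
    simpa using ENNReal.Tendsto.mul_const hlo (Or.inl one_ne_zero) (b := I)
  refine tendsto_order.mpr ⟨fun b hb => ?_, fun b hb => ?_⟩
  · filter_upwards [hlow, hlim.eventually (lt_mem_nhds hb)] with a h1 h2
    exact h2.trans_le h1
  · obtain ⟨i, hi⟩ := iInf_lt_iff.mp (hI.trans_lt hb)
    filter_upwards [(hr i).eventually (gt_mem_nhds hi)] with a h1
    exact (ENNReal.div_le_div_right (iInf_le _ i) _).trans_lt h1

theorem tendsto_iInf_meanCopies_blockSampling {d : ℕ} (s : Fin 2 → State d) (c : Criterion)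
    {η : Fin 2 → ℝ} (hη : ∀ i, 0 < η i) (ν : Fin 2) {ℓ : ℕ} (hℓ : 1 ≤ ℓ) :
    Tendsto (fun e => (⨅ K : BlockPOVM d ℓ,
        (SPRT.mk s η c e (blockSampling K)).meanCopies ν) / negLog (e ν)) smallErrors
      (𝓝 (⨅ K : BlockPOVM d ℓ, ℓ / K.relEntropy (s ν) (s (1 - ν)))) := by
  refine tendsto_iInf_div ?_ (fun K => tendsto_meanCopies_blockSampling s c hη ν hℓ K)
    (tendsto_lowerFactor (c := c) hη ν) ?_ le_rfl
  · filter_upwards [eventually_smallEnough (c := c) hη] with e he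
    exact ⟨he.negLog_ne_zero ν, negLog_ne_top _⟩
  · filter_upwards [eventually_smallEnough (c := c) hη] with e he K
    exact le_trans (by gcongr; exact iInf_le _ K) (lowerFactor_mul_div_le hη he hℓ K)

/-- Optimal blocks of arbitrary length, given the optimal relative entropy per copy. -/
theorem tendsto_iInf_iInf_meanCopies {d : ℕ} (s : Fin 2 → State d) (c : Criterion)
    {η : Fin 2 → ℝ} (hη : ∀ i, 0 < η i) (ν : Fin 2) {I : ℝ≥0∞}
    (hle : ∀ (ℓ : ℕ) (_ : 1 ≤ ℓ) (K : BlockPOVM d ℓ), I ≤ ℓ / K.relEntropy (s ν) (s (1 - ν)))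
    (hI : ∀ b, I < b → ∃ (ℓ : ℕ) (_ : 1 ≤ ℓ) (K : BlockPOVM d ℓ),
      ℓ / K.relEntropy (s ν) (s (1 - ν)) < b) :
    Tendsto (fun e => (⨅ (ℓ : ℕ) (_ : 1 ≤ ℓ) (K : BlockPOVM d ℓ),
        (SPRT.mk s η c e (blockSampling K)).meanCopies ν) / negLog (e ν)) smallErrors (𝓝 I) := by
  have h : ∀ f : ∀ ℓ, BlockPOVM d ℓ → ℝ≥0∞, ⨅ (ℓ : ℕ) (_ : 1 ≤ ℓ) (K : BlockPOVM d ℓ), f ℓ K =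
      ⨅ i : Σ ℓ : {ℓ : ℕ // 1 ≤ ℓ}, BlockPOVM d ℓ, f i.1 i.2 := fun f => by
    rw [iInf_sigma, iInf_subtype]
  simp only [h fun ℓ K => (SPRT.mk s η c _ (blockSampling K)).meanCopies ν]
  refine tendsto_iInf_div (r := fun i : Σ ℓ : {ℓ : ℕ // 1 ≤ ℓ}, BlockPOVM d ℓ =>
    ((i.1 : ℕ) : ℝ≥0∞) / i.2.relEntropy (s ν) (s (1 - ν))) ?_
    (fun i => tendsto_meanCopies_blockSampling s c hη ν i.1.2 i.2)
    (tendsto_lowerFactor (c := c) hη ν) ?_ ?_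
  · filter_upwards [eventually_smallEnough (c := c) hη] with e he
    exact ⟨he.negLog_ne_zero ν, negLog_ne_top _⟩
  · filter_upwards [eventually_smallEnough (c := c) hη] with e he i
    exact le_trans (by gcongr; exact hle _ i.1.2 i.2) (lowerFactor_mul_div_le hη he i.1.2 i.2)
  · refine le_of_forall_gt fun b hb => ?_
    obtain ⟨ℓ, hℓ, K, hK⟩ := hI b hb
    exact (iInf_le _ (⟨⟨ℓ, hℓ⟩, K⟩ : Σ ℓ : {ℓ : ℕ // 1 ≤ ℓ}, BlockPOVM d ℓ)).trans_lt hK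

theorem tendsto_mul_natCast_div_negLog {ν : Fin 2} {ℓ : ℕ → ℕ} {e : ℕ → Fin 2 → ℝ}
    (he : Tendsto e atTop smallErrors)
    (hℓe : Tendsto (fun n => (ℓ n : ℝ) / -Real.log (e n ν)) atTop (𝓝 0)) (C : ℝ≥0) :
    Tendsto (fun n => (C : ℝ≥0∞) * (ℓ n : ℝ≥0∞) / negLog (e n ν)) atTop (𝓝 0) := by
  have h1 := tendsto_ofReal_div_negLog he (ν := ν) (f := fun n => (C : ℝ) * ℓ n) (r := 0) (by
    have := hℓe.const_mul (C : ℝ)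
    rw [mul_zero] at this
    exact this.congr fun n => by ring)
  rw [ENNReal.ofReal_zero] at h1
  refine h1.congr fun n => ?_
  rw [ENNReal.ofReal_mul C.coe_nonneg, ENNReal.ofReal_coe_nnreal, ENNReal.ofReal_natCast]

/-- Schedules that yield asymptotically `D < ∞` of relative entropy per copy attain the rate `D`. -/
theorem attainsRate_of_ne_top {d : ℕ} {s : Fin 2 → State d} {S : ℕ → Schedule d} {ν : Fin 2}
    {D : ℝ≥0∞} (hD : D ≠ ∞) {κ κ' : ℕ → ℝ≥0∞} (hκD : Tendsto κ atTop (𝓝 D))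
    (hκD' : Tendsto κ' atTop (𝓝 D))
    (hκ : ∀ᶠ ℓ in atTop, ∀ k, (S ℓ k).2.relEntropy (s ν) (s (1 - ν)) ≤ κ ℓ * ((S ℓ k).1 : ℝ≥0∞))
    (hinf : ∀ᶠ ℓ in atTop, ∑' k, ((S ℓ k).1 : ℝ≥0∞) = ∞) {t : ℕ → ℕ}
    (hκ' : ∀ᶠ ℓ in atTop, ∀ k, t ℓ ≤ k →
      κ' ℓ * ((S ℓ k).1 : ℝ≥0∞) ≤ (S ℓ k).2.relEntropy (s ν) (s (1 - ν))) {B : ℝ} (hB : 0 ≤ B)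
    (hstep : ∀ᶠ ℓ in atTop, ∀ k x, (S ℓ k).2.prob (s ν) x ≤
      Real.exp (B * ℓ) * (S ℓ k).2.prob (s (1 - ν)) x)
    (ht : ∀ ℓ, ∑ k ∈ Finset.range (t ℓ), ((S ℓ k).1 : ℝ≥0∞) ≤ ℓ) :
    AttainsRate s S ν D := by
  intro c η hη ℓ e hℓ he hℓe
  refine tendsto_meanCopies hη.1 he hD (hκD.comp hℓ) (hκD'.comp hℓ) (hℓ.eventually hκ)
    (hℓ.eventually hinf) (t := fun n => t (ℓ n)) (hℓ.eventually hκ') (B := fun n => B * ℓ n)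
    (fun n => by positivity) ?_ (hℓ.eventually hstep) ?_
  · have := hℓe.const_mul B
    rw [mul_zero] at this
    exact this.congr fun n => by ring
  · have h := tendsto_mul_natCast_div_negLog he hℓe 1
    refine tendsto_of_tendsto_of_tendsto_of_le_of_le tendsto_const_nhds h (fun _ => zero_le)
      fun n => ENNReal.div_le_div_right ?_ _
    simpa using ht (ℓ n)

theorem attainsRate_top {d : ℕ} {s : Fin 2 → State d} {S : ℕ → Schedule d} {ν : Fin 2} {C : ℝ≥0}
    (h : ∀ᶠ ℓ in atTop, ∀ (c : Criterion) (η e : Fin 2 → ℝ), IsPrior η → (∀ i, 0 < e i) →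
      (SPRT.mk s η c e (S ℓ)).meanCopies ν ≤ C * ((ℓ : ℕ) : ℝ≥0∞)) :
    AttainsRate s S ν ∞ := by
  intro c η hη ℓ e hℓ he hℓe
  rw [ENNReal.inv_top]
  refine tendsto_of_tendsto_of_tendsto_of_le_of_le' tendsto_const_nhds
    (tendsto_mul_natCast_div_negLog he hℓe C) (Eventually.of_forall fun _ => zero_le) ?_
  filter_upwards [he.eventually (eventually_smallEnough (c := c) hη.1), hℓ.eventually h]
    with n h1 h2
  exact ENNReal.div_le_div_right (h2 c η (e n) hη fun i => (h1 i).1.1) _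

/-- Block-sampling with measurements that yield asymptotically `D < ∞` per copy. -/
theorem attainsRate_blockSampling {d : ℕ} {s : Fin 2 → State d} {K : ∀ ℓ, BlockPOVM d ℓ}
    {ν : Fin 2} {D : ℝ≥0∞} (hD : D ≠ ∞)
    (hK : Tendsto (fun ℓ => (K ℓ).relEntropy (s ν) (s (1 - ν)) / ℓ) atTop (𝓝 D)) {B : ℝ}
    (hB : 0 ≤ B) (hstep : ∀ᶠ ℓ in atTop, ∀ x, (K ℓ).prob (s ν) x ≤
      Real.exp (B * ℓ) * (K ℓ).prob (s (1 - ν)) x) :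
    AttainsRate s (fun ℓ => blockSampling (K ℓ)) ν D := by
  have hmul : ∀ᶠ ℓ : ℕ in atTop, (K ℓ).relEntropy (s ν) (s (1 - ν)) / ℓ * ℓ =
      (K ℓ).relEntropy (s ν) (s (1 - ν)) := by
    filter_upwards [eventually_ne_atTop 0] with ℓ hℓ
    exact ENNReal.div_mul_cancel (Nat.cast_ne_zero.mpr hℓ) (ENNReal.natCast_ne_top _)
  exact attainsRate_of_ne_top hD hK hK (hmul.mono fun _ h _ => h.ge)
    ((eventually_ne_atTop 0).mono fun ℓ hℓ => tsum_blockSampling hℓ _) (t := fun _ => 0)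
    (hmul.mono fun _ h _ _ => h.le) hB (hstep.mono fun _ h _ => h) (by simp)

theorem attainsRate_blockSampling_top {d : ℕ} {s : Fin 2 → State d} {K : ∀ ℓ, BlockPOVM d ℓ}
    {ν : Fin 2} {κ : ℝ} (hκ : 0 < κ) (hK : ∀ᶠ ℓ in atTop, κ ≤ (K ℓ).hitProb (s ν) (s (1 - ν))) :
    AttainsRate s (fun ℓ => blockSampling (K ℓ)) ν ∞ :=
  attainsRate_top (C := κ⁻¹.toNNReal) (hK.mono fun _ h c _ _ hη he =>
    meanCopies_blockSampling_le s c hη.1 he _ hκ h)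

/-! ### Tensor products of matrices -/

/-- The tensor product of a family of matrices. -/
def tensorFamily {d ℓ : ℕ} (X : Fin ℓ → Matrix (Fin d) (Fin d) ℂ) :
    Matrix (Fin ℓ → Fin d) (Fin ℓ → Fin d) ℂ :=
  Matrix.of fun x y => ∏ i, X i (x i) (y i)

section Tensor

variable {d ℓ : ℕ}

theorem tensorFamily_mul (X Y : Fin ℓ → Matrix (Fin d) (Fin d) ℂ) :
    tensorFamily X * tensorFamily Y = tensorFamily fun i => X i * Y i := by
  ext x y
  simp only [tensorFamily, Matrix.of_apply, Matrix.mul_apply]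
  rw [Finset.prod_univ_sum]
  simp [Finset.prod_mul_distrib]

theorem tensorFamily_conjTranspose (X : Fin ℓ → Matrix (Fin d) (Fin d) ℂ) :
    (tensorFamily X)ᴴ = tensorFamily fun i => (X i)ᴴ := by
  ext x y
  simp [tensorFamily, Matrix.conjTranspose_apply]

theorem tensorFamily_one : tensorFamily (fun _ : Fin ℓ => (1 : Matrix (Fin d) (Fin d) ℂ)) = 1 := by
  ext x y
  simp only [tensorFamily, Matrix.of_apply, Matrix.one_apply]
  by_cases h : x = y
  · simp [h]
  · obtain ⟨i, hi⟩ := Function.ne_iff.mp h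
    rw [if_neg h]
    exact Finset.prod_eq_zero (Finset.mem_univ i) (if_neg hi)

theorem trace_tensorFamily (X : Fin ℓ → Matrix (Fin d) (Fin d) ℂ) :
    (tensorFamily X).trace = ∏ i, (X i).trace := by
  have h := Finset.prod_univ_sum (fun _ : Fin ℓ => (Finset.univ : Finset (Fin d)))
    (fun i a => X i a a)
  simp only [Fintype.piFinset_univ] at h
  simp [tensorFamily, Matrix.trace, h]

theorem tensorPower_mul (X Y : Matrix (Fin d) (Fin d) ℂ) :
    tensorPower ℓ (X * Y) = tensorPower ℓ X * tensorPower ℓ Y :=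
  (tensorFamily_mul (fun _ => X) fun _ => Y).symm

theorem tensorPower_one : tensorPower ℓ (1 : Matrix (Fin d) (Fin d) ℂ) = 1 := tensorFamily_one

theorem tensorPower_conjTranspose (X : Matrix (Fin d) (Fin d) ℂ) :
    tensorPower ℓ Xᴴ = (tensorPower ℓ X)ᴴ := (tensorFamily_conjTranspose fun _ => X).symm

theorem tensorPower_smul (c : ℂ) (X : Matrix (Fin d) (Fin d) ℂ) :
    tensorPower ℓ (c • X) = c ^ ℓ • tensorPower ℓ X := by
  ext x y
  simp [tensorPower, Finset.prod_mul_distrib]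

theorem tensorPower_diagonal (f : Fin d → ℂ) :
    tensorPower ℓ (Matrix.diagonal f) = Matrix.diagonal fun x => ∏ i, f (x i) := by
  ext x y
  simp only [tensorPower, Matrix.of_apply, Matrix.diagonal_apply]
  by_cases h : x = y
  · simp [h]
  · obtain ⟨i, hi⟩ := Function.ne_iff.mp h
    rw [if_neg h]
    exact Finset.prod_eq_zero (Finset.mem_univ i) (if_neg hi)

theorem posSemidef_iff_exists {ι : Type*} [Fintype ι] [DecidableEq ι] {A : Matrix ι ι ℂ} :
    A.PosSemidef ↔ ∃ B : Matrix ι ι ℂ, A = Bᴴ * B := by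
  constructor
  · intro h
    open scoped MatrixOrder in
    exact CStarAlgebra.nonneg_iff_eq_star_mul_self.mp h.nonneg
  · rintro ⟨B, rfl⟩
    exact Matrix.posSemidef_conjTranspose_mul_self _

theorem tensorFamily_posSemidef {X : Fin ℓ → Matrix (Fin d) (Fin d) ℂ}
    (hX : ∀ i, (X i).PosSemidef) : (tensorFamily X).PosSemidef := by
  choose B hB using fun i => posSemidef_iff_exists.mp (hX i)
  rw [funext hB, ← tensorFamily_mul, ← tensorFamily_conjTranspose]
  exact Matrix.posSemidef_conjTranspose_mul_self _

/-- Expanding `(A + C)^{⊗ℓ}` over subsets of the factors gives positive semidefinite terms, one of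
which is `A^{⊗ℓ}`. -/
theorem tensorPower_add_sub_posSemidef {A C : Matrix (Fin d) (Fin d) ℂ} (hA : A.PosSemidef)
    (hC : C.PosSemidef) : (tensorPower ℓ (A + C) - tensorPower ℓ A).PosSemidef := by
  classical
  have h : tensorPower ℓ (A + C) =
      ∑ s : Finset (Fin ℓ), tensorFamily fun i => if i ∈ s then A else C := by
    ext x y
    simp only [tensorPower, tensorFamily, Matrix.of_apply, Matrix.add_apply, Matrix.sum_apply]
    rw [Fintype.prod_add]
    refine Finset.sum_congr rfl fun s _ => ?_
    rw [← Finset.prod_mul_prod_compl s]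
    congr 1
    · exact Finset.prod_congr rfl fun i hi => by rw [if_pos hi]
    · exact Finset.prod_congr rfl fun i hi => by rw [if_neg (Finset.mem_compl.mp hi)]
  have h2 : tensorPower ℓ A = tensorFamily fun i => if i ∈ Finset.univ then A else C := by
    simp [tensorFamily, tensorPower]
  rw [h, h2, ← Finset.sum_erase_eq_sub (Finset.mem_univ _)]
  refine Matrix.posSemidef_sum _ fun s _ => tensorFamily_posSemidef fun i => ?_
  split_ifs
  · exact hA
  · exact hC

theorem tensorPower_sub_posSemidef {A B : Matrix (Fin d) (Fin d) ℂ} (hA : A.PosSemidef)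
    (h : (B - A).PosSemidef) : (tensorPower ℓ B - tensorPower ℓ A).PosSemidef := by
  have := tensorPower_add_sub_posSemidef (ℓ := ℓ) hA h
  rwa [add_sub_cancel] at this

end Tensor

/-! ### Traces and positivity -/

theorem trace_mul_re_nonneg {ι : Type*} [Fintype ι] [DecidableEq ι] {A B : Matrix ι ι ℂ}
    (hA : A.PosSemidef) (hB : B.PosSemidef) : 0 ≤ (A * B).trace.re := by
  obtain ⟨C, rfl⟩ := posSemidef_iff_exists.mp hB
  have h : (A * (Cᴴ * C)).trace = (C * A * Cᴴ).trace := by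
    rw [← mul_assoc, Matrix.trace_mul_comm, ← mul_assoc]
  rw [h]
  exact (Complex.le_def.mp (hA.mul_mul_conjTranspose_same C).trace_nonneg).1

theorem mul_eq_zero_of_trace_mul_eq_zero {ι : Type*} [Fintype ι] [DecidableEq ι]
    {A B : Matrix ι ι ℂ} (hA : A.PosSemidef) (hB : B.PosSemidef) (h : (A * B).trace.re = 0) :
    A * B = 0 := by
  obtain ⟨C, rfl⟩ := posSemidef_iff_exists.mp hB
  obtain ⟨D, rfl⟩ := posSemidef_iff_exists.mp hA
  have h1 : (Dᴴ * D * (Cᴴ * C)).trace = ((D * Cᴴ)ᴴ * (D * Cᴴ)).trace := by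
    rw [Matrix.conjTranspose_mul, Matrix.conjTranspose_conjTranspose, ← mul_assoc,
      Matrix.trace_mul_comm]
    simp only [mul_assoc]
  have h2 : 0 ≤ ((D * Cᴴ)ᴴ * (D * Cᴴ)).trace :=
    (Matrix.posSemidef_conjTranspose_mul_self _).trace_nonneg
  have h3 : ((D * Cᴴ)ᴴ * (D * Cᴴ)).trace = 0 := by
    rw [h1] at h
    exact Complex.ext h (Complex.le_def.mp h2).2.symm
  rw [Matrix.trace_conjTranspose_mul_self_eq_zero_iff] at h3
  rw [mul_assoc, ← mul_assoc D, h3, zero_mul, mul_zero]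

/-- An operator bound `ρ ≤ r σ` passes to tensor powers. Likelihood ratios on a block are thus at
most exponential in its length for every measurement, so the overshoot is `O(ℓ)` and negligible when
`ℓ = o(-log ε)`. -/
theorem BlockPOVM.prob_le_mul {d ℓ : ℕ} (K : BlockPOVM d ℓ) {ρ σ : State d} {r : ℝ}
    (h : ((r : ℂ) • σ.mat - ρ.mat).PosSemidef) (x : Fin K.outcomes) :
    K.prob ρ x ≤ r ^ ℓ * K.prob σ x := by
  have h1 := trace_mul_re_nonneg (K.posSemidef x)
    (tensorPower_sub_posSemidef (ℓ := ℓ) ρ.posSemidef h)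
  rw [tensorPower_smul, mul_sub, Matrix.trace_sub, Matrix.mul_smul, Matrix.trace_smul,
    Complex.sub_re, smul_eq_mul, ← Complex.ofReal_pow, Complex.re_ofReal_mul] at h1
  unfold BlockPOVM.prob
  linarith

/-! ### Spectral decompositions -/

/-- `A` has eigenvalues `a` and the columns of the unitary matrix `U` as eigenvectors. -/
structure IsSpectral {ι : Type*} [Fintype ι] [DecidableEq ι] (A U : Matrix ι ι ℂ) (a : ι → ℝ) :
    Prop where
  left : Uᴴ * U = 1
  right : U * Uᴴ = 1
  eq : A = U * Matrix.diagonal (fun i => (a i : ℂ)) * Uᴴ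

theorem exists_isSpectral {ι : Type*} [Fintype ι] [DecidableEq ι] {A : Matrix ι ι ℂ}
    (hA : A.PosSemidef) : ∃ U a, IsSpectral A U a ∧ (∀ i, 0 ≤ a i) ∧
      cfc Real.log A = U * Matrix.diagonal (fun i => (Real.log (a i) : ℂ)) * Uᴴ := by
  refine ⟨hA.1.eigenvectorUnitary, hA.1.eigenvalues, ⟨?_, ?_, ?_⟩, hA.eigenvalues_nonneg, ?_⟩
  · exact Unitary.coe_star_mul_self hA.1.eigenvectorUnitary
  · exact Unitary.coe_mul_star_self hA.1.eigenvectorUnitary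
  · exact hA.1.spectral_theorem
  · rw [hA.1.cfc_eq]
    rfl

theorem IsSpectral.tensorPower {d ℓ : ℕ} {A U : Matrix (Fin d) (Fin d) ℂ} {a : Fin d → ℝ}
    (h : IsSpectral A U a) :
    IsSpectral (tensorPower ℓ A) (tensorPower ℓ U) fun x => ∏ i, a (x i) where
  left := by rw [← tensorPower_conjTranspose, ← tensorPower_mul, h.left, tensorPower_one]
  right := by rw [← tensorPower_conjTranspose, ← tensorPower_mul, h.right, tensorPower_one]
  eq := by
    rw [h.eq, tensorPower_mul, tensorPower_mul, tensorPower_diagonal, tensorPower_conjTranspose]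
    simp

section Spectral

variable {ι : Type*} [Fintype ι] [DecidableEq ι] {A B U V : Matrix ι ι ℂ} {a b : ι → ℝ}

/-- The overlaps `|⟨u_i, v_j⟩|²` of two orthonormal bases. -/
def overlap (U V : Matrix ι ι ℂ) (i j : ι) : ℝ := Complex.normSq ((Uᴴ * V) i j)

theorem overlap_nonneg (U V : Matrix ι ι ℂ) (i j : ι) : 0 ≤ overlap U V i j :=
  Complex.normSq_nonneg _

theorem trace_diagonal_conj (W : Matrix ι ι ℂ) (a f : ι → ℝ) :
    (Matrix.diagonal (fun i => (a i : ℂ)) * W * Matrix.diagonal (fun j => (f j : ℂ)) * Wᴴ).trace =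
      ((∑ i, ∑ j, a i * Complex.normSq (W i j) * f j : ℝ) : ℂ) := by
  simp only [Matrix.trace, Matrix.diag_apply]
  push_cast
  refine Finset.sum_congr rfl fun i _ => ?_
  rw [Matrix.mul_apply]
  refine Finset.sum_congr rfl fun j _ => ?_
  rw [Matrix.mul_diagonal, Matrix.diagonal_mul, Matrix.conjTranspose_apply,
    ← Complex.mul_conj]
  simp only [Complex.star_def]
  ring

theorem trace_mul_conj_diagonal (h : IsSpectral A U a) (f : ι → ℝ) :
    (A * (V * Matrix.diagonal (fun j => (f j : ℂ)) * Vᴴ)).trace =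
      ((∑ i, ∑ j, a i * overlap U V i j * f j : ℝ) : ℂ) := by
  unfold overlap
  rw [← trace_diagonal_conj, h.eq, Matrix.conjTranspose_mul, Matrix.conjTranspose_conjTranspose,
    Matrix.mul_assoc U, Matrix.mul_assoc U, Matrix.trace_mul_comm]
  congr 1
  simp only [Matrix.mul_assoc]

theorem sum_overlap_right (hU : Uᴴ * U = 1) (hV : V * Vᴴ = 1) (i : ι) :
    ∑ j, overlap U V i j = 1 := by
  have h : (Uᴴ * V) * (Uᴴ * V)ᴴ = 1 := by
    rw [Matrix.conjTranspose_mul, Matrix.conjTranspose_conjTranspose, ← Matrix.mul_assoc,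
      Matrix.mul_assoc Uᴴ, hV, Matrix.mul_one, hU]
  have h1 := congrFun (congrFun h i) i
  rw [Matrix.mul_apply, Matrix.one_apply_eq] at h1
  simp only [Matrix.conjTranspose_apply, Complex.star_def, Complex.mul_conj] at h1
  exact_mod_cast h1

theorem IsSpectral.trace_eq (h : IsSpectral A U a) : A.trace = ((∑ i, a i : ℝ) : ℂ) := by
  rw [h.eq, Matrix.trace_mul_comm, ← Matrix.mul_assoc, h.left, Matrix.one_mul,
    Matrix.trace_diagonal]
  push_cast
  rfl

/-- The quadratic form behind the data processing inequality. -/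
theorem quadratic_le (hA : IsSpectral A U a) (hB : IsSpectral B V b) (ha : ∀ i, 0 ≤ a i)
    (hb : ∀ i, 0 ≤ b i) {s : ℝ} (hs : 0 < s) {X : Matrix ι ι ℂ} (hX : X.IsHermitian) :
    2 * (X * A).trace.re - (X * X * (B + (s : ℂ) • A)).trace.re ≤
      ∑ i, ∑ j, overlap U V i j * (a i ^ 2 / (b j + s * a i)) := by
  set Y := Uᴴ * X * V with hY
  set W := Uᴴ * V with hW
  have e1 : (X * A).trace = ∑ i, ∑ j, (a i : ℂ) * (Y i j * star (W i j)) := by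
    have : (X * A).trace = (Matrix.diagonal (fun i => (a i : ℂ)) * (Y * Wᴴ)).trace := by
      rw [hA.eq, hY, hW, Matrix.conjTranspose_mul, Matrix.conjTranspose_conjTranspose,
        Matrix.trace_mul_comm, Matrix.mul_assoc, Matrix.mul_assoc, Matrix.trace_mul_comm]
      congr 1
      rw [Matrix.mul_assoc (Matrix.diagonal _)]
      congr 1
      simp only [Matrix.mul_assoc]
      rw [← Matrix.mul_assoc V, hB.right, Matrix.one_mul]
    rw [this, Matrix.trace]
    refine Finset.sum_congr rfl fun i _ => ?_
    rw [Matrix.diag_apply, Matrix.diagonal_mul, Matrix.mul_apply, Finset.mul_sum]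
    rfl
  have e2 : (X * X * A).trace = ((∑ i, ∑ j, a i * Complex.normSq (Y i j) : ℝ) : ℂ) := by
    have h1 := trace_diagonal_conj Y a (fun _ => 1)
    simp only [mul_one] at h1
    rw [← h1]
    have h2 : Matrix.diagonal (fun _ : ι => ((1 : ℝ) : ℂ)) = 1 := by simp
    rw [h2, Matrix.mul_one, hA.eq, hY, Matrix.conjTranspose_mul, Matrix.conjTranspose_mul,
      Matrix.conjTranspose_conjTranspose, hX.eq, Matrix.trace_mul_comm, Matrix.mul_assoc,
      Matrix.mul_assoc, Matrix.trace_mul_comm]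
    congr 1
    simp only [Matrix.mul_assoc]
    congr 3
    rw [← Matrix.mul_assoc V, hB.right, Matrix.one_mul]
  have e3 : (X * X * B).trace = ((∑ i, ∑ j, b j * Complex.normSq (Y i j) : ℝ) : ℂ) := by
    have h1 := trace_diagonal_conj Y (fun _ => 1) b
    simp only [one_mul] at h1
    rw [Finset.sum_congr rfl fun i _ => Finset.sum_congr rfl fun j _ =>
      mul_comm (b j) (Complex.normSq (Y i j)), ← h1]
    have h2 : Matrix.diagonal (fun _ : ι => ((1 : ℝ) : ℂ)) = 1 := by simp
    rw [h2, Matrix.one_mul, hB.eq, hY, Matrix.conjTranspose_mul, Matrix.conjTranspose_mul,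
      Matrix.conjTranspose_conjTranspose, hX.eq]
    simp only [Matrix.mul_assoc]
    rw [Matrix.trace_mul_comm Uᴴ]
    simp only [Matrix.mul_assoc]
    rw [hA.right, Matrix.mul_one, Matrix.trace_mul_comm X]
    simp only [Matrix.mul_assoc]
  have e4 : (X * X * (B + (s : ℂ) • A)).trace.re =
      ∑ i, ∑ j, (b j + s * a i) * Complex.normSq (Y i j) := by
    rw [Matrix.mul_add, Matrix.mul_smul, Matrix.trace_add, Matrix.trace_smul, e2, e3,
      Complex.add_re, smul_eq_mul, Complex.re_ofReal_mul, Complex.ofReal_re, Complex.ofReal_re,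
      Finset.mul_sum, ← Finset.sum_add_distrib]
    refine Finset.sum_congr rfl fun i _ => ?_
    rw [Finset.mul_sum, ← Finset.sum_add_distrib]
    exact Finset.sum_congr rfl fun j _ => by ring
  rw [e4, e1]
  simp only [Complex.re_sum, Finset.mul_sum, ← Finset.sum_sub_distrib]
  refine Finset.sum_le_sum fun i _ => Finset.sum_le_sum fun j _ => ?_
  have hre : ((a i : ℂ) * (Y i j * star (W i j))).re =
      a i * ((Y i j).re * (W i j).re + (Y i j).im * (W i j).im) := by
    rw [Complex.re_ofReal_mul, Complex.star_def, Complex.mul_re, Complex.conj_re, Complex.conj_im]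
    ring
  have hov : overlap U V i j = (W i j).re ^ 2 + (W i j).im ^ 2 := by
    rw [overlap, Complex.normSq_apply]
    ring
  have hn : Complex.normSq (Y i j) = (Y i j).re ^ 2 + (Y i j).im ^ 2 := by
    rw [Complex.normSq_apply]
    ring
  rw [hre, hov, hn]
  generalize (Y i j).re = y1
  generalize (Y i j).im = y2
  generalize (W i j).re = w1
  generalize (W i j).im = w2
  rcases (add_nonneg (hb j) (mul_nonneg hs.le (ha i))).eq_or_lt with h0 | h0
  · have h1 : a i = 0 := by nlinarith [ha i, hb j, mul_nonneg hs.le (ha i)]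
    rw [← h0, h1]
    simp
  -- Completing the square in the entry `y1 + i y2` of `Uᴴ X V`: the difference of the two sides is
  -- a sum of two squares over `b j + s a i`.
  · have key : 0 ≤ ((a i * w1 - (b j + s * a i) * y1) ^ 2 +
        (a i * w2 - (b j + s * a i) * y2) ^ 2) / (b j + s * a i) := by positivity
    have : (w1 ^ 2 + w2 ^ 2) * (a i ^ 2 / (b j + s * a i)) -
        (2 * (a i * (y1 * w1 + y2 * w2)) - (b j + s * a i) * (y1 ^ 2 + y2 ^ 2)) =
        ((a i * w1 - (b j + s * a i) * y1) ^ 2 +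
        (a i * w2 - (b j + s * a i) * y2) ^ 2) / (b j + s * a i) := by
      generalize b j + s * a i = t at h0
      have : t ≠ 0 := h0.ne'
      field_simp
      ring
    linarith

/-- The square of a combination of effects is at most the combination with squared coefficients. -/
theorem sum_sq_sub_sq_posSemidef {n : ℕ} {E : Fin n → Matrix ι ι ℂ} (hE : ∀ k, (E k).PosSemidef)
    (hsum : ∑ k, E k = 1) (x : Fin n → ℝ) :
    (∑ k, ((x k ^ 2 : ℝ) : ℂ) • E k -
      (∑ k, (x k : ℂ) • E k) * (∑ k, (x k : ℂ) • E k)).PosSemidef := by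
  set X := ∑ k, (x k : ℂ) • E k with hX
  have hXh : Xᴴ = X := by
    rw [hX, Matrix.conjTranspose_sum]
    refine Finset.sum_congr rfl fun k _ => ?_
    rw [Matrix.conjTranspose_smul, (hE k).1.eq, Complex.star_def, Complex.conj_ofReal]
  -- The difference is an operator-valued variance, `∑ (x_k - X) E_k (x_k - X)`, which is visibly
  -- positive.
  have h : ∑ k, ((x k ^ 2 : ℝ) : ℂ) • E k - X * X =
      ∑ k, ((x k : ℂ) • 1 - X)ᴴ * E k * ((x k : ℂ) • 1 - X) := by
    have h1 : ∀ k, ((x k : ℂ) • 1 - X)ᴴ * E k * ((x k : ℂ) • 1 - X) =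
        ((x k ^ 2 : ℝ) : ℂ) • E k - ((x k : ℂ) • E k) * X - X * ((x k : ℂ) • E k) +
          X * E k * X := by
      intro k
      rw [Matrix.conjTranspose_sub, hXh, Matrix.conjTranspose_smul, Complex.star_def,
        Complex.conj_ofReal, Matrix.conjTranspose_one]
      push_cast
      simp only [sub_mul, mul_sub, Matrix.smul_mul, Matrix.mul_smul, Matrix.one_mul,
        Matrix.mul_one, smul_smul, pow_two]
      abel
    rw [Finset.sum_congr rfl fun k _ => h1 k, Finset.sum_add_distrib, Finset.sum_sub_distrib,
      Finset.sum_sub_distrib, ← Finset.sum_mul, ← Finset.mul_sum, ← hX, ← Finset.sum_mul,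
      ← Finset.mul_sum, hsum, Matrix.mul_one]
    abel
  rw [h]
  exact Matrix.posSemidef_sum _ fun k _ => (hE k).conjTranspose_mul_mul_same _

/-- The relative entropy of the outcomes of a measurement is at most that of the states, in terms
of the spectral decompositions. -/
theorem klSum_measurement_le (hA : IsSpectral A U a) (hB : IsSpectral B V b) (ha : ∀ i, 0 ≤ a i)
    (hb : ∀ i, 0 ≤ b i) (hac : ∀ i j, b j * overlap U V i j = 0 →
      a i * overlap U V i j = 0) {n : ℕ} {E : Fin n → Matrix ι ι ℂ} (hE : ∀ k, (E k).PosSemidef)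
    (hsum : ∑ k, E k = 1) (hpq : ∀ k, (E k * B).trace.re = 0 → (E k * A).trace.re = 0)
    (hApos : A.PosSemidef) (hBpos : B.PosSemidef) :
    klSum (fun k => (E k * A).trace.re) (fun k => (E k * B).trace.re) ≤
      klSum (fun z : ι × ι => a z.1 * overlap U V z.1 z.2)
        (fun z => b z.2 * overlap U V z.1 z.2) := by
  have hp : ∀ k, 0 ≤ (E k * A).trace.re := fun k => trace_mul_re_nonneg (hE k) hApos
  have hq : ∀ k, 0 ≤ (E k * B).trace.re := fun k => trace_mul_re_nonneg (hE k) hBpos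
  refine klSum_le_of_forall_pos hp hq (fun z => mul_nonneg (ha _) (overlap_nonneg _ _ _ _))
    (fun z => mul_nonneg (hb _) (overlap_nonneg _ _ _ _)) hpq (fun z => hac z.1 z.2) ?_ ?_
  · rw [← Complex.re_sum, ← Matrix.trace_sum, ← Finset.sum_mul, hsum, Matrix.one_mul, hA.trace_eq,
      Complex.ofReal_re, Fintype.sum_prod_type]
    refine Finset.sum_congr rfl fun i _ => ?_
    change a i = ∑ y, a i * overlap U V i y
    rw [← Finset.mul_sum, sum_overlap_right hA.left hB.right, mul_one]
  · intro s hs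
    set p := fun k => (E k * A).trace.re with hpdef
    set q := fun k => (E k * B).trace.re with hqdef
    -- This choice maximizes `2 x p - x² (q + s p)` and attains `p² / (q + s p)`. The classical
    -- divergence is thereby a value of the quadratic form bounded in `quadratic_le`.
    let x : Fin n → ℝ := fun k => p k / (q k + s * p k)
    set X := ∑ k, (x k : ℂ) • E k with hX
    have hXh : X.IsHermitian := by
      rw [Matrix.IsHermitian, hX, Matrix.conjTranspose_sum]
      refine Finset.sum_congr rfl fun k _ => ?_
      rw [Matrix.conjTranspose_smul, (hE k).1.eq, Complex.star_def, Complex.conj_ofReal]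
    have h1 := quadratic_le hA hB ha hb hs hXh
    have h2 : (X * A).trace.re = ∑ k, x k * p k := by
      rw [hX, Finset.sum_mul, Matrix.trace_sum, Complex.re_sum]
      refine Finset.sum_congr rfl fun k _ => ?_
      rw [Matrix.smul_mul, Matrix.trace_smul, smul_eq_mul, Complex.re_ofReal_mul]
    have hBA : (B + (s : ℂ) • A).PosSemidef :=
      hBpos.add (hApos.smul (by exact_mod_cast hs.le))
    have h3 := trace_mul_re_nonneg (sum_sq_sub_sq_posSemidef hE hsum x) hBA
    rw [← hX, sub_mul, Matrix.trace_sub, Complex.sub_re] at h3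
    have h4 : ((∑ k, ((x k ^ 2 : ℝ) : ℂ) • E k) * (B + (s : ℂ) • A)).trace.re =
        ∑ k, x k ^ 2 * (q k + s * p k) := by
      rw [Finset.sum_mul, Matrix.trace_sum, Complex.re_sum]
      refine Finset.sum_congr rfl fun k _ => ?_
      rw [Matrix.smul_mul, Matrix.trace_smul, smul_eq_mul, Complex.re_ofReal_mul, Matrix.mul_add,
        Matrix.mul_smul, Matrix.trace_add, Matrix.trace_smul, Complex.add_re, smul_eq_mul,
        Complex.re_ofReal_mul]
    have h5 : ∀ k, p k ^ 2 / (q k + s * p k) = 2 * (x k * p k) - x k ^ 2 * (q k + s * p k) := by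
      intro k
      simp only [x]
      rcases (add_nonneg (hq k) (mul_nonneg hs.le (hp k))).eq_or_lt with h0 | h0
      · have : q k + s * p k = 0 := h0.symm
        rw [this]
        simp
      · have : q k + s * p k ≠ 0 := h0.ne'
        field_simp
        ring
    have h6 : ∀ z : ι × ι, (a z.1 * overlap U V z.1 z.2) ^ 2 /
        (b z.2 * overlap U V z.1 z.2 + s * (a z.1 * overlap U V z.1 z.2)) =
        overlap U V z.1 z.2 * (a z.1 ^ 2 / (b z.2 + s * a z.1)) := by
      intro z
      by_cases hw : overlap U V z.1 z.2 = 0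
      · simp [hw]
      · rw [show b z.2 * overlap U V z.1 z.2 + s * (a z.1 * overlap U V z.1 z.2) =
          overlap U V z.1 z.2 * (b z.2 + s * a z.1) by ring, mul_pow,
          show a z.1 ^ 2 * overlap U V z.1 z.2 ^ 2 =
            overlap U V z.1 z.2 * (overlap U V z.1 z.2 * a z.1 ^ 2) by ring,
          mul_div_mul_left _ _ hw, mul_div_assoc]
    rw [Finset.sum_congr rfl fun k _ => h5 k, Finset.sum_congr rfl fun z _ => h6 z,
      Finset.sum_sub_distrib, ← Finset.mul_sum, ← h2, Fintype.sum_prod_type]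
    linarith

end Spectral

/-! ### Supports -/

section Spectral

variable {ι : Type*} [Fintype ι] [DecidableEq ι] {A U V : Matrix ι ι ℂ} {a : ι → ℝ}

theorem IsSpectral.conj_mul_conj (h : IsSpectral A U a) (f g : ι → ℂ) :
    (U * Matrix.diagonal f * Uᴴ) * (U * Matrix.diagonal g * Uᴴ) =
      U * Matrix.diagonal (fun i => f i * g i) * Uᴴ := by
  rw [← Matrix.diagonal_mul_diagonal]
  calc (U * Matrix.diagonal f * Uᴴ) * (U * Matrix.diagonal g * Uᴴ)
      = U * Matrix.diagonal f * (Uᴴ * U) * Matrix.diagonal g * Uᴴ := by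
        simp only [Matrix.mul_assoc]
    _ = _ := by rw [h.left]; simp only [Matrix.mul_assoc, Matrix.one_mul]

theorem posSemidef_conj_diagonal (U : Matrix ι ι ℂ) {f : ι → ℝ} (hf : ∀ i, 0 ≤ f i) :
    (U * Matrix.diagonal (fun i => (f i : ℂ)) * Uᴴ).PosSemidef :=
  (Matrix.PosSemidef.diagonal (Pi.le_def.mpr fun i => Complex.zero_le_real.mpr (hf i))).mul_mul_conjTranspose_same U

end Spectral

/-- `P` is the projector onto the support of `σ`. -/
structure State.IsSuppProj {d : ℕ} (σ : State d) (P : Matrix (Fin d) (Fin d) ℂ) : Prop where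
  isHermitian : P.IsHermitian
  mul_self : P * P = P
  mul_mat : P * σ.mat = σ.mat
  exists_mul_eq : ∃ Y, σ.mat * Y = P
  exists_scale : ∃ r : ℝ, 1 ≤ r ∧ ((r : ℂ) • σ.mat - P).PosSemidef

theorem State.exists_isSuppProj {d : ℕ} (σ : State d) : ∃ P, σ.IsSuppProj P := by
  obtain ⟨V, b, hV, hb, -⟩ := exists_isSpectral σ.posSemidef
  let f : Fin d → ℝ := fun j => if b j = 0 then 0 else 1
  have hfb : ∀ j, f j * b j = b j := fun j => by
    simp only [f]
    split_ifs with h <;> simp [h]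
  have hff : ∀ j, f j * f j = f j := fun j => by
    simp only [f]
    split_ifs with h <;> simp
  have hbf : ∀ j, b j * (b j)⁻¹ = f j := fun j => by
    simp only [f]
    split_ifs with h
    · simp [h]
    · exact mul_inv_cancel₀ h
  refine ⟨V * Matrix.diagonal (fun j => (f j : ℂ)) * Vᴴ, ⟨?_, ?_, ?_, ?_, ?_⟩⟩
  · refine (posSemidef_conj_diagonal V (f := f) fun j => ?_).1
    simp only [f]
    split_ifs <;> norm_num
  · rw [hV.conj_mul_conj]
    simp only [← Complex.ofReal_mul, hff]
  · rw [hV.eq, hV.conj_mul_conj]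
    simp only [← Complex.ofReal_mul, hfb]
  · refine ⟨V * Matrix.diagonal (fun j => (((b j)⁻¹ : ℝ) : ℂ)) * Vᴴ, ?_⟩
    rw [hV.eq, hV.conj_mul_conj]
    simp only [← Complex.ofReal_mul, hbf]
  · have hnn : ∀ j, 0 ≤ (b j)⁻¹ := fun j => inv_nonneg.mpr (hb j)
    have hs : 0 ≤ ∑ j, (b j)⁻¹ := Finset.sum_nonneg fun j _ => hnn j
    -- The scale must dominate `1 / b j` for every nonzero eigenvalue. The sum of all inverses does
    -- so, with `0⁻¹ = 0`, and the summand `1` makes it at least one.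
    refine ⟨1 + ∑ j, (b j)⁻¹, by linarith, ?_⟩
    have h : ((1 + ∑ j, (b j)⁻¹ : ℝ) : ℂ) • σ.mat - V * Matrix.diagonal (fun j => (f j : ℂ)) * Vᴴ =
        V * Matrix.diagonal (fun j => (((1 + ∑ j, (b j)⁻¹) * b j - f j : ℝ) : ℂ)) * Vᴴ := by
      rw [hV.eq, ← Matrix.smul_mul, ← Matrix.mul_smul, ← Matrix.sub_mul, ← Matrix.mul_sub]
      congr 2
      rw [← Matrix.diagonal_smul, Matrix.diagonal_sub]
      congr 1
      ext j
      simp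
    rw [h]
    refine posSemidef_conj_diagonal V fun j => ?_
    rw [← hbf j, sub_nonneg, mul_comm]
    refine mul_le_mul_of_nonneg_right ?_ (hb j)
    linarith [Finset.single_le_sum (f := fun j => (b j)⁻¹) (fun i _ => hnn i) (Finset.mem_univ j)]

theorem State.one_sub_posSemidef {d : ℕ} (ρ : State d) : (1 - ρ.mat).PosSemidef := by
  obtain ⟨U, a, hU, ha, -⟩ := exists_isSpectral ρ.posSemidef
  have h1 : ∑ i, a i = 1 := by
    have := ρ.trace_eq_one
    rw [hU.trace_eq] at this
    exact_mod_cast this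
  have h2 : (1 : Matrix (Fin d) (Fin d) ℂ) - ρ.mat =
      U * Matrix.diagonal (fun i => ((1 - a i : ℝ) : ℂ)) * Uᴴ := by
    have : Matrix.diagonal (fun i => ((1 - a i : ℝ) : ℂ)) =
        1 - Matrix.diagonal (fun i => (a i : ℂ)) := by
      rw [← Matrix.diagonal_one, Matrix.diagonal_sub]
      congr 1
      ext i
      simp
    rw [this, Matrix.mul_sub, Matrix.sub_mul, Matrix.mul_one, hU.right, ← hU.eq]
  rw [h2]
  refine posSemidef_conj_diagonal U fun i => ?_
  linarith [Finset.single_le_sum (f := a) (fun i _ => ha i) (Finset.mem_univ i)]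

namespace State.IsSuppProj

variable {d : ℕ} {ρ σ : State d} {P : Matrix (Fin d) (Fin d) ℂ}

theorem supp_le_iff (h : σ.IsSuppProj P) : ρ.supp ≤ σ.supp ↔ P * ρ.mat = ρ.mat := by
  constructor
  · intro hle
    refine Matrix.mulVec_injective (funext fun w => ?_)
    obtain ⟨w', hw'⟩ := hle ⟨w, rfl⟩
    simp only [Matrix.mulVecLin_apply] at hw'
    rw [← Matrix.mulVec_mulVec, ← hw', Matrix.mulVec_mulVec, h.mul_mat]
  · rintro hP _ ⟨w, rfl⟩
    obtain ⟨Y, hY⟩ := h.exists_mul_eq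
    refine ⟨Y *ᵥ (ρ.mat *ᵥ w), ?_⟩
    simp only [Matrix.mulVecLin_apply]
    rw [Matrix.mulVec_mulVec, Matrix.mulVec_mulVec, hY, hP]

theorem posSemidef (h : σ.IsSuppProj P) : P.PosSemidef := by
  rw [← h.mul_self]
  nth_rw 1 [← h.isHermitian.eq]
  exact Matrix.posSemidef_conjTranspose_mul_self P

theorem one_sub_posSemidef (h : σ.IsSuppProj P) : (1 - P).PosSemidef := by
  have h1 : (1 - P)ᴴ * (1 - P) = 1 - P := by
    rw [Matrix.conjTranspose_sub, Matrix.conjTranspose_one, h.isHermitian.eq, mul_sub, sub_mul,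
      sub_mul, h.mul_self]
    simp
  rw [← h1]
  exact Matrix.posSemidef_conjTranspose_mul_self _

/-- Compressing `ρ ≤ 1` by the projector gives `ρ = P ρ P ≤ P`, and `P` is below a multiple of `σ`.
-/
theorem exists_le (h : σ.IsSuppProj P) (hρ : P * ρ.mat = ρ.mat) :
    ∃ r : ℝ, 1 ≤ r ∧ ((r : ℂ) • σ.mat - ρ.mat).PosSemidef := by
  obtain ⟨r, hr, hpos⟩ := h.exists_scale
  refine ⟨r, hr, ?_⟩
  have h1 : ρ.mat * P = ρ.mat := by
    have := congrArg Matrix.conjTranspose hρ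
    rwa [Matrix.conjTranspose_mul, ρ.posSemidef.1.eq, h.isHermitian.eq] at this
  have h2 : (P - ρ.mat).PosSemidef := by
    have := ρ.one_sub_posSemidef.mul_mul_conjTranspose_same P
    rwa [h.isHermitian.eq, mul_sub, sub_mul, mul_one, h.mul_self, mul_assoc, h1, hρ] at this
  have := hpos.add h2
  rwa [sub_add_sub_cancel] at this

theorem trace_pos (h : σ.IsSuppProj P) (hρ : P * ρ.mat ≠ ρ.mat) :
    0 < ((1 - P) * ρ.mat).trace.re := by
  refine (trace_mul_re_nonneg h.one_sub_posSemidef ρ.posSemidef).lt_of_ne fun h0 => hρ ?_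
  have := mul_eq_zero_of_trace_mul_eq_zero h.one_sub_posSemidef ρ.posSemidef h0.symm
  rw [sub_mul, one_mul, sub_eq_zero] at this
  exact this.symm

end State.IsSuppProj

theorem exists_le_of_supp_le {d : ℕ} {ρ σ : State d} (h : ρ.supp ≤ σ.supp) :
    ∃ r : ℝ, 1 ≤ r ∧ ((r : ℂ) • σ.mat - ρ.mat).PosSemidef := by
  obtain ⟨P, hP⟩ := σ.exists_isSuppProj
  exact hP.exists_le (hP.supp_le_iff.mp h)

theorem exists_prob_le {d : ℕ} {ρ σ : State d} (h : ρ.supp ≤ σ.supp) :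
    ∃ B : ℝ, 0 ≤ B ∧ ∀ (ℓ : ℕ) (K : BlockPOVM d ℓ) x,
      K.prob ρ x ≤ Real.exp (B * ℓ) * K.prob σ x := by
  obtain ⟨r, hr, hpos⟩ := exists_le_of_supp_le h
  refine ⟨Real.log r, Real.log_nonneg hr, fun ℓ K x => ?_⟩
  rw [mul_comm (Real.log r), Real.exp_nat_mul, Real.exp_log (by linarith)]
  exact K.prob_le_mul hpos x

theorem relEntropy_eq_top_iff {d : ℕ} {ρ σ : State d} :
    relEntropy ρ σ = ∞ ↔ ¬ ρ.supp ≤ σ.supp := by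
  unfold relEntropy
  split_ifs with h <;> simp [h]

/-! ### Relative entropy in eigenbases -/

/-- The bound `ρ ≤ r σ` is tested on the eigenvector `v_j` in the kernel of `σ`, where it leaves no
room for `ρ`. -/
theorem mul_overlap_eq_zero {d : ℕ} {ρ σ : State d} {U V : Matrix (Fin d) (Fin d) ℂ}
    {a b : Fin d → ℝ} (hU : IsSpectral ρ.mat U a) (hV : IsSpectral σ.mat V b)
    (ha : ∀ i, 0 ≤ a i) (h : ρ.supp ≤ σ.supp) {i j : Fin d} (hj : b j = 0) :
    a i * overlap U V i j = 0 := by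
  obtain ⟨r, hr, hpos⟩ := exists_le_of_supp_le h
  let f : Fin d → ℝ := Pi.single j 1
  have hf : ∀ k, 0 ≤ f k := fun k => by
    by_cases hk : k = j
    · subst hk
      simp [f]
    · simp [f, hk]
  have hF := posSemidef_conj_diagonal V hf
  have h1 := trace_mul_re_nonneg hpos hF
  have h2 : σ.mat * (V * Matrix.diagonal (fun i => (f i : ℂ)) * Vᴴ) = 0 := by
    rw [hV.eq, hV.conj_mul_conj]
    have : (fun i => (b i : ℂ) * (f i : ℂ)) = fun _ => 0 := by
      ext k
      by_cases hk : k = j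
      · simp [hk, hj]
      · simp [f, hk]
    rw [this]
    simp
  rw [sub_mul, Matrix.smul_mul, h2, smul_zero, zero_sub, Matrix.trace_neg, Complex.neg_re,
    trace_mul_conj_diagonal hU, Complex.ofReal_re] at h1
  have hnn : ∀ i k, 0 ≤ a i * overlap U V i k * f k := fun i k =>
    mul_nonneg (mul_nonneg (ha i) (overlap_nonneg _ _ _ _)) (hf k)
  have h3 : a i * overlap U V i j * f j ≤ ∑ i, ∑ k, a i * overlap U V i k * f k :=
    (Finset.single_le_sum (fun k _ => hnn i k) (Finset.mem_univ j)).trans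
      (Finset.single_le_sum (f := fun i => ∑ k, a i * overlap U V i k * f k)
        (fun i _ => Finset.sum_nonneg fun k _ => hnn i k) (Finset.mem_univ i))
  have h4 : f j = 1 := by simp [f]
  rw [h4, mul_one] at h3
  exact le_antisymm (by linarith) (mul_nonneg (ha i) (overlap_nonneg _ _ _ _))

theorem relEntropy_eq {d : ℕ} {ρ σ : State d} {U V : Matrix (Fin d) (Fin d) ℂ}
    {a b : Fin d → ℝ} (hU : IsSpectral ρ.mat U a) (hV : IsSpectral σ.mat V b)
    (hUlog : cfc Real.log ρ.mat = U * Matrix.diagonal (fun i => (Real.log (a i) : ℂ)) * Uᴴ)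
    (hVlog : cfc Real.log σ.mat = V * Matrix.diagonal (fun i => (Real.log (b i) : ℂ)) * Vᴴ)
    (h : ρ.supp ≤ σ.supp) :
    relEntropy ρ σ = ENNReal.ofReal (∑ i, ∑ j, a i * overlap U V i j *
      (Real.log (a i) - Real.log (b j))) := by
  rw [relEntropy, if_pos h, mul_sub, Matrix.trace_sub, hUlog, hVlog, hU.eq, hU.conj_mul_conj,
    ← hU.eq, trace_mul_conj_diagonal hU]
  have h1 : (U * Matrix.diagonal (fun i => (a i : ℂ) * (Real.log (a i) : ℂ)) * Uᴴ).trace =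
      ((∑ i, a i * Real.log (a i) : ℝ) : ℂ) := by
    rw [Matrix.trace_mul_comm, ← Matrix.mul_assoc, hU.left, Matrix.one_mul, Matrix.trace_diagonal]
    push_cast
    rfl
  rw [h1, ← Complex.ofReal_sub, Complex.ofReal_re]
  congr 1
  rw [← Finset.sum_sub_distrib]
  refine Finset.sum_congr rfl fun i _ => ?_
  rw [← mul_one (a i * Real.log (a i)), ← sum_overlap_right hU.left hV.right i, Finset.mul_sum,
    ← Finset.sum_sub_distrib]
  exact Finset.sum_congr rfl fun j _ => by ring

theorem mul_overlap_eq_zero_of_mul_eq_zero {d : ℕ} {ρ σ : State d}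
    {U V : Matrix (Fin d) (Fin d) ℂ} {a b : Fin d → ℝ} (hU : IsSpectral ρ.mat U a)
    (hV : IsSpectral σ.mat V b) (ha : ∀ i, 0 ≤ a i) (h : ρ.supp ≤ σ.supp) {i j : Fin d}
    (hb : b j * overlap U V i j = 0) : a i * overlap U V i j = 0 := by
  rcases mul_eq_zero.mp hb with h0 | h0
  · exact mul_overlap_eq_zero hU hV ha h h0
  · rw [h0, mul_zero]

/-- The overlap cancels in the quotient of the two classical distributions. What remains is the
expression for the quantum relative entropy in the two eigenbases. -/
theorem klSum_overlap_eq {ι : Type*} [Fintype ι] [DecidableEq ι] {U V : Matrix ι ι ℂ}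
    {a b : ι → ℝ} (hac : ∀ i j, b j * overlap U V i j = 0 → a i * overlap U V i j = 0) :
    klSum (fun z : ι × ι => a z.1 * overlap U V z.1 z.2)
        (fun z => b z.2 * overlap U V z.1 z.2) =
      ∑ i, ∑ j, a i * overlap U V i j * (Real.log (a i) - Real.log (b j)) := by
  rw [klSum, Fintype.sum_prod_type]
  refine Finset.sum_congr rfl fun i _ => Finset.sum_congr rfl fun j _ => ?_
  simp only
  by_cases h0 : a i * overlap U V i j = 0
  · rw [h0, zero_mul, zero_mul]
  · have hb0 : b j ≠ 0 := fun hj => h0 (hac i j (by rw [hj, zero_mul]))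
    rw [mul_div_mul_right _ _ (right_ne_zero_of_mul h0),
      Real.log_div (left_ne_zero_of_mul h0) hb0]

theorem IsSpectral.sum_overlap_log_eq {ι : Type*} [Fintype ι] [DecidableEq ι]
    {A U V : Matrix ι ι ℂ} {a b : ι → ℝ} (hA : IsSpectral A U a) (hV : V * Vᴴ = 1) :
    ∑ i, ∑ j, a i * overlap U V i j * (Real.log (a i) - Real.log (b j)) =
      ∑ i, a i * Real.log (a i) -
        (A * (V * Matrix.diagonal (fun j => (Real.log (b j) : ℂ)) * Vᴴ)).trace.re := by
  rw [trace_mul_conj_diagonal hA, Complex.ofReal_re, ← Finset.sum_sub_distrib]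
  refine Finset.sum_congr rfl fun i _ => ?_
  rw [← mul_one (a i * Real.log (a i)), ← sum_overlap_right hA.left hV i, Finset.mul_sum,
    ← Finset.sum_sub_distrib]
  exact Finset.sum_congr rfl fun j _ => by ring

theorem overlap_tensorPower {d ℓ : ℕ} (U V : Matrix (Fin d) (Fin d) ℂ) (x y : Fin ℓ → Fin d) :
    overlap (tensorPower ℓ U) (tensorPower ℓ V) x y = ∏ i, overlap U V (x i) (y i) := by
  rw [overlap, ← tensorPower_conjTranspose, ← tensorPower_mul, tensorPower, Matrix.of_apply,
    map_prod]
  rfl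

theorem tensorPower_hac {d ℓ : ℕ} {U V : Matrix (Fin d) (Fin d) ℂ} {a b : Fin d → ℝ}
    (hac : ∀ i j, b j * overlap U V i j = 0 → a i * overlap U V i j = 0) (x y : Fin ℓ → Fin d)
    (h0 : (∏ i, b (y i)) * overlap (tensorPower ℓ U) (tensorPower ℓ V) x y = 0) :
    (∏ i, a (x i)) * overlap (tensorPower ℓ U) (tensorPower ℓ V) x y = 0 := by
  rw [overlap_tensorPower, ← Finset.prod_mul_distrib] at h0 ⊢
  obtain ⟨i, hi, h1⟩ := Finset.prod_eq_zero_iff.mp h0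
  exact Finset.prod_eq_zero hi (hac _ _ h1)

/-- The relative entropy of `ℓ` copies in the eigenbases of the tensor powers. -/
theorem natCast_mul_relEntropy {d : ℕ} {ρ σ : State d} {U V : Matrix (Fin d) (Fin d) ℂ}
    {a b : Fin d → ℝ} (hU : IsSpectral ρ.mat U a) (hV : IsSpectral σ.mat V b)
    (hUlog : cfc Real.log ρ.mat = U * Matrix.diagonal (fun i => (Real.log (a i) : ℂ)) * Uᴴ)
    (hVlog : cfc Real.log σ.mat = V * Matrix.diagonal (fun i => (Real.log (b i) : ℂ)) * Vᴴ)
    (ha : ∀ i, 0 ≤ a i) (h : ρ.supp ≤ σ.supp) (ℓ : ℕ) :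
    ℓ * relEntropy ρ σ = ENNReal.ofReal (klSum
      (fun z : (Fin ℓ → Fin d) × (Fin ℓ → Fin d) =>
        (∏ i, a (z.1 i)) * overlap (tensorPower ℓ U) (tensorPower ℓ V) z.1 z.2)
      (fun z => (∏ i, b (z.2 i)) * overlap (tensorPower ℓ U) (tensorPower ℓ V) z.1 z.2)) := by
  have hac : ∀ i j, b j * overlap U V i j = 0 → a i * overlap U V i j = 0 :=
    fun i j => mul_overlap_eq_zero_of_mul_eq_zero hU hV ha h
  have hsum : ∑ z : Fin d × Fin d, a z.1 * overlap U V z.1 z.2 = 1 := by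
    have h1 := ρ.trace_eq_one
    rw [hU.trace_eq] at h1
    rw [Fintype.sum_prod_type]
    simp only [← Finset.mul_sum, sum_overlap_right hU.left hV.right, mul_one]
    exact_mod_cast h1
  have hpi : ∀ (f : Fin d → ℝ) (g : Fin d × Fin d → Fin d) (z : Fin ℓ → Fin d × Fin d),
      ∏ i, f (g (z i)) * overlap U V (z i).1 (z i).2 = (∏ i, f (g (z i))) *
        overlap (tensorPower ℓ U) (tensorPower ℓ V) (fun i => (z i).1) (fun i => (z i).2) := by
    intro f g z
    rw [overlap_tensorPower, Finset.prod_mul_distrib]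
  rw [relEntropy_eq hU hV hUlog hVlog h, ← klSum_overlap_eq hac, ← ENNReal.ofReal_natCast,
    ← ENNReal.ofReal_mul (by positivity),
    ← klSum_pi (p := fun z : Fin d × Fin d => a z.1 * overlap U V z.1 z.2)
      (q := fun z : Fin d × Fin d => b z.2 * overlap U V z.1 z.2) hsum (fun z => hac z.1 z.2) ℓ,
    ← klSum_comp_equiv (Equiv.arrowProdEquivProdArrow (Fin ℓ) (fun _ => Fin d) fun _ => Fin d)]
  congr 2
  · ext z
    exact hpi a Prod.fst z
  · ext z
    exact hpi b Prod.snd z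

/-- Data processing: a collective measurement on `ℓ` copies does not increase the relative
entropy. -/
theorem BlockPOVM.relEntropy_le {d ℓ : ℕ} (K : BlockPOVM d ℓ) (ρ σ : State d) :
    K.relEntropy ρ σ ≤ ℓ * SeqQHT.relEntropy ρ σ := by
  by_cases h : ρ.supp ≤ σ.supp
  · obtain ⟨B, hB, hstep⟩ := exists_prob_le h
    have hac : ∀ x, K.prob σ x = 0 → K.prob ρ x = 0 := fun x hx =>
      le_antisymm ((hstep ℓ K x).trans_eq (by rw [hx, mul_zero])) (K.prob_nonneg ρ x)
    obtain ⟨U, a, hU, ha, hUlog⟩ := exists_isSpectral ρ.posSemidef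
    obtain ⟨V, b, hV, hb, hVlog⟩ := exists_isSpectral σ.posSemidef
    rw [K.relEntropy_eq hac, natCast_mul_relEntropy hU hV hUlog hVlog ha h]
    exact ENNReal.ofReal_le_ofReal (klSum_measurement_le (hU.tensorPower (ℓ := ℓ))
      (hV.tensorPower (ℓ := ℓ)) (fun x => Finset.prod_nonneg fun i _ => ha _)
      (fun x => Finset.prod_nonneg fun i _ => hb _)
      (tensorPower_hac fun i j => mul_overlap_eq_zero_of_mul_eq_zero hU hV ha h)
      K.posSemidef K.sum_effect hac (tensorPower_posSemidef ℓ ρ.posSemidef)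
      (tensorPower_posSemidef ℓ σ.posSemidef))
  · rw [SeqQHT.relEntropy_eq_top_iff.mpr h]
    -- For an empty block the right side is `0 * ∞ = 0`, so it has to be checked that the two
    -- outcome distributions agree.
    rcases Nat.eq_zero_or_pos ℓ with rfl | hℓ
    · have h0 : ∀ X : Matrix (Fin d) (Fin d) ℂ, tensorPower 0 X = 1 := fun X => by
        ext x y
        rw [Subsingleton.elim y x, Matrix.one_apply_eq]
        simp [tensorPower]
      rw [K.relEntropy_eq_zero_iff.mpr (funext fun x => by rw [prob, prob, h0, h0])]
      simp
    · rw [ENNReal.mul_top (Nat.cast_ne_zero.mpr hℓ.ne')]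
      exact le_top

/-! ### Sharp measurements -/

/-- The measurement consists of projectors inside the eigenspaces of `σ^{⊗ℓ}`, to which every
`ρ^{⊗ℓ}` compresses as a multiple of the identity. -/
structure BlockPOVM.IsSharp {d ℓ : ℕ} (K : BlockPOVM d ℓ) (σ : State d) : Prop where
  mul_self : ∀ k, K.effect k * K.effect k = K.effect k
  exists_eigenvalue : ∀ k, ∃ s : ℝ, tensorPower ℓ σ.mat * K.effect k = (s : ℂ) • K.effect k
  exists_compression : ∀ k (ρ : State d), ∃ c : ℝ,
    K.effect k * tensorPower ℓ ρ.mat * K.effect k = (c : ℂ) • K.effect k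

section Resolution

variable {ι : Type*} [Fintype ι] [DecidableEq ι]

/-- A resolution of the identity into nonzero orthogonal projectors that commute with all elements
of `S`. -/
structure IsResolution (S : Set (Matrix ι ι ℂ)) {n : ℕ} (E : Fin n → Matrix ι ι ℂ) : Prop where
  isHermitian : ∀ k, (E k).IsHermitian
  mul_self : ∀ k, E k * E k = E k
  ne_zero : ∀ k, E k ≠ 0
  commute : ∀ k, ∀ X ∈ S, Commute (E k) X
  mul_eq_zero : ∀ i j, i ≠ j → E i * E j = 0
  sum_eq_one : ∑ k, E k = 1

/-- A nonzero traceless Hermitian matrix under the projector `E` splits `E`. -/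
theorem exists_splitting {S : Set (Matrix ι ι ℂ)} {E H : Matrix ι ι ℂ} (hE : E.IsHermitian)
    (hH : H.IsHermitian) (hEH : E * H = H) (htr : H.trace = 0) (h0 : H ≠ 0)
    (hS : ∀ X ∈ S, Commute H X) :
    ∃ P : Matrix ι ι ℂ, P.IsHermitian ∧ P * P = P ∧ P ≠ 0 ∧ P ≠ E ∧ E * P = P ∧
      P * E = P ∧ ∀ X ∈ S, Commute P X := by
  let U : Matrix ι ι ℂ := hH.eigenvectorUnitary
  let a := hH.eigenvalues
  have hs : IsSpectral H U a := ⟨Unitary.coe_star_mul_self hH.eigenvectorUnitary,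
    Unitary.coe_mul_star_self hH.eigenvectorUnitary, hH.spectral_theorem⟩
  -- The splitting projector is the spectral projector of `H` for its positive eigenvalues. Since
  -- `H` is traceless and nonzero, it has eigenvalues of both signs, so the projector is neither `0`
  -- nor `E`.
  let g : ℝ → ℝ := fun x => if 0 < x then 1 else 0
  have hcfc : cfc g H = U * Matrix.diagonal (fun i => (g (a i) : ℂ)) * Uᴴ := by
    rw [hH.cfc_eq]
    rfl
  have hinj : ∀ f : ι → ℂ, U * Matrix.diagonal f * Uᴴ = 0 → f = 0 := by
    intro f hf
    have : Matrix.diagonal f = 0 := by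
      calc Matrix.diagonal f = Uᴴ * (U * Matrix.diagonal f * Uᴴ) * U := by
            simp only [← Matrix.mul_assoc, hs.left, Matrix.one_mul]
            rw [Matrix.mul_assoc, hs.left, Matrix.mul_one]
        _ = 0 := by rw [hf]; simp
    exact Matrix.diagonal_eq_zero.mp this
  have hsum : ∑ i, a i = 0 := by
    rw [hs.trace_eq] at htr
    exact_mod_cast htr
  have hne : a ≠ 0 := by
    intro h
    apply h0
    rw [hs.eq, h]
    simp
  have hP1 : (cfc g H).IsHermitian := by
    rw [hcfc]
    refine (posSemidef_conj_diagonal U (f := fun i => g (a i)) fun i => ?_).1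
    simp only [g]
    split_ifs <;> norm_num
  have hEP : E * cfc g H = cfc g H := by
    -- The function `g` vanishes at `0`, so the projector is a multiple of `H` from the left and
    -- inherits `E H = H`.
    have h1 : cfc g H = H * (U * Matrix.diagonal (fun i => ((g (a i) / a i : ℝ) : ℂ)) * Uᴴ) := by
      have h2 := hs.conj_mul_conj (fun i => (a i : ℂ)) fun i => ((g (a i) / a i : ℝ) : ℂ)
      rw [← hs.eq] at h2
      rw [hcfc, h2]
      congr 3
      ext i
      rw [← Complex.ofReal_mul]
      congr 1
      simp only [g]
      split_ifs with h
      · field_simp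
      · simp
    rw [h1, ← Matrix.mul_assoc, hEH]
  refine ⟨cfc g H, hP1, ?_, ?_, ?_, hEP, ?_, fun X hX => ?_⟩
  · rw [hcfc, hs.conj_mul_conj]
    congr 3
    ext i
    simp only [g]
    split_ifs <;> simp
  · intro h
    rw [hcfc] at h
    have h1 := hinj _ h
    refine hne (funext fun i => ?_)
    have h2 : ∀ i, a i ≤ 0 := fun i => by
      by_contra hi
      have := congrFun h1 i
      simp [g, not_le.mp hi] at this
    exact (Finset.sum_eq_zero_iff_of_nonpos fun i _ => h2 i).mp hsum i (Finset.mem_univ i)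
  · intro h
    have h1 : U * Matrix.diagonal (fun i => ((g (a i) * a i - a i : ℝ) : ℂ)) * Uᴴ = 0 := by
      have h2 : Matrix.diagonal (fun i => ((g (a i) * a i - a i : ℝ) : ℂ)) =
          Matrix.diagonal (fun i => (g (a i) : ℂ) * (a i : ℂ)) -
            Matrix.diagonal (fun i => (a i : ℂ)) := by
        rw [Matrix.diagonal_sub]
        congr 1
        ext i
        push_cast
        rfl
      rw [h2, Matrix.mul_sub, Matrix.sub_mul, ← hs.conj_mul_conj, ← hs.eq, ← hcfc, h, hEH, sub_self]
    have h3 := hinj _ h1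
    refine hne (funext fun i => ?_)
    have h2 : ∀ i, 0 ≤ a i := fun i => by
      by_contra hi
      have h4 := congrFun h3 i
      simp only [g, Pi.zero_apply, if_neg (lt_asymm (not_le.mp hi)), zero_mul, zero_sub,
        Complex.ofReal_eq_zero, neg_eq_zero] at h4
      exact hi h4.ge
    exact (Finset.sum_eq_zero_iff_of_nonneg fun i _ => h2 i).mp hsum i (Finset.mem_univ i)
  · have := congrArg Matrix.conjTranspose hEP
    rwa [Matrix.conjTranspose_mul, hP1.eq, hE.eq] at this
  · exact IsSelfAdjoint.commute_cfc hH.isSelfAdjoint (hS X hX) g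

/-- The splitting projector `P` and its complement `E k - P` replace `E k`. Both are orthogonal to
the other members because they lie under `E k`. -/
theorem IsResolution.exists_succ {S : Set (Matrix ι ι ℂ)} {n : ℕ} {E : Fin n → Matrix ι ι ℂ}
    (h : IsResolution S E) {k : Fin n} {H : Matrix ι ι ℂ} (hH : H.IsHermitian)
    (hEH : E k * H = H) (htr : H.trace = 0) (h0 : H ≠ 0) (hS : ∀ X ∈ S, Commute H X) :
    ∃ F : Fin (n + 1) → Matrix ι ι ℂ, IsResolution S F := by
  obtain ⟨P, hP, hPP, hP0, hPE, hEP, hPE', hPS⟩ :=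
    exists_splitting (h.isHermitian k) hH hEH htr h0 hS
  set Q := E k - P with hQ
  have hQQ : Q * Q = Q := by
    rw [hQ, mul_sub, sub_mul, sub_mul, h.mul_self, hEP, hPE', hPP, sub_self, sub_zero]
  have hother : ∀ i, i ≠ k → E i * P = 0 ∧ P * E i = 0 := fun i hi => by
    constructor
    · rw [← hEP, ← mul_assoc, h.mul_eq_zero i k hi, zero_mul]
    · rw [← hPE', mul_assoc, h.mul_eq_zero k i hi.symm, mul_zero]
  have hPQ : P * Q = 0 := by rw [hQ, mul_sub, hPE', hPP, sub_self]
  have hQP : Q * P = 0 := by rw [hQ, sub_mul, hEP, hPP, sub_self]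
  set F' := Function.update E k Q with hF'
  have hk : F' k = Q := by simp [hF']
  have hi : ∀ i, i ≠ k → F' i = E i := fun i hi => by simp [hF', hi]
  refine ⟨Fin.cons P F', ⟨?_, ?_, ?_, ?_, ?_, ?_⟩⟩
  · refine Fin.cases hP fun i => ?_
    rw [Fin.cons_succ]
    by_cases hik : i = k
    · rw [hik, hk]
      exact (h.isHermitian k).sub hP
    · rw [hi i hik]
      exact h.isHermitian i
  · refine Fin.cases hPP fun i => ?_
    rw [Fin.cons_succ]
    by_cases hik : i = k
    · rw [hik, hk, hQQ]
    · rw [hi i hik, h.mul_self]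
  · refine Fin.cases hP0 fun i => ?_
    rw [Fin.cons_succ]
    by_cases hik : i = k
    · rw [hik, hk]
      exact sub_ne_zero.mpr hPE.symm
    · rw [hi i hik]
      exact h.ne_zero i
  · refine Fin.cases hPS fun i => ?_
    rw [Fin.cons_succ]
    by_cases hik : i = k
    · rw [hik, hk]
      exact fun X hX => (h.commute k X hX).sub_left (hPS X hX)
    · rw [hi i hik]
      exact h.commute i
  · refine Fin.cases (Fin.cases (fun h => absurd rfl h) fun j _ => ?_) fun i =>
      Fin.cases (fun _ => ?_) fun j hij => ?_
    · rw [Fin.cons_zero, Fin.cons_succ]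
      by_cases hjk : j = k
      · rw [hjk, hk, hPQ]
      · rw [hi j hjk, (hother j hjk).2]
    · rw [Fin.cons_zero, Fin.cons_succ]
      by_cases hik : i = k
      · rw [hik, hk, hQP]
      · rw [hi i hik, (hother i hik).1]
    · rw [Fin.cons_succ, Fin.cons_succ]
      have hij' : i ≠ j := fun h => hij (congrArg _ h)
      by_cases hik : i = k
      · have hjk : j ≠ k := fun h => hij' (hik.trans h.symm)
        rw [hik, hk, hi j hjk, hQ, sub_mul, (hother j hjk).2, h.mul_eq_zero k j hjk.symm, sub_self]
      · by_cases hjk : j = k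
        · rw [hjk, hk, hi i hik, hQ, mul_sub, (hother i hik).1, h.mul_eq_zero i k hik, sub_self]
        · rw [hi i hik, hi j hjk, h.mul_eq_zero i j hij']
  · rw [Fin.sum_univ_succ, Fin.cons_zero]
    simp only [Fin.cons_succ]
    rw [hF', Finset.sum_update_of_mem (Finset.mem_univ k), hQ, ← h.sum_eq_one,
      ← Finset.add_sum_erase _ _ (Finset.mem_univ k), Finset.sdiff_singleton_eq_erase]
    abel

theorem IsResolution.linearIndependent {S : Set (Matrix ι ι ℂ)} {n : ℕ}
    {E : Fin n → Matrix ι ι ℂ} (h : IsResolution S E) : LinearIndependent ℂ E := by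
  rw [Fintype.linearIndependent_iff]
  intro g hg i
  have h1 := congrArg (fun X => X * E i) hg
  simp only [Finset.sum_mul, zero_mul, Matrix.smul_mul] at h1
  rw [Finset.sum_eq_single i (fun j _ hj => by rw [h.mul_eq_zero j i hj, smul_zero])
    (fun h => absurd (Finset.mem_univ i) h), h.mul_self] at h1
  exact (smul_eq_zero.mp h1).resolve_right (h.ne_zero i)

/-- In a resolution of maximal length, compressions that commute with `S` are scalar. -/
theorem IsResolution.exists_smul_eq {S : Set (Matrix ι ι ℂ)} {n : ℕ} {E : Fin n → Matrix ι ι ℂ}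
    (h : IsResolution S E) (hmax : ¬ ∃ F : Fin (n + 1) → Matrix ι ι ℂ, IsResolution S F)
    {X : Matrix ι ι ℂ} (hX : X.IsHermitian) (k : Fin n)
    (hS : ∀ Y ∈ S, Commute (E k * X * E k) Y) : ∃ c : ℝ, E k * X * E k = (c : ℂ) • E k := by
  have hEpos : (E k).PosSemidef := by
    rw [← h.mul_self k]
    nth_rw 1 [← (h.isHermitian k).eq]
    exact Matrix.posSemidef_conjTranspose_mul_self _
  have htr : (E k).trace ≠ 0 := fun h0 => h.ne_zero k (hEpos.trace_eq_zero_iff.mp h0)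
  have hXE : (E k * X * E k).IsHermitian := by
    have := Matrix.isHermitian_mul_mul_conjTranspose (E k) hX
    rwa [(h.isHermitian k).eq] at this
  have hre : ∀ {Y : Matrix ι ι ℂ}, Y.IsHermitian → ((Y.trace.re : ℝ) : ℂ) = Y.trace := by
    intro Y hY
    rw [← Complex.conj_eq_iff_re, ← Complex.star_def, ← Matrix.trace_conjTranspose, hY.eq]
  -- The constant makes the compression minus `c E_k` traceless. If this difference were nonzero, it
  -- would split `E_k` and contradict maximality.
  set c : ℝ := (E k * X * E k).trace.re / (E k).trace.re with hc
  refine ⟨c, ?_⟩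
  by_contra hne
  refine hmax (h.exists_succ (k := k) (H := E k * X * E k - (c : ℂ) • E k) ?_ ?_ ?_
    (sub_ne_zero.mpr hne) ?_)
  · refine hXE.sub ?_
    rw [Matrix.IsHermitian, Matrix.conjTranspose_smul, (h.isHermitian k).eq, Complex.star_def,
      Complex.conj_ofReal]
  · rw [mul_sub, Matrix.mul_smul, h.mul_self, ← mul_assoc, ← mul_assoc, h.mul_self]
  · rw [Matrix.trace_sub, Matrix.trace_smul, smul_eq_mul, hc, Complex.ofReal_div, hre hXE,
      hre (h.isHermitian k), div_mul_cancel₀ _ htr, sub_self]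
  · exact fun Y hY => (hS Y hY).sub_left ((h.commute k Y hY).smul_left _)

/-- The identity alone is a resolution of length one. If each resolution could be lengthened, the
bound `N` would be exceeded. -/
theorem exists_maximal_resolution [Nonempty ι] (S : Set (Matrix ι ι ℂ)) {N : ℕ}
    (hN : ∀ (n : ℕ) (E : Fin n → Matrix ι ι ℂ), IsResolution S E → n ≤ N) :
    ∃ (n : ℕ) (E : Fin n → Matrix ι ι ℂ), IsResolution S E ∧
      ¬ ∃ F : Fin (n + 1) → Matrix ι ι ℂ, IsResolution S F := by
  by_contra hcon
  push Not at hcon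
  have h : ∀ n : ℕ, ∃ E : Fin (n + 1) → Matrix ι ι ℂ, IsResolution S E := by
    intro n
    induction n with
    | zero =>
      exact ⟨fun _ => 1, ⟨fun _ => Matrix.isHermitian_one, fun _ => mul_one 1,
        fun _ => one_ne_zero, fun _ X _ => Commute.one_left X,
        fun i j hij => absurd (Fin.ext (by omega)) hij, by simp⟩⟩
    | succ n ih =>
      obtain ⟨E, hE⟩ := ih
      exact hcon _ E hE
  obtain ⟨E, hE⟩ := h N
  exact absurd (hN _ E hE) (by omega)

end Resolution

/-! ### Permutation invariance -/

/-- The matrix permuting the tensor factors. -/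
def permMatrix {d ℓ : ℕ} (π : Equiv.Perm (Fin ℓ)) : Matrix (Fin ℓ → Fin d) (Fin ℓ → Fin d) ℂ :=
  Matrix.of fun x y => if x ∘ π = y then 1 else 0

section Perm

variable {d ℓ : ℕ}

theorem commute_permMatrix_iff {π : Equiv.Perm (Fin ℓ)}
    {X : Matrix (Fin ℓ → Fin d) (Fin ℓ → Fin d) ℂ} :
    Commute X (permMatrix π) ↔ ∀ x y, X (x ∘ π) (y ∘ π) = X x y := by
  have h1 : ∀ x y : Fin ℓ → Fin d, (X * permMatrix (d := d) π) x (y ∘ π) = X x y := by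
    intro x y
    rw [Matrix.mul_apply, Finset.sum_eq_single y]
    · simp [permMatrix]
    · intro z _ hz
      have : z ∘ π ≠ y ∘ π := fun h => hz (π.surjective.injective_comp_right h)
      simp [permMatrix, this]
    · simp
  have h2 : ∀ x z : Fin ℓ → Fin d, (permMatrix (d := d) π * X) x z = X (x ∘ π) z := by
    intro x z
    rw [Matrix.mul_apply, Finset.sum_eq_single (x ∘ π)]
    · simp [permMatrix]
    · intro y _ hy
      simp [permMatrix, hy.symm]
    · simp
  constructor
  · intro h x y
    rw [← h2, ← h.eq, h1]
  · intro h
    ext x z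
    have hz : z = (z ∘ π.symm) ∘ π := by
      ext i
      simp
    rw [hz, h1, h2, h]

theorem tensorPower_commute_permMatrix (A : Matrix (Fin d) (Fin d) ℂ) (π : Equiv.Perm (Fin ℓ)) :
    Commute (tensorPower ℓ A) (permMatrix π) :=
  commute_permMatrix_iff.mpr fun x y => Equiv.prod_comp π fun i => A (x i) (y i)

/-- The number of occurrences of each pair of letters. -/
def pairType (x y : Fin ℓ → Fin d) : Fin d × Fin d → Fin (ℓ + 1) := fun z =>
  ⟨Fintype.card {i // (x i, y i) = z},
    Nat.lt_succ_of_le ((Fintype.card_subtype_le _).trans_eq (Fintype.card_fin ℓ))⟩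

/-- Equal counts give bijections between the positions carrying each pair of letters, and these glue
to one permutation. -/
theorem exists_perm_of_pairType_eq {x y x' y' : Fin ℓ → Fin d}
    (h : pairType x y = pairType x' y') :
    ∃ π : Equiv.Perm (Fin ℓ), x' ∘ π = x ∧ y' ∘ π = y := by
  have h1 : ∀ z, Nonempty ({i // (x i, y i) = z} ≃ {i // (x' i, y' i) = z}) := fun z =>
    Fintype.card_eq.mp (congrArg Fin.val (congrFun h z))
  let e := fun z => (h1 z).some
  have h2 : ∀ i, (x' (Equiv.ofFiberEquiv e i), y' (Equiv.ofFiberEquiv e i)) = (x i, y i) :=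
    fun i => Equiv.ofFiberEquiv_map e i
  exact ⟨Equiv.ofFiberEquiv e, funext fun i => congrArg Prod.fst (h2 i),
    funext fun i => congrArg Prod.snd (h2 i)⟩

/-- A matrix that commutes with the permutations has entries depending only on the pair type of row
and column. There are at most `(ℓ + 1)^(d * d)` types, which bounds the dimension of the commutant
polynomially in `ℓ`. -/
theorem card_le_of_linearIndependent_of_commute {n : ℕ}
    {E : Fin n → Matrix (Fin ℓ → Fin d) (Fin ℓ → Fin d) ℂ} (hE : LinearIndependent ℂ E)
    (hc : ∀ k π, Commute (E k) (permMatrix π)) : n ≤ (ℓ + 1) ^ (d * d) := by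
  classical
  let Φ : ((Fin d × Fin d → Fin (ℓ + 1)) → ℂ) →ₗ[ℂ] Matrix (Fin ℓ → Fin d) (Fin ℓ → Fin d) ℂ :=
    { toFun := fun g => Matrix.of fun x y => g (pairType x y)
      map_add' := fun _ _ => rfl
      map_smul' := fun _ _ => rfl }
  have hmem : ∀ k, E k ∈ LinearMap.range Φ := by
    intro k
    refine ⟨fun t => if h : ∃ z : (Fin ℓ → Fin d) × (Fin ℓ → Fin d), pairType z.1 z.2 = t then
      E k h.choose.1 h.choose.2 else 0, ?_⟩
    ext x y
    have hex : ∃ z : (Fin ℓ → Fin d) × (Fin ℓ → Fin d), pairType z.1 z.2 = pairType x y :=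
      ⟨(x, y), rfl⟩
    change (if h : ∃ z : (Fin ℓ → Fin d) × (Fin ℓ → Fin d), pairType z.1 z.2 = pairType x y then
      E k h.choose.1 h.choose.2 else 0) = _
    rw [dif_pos hex]
    obtain ⟨π, hx, hy⟩ := exists_perm_of_pairType_eq hex.choose_spec
    rw [← hx, ← hy]
    exact commute_permMatrix_iff.mp (hc k π) x y
  have h1 : LinearIndependent ℂ fun k => (⟨E k, hmem k⟩ : LinearMap.range Φ) :=
    LinearIndependent.of_comp (LinearMap.range Φ).subtype hE
  have h2 := h1.fintype_card_le_finrank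
  rw [Fintype.card_fin] at h2
  refine h2.trans ((LinearMap.finrank_range_le Φ).trans ?_)
  simp

end Perm

/-- Measurements with polynomially many outcomes that are sharp for all states of a commuting
family. -/
theorem exists_isSharp {d : ℕ} (hd : 0 < d) (ℓ : ℕ) (T : Set (State d))
    (hT : ∀ σ ∈ T, ∀ τ ∈ T, Commute σ.mat τ.mat) :
    ∃ K : BlockPOVM d ℓ, K.outcomes ≤ (ℓ + 1) ^ (d * d) ∧ ∀ σ ∈ T, K.IsSharp σ := by
  have : Nonempty (Fin d) := ⟨⟨0, hd⟩⟩
  let S : Set (Matrix (Fin ℓ → Fin d) (Fin ℓ → Fin d) ℂ) :=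
    Set.range permMatrix ∪ (fun σ : State d => tensorPower ℓ σ.mat) '' T
  have hbound : ∀ (n : ℕ) (E : Fin n → Matrix (Fin ℓ → Fin d) (Fin ℓ → Fin d) ℂ),
      IsResolution S E → n ≤ (ℓ + 1) ^ (d * d) := fun n E hE =>
    card_le_of_linearIndependent_of_commute hE.linearIndependent fun k π =>
      hE.commute k _ (Or.inl ⟨π, rfl⟩)
  obtain ⟨n, E, hE, hmax⟩ := exists_maximal_resolution S hbound
  have hpos : ∀ k, (E k).PosSemidef := fun k => by
    rw [← hE.mul_self k]
    nth_rw 1 [← (hE.isHermitian k).eq]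
    exact Matrix.posSemidef_conjTranspose_mul_self _
  have hσ : ∀ σ ∈ T, ∀ k, Commute (E k) (tensorPower ℓ σ.mat) := fun σ hσ k =>
    hE.commute k _ (Or.inr ⟨σ, hσ, rfl⟩)
  have heig : ∀ σ ∈ T, ∀ k, ∃ s : ℝ, tensorPower ℓ σ.mat * E k = (s : ℂ) • E k := by
    intro σ hσT k
    have hEE : E k * tensorPower ℓ σ.mat * E k = tensorPower ℓ σ.mat * E k := by
      rw [(hσ σ hσT k).eq, mul_assoc, hE.mul_self]
    rw [← hEE]
    refine hE.exists_smul_eq hmax (tensorPower_posSemidef ℓ σ.posSemidef).1 k fun Y hY => ?_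
    refine ((hE.commute k Y hY).mul_left ?_).mul_left (hE.commute k Y hY)
    rcases hY with ⟨π, rfl⟩ | ⟨τ, hτ, rfl⟩
    · exact tensorPower_commute_permMatrix _ π
    · rw [Commute, SemiconjBy, ← tensorPower_mul, ← tensorPower_mul, (hT σ hσT τ hτ).eq]
  refine ⟨⟨n, E, hpos, hE.sum_eq_one⟩, hbound n E hE, fun σ hσT =>
    ⟨hE.mul_self, heig σ hσT, fun k ρ => ?_⟩⟩
  refine hE.exists_smul_eq hmax (tensorPower_posSemidef ℓ ρ.posSemidef).1 k fun Y hY => ?_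
  rcases hY with ⟨π, rfl⟩ | ⟨τ, hτ, rfl⟩
  · have h1 := hE.commute k (permMatrix π) (Or.inl ⟨π, rfl⟩)
    exact (h1.mul_left (tensorPower_commute_permMatrix _ π)).mul_left h1
  -- On the range of `E k` the matrix `τ^{⊗ℓ}` acts as the scalar `s` from both sides, so it
  -- commutes with every compression by `E k`, even if `ρ` and `τ` do not commute.
  · obtain ⟨s, hs⟩ := heig τ hτ k
    have hs' : E k * tensorPower ℓ τ.mat = (s : ℂ) • E k := by rw [(hσ τ hτ k).eq, hs]
    rw [Commute, SemiconjBy, mul_assoc, hs', ← mul_assoc, ← mul_assoc, hs, Matrix.mul_smul,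
      Matrix.smul_mul, Matrix.smul_mul]

/-! ### Bounds for sharp measurements -/

theorem IsSpectral.conj_mul_of_mul_eq_smul {ι : Type*} [Fintype ι] [DecidableEq ι]
    {A U E : Matrix ι ι ℂ} {a : ι → ℝ} (hA : IsSpectral A U a) {s : ℝ}
    (h : A * E = (s : ℂ) • E) (f : ℝ → ℝ) :
    (U * Matrix.diagonal (fun i => (f (a i) : ℂ)) * Uᴴ) * E = (f s : ℂ) • E := by
  have h1 : Matrix.diagonal (fun i => (a i : ℂ)) * (Uᴴ * E) = (s : ℂ) • (Uᴴ * E) := by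
    rw [← Matrix.mul_smul, ← h, hA.eq]
    simp only [← Matrix.mul_assoc, hA.left, Matrix.one_mul]
  have h2 : Matrix.diagonal (fun i => (f (a i) : ℂ)) * (Uᴴ * E) = (f s : ℂ) • (Uᴴ * E) := by
    ext i j
    have h3 := congrFun (congrFun h1 i) j
    rw [Matrix.diagonal_mul, Matrix.smul_apply, smul_eq_mul] at h3 ⊢
    rcases mul_eq_mul_right_iff.mp h3 with h4 | h4
    · rw [Complex.ofReal_inj.mp h4]
    · rw [h4, mul_zero, mul_zero]
  rw [Matrix.mul_assoc, Matrix.mul_assoc, h2, Matrix.mul_smul, ← Matrix.mul_assoc, hA.right,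
    Matrix.one_mul]

/-- A spectral projector compressed by `E` is at most the compression of the whole matrix. -/
theorem IsSpectral.mul_diag_le {ι : Type*} [Fintype ι] [DecidableEq ι]
    {A U E : Matrix ι ι ℂ} {a : ι → ℝ} (hA : IsSpectral A U a) (ha : ∀ i, 0 ≤ a i)
    (hE : E.IsHermitian) {c : ℝ} (hc : E * A * E = (c : ℂ) • E) {i : ι}
    (hpos : 0 < ((Uᴴ * E * U) i i).re) : a i * ((Uᴴ * E * U) i i).re ≤ c := by
  set W := Uᴴ * E * U with hW
  have hWh : Wᴴ = W := by
    rw [hW, Matrix.conjTranspose_mul, Matrix.conjTranspose_mul, Matrix.conjTranspose_conjTranspose,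
      hE.eq, Matrix.mul_assoc]
  -- In the eigenbasis of `A` the hypothesis reads `W diag(a) W = c W`. Its `i`-th diagonal entry is
  -- `∑ a_j |W_ij|² = c W_ii`. Keeping the term `j = i` and dividing by `W_ii` gives the claim.
  have h1 : W * Matrix.diagonal (fun i => (a i : ℂ)) * W = (c : ℂ) • W := by
    calc W * Matrix.diagonal (fun i => (a i : ℂ)) * W
        = Uᴴ * (E * (U * Matrix.diagonal (fun i => (a i : ℂ)) * Uᴴ) * E) * U := by
          simp only [hW, Matrix.mul_assoc]
      _ = _ := by rw [← hA.eq, hc, Matrix.mul_smul, Matrix.smul_mul]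
  have h2 := congrFun (congrFun h1 i) i
  rw [Matrix.mul_apply, Matrix.smul_apply, smul_eq_mul] at h2
  have h3 : ∀ j, (W * Matrix.diagonal (fun i => (a i : ℂ))) i j * W j i =
      ((a j * Complex.normSq (W i j) : ℝ) : ℂ) := by
    intro j
    have : W j i = star (W i j) := by
      rw [← Matrix.conjTranspose_apply, hWh]
    rw [Matrix.mul_diagonal, this, Complex.star_def]
    push_cast
    rw [← Complex.mul_conj]
    ring
  simp only [h3] at h2
  have h4 := congrArg Complex.re h2
  rw [← Complex.ofReal_sum, Complex.ofReal_re, Complex.re_ofReal_mul] at h4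
  have h5 : a i * Complex.normSq (W i i) ≤ ∑ j, a j * Complex.normSq (W i j) :=
    Finset.single_le_sum (f := fun j => a j * Complex.normSq (W i j))
      (fun j _ => mul_nonneg (ha j) (Complex.normSq_nonneg _)) (Finset.mem_univ i)
  have h6 : (W i i).re ^ 2 ≤ Complex.normSq (W i i) := by
    rw [Complex.normSq_apply]
    nlinarith [mul_self_nonneg (W i i).im]
  refine le_of_mul_le_mul_right ?_ hpos
  calc a i * (W i i).re * (W i i).re = a i * (W i i).re ^ 2 := by ring
    _ ≤ a i * Complex.normSq (W i i) := mul_le_mul_of_nonneg_left h6 (ha i)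
    _ ≤ c * (W i i).re := h5.trans h4.le

namespace BlockPOVM

variable {d ℓ : ℕ} {K : BlockPOVM d ℓ} {ρ σ : State d}

theorem re_trace_smul_effect (K : BlockPOVM d ℓ) (k : Fin K.outcomes) (c : ℝ) :
    ((c : ℂ) • K.effect k).trace.re = c * (K.effect k).trace.re := by
  rw [Matrix.trace_smul, smul_eq_mul, Complex.re_ofReal_mul]

theorem IsSharp.prob_eq_of_eigenvalue {k : Fin K.outcomes} {s : ℝ}
    (hs : tensorPower ℓ σ.mat * K.effect k = (s : ℂ) • K.effect k) :
    K.prob σ k = s * (K.effect k).trace.re := by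
  rw [prob, Matrix.trace_mul_comm, hs, re_trace_smul_effect]

theorem IsSharp.prob_eq_of_compression (h : K.IsSharp σ) {k : Fin K.outcomes} {c : ℝ}
    (hc : K.effect k * tensorPower ℓ ρ.mat * K.effect k = (c : ℂ) • K.effect k) :
    K.prob ρ k = c * (K.effect k).trace.re := by
  rw [← re_trace_smul_effect, ← hc, Matrix.trace_mul_comm, ← mul_assoc, h.mul_self, prob]

/-- The inequality `log x ≤ x - 1` at `x = 1 / (n e)` bounds `-e log e`. Summed over `n` weights `e`
of total mass one, the right side becomes `a log n`: a distribution on `n` points has entropy at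
most `log n`. -/
theorem mul_log_sub_log_le {a e c n : ℝ} (ha : 0 ≤ a) (he : 0 ≤ e) (hn : 0 < n)
    (hc : 0 < e → a * e ≤ c) :
    a * e * (Real.log a - Real.log c) ≤ a * (e * Real.log n + 1 / n - e) := by
  rcases he.eq_or_lt with rfl | he
  · have : 0 ≤ a * (1 / n) := by positivity
    simpa using this
  rcases ha.eq_or_lt with rfl | ha
  · simp
  rw [mul_assoc]
  refine mul_le_mul_of_nonneg_left ?_ ha.le
  have h1 : Real.log a + Real.log e ≤ Real.log c := by
    rw [← Real.log_mul ha.ne' he.ne']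
    exact Real.log_le_log (by positivity) (hc he)
  have h2 : -Real.log e ≤ Real.log n + 1 / (n * e) - 1 := by
    have := Real.log_le_sub_one_of_pos (x := 1 / (n * e)) (by positivity)
    rw [Real.log_div one_ne_zero (by positivity), Real.log_one, Real.log_mul hn.ne' he.ne'] at this
    linarith
  calc e * (Real.log a - Real.log c) ≤ e * (Real.log n + 1 / (n * e) - 1) :=
        mul_le_mul_of_nonneg_left (by linarith) he.le
    _ = e * Real.log n + 1 / n - e := by field_simp

/-- The outcomes that are impossible under `σ` have positive probability under `ρ` if the support
of `ρ` is not contained in that of `σ`. -/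
theorem le_hitProb {P : Matrix (Fin d) (Fin d) ℂ} (hP : σ.IsSuppProj P)
    (hK : ∀ k, ∃ s : ℝ, tensorPower ℓ σ.mat * K.effect k = (s : ℂ) • K.effect k) (hℓ : ℓ ≠ 0)  :
    ((1 - P) * ρ.mat).trace.re ≤ K.hitProb ρ σ := by
  classical
  choose s hs using hK
  obtain ⟨Y, hY⟩ := hP.exists_mul_eq
  -- `G` collects the outcomes possible under `σ`. It is fixed by the support projector `P^{⊗ℓ}`,
  -- hence lies below it, so under `ρ` it has probability at most `x^ℓ ≤ x`.
  set G := ∑ k with s k ≠ 0, K.effect k with hG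
  have hPh : (tensorPower ℓ P)ᴴ = tensorPower ℓ P := by
    rw [← tensorPower_conjTranspose, hP.isHermitian.eq]
  have hPP : tensorPower ℓ P * tensorPower ℓ P = tensorPower ℓ P := by
    rw [← tensorPower_mul, hP.mul_self]
  have hPG : tensorPower ℓ P * G = G := by
    rw [hG, Finset.mul_sum]
    refine Finset.sum_congr rfl fun k hk => ?_
    have hk' : s k ≠ 0 := (Finset.mem_filter.mp hk).2
    have h1 : (s k : ℂ) • (tensorPower ℓ P * K.effect k) = (s k : ℂ) • K.effect k := by
      rw [← Matrix.mul_smul, ← hs k, ← mul_assoc, ← tensorPower_mul, hP.mul_mat]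
    exact smul_right_injective _ (Complex.ofReal_ne_zero.mpr hk') h1
  have hGh : Gᴴ = G := by
    rw [hG, Matrix.conjTranspose_sum]
    exact Finset.sum_congr rfl fun k _ => (K.posSemidef k).1.eq
  have hGP : G * tensorPower ℓ P = G := by
    have := congrArg Matrix.conjTranspose hPG
    rwa [Matrix.conjTranspose_mul, hGh, hPh] at this
  have h1G : (1 - G).PosSemidef := by
    have : 1 - G = ∑ k with ¬ s k ≠ 0, K.effect k := by
      rw [← K.sum_effect, sub_eq_iff_eq_add', hG, Finset.sum_filter_add_sum_filter_not]
    rw [this]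
    exact Matrix.posSemidef_sum _ fun k _ => K.posSemidef k
  have hle : (tensorPower ℓ P - G).PosSemidef := by
    have := h1G.mul_mul_conjTranspose_same (tensorPower ℓ P)
    rwa [hPh, mul_sub, sub_mul, mul_one, hPP, hPG, hGP] at this
  have h2 : ∑ k with s k ≠ 0, K.prob ρ k ≤ (tensorPower ℓ P * tensorPower ℓ ρ.mat).trace.re := by
    have := trace_mul_re_nonneg hle (tensorPower_posSemidef ℓ ρ.posSemidef)
    rw [sub_mul, Matrix.trace_sub, Complex.sub_re, hG, Finset.sum_mul, Matrix.trace_sum,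
      Complex.re_sum] at this
    simp only [prob]
    linarith
  set x := (P * ρ.mat).trace.re with hx
  have hκ : ((1 - P) * ρ.mat).trace.re = 1 - x := by
    rw [sub_mul, one_mul, Matrix.trace_sub, ρ.trace_eq_one, Complex.sub_re, Complex.one_re]
  have hx0 : 0 ≤ x := trace_mul_re_nonneg hP.posSemidef ρ.posSemidef
  have hx1 : x ≤ 1 := by
    have := trace_mul_re_nonneg hP.one_sub_posSemidef ρ.posSemidef
    linarith
  have h3 : (tensorPower ℓ P * tensorPower ℓ ρ.mat).trace.re = x ^ ℓ := by
    have him : (P * ρ.mat).trace = (x : ℂ) := by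
      refine Complex.ext rfl ?_
      rw [Complex.ofReal_im]
      have h4 : star (P * ρ.mat).trace = (P * ρ.mat).trace := by
        rw [← Matrix.trace_conjTranspose, Matrix.conjTranspose_mul, hP.isHermitian.eq,
          ρ.posSemidef.1.eq, Matrix.trace_mul_comm]
      exact Complex.conj_eq_iff_im.mp h4
    rw [← tensorPower_mul, trace_tensorPower, him, ← Complex.ofReal_pow, Complex.ofReal_re]
  have h4 : x ^ ℓ ≤ x := pow_le_of_le_one hx0 hx1 hℓ
  have h5 : 1 - ∑ k with s k ≠ 0, K.prob ρ k ≤ K.hitProb ρ σ := by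
    rw [← K.sum_prob ρ, ← Finset.sum_filter_add_sum_filter_not Finset.univ (fun k => s k ≠ 0),
      add_sub_cancel_left, hitProb, Finset.sum_filter]
    refine Finset.sum_le_sum fun k _ => ?_
    by_cases hk : s k = 0
    · have : K.prob σ k = 0 := by
        rw [prob, Matrix.trace_mul_comm, hs k, hk]
        simp
      simp [hk, this]
    · simp only [hk, ne_eq, not_false_eq_true, not_true_eq_false, if_false]
      split_ifs
      · exact K.prob_nonneg ρ k
      · exact le_rfl
  linarith

/-- A sharp measurement loses at most the logarithm of the number of outcomes. -/
theorem IsSharp.mul_relEntropy_le (h : K.IsSharp σ) (ρ : State d) :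
    ℓ * SeqQHT.relEntropy ρ σ ≤ K.relEntropy ρ σ + ENNReal.ofReal (Real.log K.outcomes) := by
  by_cases hsupp : ρ.supp ≤ σ.supp
  · obtain ⟨B, hB, hstep⟩ := exists_prob_le hsupp
    have hac : ∀ x, K.prob σ x = 0 → K.prob ρ x = 0 := fun x hx =>
      le_antisymm ((hstep ℓ K x).trans_eq (by rw [hx, mul_zero])) (K.prob_nonneg ρ x)
    obtain ⟨U, a, hU, ha, hUlog⟩ := exists_isSpectral ρ.posSemidef
    obtain ⟨V, b, hV, hb, hVlog⟩ := exists_isSpectral σ.posSemidef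
    choose s hs using h.exists_eigenvalue
    choose c hc using fun k => h.exists_compression k ρ
    have hn : 0 < (K.outcomes : ℝ) := by
      have h1 : K.outcomes ≠ 0 := fun h0 => by
        have h2 := K.sum_prob ρ
        have : IsEmpty (Fin K.outcomes) := by
          rw [h0]
          infer_instance
        simp at h2
      exact_mod_cast Nat.pos_of_ne_zero h1
    have hn1 : (1 : ℝ) ≤ K.outcomes := by exact_mod_cast hn
    have hUℓ := hU.tensorPower (ℓ := ℓ)
    have hVℓ := hV.tensorPower (ℓ := ℓ)
    rw [natCast_mul_relEntropy hU hV hUlog hVlog ha hsupp, K.relEntropy_eq hac,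
      ← ENNReal.ofReal_add (K.klSum_nonneg hac) (Real.log_nonneg hn1)]
    refine ENNReal.ofReal_le_ofReal ?_
    rw [klSum_overlap_eq (tensorPower_hac fun i j =>
      mul_overlap_eq_zero_of_mul_eq_zero hU hV ha hsupp), hUℓ.sum_overlap_log_eq hVℓ.right]
    generalize hA : (fun x : Fin ℓ → Fin d => ∏ i, a (x i)) = A at hUℓ
    have hA' : ∀ x : Fin ℓ → Fin d, ∏ i, a (x i) = A x := fun x => congrFun hA x
    have hA0 : ∀ x, 0 ≤ A x := fun x => by
      rw [← hA' x]
      exact Finset.prod_nonneg fun i _ => ha _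
    simp only [hA']
    -- The projectors lie in eigenspaces of `σ^{⊗ℓ}`, so its logarithm is a combination of the
    -- effects. The cross term `tr ρ log σ` is therefore read off from the outcome probabilities
    -- without loss.
    have hlog : (tensorPower ℓ V * Matrix.diagonal
        (fun x => (Real.log (∏ i, b (x i)) : ℂ)) * (tensorPower ℓ V)ᴴ) =
        ∑ k, (Real.log (s k) : ℂ) • K.effect k := by
      rw [← Matrix.mul_one (tensorPower ℓ V * _ * _), ← K.sum_effect, Finset.mul_sum]
      exact Finset.sum_congr rfl fun k _ => hVℓ.conj_mul_of_mul_eq_smul (hs k) Real.log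
    have htr : (tensorPower ℓ ρ.mat * ∑ k, (Real.log (s k) : ℂ) • K.effect k).trace.re =
        ∑ k, Real.log (s k) * K.prob ρ k := by
      rw [Finset.mul_sum, Matrix.trace_sum, Complex.re_sum]
      refine Finset.sum_congr rfl fun k _ => ?_
      rw [Matrix.mul_smul, Matrix.trace_smul, smul_eq_mul, Complex.re_ofReal_mul,
        Matrix.trace_mul_comm]
      rfl
    rw [hlog, htr]
    -- The weight of the eigenvector `x` of `ρ^{⊗ℓ}` in the range of the projector `k`. For fixed
    -- `x` these weights form a probability distribution over the outcomes.
    set e : (Fin ℓ → Fin d) → Fin K.outcomes → ℝ := fun x k =>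
      (((tensorPower ℓ U)ᴴ * K.effect k * tensorPower ℓ U) x x).re with he
    have he0 : ∀ x k, 0 ≤ e x k := fun x k =>
      (Complex.le_def.mp (((K.posSemidef k).conjTranspose_mul_mul_same _).diag_nonneg (i := x))).1
    have he1 : ∀ x, ∑ k, e x k = 1 := fun x => by
      simp only [he]
      rw [← Complex.re_sum, ← Matrix.sum_apply, ← Finset.sum_mul, ← Finset.mul_sum, K.sum_effect,
        Matrix.mul_one, hUℓ.left, Matrix.one_apply_eq, Complex.one_re]
    have hp : ∀ k, K.prob ρ k = ∑ x, A x * e x k := fun k => by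
      have h1 : (K.effect k * tensorPower ℓ ρ.mat).trace =
          (Matrix.diagonal (fun x => (A x : ℂ)) *
            ((tensorPower ℓ U)ᴴ * K.effect k * tensorPower ℓ U)).trace := by
        rw [hUℓ.eq, Matrix.trace_mul_comm, Matrix.mul_assoc, Matrix.mul_assoc,
          Matrix.trace_mul_comm]
        simp only [Matrix.mul_assoc]
      rw [prob, h1, Matrix.trace, Complex.re_sum]
      refine Finset.sum_congr rfl fun x _ => ?_
      rw [Matrix.diag_apply, Matrix.diagonal_mul, Complex.re_ofReal_mul]
    have hAsum : ∑ x, A x = 1 := by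
      have h1 := trace_tensorPower ℓ ρ.mat
      rw [ρ.trace_eq_one, hUℓ.trace_eq, one_pow] at h1
      exact_mod_cast h1
    -- Pinching to the scalars `c k` raises the entropy of `ρ^{⊗ℓ}` by at most the logarithm of the
    -- number of projectors. This is the only loss.
    have key : ∑ x, A x * Real.log (A x) - ∑ k, K.prob ρ k * Real.log (c k) ≤
        Real.log K.outcomes := by
      calc ∑ x, A x * Real.log (A x) - ∑ k, K.prob ρ k * Real.log (c k)
          = ∑ x, ∑ k, A x * e x k * (Real.log (A x) - Real.log (c k)) := by
            simp only [mul_sub, Finset.sum_sub_distrib]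
            congr 1
            · refine Finset.sum_congr rfl fun x _ => ?_
              rw [← Finset.sum_mul, ← Finset.mul_sum, he1, mul_one]
            · rw [Finset.sum_comm]
              refine Finset.sum_congr rfl fun k _ => ?_
              rw [hp, Finset.sum_mul]
        _ ≤ ∑ x, ∑ k, A x * (e x k * Real.log K.outcomes + 1 / K.outcomes - e x k) := by
            refine Finset.sum_le_sum fun x _ => Finset.sum_le_sum fun k _ => ?_
            exact mul_log_sub_log_le (hA0 x) (he0 x k) hn fun hpos =>
              hUℓ.mul_diag_le hA0 (K.posSemidef k).1 (hc k) hpos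
        _ = Real.log K.outcomes := by
            have h1 : ∀ x, ∑ k, A x * (e x k * Real.log K.outcomes + 1 / K.outcomes - e x k) =
                A x * Real.log K.outcomes := fun x => by
              rw [← Finset.mul_sum, Finset.sum_sub_distrib, Finset.sum_add_distrib,
                ← Finset.sum_mul, he1, Finset.sum_const, Finset.card_univ, Fintype.card_fin,
                nsmul_eq_mul, mul_one_div_cancel hn.ne', one_mul, add_sub_cancel_right]
            simp only [h1]
            rw [← Finset.sum_mul, hAsum, one_mul]
    have hkl : klSum (K.prob ρ) (K.prob σ) =
        ∑ k, K.prob ρ k * Real.log (c k) - ∑ k, Real.log (s k) * K.prob ρ k := by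
      rw [klSum, ← Finset.sum_sub_distrib]
      refine Finset.sum_congr rfl fun k _ => ?_
      by_cases hk : K.prob ρ k = 0
      · rw [hk]
        simp
      · have hk' : K.prob σ k ≠ 0 := fun h0 => hk (hac k h0)
        have h1 := h.prob_eq_of_compression (hc k)
        have h2 := IsSharp.prob_eq_of_eigenvalue (hs k)
        rw [h1] at hk
        rw [h2] at hk'
        have h3 : K.prob ρ k / K.prob σ k = c k / s k := by
          rw [h1, h2, mul_div_mul_right _ _ (right_ne_zero_of_mul hk)]
        rw [h3, Real.log_div (left_ne_zero_of_mul hk) (left_ne_zero_of_mul hk')]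
        ring
    linarith
  · rcases Nat.eq_zero_or_pos ℓ with rfl | hℓ
    · simp
    · obtain ⟨P, hP⟩ := σ.exists_isSuppProj
      have h1 := hP.trace_pos (mt hP.supp_le_iff.mpr hsupp)
      rw [K.relEntropy_eq_top_iff.mpr
        (h1.trans_le (le_hitProb hP h.exists_eigenvalue hℓ.ne')), top_add]
      exact le_top

end BlockPOVM

/-! ### Sequences of sharp measurements -/

section Sequences

variable {d : ℕ} {K : ∀ ℓ, BlockPOVM d ℓ} {σ : State d}

theorem tendsto_ofReal_log_div (c : ℕ) :
    Tendsto (fun ℓ : ℕ => ENNReal.ofReal (Real.log (((ℓ + 1) ^ c : ℕ) : ℝ)) / ℓ) atTop (𝓝 0) := by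
  have h1 : Tendsto (fun ℓ : ℕ => Real.log ((ℓ : ℝ) + 1) / ((ℓ : ℝ) + 1)) atTop (𝓝 0) := by
    have := Real.tendsto_pow_log_div_mul_add_atTop 1 0 1 one_ne_zero
    simp only [pow_one, one_mul, add_zero] at this
    exact this.comp (tendsto_atTop_add_const_right _ 1 tendsto_natCast_atTop_atTop)
  -- The factor `2` absorbs the passage from `ℓ + 1` to `ℓ` in the denominator, as `ℓ + 1 ≤ 2 ℓ`.
  have h2 : Tendsto (fun ℓ : ℕ => (c : ℝ) * (2 * (Real.log ((ℓ : ℝ) + 1) / ((ℓ : ℝ) + 1)))) atTop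
      (𝓝 0) := by
    have := (h1.const_mul 2).const_mul (c : ℝ)
    simpa using this
  have h3 := ENNReal.tendsto_ofReal h2
  rw [ENNReal.ofReal_zero] at h3
  refine tendsto_of_tendsto_of_tendsto_of_le_of_le' tendsto_const_nhds h3
    (Eventually.of_forall fun _ => zero_le) ?_
  filter_upwards [eventually_gt_atTop 0] with ℓ hℓ
  have hℓ' : (1 : ℝ) ≤ ℓ := by exact_mod_cast hℓ
  rw [← ENNReal.ofReal_natCast ℓ, ← ENNReal.ofReal_div_of_pos (by linarith)]
  refine ENNReal.ofReal_le_ofReal ?_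
  push_cast
  rw [Real.log_pow, mul_div_assoc]
  refine mul_le_mul_of_nonneg_left ?_ (Nat.cast_nonneg c)
  rw [← mul_div_assoc, div_le_div_iff₀ (by linarith) (by linarith)]
  have : 0 ≤ Real.log ((ℓ : ℝ) + 1) := Real.log_nonneg (by linarith)
  nlinarith

/-- The loss `log (ℓ + 1)^c` of a sharp measurement is `o(ℓ)`, and data processing gives the
matching upper bound. With `D = ∞` the same squeeze applies, as `∞` minus a finite loss is `∞`. -/
theorem tendsto_relEntropy_of_isSharp {c : ℕ} (hK : ∀ ℓ, (K ℓ).IsSharp σ)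
    (hn : ∀ ℓ, (K ℓ).outcomes ≤ (ℓ + 1) ^ c) (ρ : State d) :
    Tendsto (fun ℓ => (K ℓ).relEntropy ρ σ / ℓ) atTop (𝓝 (relEntropy ρ σ)) := by
  have hlow : Tendsto (fun ℓ : ℕ => relEntropy ρ σ -
      ENNReal.ofReal (Real.log (((ℓ + 1) ^ c : ℕ) : ℝ)) / ℓ) atTop (𝓝 (relEntropy ρ σ)) := by
    have := ENNReal.Tendsto.sub (tendsto_const_nhds (x := relEntropy ρ σ))
      (tendsto_ofReal_log_div c) (Or.inr ENNReal.zero_ne_top)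
    rwa [tsub_zero] at this
  refine tendsto_of_tendsto_of_tendsto_of_le_of_le' hlow tendsto_const_nhds ?_ ?_
  · filter_upwards [eventually_gt_atTop 0] with ℓ hℓ
    have h0 : (ℓ : ℝ≥0∞) ≠ 0 := Nat.cast_ne_zero.mpr hℓ.ne'
    rw [tsub_le_iff_right, ← ENNReal.add_div, ENNReal.le_div_iff_mul_le (Or.inl h0)
      (Or.inl (ENNReal.natCast_ne_top ℓ)), mul_comm]
    refine ((hK ℓ).mul_relEntropy_le ρ).trans ?_
    refine add_le_add_right (ENNReal.ofReal_le_ofReal ?_) _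
    by_cases h1 : (K ℓ).outcomes = 0
    · rw [h1, Nat.cast_zero, Real.log_zero]
      exact Real.log_nonneg (by exact_mod_cast Nat.one_le_pow _ _ (by omega))
    · exact Real.log_le_log (by exact_mod_cast Nat.pos_of_ne_zero h1) (by exact_mod_cast hn ℓ)
  · filter_upwards [eventually_gt_atTop 0] with ℓ hℓ
    refine ENNReal.div_le_of_le_mul ?_
    rw [mul_comm]
    exact (K ℓ).relEntropy_le ρ σ

theorem attainsRate_of_isSharp {c : ℕ} (hK : ∀ ℓ, (K ℓ).IsSharp σ)
    (hn : ∀ ℓ, (K ℓ).outcomes ≤ (ℓ + 1) ^ c) {s : Fin 2 → State d} {ν : Fin 2}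
    (hs : s (1 - ν) = σ) :
    AttainsRate s (fun ℓ => blockSampling (K ℓ)) ν (relEntropy (s ν) (s (1 - ν))) := by
  by_cases h : (s ν).supp ≤ (s (1 - ν)).supp
  · obtain ⟨B, hB, hstep⟩ := exists_prob_le h
    refine attainsRate_blockSampling (fun h0 => relEntropy_eq_top_iff.mp h0 h) ?_ hB
      (Eventually.of_forall fun ℓ x => hstep ℓ (K ℓ) x)
    rw [hs]
    exact tendsto_relEntropy_of_isSharp hK hn (s ν)
  · rw [relEntropy_eq_top_iff.mpr h]
    obtain ⟨P, hP⟩ := (s (1 - ν)).exists_isSuppProj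
    refine attainsRate_blockSampling_top (hP.trace_pos (mt hP.supp_le_iff.mpr h)) ?_
    filter_upwards [eventually_ne_atTop 0] with ℓ hℓ
    exact BlockPOVM.le_hitProb hP (by rw [hs]; exact (hK ℓ).exists_eigenvalue) hℓ

theorem State.dim_pos (σ : State d) : 0 < d := by
  rcases Nat.eq_zero_or_pos d with rfl | h
  · have := σ.trace_eq_one
    simp [Matrix.trace] at this
  · exact h

/-- For each state there is a sequence of sharp measurements. -/
theorem exists_sharpMeasurement (d : ℕ) : ∃ F : State d → ∀ ℓ, BlockPOVM d ℓ,
    ∀ σ ℓ, (F σ ℓ).IsSharp σ ∧ (F σ ℓ).outcomes ≤ (ℓ + 1) ^ (d * d) := by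
  have h : ∀ (σ : State d) (ℓ : ℕ), ∃ K : BlockPOVM d ℓ,
      K.IsSharp σ ∧ K.outcomes ≤ (ℓ + 1) ^ (d * d) := fun σ ℓ => by
    obtain ⟨K, h1, h2⟩ := exists_isSharp σ.dim_pos ℓ {σ} (by
      rintro _ rfl _ rfl
      exact Commute.refl _)
    exact ⟨K, h2 σ rfl, h1⟩
  choose F hF using h
  exact ⟨F, hF⟩

theorem exists_attainsRate (d : ℕ) : ∃ F : State d → ∀ ℓ, BlockPOVM d ℓ,
    ∀ (s : Fin 2 → State d) (ν : Fin 2),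
      AttainsRate s (fun ℓ => blockSampling (F (s (1 - ν)) ℓ)) ν
        (relEntropy (s ν) (s (1 - ν))) := by
  obtain ⟨F, hF⟩ := exists_sharpMeasurement d
  exact ⟨F, fun s ν => attainsRate_of_isSharp (fun ℓ => (hF _ ℓ).1) (fun ℓ => (hF _ ℓ).2) rfl⟩

/-- Tensor powers of commuting states commute, so a single maximal resolution is sharp for both of
them. -/
theorem exists_attainsRate_of_commute (s : Fin 2 → State d)
    (h : Commute (s 0).mat (s 1).mat) : ∃ K : ∀ ℓ, BlockPOVM d ℓ, ∀ ν,
      AttainsRate s (fun ℓ => blockSampling (K ℓ)) ν (relEntropy (s ν) (s (1 - ν))) := by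
  have h1 : ∀ ℓ, ∃ K : BlockPOVM d ℓ, K.outcomes ≤ (ℓ + 1) ^ (d * d) ∧
      ∀ σ ∈ Set.range s, K.IsSharp σ := fun ℓ => by
    refine exists_isSharp (s 0).dim_pos ℓ (Set.range s) ?_
    rintro _ ⟨i, rfl⟩ _ ⟨j, rfl⟩
    fin_cases i <;> fin_cases j
    · exact Commute.refl _
    · exact h
    · exact h.symm
    · exact Commute.refl _
  choose K hK using h1
  exact ⟨K, fun ν => attainsRate_of_isSharp (fun ℓ => (hK ℓ).2 _ ⟨1 - ν, rfl⟩)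
    (fun ℓ => (hK ℓ).1) rfl⟩

theorem inv_relEntropy_le {ℓ : ℕ} (hℓ : 1 ≤ ℓ) (K : BlockPOVM d ℓ) (ρ σ : State d) :
    (relEntropy ρ σ)⁻¹ ≤ ℓ / K.relEntropy ρ σ := by
  have h0 : (ℓ : ℝ≥0∞) ≠ 0 := Nat.cast_ne_zero.mpr (by omega)
  rw [← ENNReal.inv_div (Or.inl (ENNReal.natCast_ne_top ℓ)) (Or.inl h0), ENNReal.inv_le_inv]
  refine ENNReal.div_le_of_le_mul ?_
  rw [mul_comm]
  exact K.relEntropy_le ρ σ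

theorem tendsto_natCast_div_relEntropy {ρ : State d} {D : ℝ≥0∞}
    (hK : Tendsto (fun ℓ => (K ℓ).relEntropy ρ σ / ℓ) atTop
    (𝓝 D)) : Tendsto (fun ℓ : ℕ => (ℓ : ℝ≥0∞) / (K ℓ).relEntropy ρ σ) atTop (𝓝 D⁻¹) := by
  refine (tendsto_inv_iff.mpr hK).congr' ?_
  filter_upwards [eventually_ne_atTop 0] with ℓ hℓ
  exact ENNReal.inv_div (Or.inl (ENNReal.natCast_ne_top ℓ)) (Or.inl (Nat.cast_ne_zero.mpr hℓ))

theorem tendsto_iInf_div_relEntropy (ρ σ : State d) :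
    Tendsto (fun ℓ : ℕ => ⨅ K : BlockPOVM d ℓ, ℓ / K.relEntropy ρ σ) atTop
      (𝓝 (relEntropy ρ σ)⁻¹) := by
  obtain ⟨F, hF⟩ := exists_sharpMeasurement d
  refine tendsto_of_tendsto_of_tendsto_of_le_of_le' tendsto_const_nhds
    (tendsto_natCast_div_relEntropy (tendsto_relEntropy_of_isSharp (fun ℓ => (hF σ ℓ).1)
      (fun ℓ => (hF σ ℓ).2) ρ)) ?_ (Eventually.of_forall fun ℓ => iInf_le _ _)
  filter_upwards [eventually_ge_atTop 1] with ℓ hℓ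
  exact le_iInf fun K => inv_relEntropy_le hℓ K ρ σ

theorem tendsto_iInf_iInf_meanCopies_relEntropy (s : Fin 2 → State d) (c : Criterion)
    {η : Fin 2 → ℝ} (hη : ∀ i, 0 < η i) (ν : Fin 2) :
    Tendsto (fun e => (⨅ (ℓ : ℕ) (_ : 1 ≤ ℓ) (K : BlockPOVM d ℓ),
      (SPRT.mk s η c e (blockSampling K)).meanCopies ν) / negLog (e ν)) smallErrors
      (𝓝 (relEntropy (s ν) (s (1 - ν)))⁻¹) := by
  refine tendsto_iInf_iInf_meanCopies s c hη ν (fun ℓ hℓ K => inv_relEntropy_le hℓ K _ _)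
    fun b hb => ?_
  obtain ⟨ℓ, h1, h2⟩ := (((tendsto_iInf_div_relEntropy (s ν) (s (1 - ν))).eventually_lt_const
    hb).and (eventually_ge_atTop 1)).exists
  obtain ⟨K, hK⟩ := iInf_lt_iff.mp h1
  exact ⟨ℓ, h2, K, hK⟩

end Sequences

/-! ### Product measurements -/

section Product

open scoped Kronecker

variable {d m n : ℕ}

/-- Splitting a block into two. -/
def splitEquiv (d m n : ℕ) : (Fin (m + n) → Fin d) ≃ (Fin m → Fin d) × (Fin n → Fin d) :=
  (Fin.appendEquiv m n).symm

theorem tensorPower_add (X : Matrix (Fin d) (Fin d) ℂ) :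
    tensorPower (m + n) X =
      (tensorPower m X ⊗ₖ tensorPower n X).submatrix (splitEquiv d m n) (splitEquiv d m n) := by
  ext x y
  simp only [tensorPower, Matrix.of_apply, Fin.prod_univ_add]
  rfl

namespace BlockPOVM

theorem trace_effect_mul_tensorPower (K : BlockPOVM d m) (ρ : State d) (x : Fin K.outcomes) :
    (K.effect x * tensorPower m ρ.mat).trace = (K.prob ρ x : ℂ) := by
  refine Complex.ext rfl ?_
  rw [Complex.ofReal_im]
  refine Complex.conj_eq_iff_im.mp ?_
  rw [← Complex.star_def, ← Matrix.trace_conjTranspose, Matrix.conjTranspose_mul,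
    (K.posSemidef x).1.eq, (tensorPower_posSemidef m ρ.posSemidef).1.eq, Matrix.trace_mul_comm]

/-- The measurement of `K` on the first part of a block and of `L` on the second. -/
def prod (K : BlockPOVM d m) (L : BlockPOVM d n) : BlockPOVM d (m + n) where
  outcomes := K.outcomes * L.outcomes
  effect z := (K.effect (finProdFinEquiv.symm z).1 ⊗ₖ L.effect (finProdFinEquiv.symm z).2).submatrix
    (splitEquiv d m n) (splitEquiv d m n)
  posSemidef z := ((K.posSemidef _).kronecker (L.posSemidef _)).submatrix _
  sum_effect := by
    rw [finProdFinEquiv.symm.sum_comp fun z : Fin K.outcomes × Fin L.outcomes =>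
      (K.effect z.1 ⊗ₖ L.effect z.2).submatrix (splitEquiv d m n) (splitEquiv d m n),
      Fintype.sum_prod_type]
    have h : ∑ x, ∑ y, K.effect x ⊗ₖ L.effect y =
        (1 : Matrix ((Fin m → Fin d) × (Fin n → Fin d)) _ ℂ) := by
      rw [← Matrix.one_kronecker_one, ← K.sum_effect, ← L.sum_effect]
      ext i j
      simp only [Matrix.sum_apply, Matrix.kroneckerMap_apply, Finset.sum_mul_sum]
    rw [← Matrix.submatrix_one_equiv (splitEquiv d m n), ← h]
    ext i j
    simp only [Matrix.sum_apply, Matrix.submatrix_apply]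

variable (K : BlockPOVM d m) (L : BlockPOVM d n) (ρ σ : State d)

/-- The outcomes of a product measurement are pairs of outcomes. -/
def prodOutcome : Fin (K.prod L).outcomes ≃ Fin K.outcomes × Fin L.outcomes :=
  finProdFinEquiv.symm

theorem effect_prod (z : Fin (K.prod L).outcomes) : (K.prod L).effect z =
    (K.effect (K.prodOutcome L z).1 ⊗ₖ L.effect (K.prodOutcome L z).2).submatrix
      (splitEquiv d m n) (splitEquiv d m n) := rfl

theorem prob_prod (z : Fin (K.prod L).outcomes) : (K.prod L).prob ρ z =
    K.prob ρ (K.prodOutcome L z).1 * L.prob ρ (K.prodOutcome L z).2 := by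
  have h : ((K.prod L).effect z * tensorPower (m + n) ρ.mat).trace =
      ((K.prob ρ (K.prodOutcome L z).1 * L.prob ρ (K.prodOutcome L z).2 : ℝ) : ℂ) := by
    rw [Complex.ofReal_mul, ← trace_effect_mul_tensorPower, ← trace_effect_mul_tensorPower,
      ← Matrix.trace_kronecker, Matrix.mul_kronecker_mul, tensorPower_add,
      effect_prod, Matrix.submatrix_mul_equiv]
    generalize (K.effect (K.prodOutcome L z).1 ⊗ₖ L.effect (K.prodOutcome L z).2) *
      (tensorPower m ρ.mat ⊗ₖ tensorPower n ρ.mat) = X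
    exact (splitEquiv d m n).sum_comp fun i => X i i
  rw [prob, h, Complex.ofReal_re]

theorem exists_prob_ne_zero : ∃ x, K.prob ρ x ≠ 0 := by
  by_contra h
  push Not at h
  have := K.sum_prob ρ
  simp [h] at this

variable {ρ σ}

/-- Unless the right side is infinite, absolute continuity of the product passes to both factors.
Each factor is tested against an outcome of positive probability of the other. -/
theorem relEntropy_add_le_prod :
    K.relEntropy ρ σ + L.relEntropy ρ σ ≤ (K.prod L).relEntropy ρ σ := by
  by_cases htop : (K.prod L).relEntropy ρ σ = ∞
  · rw [htop]
    exact le_top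
  have hac := (K.prod L).relEntropy_ne_top_iff.mp htop
  have hac' : ∀ x y, K.prob σ x * L.prob σ y = 0 → K.prob ρ x * L.prob ρ y = 0 := by
    intro x y h
    have := hac ((K.prodOutcome L).symm (x, y))
    rw [prob_prod, prob_prod, Equiv.apply_symm_apply] at this
    exact this h
  have hK : ∀ x, K.prob σ x = 0 → K.prob ρ x = 0 := by
    intro x hx
    obtain ⟨y, hy⟩ := L.exists_prob_ne_zero ρ
    exact (mul_eq_zero.mp (hac' x y (by rw [hx, zero_mul]))).resolve_right hy
  have hL : ∀ y, L.prob σ y = 0 → L.prob ρ y = 0 := by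
    intro y hy
    obtain ⟨x, hx⟩ := K.exists_prob_ne_zero ρ
    exact (mul_eq_zero.mp (hac' x y (by rw [hy, mul_zero]))).resolve_left hx
  rw [K.relEntropy_eq hK, L.relEntropy_eq hL, (K.prod L).relEntropy_eq hac,
    ← ENNReal.ofReal_add (K.klSum_nonneg hK) (L.klSum_nonneg hL),
    ← klSum_prod (K.sum_prob ρ) (L.sum_prob ρ) hK hL, ← klSum_comp_equiv (K.prodOutcome L)]
  refine le_of_eq ?_
  congr 2
  · ext z
    exact (K.prob_prod L ρ z).symm
  · ext z
    exact (K.prob_prod L σ z).symm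

theorem sum_prod (f : Fin K.outcomes → Fin L.outcomes → ℝ) :
    ∑ z : Fin (K.prod L).outcomes, f (K.prodOutcome L z).1 (K.prodOutcome L z).2 =
      ∑ x, ∑ y, f x y := by
  rw [← Fintype.sum_prod_type' f]
  exact (K.prodOutcome L).sum_comp fun z : Fin K.outcomes × Fin L.outcomes => f z.1 z.2

theorem hitProb_left_le_prod : K.hitProb ρ σ ≤ (K.prod L).hitProb ρ σ := by
  have h : K.hitProb ρ σ = ∑ x, ∑ y, if K.prob σ x = 0 then K.prob ρ x * L.prob ρ y else 0 := by
    refine Finset.sum_congr rfl fun x _ => ?_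
    split_ifs
    · rw [← Finset.mul_sum, L.sum_prob, mul_one]
    · simp
  rw [h, ← K.sum_prod L, hitProb]
  refine Finset.sum_le_sum fun z _ => ?_
  rw [prob_prod, prob_prod]
  have := mul_nonneg (K.prob_nonneg ρ (K.prodOutcome L z).1)
    (L.prob_nonneg ρ (K.prodOutcome L z).2)
  split_ifs with h1 h2 h2
  · exact le_rfl
  · exact absurd (by rw [h1, zero_mul]) h2
  · exact this
  · exact le_rfl

theorem hitProb_right_le_prod : L.hitProb ρ σ ≤ (K.prod L).hitProb ρ σ := by
  have h : L.hitProb ρ σ = ∑ x, ∑ y, if L.prob σ y = 0 then K.prob ρ x * L.prob ρ y else 0 := by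
    rw [Finset.sum_comm]
    refine Finset.sum_congr rfl fun y _ => ?_
    split_ifs
    · rw [← Finset.sum_mul, K.sum_prob, one_mul]
    · simp
  rw [h, ← K.sum_prod L, hitProb]
  refine Finset.sum_le_sum fun z _ => ?_
  rw [prob_prod, prob_prod]
  have := mul_nonneg (K.prob_nonneg ρ (K.prodOutcome L z).1)
    (L.prob_nonneg ρ (K.prodOutcome L z).2)
  split_ifs with h1 h2 h2
  · exact le_rfl
  · exact absurd (by rw [h1, mul_zero]) h2
  · exact this
  · exact le_rfl

/-- The measurement with a single outcome. -/
def trivial (d n : ℕ) : BlockPOVM d n where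
  outcomes := 1
  effect _ := 1
  posSemidef _ := Matrix.PosSemidef.one
  sum_effect := by simp

/-- Independent repetitions of a measurement on part of a longer block. -/
theorem exists_mul_relEntropy_le {ℓ : ℕ} (K : BlockPOVM d ℓ) (r k : ℕ) :
    ∀ n, n = r + k * ℓ → ∃ L : BlockPOVM d n, ∀ ρ σ : State d,
      k * K.relEntropy ρ σ ≤ L.relEntropy ρ σ := by
  induction k with
  | zero => exact fun n _ => ⟨trivial d n, fun ρ σ => by simp⟩
  | succ k ih =>
    rintro n rfl
    obtain ⟨L, hL⟩ := ih _ rfl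
    have h : r + (k + 1) * ℓ = (r + k * ℓ) + ℓ := by ring
    rw [h]
    refine ⟨L.prod K, fun ρ σ => ?_⟩
    refine le_trans ?_ (L.relEntropy_add_le_prod K)
    rw [Nat.cast_add, Nat.cast_one, add_mul, one_mul]
    exact add_le_add_left (hL ρ σ) _

end BlockPOVM

end Product

/-! ### Supports that are not nested -/

/-- The prefix takes at most `ℓ` copies whatever `E` does, so only the blocks have to detect the
exclusion. This serves the hypothesis for which `E` was not designed. -/
theorem meanCopies_prefixedSampling_le_mul {d ℓ : ℕ} (s : Fin 2 → State d) (c : Criterion)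
    {η e : Fin 2 → ℝ} (hη : ∀ i, 0 < η i) (he : ∀ i, 0 < e i) (E : BlockPOVM d 1)
    (K : BlockPOVM d ℓ) {ν : Fin 2}
    {κ : ℝ} (hκ0 : 0 < κ) (hκ : κ ≤ K.hitProb (s ν) (s (1 - ν))) :
    (SPRT.mk s η c e (prefixedSampling ℓ E K)).meanCopies ν ≤
      (1 + ENNReal.ofReal κ⁻¹) * ℓ := by
  have hκ1 : κ ≤ 1 := hκ.trans (K.hitProb_le_one _ _)
  set T := SPRT.mk s η c e (prefixedSampling ℓ E K) with hT
  have h1 : ∀ k, k < ℓ → (T.schedule k).1 = 1 := fun k hk =>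
    congrArg Sigma.fst (prefixedSampling_of_lt E K hk)
  have h2 : ∀ k, T.schedule (ℓ + k) = ⟨ℓ, K⟩ := fun k =>
    prefixedSampling_of_le E K (Nat.le_add_right ℓ k)
  have hs1 : ∀ k, T.survival (T.states ν) k ≤ 1 := fun k =>
    (T.survival_le_prod hη he ν k).trans (Finset.prod_le_one
      (fun i _ => sub_nonneg.mpr ((T.schedule i).2.hitProb_le_one _ _))
      fun i _ => sub_le_self _ ((T.schedule i).2.hitProb_nonneg _ _))
  have hs2 : ∀ k, T.survival (T.states ν) (ℓ + k) ≤ (1 - κ) ^ k := fun k => by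
    refine (T.survival_le_prod hη he ν _).trans ?_
    rw [Finset.prod_range_add, ← one_mul ((1 - κ) ^ k)]
    refine mul_le_mul (Finset.prod_le_one
      (fun i _ => sub_nonneg.mpr ((T.schedule i).2.hitProb_le_one _ _))
      fun i _ => sub_le_self _ ((T.schedule i).2.hitProb_nonneg _ _)) ?_
      (Finset.prod_nonneg fun i _ => sub_nonneg.mpr ((T.schedule _).2.hitProb_le_one _ _))
      zero_le_one
    calc ∏ i ∈ Finset.range k, (1 - (T.schedule (ℓ + i)).2.hitProb (T.states ν) (T.states (1 - ν)))
        ≤ ∏ _i ∈ Finset.range k, (1 - κ) := Finset.prod_le_prod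
          (fun i _ => sub_nonneg.mpr ((T.schedule _).2.hitProb_le_one _ _))
          fun i _ => by
            rw [h2 i]
            exact sub_le_sub_left hκ 1
      _ = (1 - κ) ^ k := by simp
  rw [SPRT.meanCopies_eq, ← ENNReal.summable.sum_add_tsum_nat_add' (k := ℓ), add_mul]
  refine add_le_add ?_ ?_
  · calc ∑ k ∈ Finset.range ℓ, ((T.schedule k).1 : ℝ≥0∞) * ENNReal.ofReal (T.survival (T.states ν) k)
        ≤ ∑ _k ∈ Finset.range ℓ, 1 := Finset.sum_le_sum fun k hk => by
          rw [h1 k (Finset.mem_range.mp hk), Nat.cast_one, one_mul]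
          exact ENNReal.ofReal_le_one.mpr (hs1 k)
      _ = 1 * ℓ := by simp
  · rw [← one_sub_ofReal_one_sub hκ0 hκ1, ← ENNReal.tsum_geometric, ← ENNReal.tsum_mul_right]
    refine ENNReal.tsum_le_tsum fun k => ?_
    rw [add_comm k ℓ, h2 k, mul_comm, ← ENNReal.ofReal_pow (by linarith)]
    exact mul_le_mul_left (ENNReal.ofReal_le_ofReal (hs2 k)) _

theorem meanCopies_blockSampling_zero {d : ℕ} (s : Fin 2 → State d) (c : Criterion)
    (η e : Fin 2 → ℝ) (K : BlockPOVM d 0) (ν : Fin 2) :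
    (SPRT.mk s η c e (blockSampling K)).meanCopies ν = 0 := by
  rw [SPRT.meanCopies_eq]
  simp [blockSampling]

/-- If the support of one state is not contained in that of the other, the mean for the former can
be kept bounded at no cost for the latter. -/
theorem exists_attainsRate_of_not_supp_le {d : ℕ} (s : Fin 2 → State d) (ν : Fin 2)
    (h : ¬ (s (1 - ν)).supp ≤ (s ν).supp) :
    ∃ (E : BlockPOVM d 1) (K : ∀ ℓ, BlockPOVM d ℓ) (C : ℝ≥0),
      (AttainsRate s (fun ℓ => blockSampling (K ℓ)) ν (relEntropy (s ν) (s (1 - ν))) ∧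
        Tendsto (fun ℓ => (K ℓ).relEntropy (s ν) (s (1 - ν)) / ℓ) atTop
          (𝓝 (relEntropy (s ν) (s (1 - ν)))) ∧
        (∀ᶠ ℓ in atTop, (K ℓ).relEntropy (s (1 - ν)) (s ν) = ∞) ∧
        ∀ (c : Criterion) (η e : Fin 2 → ℝ) (ℓ : ℕ), IsPrior η → (∀ i, 0 < e i) →
          (SPRT.mk s η c e (blockSampling (K ℓ))).meanCopies (1 - ν) ≤ C * ℓ) ∧
      (AttainsRate s (fun ℓ => prefixedSampling ℓ E (K ℓ)) ν (relEntropy (s ν) (s (1 - ν))) ∧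
        ∀ (c : Criterion) (η e : Fin 2 → ℝ) (ℓ : ℕ), IsPrior η → (∀ i, 0 < e i) →
          (SPRT.mk s η c e (prefixedSampling ℓ E (K ℓ))).meanCopies (1 - ν) ≤ C) := by
  obtain ⟨F, hF⟩ := exists_sharpMeasurement d
  set σ := s (1 - ν) with hσ
  obtain ⟨P, hP⟩ := (s ν).exists_isSuppProj
  have hκ := hP.trace_pos (mt hP.supp_le_iff.mpr h)
  set κ := ((1 - P) * σ.mat).trace.re with hκdef
  let E : BlockPOVM d 1 := F (s ν) 1
  -- All copies but one go to the measurement that is sharp for `σ`, which keeps the rate for `ν`.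
  -- The last one goes to `E`, which excludes `ν` with fixed probability when `σ` is true. The case
  -- `ℓ = 0` uses no copies and is harmless.
  let K : ∀ ℓ, BlockPOVM d ℓ := fun ℓ => match ℓ with
    | 0 => F σ 0
    | ℓ + 1 => (F σ ℓ).prod E
  have hE : κ ≤ E.hitProb σ (s ν) :=
    BlockPOVM.le_hitProb hP (hF (s ν) 1).1.exists_eigenvalue one_ne_zero
  have hKhit : ∀ ℓ, ℓ ≠ 0 → κ ≤ (K ℓ).hitProb σ (s ν) := by
    intro ℓ hℓ
    obtain ⟨m, rfl⟩ := Nat.exists_eq_succ_of_ne_zero hℓ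
    exact hE.trans ((F σ m).hitProb_right_le_prod E)
  have hν : s (1 - (1 - ν)) = s ν := by rw [one_sub_one_sub]
  have hKD : Tendsto (fun ℓ => (K ℓ).relEntropy (s ν) σ / ℓ) atTop (𝓝 (relEntropy (s ν) σ)) := by
    rw [← tendsto_add_atTop_iff_nat 1]
    have h1 := tendsto_relEntropy_of_isSharp (fun ℓ => (hF σ ℓ).1) (fun ℓ => (hF σ ℓ).2) (s ν)
    have h2 : Tendsto (fun ℓ : ℕ => (ℓ : ℝ≥0∞) / ((ℓ + 1 : ℕ) : ℝ≥0∞)) atTop (𝓝 1) := by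
      have h3 := ENNReal.tendsto_ofReal (tendsto_natCast_div_add_atTop (1 : ℝ))
      rw [ENNReal.ofReal_one] at h3
      refine h3.congr fun ℓ => ?_
      rw [ENNReal.ofReal_div_of_pos (by positivity), ENNReal.ofReal_natCast, ← Nat.cast_add_one,
        ENNReal.ofReal_natCast]
    have h4 := ENNReal.Tendsto.mul h1 (Or.inr ENNReal.one_ne_top) h2 (Or.inl one_ne_zero)
    rw [mul_one] at h4
    refine tendsto_of_tendsto_of_tendsto_of_le_of_le' h4 tendsto_const_nhds ?_
      (Eventually.of_forall fun ℓ => ?_)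
    · filter_upwards [eventually_ne_atTop 0] with ℓ hℓ
      have hℓ0 : (ℓ : ℝ≥0∞) ≠ 0 := Nat.cast_ne_zero.mpr hℓ
      rw [← mul_div_assoc, ENNReal.div_mul_cancel hℓ0 (ENNReal.natCast_ne_top ℓ)]
      exact ENNReal.div_le_div_right
        (le_self_add.trans ((F σ ℓ).relEntropy_add_le_prod E)) _
    · refine ENNReal.div_le_of_le_mul ?_
      rw [mul_comm]
      exact (K (ℓ + 1)).relEntropy_le (s ν) σ
  have hblock : ∀ (c : Criterion) (η e : Fin 2 → ℝ) (ℓ : ℕ), IsPrior η → (∀ i, 0 < e i) →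
      (SPRT.mk s η c e (blockSampling (K ℓ))).meanCopies (1 - ν) ≤
        ENNReal.ofReal κ⁻¹ * ℓ := by
    intro c η e ℓ hη he
    rcases Nat.eq_zero_or_pos ℓ with rfl | hℓ
    · rw [meanCopies_blockSampling_zero]
      exact zero_le
    · exact meanCopies_blockSampling_le s c hη.1 he (K ℓ) hκ (by
        rw [hν]
        exact hKhit ℓ hℓ.ne')
  have hprefix : ∀ (c : Criterion) (η e : Fin 2 → ℝ) (ℓ : ℕ), IsPrior η → (∀ i, 0 < e i) →
      (SPRT.mk s η c e (prefixedSampling ℓ E (K ℓ))).meanCopies (1 - ν) ≤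
        ENNReal.ofReal κ⁻¹ + ENNReal.ofReal κ⁻¹ * ENNReal.ofReal κ⁻¹ := by
    intro c η e ℓ hη he
    rcases Nat.eq_zero_or_pos ℓ with rfl | hℓ
    · have : prefixedSampling 0 E (K 0) = blockSampling (K 0) := by
        funext k
        exact prefixedSampling_of_le E (K 0) (Nat.zero_le k)
      rw [this, meanCopies_blockSampling_zero]
      exact zero_le
    · exact meanCopies_prefixedSampling_le s c hη.1 he E (K ℓ) hκ (by rw [hν]; exact hE) (by
        rw [hν]
        exact hKhit ℓ hℓ.ne')
  refine ⟨E, K, Real.toNNReal κ⁻¹ + Real.toNNReal κ⁻¹ * Real.toNNReal κ⁻¹,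
    ⟨?_, hKD, ?_, fun c η e ℓ hη he => (hblock c η e ℓ hη he).trans ?_⟩, ?_,
    fun c η e ℓ hη he => (hprefix c η e ℓ hη he).trans_eq ?_⟩
  · by_cases hs : (s ν).supp ≤ σ.supp
    · obtain ⟨B, hB, hstep⟩ := exists_prob_le hs
      exact attainsRate_blockSampling (fun h0 => relEntropy_eq_top_iff.mp h0 hs) hKD hB
        (Eventually.of_forall fun ℓ x => hstep ℓ (K ℓ) x)
    · rw [relEntropy_eq_top_iff.mpr hs]
      obtain ⟨Q, hQ⟩ := σ.exists_isSuppProj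
      refine attainsRate_blockSampling_top (hQ.trace_pos (mt hQ.supp_le_iff.mpr hs)) ?_
      -- One copy of the block belongs to `E`, so `2 ≤ ℓ` leaves at least one for the sharp
      -- measurement.
      filter_upwards [eventually_ge_atTop 2] with ℓ hℓ
      obtain ⟨m, rfl⟩ : ∃ m, ℓ = m + 1 := ⟨ℓ - 1, by omega⟩
      exact (BlockPOVM.le_hitProb hQ (hF σ m).1.exists_eigenvalue (by omega)).trans
        ((F σ m).hitProb_left_le_prod E)
  · filter_upwards [eventually_ne_atTop 0] with ℓ hℓ
    exact (K ℓ).relEntropy_eq_top_iff.mpr (hκ.trans_le (hKhit ℓ hℓ))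
  · refine mul_le_mul_left ?_ _
    rw [ENNReal.coe_add]
    exact le_self_add
  · by_cases hs : (s ν).supp ≤ σ.supp
    · obtain ⟨B, hB, hstep⟩ := exists_prob_le hs
      have hD : relEntropy (s ν) σ ≠ ∞ := fun h0 => relEntropy_eq_top_iff.mp h0 hs
      -- The upper bound per copy has to hold for the prefix as well, so it is the data processing
      -- bound `D` itself. The lower bound is needed only after the `ℓ` stages of the prefix.
      refine attainsRate_of_ne_top hD (κ := fun _ => relEntropy (s ν) σ) tendsto_const_nhds hKD
        (Eventually.of_forall fun ℓ k => ?_) ?_ (t := fun ℓ => ℓ) ?_ hB ?_ fun ℓ => ?_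
      · rw [mul_comm]
        exact BlockPOVM.relEntropy_le _ _ _
      · filter_upwards [eventually_ne_atTop 0] with ℓ hℓ
        refine top_le_iff.mp ((tsum_blockSampling hℓ (K ℓ)).symm.le.trans
          (ENNReal.tsum_le_tsum fun k => ?_) |>.trans
          (ENNReal.tsum_comp_le_tsum_of_injective (add_left_injective ℓ) _))
        rw [prefixedSampling_of_le E (K ℓ) (Nat.le_add_left ℓ k)]
        exact le_rfl
      · filter_upwards [eventually_ne_atTop 0] with ℓ hℓ k hk
        rw [prefixedSampling_of_le E (K ℓ) hk]
        exact (ENNReal.div_mul_cancel (Nat.cast_ne_zero.mpr hℓ) (ENNReal.natCast_ne_top ℓ)).le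
      · filter_upwards [eventually_ge_atTop 1] with ℓ hℓ k
        by_cases hk : k < ℓ
        · rw [prefixedSampling_of_lt E (K ℓ) hk]
          intro x
          refine (hstep 1 E x).trans (mul_le_mul_of_nonneg_right (Real.exp_le_exp.mpr ?_)
            (E.prob_nonneg _ _))
          exact mul_le_mul_of_nonneg_left (by exact_mod_cast hℓ) hB
        · rw [prefixedSampling_of_le E (K ℓ) (not_lt.mp hk)]
          exact hstep ℓ (K ℓ)
      · rw [Finset.sum_congr rfl fun k hk => by
          rw [prefixedSampling_of_lt E (K ℓ) (Finset.mem_range.mp hk)]]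
        simp
    · rw [relEntropy_eq_top_iff.mpr hs]
      obtain ⟨Q, hQ⟩ := σ.exists_isSuppProj
      refine attainsRate_top (C := 1 + Real.toNNReal ((1 - Q) * (s ν).mat).trace.re⁻¹) ?_
      filter_upwards [eventually_ge_atTop 2] with ℓ hℓ c η e hη he
      obtain ⟨m, rfl⟩ : ∃ m, ℓ = m + 1 := ⟨ℓ - 1, by omega⟩
      rw [ENNReal.coe_add, ENNReal.coe_one]
      exact meanCopies_prefixedSampling_le_mul s c hη.1 he E (K (m + 1))
        (hQ.trace_pos (mt hQ.supp_le_iff.mpr hs))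
        ((BlockPOVM.le_hitProb hQ (hF σ m).1.exists_eigenvalue (by omega)).trans
          ((F σ m).hitProb_left_le_prod E))
  · rw [ENNReal.coe_add, ENNReal.coe_mul]
    rfl

/-! ### The Bayesian mean -/

/-- If `ρ` and `σ` gave every effect `τ` the same probability, the choices `τ = ρ` and `τ = σ` would
give `tr (ρ - σ)² = 0`. A suitable two-outcome measurement therefore makes both relative entropies
nonzero and the optimal Bayesian rate finite. -/
theorem exists_relEntropy_ne_zero {d : ℕ} {s : Fin 2 → State d} (hs : s 0 ≠ s 1) :
    ∃ K : BlockPOVM d 1, ∀ ν, K.relEntropy (s ν) (s (1 - ν)) ≠ 0 := by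
  have hpsd : ∀ τ : State d, (1 - tensorPower 1 τ.mat).PosSemidef := fun τ => by
    have := tensorPower_sub_posSemidef (ℓ := 1) τ.posSemidef τ.one_sub_posSemidef
    rwa [tensorPower_one] at this
  let E : State d → BlockPOVM d 1 := fun τ =>
    { outcomes := 2
      effect := ![tensorPower 1 τ.mat, 1 - tensorPower 1 τ.mat]
      posSemidef := fun x => by
        fin_cases x
        · exact tensorPower_posSemidef 1 τ.posSemidef
        · exact hpsd τ
      sum_effect := by simp }
  have hE : ∀ τ ρ : State d, (E τ).prob ρ (0 : Fin 2) = (τ.mat * ρ.mat).trace.re := fun τ ρ => by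
    change (tensorPower 1 τ.mat * tensorPower 1 ρ.mat).trace.re = _
    rw [← tensorPower_mul, trace_tensorPower, pow_one]
  have hex : ∃ τ, (E τ).prob (s 0) ≠ (E τ).prob (s 1) := by
    by_contra hcon
    push Not at hcon
    have h : ∀ τ : State d, (τ.mat * (s 0).mat).trace.re = (τ.mat * (s 1).mat).trace.re :=
      fun τ => by
        rw [← hE, ← hE]
        exact congrFun (hcon τ) (0 : Fin 2)
    set H := (s 0).mat - (s 1).mat with hH
    have hHh : Hᴴ = H := by
      rw [hH, Matrix.conjTranspose_sub, (s 0).posSemidef.1.eq, (s 1).posSemidef.1.eq]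
    have h1 : (Hᴴ * H).trace.re = 0 := by
      rw [hHh, hH, sub_mul, mul_sub, mul_sub, Matrix.trace_sub, Matrix.trace_sub, Matrix.trace_sub,
        Complex.sub_re, Complex.sub_re, Complex.sub_re, h, h]
      ring
    have h2 : (Hᴴ * H).trace = 0 :=
      Complex.ext h1 (Complex.le_def.mp (Matrix.posSemidef_conjTranspose_mul_self H).trace_nonneg).2.symm
    rw [Matrix.trace_conjTranspose_mul_self_eq_zero_iff, hH, sub_eq_zero] at h2
    apply hs
    cases h3 : s 0
    cases h4 : s 1
    rw [h3, h4] at h2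
    simp only at h2
    subst h2
    rfl
  obtain ⟨τ, hτ⟩ := hex
  refine ⟨E τ, fun ν h0 => ?_⟩
  rw [BlockPOVM.relEntropy_eq_zero_iff] at h0
  fin_cases ν
  · exact hτ h0
  · exact hτ h0.symm

/-- The weighted sum of the means of block-sampling with `K`, to leading order. -/
def weightedRate {d ℓ : ℕ} (s : Fin 2 → State d) (η : Fin 2 → ℝ) (w : Fin 2 → ℝ≥0∞)
    (K : BlockPOVM d ℓ) : ℝ≥0∞ :=
  ∑ ν : Fin 2, ENNReal.ofReal (η ν) * (ℓ * w ν / K.relEntropy (s ν) (s (1 - ν)))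

/-- The infimum of `weightedRate` over all block lengths and measurements. -/
def optimalRate {d : ℕ} (s : Fin 2 → State d) (η : Fin 2 → ℝ) (w : Fin 2 → ℝ≥0∞) : ℝ≥0∞ :=
  ⨅ (ℓ : ℕ) (_ : 1 ≤ ℓ) (K : BlockPOVM d ℓ), weightedRate s η w K

section Bayes

variable {d : ℕ} {s : Fin 2 → State d} {η : Fin 2 → ℝ}

theorem optimalRate_le (w : Fin 2 → ℝ≥0∞) {ℓ : ℕ} (hℓ : 1 ≤ ℓ) (K : BlockPOVM d ℓ) :
    optimalRate s η w ≤ weightedRate s η w K :=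
  (iInf₂_le ℓ hℓ).trans (iInf_le _ K)

theorem weightedRate_mul (c : ℝ≥0∞) (w : Fin 2 → ℝ≥0∞) {ℓ : ℕ} (K : BlockPOVM d ℓ) :
    weightedRate s η (fun ν => c * w ν) K = c * weightedRate s η w K := by
  rw [weightedRate, weightedRate, Finset.mul_sum]
  refine Finset.sum_congr rfl fun ν _ => ?_
  simp only [div_eq_mul_inv]
  ring

theorem weightedRate_mono {w w' : Fin 2 → ℝ≥0∞} (h : ∀ ν, w ν ≤ w' ν) {ℓ : ℕ}
    (K : BlockPOVM d ℓ) : weightedRate s η w K ≤ weightedRate s η w' K :=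
  Finset.sum_le_sum fun ν _ => mul_le_mul_right
    (ENNReal.div_le_div_right (mul_le_mul_right (h ν) _) _) _

theorem mul_optimalRate_le {c : ℝ≥0∞} {w w' : Fin 2 → ℝ≥0∞} (h : ∀ ν, c * w ν ≤ w' ν) :
    c * optimalRate s η w ≤ optimalRate s η w' := by
  refine le_iInf₂ fun ℓ hℓ => le_iInf fun K => ?_
  refine le_trans ?_ (weightedRate_mono h K)
  rw [weightedRate_mul]
  exact mul_le_mul_right (optimalRate_le w hℓ K) c

theorem tendsto_one_add_inv_div {m : ℕ} (hm : 1 ≤ m) :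
    Tendsto (fun n : ℕ => 1 + ((n / m : ℕ) : ℝ≥0∞)⁻¹) atTop (𝓝 1) := by
  have h := (ENNReal.tendsto_inv_nat_nhds_zero.comp
    (Nat.tendsto_div_const_atTop (by omega : m ≠ 0))).const_add 1
  rwa [add_zero] at h

/-- The optimum over measurements on long blocks of equal length is the overall optimum. -/
theorem tendsto_iInf_weightedRate (w : Fin 2 → ℝ≥0∞) :
    Tendsto (fun ℓ => ⨅ K : BlockPOVM d ℓ, weightedRate s η w K) atTop
      (𝓝 (optimalRate s η w)) := by
  refine tendsto_order.mpr ⟨fun b hb => ?_, fun b hb => ?_⟩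
  · filter_upwards [eventually_ge_atTop 1] with ℓ hℓ
    exact hb.trans_le (le_iInf fun K => optimalRate_le w hℓ K)
  · obtain ⟨m, h1⟩ := iInf_lt_iff.mp hb
    obtain ⟨hm, h2⟩ := iInf_lt_iff.mp h1
    obtain ⟨K, hK⟩ := iInf_lt_iff.mp h2
    have hlim : Tendsto (fun n : ℕ => (1 + ((n / m : ℕ) : ℝ≥0∞)⁻¹) * weightedRate s η w K) atTop
        (𝓝 (weightedRate s η w K)) := by
      have := ENNReal.Tendsto.mul_const (tendsto_one_add_inv_div hm)
        (Or.inr (hK.trans_le le_top).ne)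
      rwa [one_mul] at this
    filter_upwards [hlim.eventually_lt_const hK, eventually_ge_atTop m] with n hn hmn
    have hk : 1 ≤ n / m := (Nat.one_le_div_iff (by omega)).mpr hmn
    -- A block of length `n` holds `n / m` repetitions of `K`, and the remaining `n % m` copies are
    -- ignored. The waste is the factor `1 + 1 / (n / m)`.
    obtain ⟨L, hL⟩ := K.exists_mul_relEntropy_le (n % m) (n / m) n (Nat.mod_add_div' n m).symm
    refine lt_of_le_of_lt ((iInf_le _ L).trans ?_) hn
    set k := n / m with hkdef
    have hk0 : (k : ℝ≥0∞) ≠ 0 := Nat.cast_ne_zero.mpr (by omega)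
    have hktop : (k : ℝ≥0∞) ≠ ∞ := ENNReal.natCast_ne_top k
    have hnk : (n : ℝ≥0∞) * (k : ℝ≥0∞)⁻¹ ≤ (1 + (k : ℝ≥0∞)⁻¹) * m := by
      have h3 : n ≤ (k + 1) * m := by
        exact (Nat.lt_mul_of_div_lt (Nat.lt_succ_self (n / m)) (by omega)).le
      calc (n : ℝ≥0∞) * (k : ℝ≥0∞)⁻¹ ≤ ((k + 1) * m : ℝ≥0∞) * (k : ℝ≥0∞)⁻¹ := by
            gcongr
            exact_mod_cast h3
        _ = ((k : ℝ≥0∞) * (k : ℝ≥0∞)⁻¹ + (k : ℝ≥0∞)⁻¹) * m := by ring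
        _ = _ := by rw [ENNReal.mul_inv_cancel hk0 hktop]
    rw [weightedRate, weightedRate, Finset.mul_sum]
    refine Finset.sum_le_sum fun ν _ => ?_
    rw [mul_left_comm]
    refine mul_le_mul_right ?_ _
    calc (n : ℝ≥0∞) * w ν / L.relEntropy (s ν) (s (1 - ν))
        ≤ n * w ν / (k * K.relEntropy (s ν) (s (1 - ν))) :=
          ENNReal.div_le_div_left (hL _ _) _
      _ = (n * (k : ℝ≥0∞)⁻¹) * (w ν * (K.relEntropy (s ν) (s (1 - ν)))⁻¹) := by
          rw [div_eq_mul_inv, ENNReal.mul_inv (Or.inl hk0) (Or.inl hktop)]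
          ring
      _ ≤ ((1 + (k : ℝ≥0∞)⁻¹) * m) * (w ν * (K.relEntropy (s ν) (s (1 - ν)))⁻¹) := by gcongr
      _ = _ := by
          rw [div_eq_mul_inv]
          ring

theorem sum_fin_two_eq {M : Type*} [AddCommMonoid M] (f : Fin 2 → M) (ν : Fin 2) :
    ∑ i, f i = f ν + f (1 - ν) := by
  rw [Fin.sum_univ_two]
  fin_cases ν
  · rfl
  · exact add_comm _ _

theorem mul_inv_relEntropy_le_optimalRate (w : Fin 2 → ℝ≥0∞) (ν : Fin 2) :
    ENNReal.ofReal (η ν) * (w ν * (relEntropy (s ν) (s (1 - ν)))⁻¹) ≤ optimalRate s η w := by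
  refine le_iInf₂ fun ℓ hℓ => le_iInf fun K => ?_
  rw [weightedRate, sum_fin_two_eq _ ν]
  refine le_trans ?_ le_self_add
  refine mul_le_mul_right ?_ _
  rw [mul_comm (ℓ : ℝ≥0∞), mul_div_assoc]
  exact mul_le_mul_right (inv_relEntropy_le hℓ K _ _) _

theorem weightedRate_ne_top {w : Fin 2 → ℝ≥0∞} (hw : ∀ ν, w ν ≠ ∞) {ℓ : ℕ} {K : BlockPOVM d ℓ}
    (hK : ∀ ν, K.relEntropy (s ν) (s (1 - ν)) ≠ 0) : weightedRate s η w K ≠ ∞ := by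
  refine ENNReal.sum_ne_top.mpr fun ν _ => ENNReal.mul_ne_top ENNReal.ofReal_ne_top
    (ENNReal.div_ne_top (ENNReal.mul_ne_top (ENNReal.natCast_ne_top ℓ) (hw ν)) (hK ν))

/-- The converse bounds for the two means hold with factors independent of `ℓ` and `K`. The smaller
of the two yields a bound for the weighted sum that survives the infimum. -/
theorem min_lowerFactor_mul_le {c : Criterion} {e : Fin 2 → ℝ} (hη : ∀ i, 0 < η i)
    (he : SmallEnough c η e) {ℓ : ℕ} (hℓ : 1 ≤ ℓ) (K : BlockPOVM d ℓ) :
    min (lowerFactor c η 0 e) (lowerFactor c η 1 e) * weightedRate s η (fun ν => negLog (e ν)) K ≤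
      (SPRT.mk s η c e (blockSampling K)).bayesMean := by
  rw [weightedRate, SPRT.bayesMean, Finset.mul_sum]
  refine Finset.sum_le_sum fun ν _ => ?_
  rw [mul_left_comm]
  refine mul_le_mul_right ?_ _
  have h1 := lowerFactor_mul_div_le (s := s) hη he (ν := ν) hℓ K
  rw [ENNReal.le_div_iff_mul_le (Or.inl (he.negLog_ne_zero ν)) (Or.inl (negLog_ne_top _))] at h1
  refine le_trans ?_ h1
  have h2 : min (lowerFactor c η 0 e) (lowerFactor c η 1 e) ≤ lowerFactor c η ν e := by
    fin_cases ν
    · exact min_le_left _ _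
    · exact min_le_right _ _
  calc min (lowerFactor c η 0 e) (lowerFactor c η 1 e) *
        (ℓ * negLog (e ν) / K.relEntropy (s ν) (s (1 - ν)))
      ≤ lowerFactor c η ν e * (ℓ * negLog (e ν) / K.relEntropy (s ν) (s (1 - ν))) := by gcongr
    _ = _ := by
      simp only [div_eq_mul_inv]
      ring

theorem tendsto_div_one {α : Type*} {l : Filter α} {f g lo : α → ℝ≥0∞}
    (hg : ∀ᶠ a in l, g a ≠ 0 ∧ g a ≠ ∞) (hlo : Tendsto lo l (𝓝 1))
    (hle : ∀ᶠ a in l, lo a * g a ≤ f a)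
    (hup : ∀ B : ℝ≥0∞, 1 < B → B ≠ ∞ → ∀ᶠ a in l, f a ≤ B * g a) :
    Tendsto (fun a => f a / g a) l (𝓝 1) := by
  refine tendsto_order.mpr ⟨fun b hb => ?_, fun b hb => ?_⟩
  · filter_upwards [hg, hle, hlo.eventually_const_lt hb] with a h1 h2 h3
    refine h3.trans_le ?_
    rwa [ENNReal.le_div_iff_mul_le (Or.inl h1.1) (Or.inl h1.2)]
  · obtain ⟨B, hB1, hBb⟩ := exists_between hb
    filter_upwards [hup B hB1 (hBb.trans_le le_top).ne] with a h1
    exact (ENNReal.div_le_of_le_mul h1).trans_lt hBb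

/-- The upper bound when exactly one relative entropy is infinite. -/
theorem eventually_bayesMean_le_of_top (hη : IsPrior η) (hs : s 0 ≠ s 1) (c : Criterion)
    {ν : Fin 2} (hD : relEntropy (s ν) (s (1 - ν)) ≠ ∞)
    (hD' : relEntropy (s (1 - ν)) (s ν) = ∞) (ℓ₀ : ℕ) {B : ℝ≥0∞} (hB : 1 < B) :
    ∀ᶠ e in smallErrors, (⨅ (ℓ : ℕ) (_ : ℓ₀ ≤ ℓ) (K : BlockPOVM d ℓ),
      (SPRT.mk s η c e (blockSampling K)).bayesMean) ≤
        B * optimalRate s η (fun ν => negLog (e ν)) := by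
  -- With these measurements the mean for `1 - ν` stays bounded as the errors vanish. The Bayesian
  -- mean is then governed by the term for `ν`, which by data processing is also a lower bound for
  -- `optimalRate`.
  obtain ⟨-, K, C, ⟨-, hK, -, hC⟩, -⟩ :=
    exists_attainsRate_of_not_supp_le s ν (relEntropy_eq_top_iff.mp hD')
  obtain ⟨K₀, hK₀⟩ := exists_relEntropy_ne_zero hs
  have hD0 : relEntropy (s ν) (s (1 - ν)) ≠ 0 := fun h0 => hK₀ ν (by
    have := K₀.relEntropy_le (s ν) (s (1 - ν))
    rwa [h0, mul_zero, nonpos_iff_eq_zero] at this)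
  have hDi0 : (relEntropy (s ν) (s (1 - ν)))⁻¹ ≠ 0 := ENNReal.inv_ne_zero.mpr hD
  have hDitop : (relEntropy (s ν) (s (1 - ν)))⁻¹ ≠ ∞ := ENNReal.inv_ne_top.mpr hD0
  have hlt : (relEntropy (s ν) (s (1 - ν)))⁻¹ < B * (relEntropy (s ν) (s (1 - ν)))⁻¹ := by
    conv_lhs => rw [← one_mul (relEntropy (s ν) (s (1 - ν)))⁻¹]
    exact ENNReal.mul_lt_mul_left hDi0 hDitop hB
  obtain ⟨ℓ, h1, h2⟩ := (((tendsto_natCast_div_relEntropy hK).eventually_lt_const hlt).and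
    (eventually_ge_atTop (max ℓ₀ 1))).exists
  have hlim : Tendsto (fun e => ENNReal.ofReal (η ν) *
      ((SPRT.mk s η c e (blockSampling (K ℓ))).meanCopies ν / negLog (e ν)) +
      ENNReal.ofReal (η (1 - ν)) * (C * ℓ) / negLog (e ν)) smallErrors
      (𝓝 (ENNReal.ofReal (η ν) * (ℓ / (K ℓ).relEntropy (s ν) (s (1 - ν))) + 0)) := by
    refine Tendsto.add (ENNReal.Tendsto.const_mul (tendsto_meanCopies_blockSampling s c hη.1 ν
      (le_of_max_le_right h2) (K ℓ)) (Or.inr ENNReal.ofReal_ne_top))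
      (tendsto_const_div_negLog tendsto_id ν ?_)
    exact ENNReal.mul_ne_top ENNReal.ofReal_ne_top
      (ENNReal.mul_ne_top ENNReal.coe_ne_top (ENNReal.natCast_ne_top ℓ))
  rw [add_zero] at hlim
  have hη0 : ENNReal.ofReal (η ν) ≠ 0 := (ENNReal.ofReal_pos.mpr (hη.1 ν)).ne'
  have hlt' := ENNReal.mul_lt_mul_right hη0 ENNReal.ofReal_ne_top h1
  filter_upwards [hlim.eventually_lt_const hlt', eventually_smallEnough (c := c) hη.1]
    with e he hsmall
  have hx0 := hsmall.negLog_ne_zero ν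
  have hxtop := negLog_ne_top (e ν)
  refine (iInf₂_le ℓ (le_of_max_le_left h2)).trans ((iInf_le _ (K ℓ)).trans ?_)
  rw [SPRT.bayesMean, sum_fin_two_eq _ ν]
  calc ENNReal.ofReal (η ν) * (SPRT.mk s η c e (blockSampling (K ℓ))).meanCopies ν +
        ENNReal.ofReal (η (1 - ν)) * (SPRT.mk s η c e (blockSampling (K ℓ))).meanCopies (1 - ν)
      ≤ ENNReal.ofReal (η ν) * (SPRT.mk s η c e (blockSampling (K ℓ))).meanCopies ν +
        ENNReal.ofReal (η (1 - ν)) * (C * ℓ) := by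
        gcongr
        exact hC c η e ℓ hη fun i => (hsmall i).1.1
    _ = (ENNReal.ofReal (η ν) *
      ((SPRT.mk s η c e (blockSampling (K ℓ))).meanCopies ν / negLog (e ν)) +
      ENNReal.ofReal (η (1 - ν)) * (C * ℓ) / negLog (e ν)) * negLog (e ν) := by
        rw [add_mul, mul_assoc, ENNReal.div_mul_cancel hx0 hxtop, ENNReal.div_mul_cancel hx0 hxtop]
    _ ≤ (ENNReal.ofReal (η ν) * (B * (relEntropy (s ν) (s (1 - ν)))⁻¹)) * negLog (e ν) := by
        gcongr
    _ = B * (ENNReal.ofReal (η ν) * (negLog (e ν) * (relEntropy (s ν) (s (1 - ν)))⁻¹)) := by ring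
    _ ≤ _ := mul_le_mul_right
      (mul_inv_relEntropy_le_optimalRate (fun ν => negLog (e ν)) ν) B

/-- The upper bound when both relative entropies are finite. -/
theorem eventually_bayesMean_le_of_ne_top (hη : IsPrior η) (hs : s 0 ≠ s 1) (c : Criterion)
    (hD : ∀ ν, relEntropy (s ν) (s (1 - ν)) ≠ ∞) (ℓ₀ : ℕ) {B : ℝ≥0∞} (hB : 1 < B)
    (hBtop : B ≠ ∞) :
    ∀ᶠ e in smallErrors, (⨅ (ℓ : ℕ) (_ : ℓ₀ ≤ ℓ) (K : BlockPOVM d ℓ),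
      (SPRT.mk s η c e (blockSampling K)).bayesMean) ≤
        B * optimalRate s η (fun ν => negLog (e ν)) := by
  -- The two logarithms may diverge at unrelated speeds, and no single `K` need be nearly optimal
  -- for all their ratios. Along an ultrafilter the normalized weights `W e` converge, by
  -- compactness of `[0, ∞]`, and one `K` that is nearly optimal for the limit suffices.
  refine Filter.mem_iff_ultrafilter.mpr fun u hu => ?_
  let X : (Fin 2 → ℝ) → ℝ≥0∞ := fun e => negLog (e 0) + negLog (e 1)
  let W : (Fin 2 → ℝ) → Fin 2 → ℝ≥0∞ := fun e ν => negLog (e ν) / X e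
  have hsmall : ∀ᶠ e in (u : Filter (Fin 2 → ℝ)), SmallEnough c η e :=
    (eventually_smallEnough hη.1).filter_mono hu
  have hX : ∀ e, SmallEnough c η e → X e ≠ 0 ∧ X e ≠ ∞ := fun e he =>
    ⟨fun h0 => he.negLog_ne_zero 0 (add_eq_zero.mp h0).1,
      ENNReal.add_ne_top.mpr ⟨negLog_ne_top _, negLog_ne_top _⟩⟩
  have hlim : ∀ ν, ∃ w, Tendsto (fun e => W e ν) u (𝓝 w) := fun ν =>
    ⟨_, (u.map fun e => W e ν).le_nhds_lim⟩
  choose w hw using hlim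
  have hwsum : w 0 + w 1 = 1 := by
    refine tendsto_nhds_unique ((hw 0).add (hw 1)) (tendsto_const_nhds.congr' ?_)
    filter_upwards [hsmall] with e he
    simp only [W]
    rw [← ENNReal.add_div]
    exact (ENNReal.div_self (hX e he).1 (hX e he).2).symm
  have hwtop : ∀ ν, w ν ≠ ∞ := by
    have := ENNReal.add_ne_top.mp (hwsum.trans_ne ENNReal.one_ne_top)
    intro ν
    fin_cases ν
    · exact this.1
    · exact this.2
  obtain ⟨μ, hμ⟩ : ∃ μ, w μ ≠ 0 := by
    by_contra hcon
    push Not at hcon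
    rw [hcon 0, hcon 1, add_zero] at hwsum
    exact zero_ne_one hwsum
  set g := optimalRate s η w with hg
  have hη0 : ∀ ν, ENNReal.ofReal (η ν) ≠ 0 := fun ν => (ENNReal.ofReal_pos.mpr (hη.1 ν)).ne'
  have hg0 : g ≠ 0 := fun h0 => by
    have := mul_inv_relEntropy_le_optimalRate (s := s) (η := η) w μ
    rw [← hg, h0, nonpos_iff_eq_zero] at this
    exact mul_ne_zero (hη0 μ) (mul_ne_zero hμ (ENNReal.inv_ne_zero.mpr (hD μ))) this
  obtain ⟨K₀, hK₀⟩ := exists_relEntropy_ne_zero hs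
  have hgtop : g ≠ ∞ := ne_top_of_le_ne_top (weightedRate_ne_top hwtop hK₀)
    (optimalRate_le w le_rfl K₀)
  -- The slack `B` is shared: `B * b > 1` is spent on choosing a nearly optimal `K`, and `b < 1` on
  -- replacing the weights `W e` by their limit.
  obtain ⟨b, hb1, hb2⟩ := exists_between (ENNReal.inv_lt_one.mpr hB)
  have hlt : g < B * b * g := by
    conv_lhs => rw [← one_mul g]
    refine ENNReal.mul_lt_mul_left hg0 hgtop ?_
    rw [← ENNReal.mul_inv_cancel (one_pos.trans hB).ne' hBtop]
    exact ENNReal.mul_lt_mul_right (one_pos.trans hB).ne' hBtop hb1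
  obtain ⟨ℓ, h1, h2⟩ := (((tendsto_iInf_weightedRate (s := s) (η := η) w).eventually_lt_const
    hlt).and (eventually_ge_atTop (max ℓ₀ 1))).exists
  obtain ⟨K, hK⟩ := iInf_lt_iff.mp h1
  have hℓ : 1 ≤ ℓ := le_of_max_le_right h2
  have hℓ0 : (ℓ : ℝ≥0∞) ≠ 0 := Nat.cast_ne_zero.mpr (by omega)
  -- The limit of a product with a weight tending to `0` requires finite means. A finite rate
  -- excludes zero relative entropy for the hypothesis `μ` of positive weight. The other one then
  -- cannot vanish either, since both vanish exactly when the two outcome distributions coincide.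
  have hKne : ∀ ν, K.relEntropy (s ν) (s (1 - ν)) ≠ 0 := by
    have hμne : K.relEntropy (s μ) (s (1 - μ)) ≠ 0 := fun h0 => by
      rw [weightedRate, sum_fin_two_eq _ μ, h0, ENNReal.div_zero (mul_ne_zero hℓ0 hμ),
        ENNReal.mul_top (hη0 μ), top_add] at hK
      exact not_top_lt hK
    intro ν
    by_cases hνμ : ν = μ
    · rwa [hνμ]
    · rw [eq_one_sub_of_ne hνμ, one_sub_one_sub]
      intro h0
      rw [BlockPOVM.relEntropy_eq_zero_iff] at h0
      exact hμne (K.relEntropy_eq_zero_iff.mpr h0.symm)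
  have hmean : Tendsto (fun e => ∑ ν, ENNReal.ofReal (η ν) *
      ((SPRT.mk s η c e (blockSampling K)).meanCopies ν / negLog (e ν) * W e ν)) u
      (𝓝 (∑ ν, ENNReal.ofReal (η ν) * (ℓ / K.relEntropy (s ν) (s (1 - ν)) * w ν))) := by
    refine tendsto_finsetSum _ fun ν _ => ENNReal.Tendsto.const_mul (ENNReal.Tendsto.mul
      ((tendsto_meanCopies_blockSampling s c hη.1 ν hℓ K).mono_left hu) (Or.inr (hwtop ν))
      (hw ν) (Or.inr (ENNReal.div_ne_top (ENNReal.natCast_ne_top ℓ) (hKne ν))))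
      (Or.inr ENNReal.ofReal_ne_top)
  have hsum : ∑ ν, ENNReal.ofReal (η ν) * (ℓ / K.relEntropy (s ν) (s (1 - ν)) * w ν) =
      weightedRate s η w K := by
    refine Finset.sum_congr rfl fun ν _ => ?_
    simp only [div_eq_mul_inv]
    ring
  rw [hsum] at hmean
  have hWw : ∀ᶠ e in (u : Filter (Fin 2 → ℝ)), ∀ ν, b * w ν ≤ W e ν := by
    refine eventually_all.mpr fun ν => ?_
    by_cases h0 : w ν = 0
    · refine Eventually.of_forall fun e => ?_
      rw [h0, mul_zero]
      exact zero_le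
    · refine ((hw ν).eventually_const_lt ?_).mono fun e he => he.le
      conv_rhs => rw [← one_mul (w ν)]
      exact ENNReal.mul_lt_mul_left h0 (hwtop ν) hb2
  filter_upwards [hsmall, hWw, hmean.eventually_lt_const hK] with e he h3 h4
  refine (iInf₂_le ℓ (le_of_max_le_left h2)).trans ((iInf_le _ K).trans ?_)
  have h5 : (SPRT.mk s η c e (blockSampling K)).bayesMean =
      X e * ∑ ν, ENNReal.ofReal (η ν) *
      ((SPRT.mk s η c e (blockSampling K)).meanCopies ν / negLog (e ν) * W e ν) := by
    rw [SPRT.bayesMean, Finset.mul_sum]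
    refine Finset.sum_congr rfl fun ν _ => ?_
    have h6 : X e * W e ν = negLog (e ν) := ENNReal.mul_div_cancel (hX e he).1 (hX e he).2
    rw [mul_left_comm, mul_left_comm (X e), h6,
      ENNReal.div_mul_cancel (he.negLog_ne_zero ν) (negLog_ne_top _)]
  rw [h5]
  calc X e * ∑ ν, ENNReal.ofReal (η ν) *
      ((SPRT.mk s η c e (blockSampling K)).meanCopies ν / negLog (e ν) * W e ν)
      ≤ X e * (B * b * g) := mul_le_mul_right h4.le _
    _ = B * ((X e * b) * g) := by ring
    _ ≤ B * optimalRate s η (fun ν => negLog (e ν)) := by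
      refine mul_le_mul_right (mul_optimalRate_le fun ν => ?_) B
      rw [mul_assoc]
      calc X e * (b * w ν) ≤ X e * W e ν := mul_le_mul_right (h3 ν) _
        _ = negLog (e ν) := ENNReal.mul_div_cancel (hX e he).1 (hX e he).2

theorem tendsto_blockRate (e : Fin 2 → ℝ) :
    Tendsto (fun ℓ => blockRate s η e ℓ) atTop (𝓝 (optimalRate s η fun ν => negLog (e ν))) :=
  tendsto_iInf_weightedRate fun ν => negLog (e ν)

theorem tendsto_iInf_bayesMean (hη : IsPrior η) (hs : s 0 ≠ s 1) (c : Criterion)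
    (hD : relEntropy (s 0) (s 1) ≠ ∞ ∨ relEntropy (s 1) (s 0) ≠ ∞) {ℓ₀ : ℕ} (hℓ₀ : 1 ≤ ℓ₀) :
    Tendsto (fun e => (⨅ (ℓ : ℕ) (_ : ℓ₀ ≤ ℓ) (K : BlockPOVM d ℓ),
      (SPRT.mk s η c e (blockSampling K)).bayesMean) / optimalRate s η fun ν => negLog (e ν))
      smallErrors (𝓝 1) := by
  obtain ⟨K₀, hK₀⟩ := exists_relEntropy_ne_zero hs
  have hη0 : ∀ ν, ENNReal.ofReal (η ν) ≠ 0 := fun ν => (ENNReal.ofReal_pos.mpr (hη.1 ν)).ne'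
  have hμ : ∃ μ, relEntropy (s μ) (s (1 - μ)) ≠ ∞ := by
    rcases hD with h | h
    · exact ⟨0, h⟩
    · exact ⟨1, h⟩
  obtain ⟨μ, hμ⟩ := hμ
  refine tendsto_div_one (lo := fun e => min (lowerFactor c η 0 e) (lowerFactor c η 1 e))
    ?_ ?_ ?_ fun B hB hBtop => ?_
  · filter_upwards [eventually_smallEnough (c := c) hη.1] with e he
    refine ⟨fun h0 => ?_, ne_top_of_le_ne_top (weightedRate_ne_top (fun ν => negLog_ne_top _) hK₀)
      (optimalRate_le _ le_rfl K₀)⟩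
    have := mul_inv_relEntropy_le_optimalRate (s := s) (η := η) (fun ν => negLog (e ν)) μ
    rw [h0, nonpos_iff_eq_zero] at this
    exact mul_ne_zero (hη0 μ) (mul_ne_zero (he.negLog_ne_zero μ)
      (ENNReal.inv_ne_zero.mpr hμ)) this
  · have := (tendsto_lowerFactor (c := c) hη.1 0).min (tendsto_lowerFactor (c := c) hη.1 1)
    rwa [min_self] at this
  · filter_upwards [eventually_smallEnough (c := c) hη.1] with e he
    refine le_iInf₂ fun ℓ hℓ => le_iInf fun K => ?_
    exact (mul_le_mul_right (optimalRate_le _ (hℓ₀.trans hℓ) K) _).trans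
      (min_lowerFactor_mul_le hη.1 he (hℓ₀.trans hℓ) K)
  · by_cases hall : ∀ ν, relEntropy (s ν) (s (1 - ν)) ≠ ∞
    · exact eventually_bayesMean_le_of_ne_top hη hs c hall ℓ₀ hB hBtop
    · push Not at hall
      obtain ⟨ν, hν⟩ := hall
      have hνμ : ν ≠ μ := fun h => hμ (h ▸ hν)
      rw [eq_one_sub_of_ne hνμ, one_sub_one_sub] at hν
      exact eventually_bayesMean_le_of_top hη hs c hμ hν ℓ₀ hB

end Bayes

/-! ### Collective spin operators -/

section Collective

variable {ℓ : ℕ}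

theorem siteOp_eq_tensorFamily (i : Fin ℓ) (X : Matrix (Fin 2) (Fin 2) ℂ) :
    siteOp i X = tensorFamily (Function.update (fun _ => 1) i X) := by
  classical
  ext x y
  simp only [siteOp, tensorFamily, Matrix.of_apply]
  rw [← Finset.mul_prod_erase _ _ (Finset.mem_univ i), Function.update_self]
  have h : ∀ j ∈ Finset.univ.erase i,
      (Function.update (fun _ => (1 : Matrix (Fin 2) (Fin 2) ℂ)) i X j) (x j) (y j) =
        if x j = y j then 1 else 0 := fun j hj => by
    rw [Function.update_of_ne (Finset.ne_of_mem_erase hj), Matrix.one_apply]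
  rw [Finset.prod_congr rfl h, Finset.prod_ite_zero, Finset.prod_const_one]
  simp only [Finset.mem_erase, Finset.mem_univ, and_true, mul_ite, mul_one, mul_zero]

theorem siteOp_add (i : Fin ℓ) (X Y : Matrix (Fin 2) (Fin 2) ℂ) :
    siteOp i (X + Y) = siteOp i X + siteOp i Y := by
  ext x y
  simp only [siteOp, Matrix.of_apply, Matrix.add_apply]
  split_ifs <;> simp

theorem siteOp_smul (i : Fin ℓ) (c : ℂ) (X : Matrix (Fin 2) (Fin 2) ℂ) :
    siteOp i (c • X) = c • siteOp i X := by
  ext x y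
  simp only [siteOp, Matrix.of_apply, Matrix.smul_apply]
  split_ifs <;> simp

theorem siteOp_conjTranspose (i : Fin ℓ) (X : Matrix (Fin 2) (Fin 2) ℂ) :
    (siteOp i X)ᴴ = siteOp i Xᴴ := by
  ext x y
  simp only [siteOp, Matrix.of_apply, Matrix.conjTranspose_apply]
  by_cases h : ∀ j, j ≠ i → x j = y j
  · rw [if_pos h, if_pos fun j hj => (h j hj).symm]
  · rw [if_neg h, if_neg fun h' => h fun j hj => (h' j hj).symm, star_zero]

theorem siteOp_mul_self (i : Fin ℓ) (X Y : Matrix (Fin 2) (Fin 2) ℂ) :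
    siteOp i X * siteOp i Y = siteOp i (X * Y) := by
  classical
  simp only [siteOp_eq_tensorFamily, tensorFamily_mul]
  congr 1
  ext1 j
  by_cases h : j = i
  · subst h
    simp
  · simp [h]

theorem siteOp_commute {i j : Fin ℓ} (hij : i ≠ j) (X Y : Matrix (Fin 2) (Fin 2) ℂ) :
    Commute (siteOp i X) (siteOp j Y) := by
  classical
  simp only [Commute, SemiconjBy, siteOp_eq_tensorFamily, tensorFamily_mul]
  congr 1
  ext1 k
  by_cases h : k = i
  · subst h
    simp [hij]
  · simp [h]

theorem tensorPower_mul_siteOp_mul {U V : Matrix (Fin 2) (Fin 2) ℂ} (h : U * V = 1) (i : Fin ℓ)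
    (X : Matrix (Fin 2) (Fin 2) ℂ) :
    tensorPower ℓ U * siteOp i X * tensorPower ℓ V = siteOp i (U * X * V) := by
  classical
  have hpow : ∀ W : Matrix (Fin 2) (Fin 2) ℂ, tensorPower ℓ W = tensorFamily fun _ => W :=
    fun _ => rfl
  simp only [hpow, siteOp_eq_tensorFamily, tensorFamily_mul]
  congr 1
  ext1 k
  by_cases hk : k = i
  · subst hk
    simp
  · simp [hk, h]

/-- The sum over all sites of the operator `X`. -/
def collective (ℓ : ℕ) (X : Matrix (Fin 2) (Fin 2) ℂ) :
    Matrix (Fin ℓ → Fin 2) (Fin ℓ → Fin 2) ℂ := ∑ i, siteOp i X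

theorem collective_add (X Y : Matrix (Fin 2) (Fin 2) ℂ) :
    collective ℓ (X + Y) = collective ℓ X + collective ℓ Y := by
  simp only [collective, siteOp_add, Finset.sum_add_distrib]

theorem collective_smul (c : ℂ) (X : Matrix (Fin 2) (Fin 2) ℂ) :
    collective ℓ (c • X) = c • collective ℓ X := by
  simp only [collective, siteOp_smul, Finset.smul_sum]

theorem collective_sum (c : Fin 3 → ℂ) (X : Fin 3 → Matrix (Fin 2) (Fin 2) ℂ) :
    collective ℓ (∑ a, c a • X a) = ∑ a, c a • collective ℓ (X a) := by
  simp only [Fin.sum_univ_three, collective_add, collective_smul]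

theorem collective_conjTranspose (X : Matrix (Fin 2) (Fin 2) ℂ) :
    (collective ℓ X)ᴴ = collective ℓ Xᴴ := by
  simp only [collective, Matrix.conjTranspose_sum, siteOp_conjTranspose]

/-- Operators at different sites commute, so only equal sites contribute: `collective` preserves
commutators, and spin relations reduce to identities between `2 × 2` matrices. -/
theorem collective_mul_sub (X Y : Matrix (Fin 2) (Fin 2) ℂ) :
    collective ℓ X * collective ℓ Y - collective ℓ Y * collective ℓ X =
      collective ℓ (X * Y - Y * X) := by
  have h1 : ∀ i j : Fin ℓ, siteOp i X * siteOp j Y - siteOp j Y * siteOp i X =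
      if i = j then siteOp i (X * Y - Y * X) else 0 := by
    intro i j
    split_ifs with hij
    · subst hij
      rw [siteOp_mul_self, siteOp_mul_self, sub_eq_add_neg (X * Y), siteOp_add,
        ← neg_one_smul ℂ (Y * X), siteOp_smul, neg_one_smul, sub_eq_add_neg]
    · rw [(siteOp_commute hij X Y).eq, sub_self]
  simp only [collective, Finset.sum_mul_sum]
  rw [Finset.sum_comm (f := fun i j => siteOp i Y * siteOp j X), ← Finset.sum_sub_distrib]
  refine Finset.sum_congr rfl fun i _ => ?_
  rw [← Finset.sum_sub_distrib]
  simp only [h1]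
  simp

theorem tensorPower_mul_collective_mul {U V : Matrix (Fin 2) (Fin 2) ℂ} (h : U * V = 1)
    (X : Matrix (Fin 2) (Fin 2) ℂ) :
    tensorPower ℓ U * collective ℓ X * tensorPower ℓ V = collective ℓ (U * X * V) := by
  simp only [collective, Finset.mul_sum, Finset.sum_mul, tensorPower_mul_siteOp_mul h]

theorem collective_commute_permMatrix (X : Matrix (Fin 2) (Fin 2) ℂ) (π : Equiv.Perm (Fin ℓ)) :
    Commute (collective ℓ X) (permMatrix π) := by
  refine commute_permMatrix_iff.mpr fun x y => ?_
  simp only [collective, Matrix.sum_apply]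
  rw [← Equiv.sum_comp π fun i => siteOp i X x y]
  refine Finset.sum_congr rfl fun i _ => ?_
  have h : (∀ j, j ≠ i → (x ∘ π) j = (y ∘ π) j) ↔ ∀ j, j ≠ π i → x j = y j := by
    constructor
    · intro h j hj
      have := h (π.symm j) fun h' => hj (by rw [← h', Equiv.apply_symm_apply])
      simpa using this
    · exact fun h j hj => h (π j) fun h' => hj (π.injective h')
  simp only [siteOp, Matrix.of_apply]
  by_cases h0 : ∀ j, j ≠ π i → x j = y j
  · rw [if_pos h0, if_pos (h.mpr h0)]
    rfl
  · rw [if_neg h0, if_neg (mt h.mp h0)]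

theorem trace_siteOp_mul_tensorPower {σ : Matrix (Fin 2) (Fin 2) ℂ} (hσ : σ.trace = 1) (i : Fin ℓ)
    (X : Matrix (Fin 2) (Fin 2) ℂ) : (siteOp i X * tensorPower ℓ σ).trace = (X * σ).trace := by
  classical
  have hpow : tensorPower ℓ σ = tensorFamily fun _ => σ := rfl
  rw [hpow, siteOp_eq_tensorFamily, tensorFamily_mul, trace_tensorFamily,
    Finset.prod_eq_single i]
  · simp
  · intro j _ hj
    simp [hj, hσ]
  · simp

theorem trace_siteOp_mul_siteOp_mul_tensorPower {σ : Matrix (Fin 2) (Fin 2) ℂ}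
    (hσ : σ.trace = 1) {i j : Fin ℓ} (hij : i ≠ j) (X Y : Matrix (Fin 2) (Fin 2) ℂ) :
    (siteOp i X * siteOp j Y * tensorPower ℓ σ).trace = (X * σ).trace * (Y * σ).trace := by
  classical
  have hpow : tensorPower ℓ σ = tensorFamily fun _ => σ := rfl
  rw [hpow, siteOp_eq_tensorFamily, siteOp_eq_tensorFamily, tensorFamily_mul, tensorFamily_mul,
    trace_tensorFamily, Finset.prod_eq_mul i j hij]
  · simp [hij, hij.symm]
  · intro k _ hk
    simp [hk.1, hk.2, hσ]
  · simp
  · simp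

theorem trace_collective_mul_tensorPower {σ : Matrix (Fin 2) (Fin 2) ℂ} (hσ : σ.trace = 1)
    (X : Matrix (Fin 2) (Fin 2) ℂ) :
    (collective ℓ X * tensorPower ℓ σ).trace = ℓ * (X * σ).trace := by
  simp only [collective, Finset.sum_mul, Matrix.trace_sum, trace_siteOp_mul_tensorPower hσ]
  simp

/-- In a product state the `ℓ (ℓ - 1)` ordered pairs of distinct sites are uncorrelated. -/
theorem trace_collective_sq_mul_tensorPower {σ : Matrix (Fin 2) (Fin 2) ℂ} (hσ : σ.trace = 1)
    (X : Matrix (Fin 2) (Fin 2) ℂ) :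
    (collective ℓ X * collective ℓ X * tensorPower ℓ σ).trace =
      ℓ * (X * X * σ).trace + ℓ * (ℓ - 1) * (X * σ).trace ^ 2 := by
  have h : ∀ i j : Fin ℓ, (siteOp i X * siteOp j X * tensorPower ℓ σ).trace =
      (X * σ).trace ^ 2 + if i = j then (X * X * σ).trace - (X * σ).trace ^ 2 else 0 := by
    intro i j
    split_ifs with hij
    · rw [hij, siteOp_mul_self, trace_siteOp_mul_tensorPower hσ]
      ring
    · rw [trace_siteOp_mul_siteOp_mul_tensorPower hσ hij]
      ring
  rw [collective, Finset.sum_mul_sum]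
  simp only [Finset.sum_mul, Matrix.trace_sum, h,
    Finset.sum_add_distrib, Finset.sum_ite_eq, Finset.mem_univ, if_true, Finset.sum_const,
    Finset.card_univ, Fintype.card_fin, nsmul_eq_mul]
  ring

end Collective

/-! ### Angular momentum -/

section AngularMomentum

variable {ℓ : ℕ}

theorem angMom_eq (a : Fin 3) : angMom ℓ a = (1 / 2 : ℂ) • collective ℓ (pauli a) := rfl

theorem pauli_conjTranspose (a : Fin 3) : (pauli a)ᴴ = pauli a := by
  fin_cases a <;> ext i j <;> fin_cases i <;> fin_cases j <;>
    simp [pauli, Matrix.conjTranspose_apply]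

theorem angMom_isHermitian (a : Fin 3) : (angMom ℓ a).IsHermitian := by
  rw [Matrix.IsHermitian, angMom_eq, Matrix.conjTranspose_smul, collective_conjTranspose,
    pauli_conjTranspose]
  simp

theorem angMomAlong_eq (v : EuclideanSpace ℝ (Fin 3)) :
    angMomAlong ℓ v = (1 / 2 : ℂ) • collective ℓ (∑ a, (v a : ℂ) • pauli a) := by
  rw [angMomAlong, collective_sum, Finset.smul_sum]
  refine Finset.sum_congr rfl fun a _ => ?_
  rw [angMom_eq, smul_comm]

theorem angMomAlong_isHermitian (v : EuclideanSpace ℝ (Fin 3)) :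
    (angMomAlong ℓ v).IsHermitian := by
  rw [Matrix.IsHermitian, angMomAlong, Matrix.conjTranspose_sum]
  refine Finset.sum_congr rfl fun a _ => ?_
  rw [Matrix.conjTranspose_smul, (angMom_isHermitian a).eq, Complex.star_def, Complex.conj_ofReal]

theorem angMomSq_posSemidef : (angMomSq ℓ).PosSemidef := by
  refine Matrix.posSemidef_sum _ fun a _ => ?_
  nth_rw 1 [← (angMom_isHermitian a).eq]
  exact Matrix.posSemidef_conjTranspose_mul_self _

theorem angMomSq_commute_permMatrix (π : Equiv.Perm (Fin ℓ)) :
    Commute (angMomSq ℓ) (permMatrix π) := by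
  refine Commute.sum_left _ _ _ fun a _ => ?_
  have h : Commute (angMom ℓ a) (permMatrix π) :=
    (collective_commute_permMatrix (pauli a) π).smul_left _
  exact h.mul_left h

theorem angMomAlong_commute_permMatrix (v : EuclideanSpace ℝ (Fin 3)) (π : Equiv.Perm (Fin ℓ)) :
    Commute (angMomAlong ℓ v) (permMatrix π) :=
  Commute.sum_left _ _ _ fun a _ =>
    ((collective_commute_permMatrix (pauli a) π).smul_left _).smul_left _

/-- The raising operator `J₊`. -/
def raising (ℓ : ℕ) : Matrix (Fin ℓ → Fin 2) (Fin ℓ → Fin 2) ℂ := collective ℓ !![0, 1; 0, 0]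

/-- The lowering operator `J₋`. -/
def lowering (ℓ : ℕ) : Matrix (Fin ℓ → Fin 2) (Fin ℓ → Fin 2) ℂ := collective ℓ !![0, 0; 1, 0]

theorem raising_conjTranspose : (raising ℓ)ᴴ = lowering ℓ := by
  rw [raising, collective_conjTranspose, lowering]
  congr 1
  ext i j
  fin_cases i <;> fin_cases j <;> simp [Matrix.conjTranspose_apply]

theorem raising_mul_lowering :
    raising ℓ * lowering ℓ - lowering ℓ * raising ℓ = (2 : ℂ) • angMom ℓ 2 := by
  rw [raising, lowering, collective_mul_sub, angMom_eq, smul_smul]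
  norm_num
  congr 1
  ext i j
  fin_cases i <;> fin_cases j <;> simp [pauli]

theorem angMom_two_mul_raising :
    angMom ℓ 2 * raising ℓ - raising ℓ * angMom ℓ 2 = raising ℓ := by
  rw [angMom_eq, Matrix.smul_mul, Matrix.mul_smul, ← smul_sub, raising, collective_mul_sub,
    ← collective_smul]
  congr 1
  ext i j
  fin_cases i <;> fin_cases j <;> simp [pauli]
  norm_num

theorem angMom_two_mul_lowering :
    angMom ℓ 2 * lowering ℓ - lowering ℓ * angMom ℓ 2 = -lowering ℓ := by
  rw [angMom_eq, Matrix.smul_mul, Matrix.mul_smul, ← smul_sub, lowering, collective_mul_sub,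
    ← collective_smul, ← neg_one_smul ℂ, ← collective_smul]
  congr 1
  ext i j
  fin_cases i <;> fin_cases j <;> simp [pauli]
  norm_num

theorem angMomSq_eq : angMomSq ℓ =
    lowering ℓ * raising ℓ + angMom ℓ 2 + angMom ℓ 2 * angMom ℓ 2 := by
  have h0 : angMom ℓ 0 = (1 / 2 : ℂ) • (raising ℓ + lowering ℓ) := by
    rw [angMom_eq, raising, lowering, ← collective_add]
    congr 2
    ext i j
    fin_cases i <;> fin_cases j <;> simp [pauli]
  have h1 : angMom ℓ 1 = (-Complex.I / 2 : ℂ) • (raising ℓ - lowering ℓ) := by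
    have : raising ℓ - lowering ℓ = collective ℓ (!![0, 1; 0, 0] + (-1 : ℂ) • !![0, 0; 1, 0]) := by
      rw [collective_add, collective_smul, neg_one_smul, ← sub_eq_add_neg]
      rfl
    rw [angMom_eq, this, ← collective_smul, ← collective_smul]
    congr 1
    ext i j
    fin_cases i <;> fin_cases j <;> simp [pauli] <;> ring
  have h2 := raising_mul_lowering (ℓ := ℓ)
  have hJ : angMom ℓ 2 = (1 / 2 : ℂ) • (raising ℓ * lowering ℓ - lowering ℓ * raising ℓ) := by
    rw [h2, smul_smul]
    norm_num
  rw [angMomSq, Fin.sum_univ_three]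
  congr 1
  rw [h0, h1]
  nth_rw 1 [hJ]
  simp only [Matrix.smul_mul, Matrix.mul_smul, smul_smul]
  have hI : (-Complex.I / 2) * (-Complex.I / 2) = -(1 / 4 : ℂ) := by
    ring_nf
    rw [Complex.I_sq]
    norm_num
  rw [hI]
  simp only [mul_add, add_mul, mul_sub, sub_mul, smul_add, smul_sub]
  module

theorem angMomSq_eq' : angMomSq ℓ =
    raising ℓ * lowering ℓ - angMom ℓ 2 + angMom ℓ 2 * angMom ℓ 2 := by
  have h := raising_mul_lowering (ℓ := ℓ)
  rw [sub_eq_iff_eq_add] at h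
  rw [angMomSq_eq, h, two_smul]
  abel

theorem angMomSq_commute_angMom_two : Commute (angMomSq ℓ) (angMom ℓ 2) := by
  have h1 := angMom_two_mul_raising (ℓ := ℓ)
  have h2 := angMom_two_mul_lowering (ℓ := ℓ)
  rw [sub_eq_iff_eq_add] at h1 h2
  have h3 : Commute (lowering ℓ * raising ℓ) (angMom ℓ 2) := by
    rw [Commute, SemiconjBy, ← mul_assoc, h2, add_mul, mul_assoc (lowering ℓ) (angMom ℓ 2), h1]
    noncomm_ring
  rw [angMomSq_eq]
  exact (h3.add_left (Commute.refl _)).add_left ((Commute.refl _).mul_left (Commute.refl _))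

theorem angMomSq_commute_raising : Commute (angMomSq ℓ) (raising ℓ) := by
  have h1 := angMom_two_mul_raising (ℓ := ℓ)
  have h2 := raising_mul_lowering (ℓ := ℓ)
  rw [sub_eq_iff_eq_add] at h1 h2
  set Z := angMom ℓ 2
  set R := raising ℓ
  set L := lowering ℓ
  rw [two_smul] at h2
  have h3 : R * (L * R) = (Z + Z + L * R) * R := by rw [← mul_assoc, h2]
  have h4 : Z * Z * R = R + (R * Z + R * Z) + R * (Z * Z) := by
    rw [mul_assoc, h1, mul_add, h1, ← mul_assoc, h1]
    noncomm_ring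
  rw [Commute, SemiconjBy, angMomSq_eq, mul_add, mul_add, add_mul, add_mul, h3, h4, h1]
  rw [add_mul, add_mul, h1]
  abel

theorem angMomSq_commute_lowering : Commute (angMomSq ℓ) (lowering ℓ) := by
  have h := congrArg Matrix.conjTranspose (angMomSq_commute_raising (ℓ := ℓ)).eq
  rw [Matrix.conjTranspose_mul, Matrix.conjTranspose_mul, raising_conjTranspose,
    angMomSq_posSemidef.1.eq] at h
  exact h.symm

end AngularMomentum

/-! ### Rotations -/

section Rotation

variable {ℓ : ℕ}

/-- With `N` the spin along `v` and `Z = pauli 2`, the matrix `N + Z` has square `2 (1 + v 2)` and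
carries `Z` to `N`. Normalized, it is the half-turn about the bisector of `v` and the third axis. It
degenerates only for `v` opposite to that axis, where `pauli 0` does the same. -/
theorem exists_rotation {v : EuclideanSpace ℝ (Fin 3)} (hv : ‖v‖ = 1) :
    ∃ U : Matrix (Fin 2) (Fin 2) ℂ, Uᴴ * U = 1 ∧ U * Uᴴ = 1 ∧
      U * pauli 2 * Uᴴ = ∑ a, (v a : ℂ) • pauli a := by
  have hsum : v 0 ^ 2 + v 1 ^ 2 + v 2 ^ 2 = 1 := by
    have := EuclideanSpace.real_norm_sq_eq v
    rw [hv, Fin.sum_univ_three] at this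
    linarith
  by_cases hz : v 2 = -1
  · have h0 : v 0 = 0 := by
      rw [hz] at hsum
      nlinarith [sq_nonneg (v 0), sq_nonneg (v 1)]
    have h1 : v 1 = 0 := by
      rw [hz] at hsum
      nlinarith [sq_nonneg (v 0), sq_nonneg (v 1)]
    have hs : pauli 0 * pauli 0 = 1 := by
      ext i j
      fin_cases i <;> fin_cases j <;> simp [pauli]
    refine ⟨pauli 0, ?_, ?_, ?_⟩
    · rw [pauli_conjTranspose, hs]
    · rw [pauli_conjTranspose, hs]
    · rw [pauli_conjTranspose, Fin.sum_univ_three, h0, h1, hz]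
      ext i j
      fin_cases i <;> fin_cases j <;> simp [pauli]
  · have hpos : 0 < 2 * (1 + v 2) := by
      have : -1 ≤ v 2 := by nlinarith [sq_nonneg (v 0), sq_nonneg (v 1)]
      have : -1 < v 2 := lt_of_le_of_ne this (Ne.symm hz)
      linarith
    have hc : (v 0 : ℂ) ^ 2 + (v 1 : ℂ) ^ 2 + (v 2 : ℂ) ^ 2 = 1 := by
      rw [← Complex.ofReal_one, ← hsum]
      push_cast
      rfl
    have hI : Complex.I ^ 2 = -1 := Complex.I_sq
    set N := ∑ a, (v a : ℂ) • pauli a with hN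
    have hNe : N = !![(v 2 : ℂ), v 0 - v 1 * Complex.I; v 0 + v 1 * Complex.I, -(v 2 : ℂ)] := by
      rw [hN, Fin.sum_univ_three]
      ext i j
      fin_cases i <;> fin_cases j <;> simp [pauli] <;> ring
    set H := N + pauli 2 with hH
    have hHe : H = !![(v 2 : ℂ) + 1, v 0 - v 1 * Complex.I;
        v 0 + v 1 * Complex.I, -(v 2 : ℂ) - 1] := by
      rw [hH, hNe]
      ext i j
      fin_cases i <;> fin_cases j <;> simp [pauli] <;> ring
    have hHH : H * H = ((2 * (1 + v 2) : ℝ) : ℂ) • 1 := by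
      rw [hHe]
      ext i j
      fin_cases i <;> fin_cases j <;> simp
      · linear_combination hc - (v 1 : ℂ) ^ 2 * hI
      · ring
      · ring
      · linear_combination hc - (v 1 : ℂ) ^ 2 * hI
    have hHZ : H * pauli 2 * H = ((2 * (1 + v 2) : ℝ) : ℂ) • N := by
      rw [hHe, hNe]
      ext i j
      fin_cases i <;> fin_cases j <;> simp [pauli]
      · linear_combination -hc + (v 1 : ℂ) ^ 2 * hI
      · ring
      · ring
      · linear_combination hc - (v 1 : ℂ) ^ 2 * hI
    have hHh : Hᴴ = H := by
      rw [hHe]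
      ext i j
      fin_cases i <;> fin_cases j <;> simp [Matrix.conjTranspose_apply] <;> ring
    set c : ℝ := (Real.sqrt (2 * (1 + v 2)))⁻¹ with hcdef
    have hcc : ((c : ℂ) * c) * ((2 * (1 + v 2) : ℝ) : ℂ) = 1 := by
      rw [← Complex.ofReal_mul, ← Complex.ofReal_mul, ← Complex.ofReal_one]
      congr 1
      rw [hcdef, ← mul_inv, Real.mul_self_sqrt hpos.le]
      exact inv_mul_cancel₀ hpos.ne'
    have hUh : ((c : ℂ) • H)ᴴ = (c : ℂ) • H := by
      rw [Matrix.conjTranspose_smul, hHh, Complex.star_def, Complex.conj_ofReal]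
    have hUU : ((c : ℂ) • H) * ((c : ℂ) • H) = 1 := by
      rw [Matrix.smul_mul, Matrix.mul_smul, hHH, smul_smul, smul_smul, hcc, one_smul]
    refine ⟨(c : ℂ) • H, ?_, ?_, ?_⟩
    · rw [hUh, hUU]
    · rw [hUh, hUU]
    · rw [hUh, Matrix.smul_mul, Matrix.mul_smul, Matrix.smul_mul, hHZ, smul_smul, smul_smul, hcc,
        one_smul]

theorem trace_pauli_mul_pauli (a b : Fin 3) :
    (pauli a * pauli b).trace = if a = b then 2 else 0 := by
  fin_cases a <;> fin_cases b <;> simp [pauli, Matrix.trace_fin_two] <;> norm_num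

theorem eq_sum_pauli {X : Matrix (Fin 2) (Fin 2) ℂ} (hX : X.trace = 0) :
    X = ∑ b, (1 / 2 * (pauli b * X).trace) • pauli b := by
  rw [Matrix.trace_fin_two] at hX
  rw [Fin.sum_univ_three]
  have hI : Complex.I ^ 2 = -1 := Complex.I_sq
  ext i j
  fin_cases i <;> fin_cases j <;> simp [pauli, Matrix.trace_fin_two,
    Matrix.vecMul, dotProduct, Fin.sum_univ_two]
  · linear_combination (1 / 2) * hX
  · linear_combination (1 / 2 * X 0 1 - 1 / 2 * X 1 0) * hI
  · linear_combination (1 / 2 * X 1 0 - 1 / 2 * X 0 1) * hI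
  · linear_combination (1 / 2) * hX

theorem tensorPower_mul_mul_mul {U : Matrix (Fin 2) (Fin 2) ℂ} (hU : Uᴴ * U = 1)
    (X Y : Matrix (Fin ℓ → Fin 2) (Fin ℓ → Fin 2) ℂ) :
    tensorPower ℓ U * (X * Y) * tensorPower ℓ Uᴴ =
      (tensorPower ℓ U * X * tensorPower ℓ Uᴴ) * (tensorPower ℓ U * Y * tensorPower ℓ Uᴴ) := by
  have h : tensorPower ℓ Uᴴ * tensorPower ℓ U = 1 := by
    rw [← tensorPower_mul, hU, tensorPower_one]
  calc tensorPower ℓ U * (X * Y) * tensorPower ℓ Uᴴ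
      = tensorPower ℓ U * X * 1 * Y * tensorPower ℓ Uᴴ := by
        rw [mul_one]
        simp only [mul_assoc]
    _ = _ := by
      rw [← h]
      simp only [mul_assoc]

/-- The total angular momentum is invariant under rotations. -/
theorem angMomSq_invariant {U : Matrix (Fin 2) (Fin 2) ℂ} (hU : Uᴴ * U = 1) :
    tensorPower ℓ U * angMomSq ℓ * tensorPower ℓ Uᴴ = angMomSq ℓ := by
  have hU' : U * Uᴴ = 1 := mul_eq_one_comm.mp hU
  have htr : ∀ a, (U * pauli a * Uᴴ).trace = 0 := fun a => by
    rw [Matrix.trace_mul_comm, ← mul_assoc, hU, one_mul]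
    fin_cases a <;> simp [pauli, Matrix.trace_fin_two]
  obtain ⟨R, hexp⟩ : ∃ R : Fin 3 → Fin 3 → ℂ,
      ∀ a, U * pauli a * Uᴴ = ∑ b, R a b • pauli b :=
    ⟨fun a b => 1 / 2 * (pauli b * (U * pauli a * Uᴴ)).trace,
      fun a => eq_sum_pauli (htr a)⟩
  -- Conjugation preserves the traces of products of Pauli matrices, so the coefficients `R` form an
  -- orthogonal matrix, and the sum of squares `J²` does not change.
  have hRR : Matrix.of R * (Matrix.of R)ᵀ = 1 := by
    ext a c
    have h1 : ((U * pauli a * Uᴴ) * (U * pauli c * Uᴴ)).trace = if a = c then 2 else 0 := by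
      rw [← trace_pauli_mul_pauli]
      calc ((U * pauli a * Uᴴ) * (U * pauli c * Uᴴ)).trace
          = (U * (pauli a * (Uᴴ * U) * pauli c) * Uᴴ).trace := by simp only [mul_assoc]
        _ = _ := by
          rw [hU, mul_one, Matrix.trace_mul_comm, ← mul_assoc, hU, one_mul]
    rw [hexp a, hexp c, Finset.sum_mul_sum, Matrix.trace_sum] at h1
    have h2 : ∀ i, (∑ j, R a i • pauli i * R c j • pauli j).trace = 2 * (R a i * R c i) := by
      intro i
      simp only [Matrix.trace_sum, Matrix.smul_mul, Matrix.mul_smul, Matrix.trace_smul,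
        trace_pauli_mul_pauli, smul_eq_mul, mul_ite, mul_zero, Finset.sum_ite_eq,
        Finset.mem_univ, if_true]
      ring
    simp only [h2] at h1
    rw [← Finset.mul_sum] at h1
    rw [Matrix.mul_apply, Matrix.one_apply]
    simp only [Matrix.transpose_apply, Matrix.of_apply]
    split_ifs at h1 ⊢ with h
    · linear_combination (1 / 2) * h1
    · linear_combination (1 / 2) * h1
  have hRR' : (Matrix.of R)ᵀ * Matrix.of R = 1 := mul_eq_one_comm.mp hRR
  have hJ : ∀ a, tensorPower ℓ U * angMom ℓ a * tensorPower ℓ Uᴴ = ∑ b, R a b • angMom ℓ b := by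
    intro a
    rw [angMom_eq, Matrix.mul_smul, Matrix.smul_mul, tensorPower_mul_collective_mul hU', hexp,
      collective_sum, Finset.smul_sum]
    refine Finset.sum_congr rfl fun b _ => ?_
    rw [angMom_eq, smul_comm]
  have hJJ : ∀ a, tensorPower ℓ U * (angMom ℓ a * angMom ℓ a) * tensorPower ℓ Uᴴ =
      ∑ b, ∑ c, (R a b * R a c) • (angMom ℓ b * angMom ℓ c) := by
    intro a
    rw [tensorPower_mul_mul_mul hU, hJ, Finset.sum_mul_sum]
    refine Finset.sum_congr rfl fun b _ => Finset.sum_congr rfl fun c _ => ?_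
    rw [Matrix.smul_mul, Matrix.mul_smul, smul_smul]
  rw [angMomSq, Finset.mul_sum, Finset.sum_mul, Finset.sum_congr rfl fun a _ => hJJ a,
    Finset.sum_comm]
  refine Finset.sum_congr rfl fun b _ => ?_
  rw [Finset.sum_comm]
  have h : ∀ c, ∑ a, (R a b * R a c) • (angMom ℓ b * angMom ℓ c) =
      if b = c then angMom ℓ b * angMom ℓ c else 0 := by
    intro c
    rw [← Finset.sum_smul]
    have h1 := congrFun (congrFun hRR' b) c
    rw [Matrix.mul_apply, Matrix.one_apply] at h1
    simp only [Matrix.transpose_apply, Matrix.of_apply] at h1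
    rw [h1]
    split_ifs <;> simp
  simp only [h, Finset.sum_ite_eq, Finset.mem_univ, if_true]

theorem angMom_two_conj {U : Matrix (Fin 2) (Fin 2) ℂ} {v : EuclideanSpace ℝ (Fin 3)}
    (hU : U * Uᴴ = 1) (hv : U * pauli 2 * Uᴴ = ∑ a, (v a : ℂ) • pauli a) :
    tensorPower ℓ U * angMom ℓ 2 * tensorPower ℓ Uᴴ = angMomAlong ℓ v := by
  rw [angMom_eq, Matrix.mul_smul, Matrix.smul_mul, tensorPower_mul_collective_mul hU, hv,
    angMomAlong_eq]

theorem angMomSq_commute_angMomAlong {v : EuclideanSpace ℝ (Fin 3)} (hv : ‖v‖ = 1) :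
    Commute (angMomSq ℓ) (angMomAlong ℓ v) := by
  obtain ⟨U, hU, hU', hv⟩ := exists_rotation hv
  have h := congrArg (fun X => tensorPower ℓ U * X * tensorPower ℓ Uᴴ)
    (angMomSq_commute_angMom_two (ℓ := ℓ)).eq
  simp only [tensorPower_mul_mul_mul hU, angMomSq_invariant hU, angMom_two_conj hU' hv] at h
  exact h

end Rotation

/-! ### Joint spectral measurements -/

section JointSpectral

variable {ι : Type*} [Fintype ι] [DecidableEq ι]

/-- The spectral projectors of a Hermitian matrix. -/
theorem exists_spectralProjectors {A : Matrix ι ι ℂ} (hA : A.IsHermitian) :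
    ∃ (Λ : Finset ℝ) (P : ℝ → Matrix ι ι ℂ), (∀ x ∈ Λ, ∃ i, hA.eigenvalues i = x) ∧
      (∀ x, (P x).IsHermitian) ∧ (∀ x, P x * P x = P x) ∧ (∀ x y, x ≠ y → P x * P y = 0) ∧
      (∀ X, Commute A X → ∀ x, Commute (P x) X) ∧ ∑ x ∈ Λ, P x = 1 ∧
      ∀ x ∈ Λ, ∀ w, P x *ᵥ w = w ↔ A *ᵥ w = (x : ℂ) • w := by
  classical
  let U : Matrix ι ι ℂ := hA.eigenvectorUnitary
  let a := hA.eigenvalues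
  have hs : IsSpectral A U a := ⟨Unitary.coe_star_mul_self hA.eigenvectorUnitary,
    Unitary.coe_mul_star_self hA.eigenvectorUnitary, hA.spectral_theorem⟩
  let g : ℝ → ℝ → ℝ := fun x t => if t = x then 1 else 0
  have hcfc : ∀ x, cfc (g x) A = U * Matrix.diagonal (fun i => (g x (a i) : ℂ)) * Uᴴ := by
    intro x
    rw [hA.cfc_eq]
    rfl
  have hAP : ∀ x, A * cfc (g x) A = (x : ℂ) • cfc (g x) A := by
    intro x
    have h := hs.conj_mul_conj (fun i => (a i : ℂ)) fun i => (g x (a i) : ℂ)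
    rw [← hs.eq] at h
    rw [hcfc, h, ← Matrix.smul_mul, ← Matrix.mul_smul, ← Matrix.diagonal_smul]
    congr 3
    ext i
    simp only [g, Pi.smul_apply, smul_eq_mul]
    split_ifs with hi
    · rw [hi]
    · simp
  have hsum : ∑ x ∈ Finset.univ.image a, cfc (g x) A = 1 := by
    have h : ∑ x ∈ Finset.univ.image a, Matrix.diagonal (fun i => (g x (a i) : ℂ)) = 1 := by
      ext i j
      rw [Matrix.sum_apply]
      by_cases hij : i = j
      · subst hij
        simp only [Matrix.diagonal_apply_eq, Matrix.one_apply_eq, g]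
        rw [Finset.sum_eq_single (a i)]
        · simp
        · intro x _ hx
          simp [Ne.symm hx]
        · intro hx
          exact absurd (Finset.mem_image_of_mem a (Finset.mem_univ i)) hx
      · simp [hij]
    simp only [hcfc]
    rw [← Finset.sum_mul, ← Finset.mul_sum, h, mul_one, hs.right]
  have hcomm : ∀ X, Commute A X → ∀ x, Commute (cfc (g x) A) X := fun X hX x =>
    IsSelfAdjoint.commute_cfc hA.isSelfAdjoint hX (g x)
  refine ⟨Finset.univ.image a, fun x => cfc (g x) A, fun x hx => ?_, fun x => ?_, fun x => ?_,
    fun x y hxy => ?_, hcomm, hsum, fun x hx w => ⟨fun h => ?_, fun h => ?_⟩⟩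
  · obtain ⟨i, -, hi⟩ := Finset.mem_image.mp hx
    exact ⟨i, hi⟩
  · beta_reduce
    rw [hcfc]
    refine (posSemidef_conj_diagonal U (f := fun i => g x (a i)) fun i => ?_).1
    simp only [g]
    split_ifs <;> norm_num
  · beta_reduce
    rw [hcfc, hs.conj_mul_conj]
    congr 3
    ext i
    simp only [g]
    split_ifs <;> simp
  · simp only [hcfc]
    rw [hs.conj_mul_conj]
    have : (fun i => (g x (a i) : ℂ) * (g y (a i) : ℂ)) = fun _ => 0 := by
      ext i
      simp only [g]
      split_ifs with h1 h2
      · exact absurd (h1.symm.trans h2) hxy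
      all_goals simp
    rw [this]
    simp
  · rw [← h, Matrix.mulVec_mulVec, hAP, Matrix.smul_mulVec]
  · have h1 : ∀ y, y ≠ x → cfc (g y) A *ᵥ w = 0 := by
      intro y hy
      have h2 : (y : ℂ) • (cfc (g y) A *ᵥ w) = (x : ℂ) • (cfc (g y) A *ᵥ w) := by
        rw [← Matrix.smul_mulVec, ← hAP, (hcomm A (Commute.refl A) y).symm.eq,
          ← Matrix.mulVec_mulVec, h, Matrix.mulVec_smul]
      rw [← sub_eq_zero, ← sub_smul] at h2
      exact (smul_eq_zero.mp h2).resolve_left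
        (sub_ne_zero.mpr fun h => hy (Complex.ofReal_injective h))
    calc cfc (g x) A *ᵥ w = ∑ y ∈ Finset.univ.image a, cfc (g y) A *ᵥ w :=
          (Finset.sum_eq_single_of_mem x hx fun y _ hy => h1 y hy).symm
      _ = w := by rw [← Matrix.sum_mulVec, hsum, Matrix.one_mulVec]

/-- The projectors are the nonzero products of spectral projectors of `A` and `B`. Each is a
function of `A` or `B`, so it commutes with everything that both matrices commute with. -/
theorem exists_jointSpectral {S : Set (Matrix ι ι ℂ)} {A B : Matrix ι ι ℂ} (hA : A.PosSemidef)
    (hB : B.IsHermitian) (hAB : Commute A B) (hSA : ∀ X ∈ S, Commute A X)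
    (hSB : ∀ X ∈ S, Commute B X) :
    ∃ (n : ℕ) (E : Fin n → Matrix ι ι ℂ) (a b : Fin n → ℝ), IsResolution S E ∧
      (∀ k, 0 ≤ a k) ∧ Function.Injective (fun k => (a k, b k)) ∧
      ∀ k w, E k *ᵥ w = w ↔ A *ᵥ w = (a k : ℂ) • w ∧ B *ᵥ w = (b k : ℂ) • w := by
  classical
  obtain ⟨Λ, P, hΛ, hP, hPP, hPne, hPc, hPsum, hPw⟩ := exists_spectralProjectors hA.1
  obtain ⟨Μ, Q, -, hQ, hQQ, hQne, hQc, hQsum, hQw⟩ := exists_spectralProjectors hB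
  have hPQ : ∀ x y, Commute (P x) (Q y) := fun x y => hPc _ (hQc A hAB.symm y).symm x
  let T := (Λ ×ˢ Μ).filter fun z => P z.1 * Q z.2 ≠ 0
  let z : Fin T.card → ℝ × ℝ := fun k => (T.equivFin.symm k).1
  have hzT : ∀ k, z k ∈ T := fun k => (T.equivFin.symm k).2
  have hz : ∀ k, (z k).1 ∈ Λ ∧ (z k).2 ∈ Μ ∧ P (z k).1 * Q (z k).2 ≠ 0 := fun k => by
    have := Finset.mem_filter.mp (hzT k)
    exact ⟨(Finset.mem_product.mp this.1).1, (Finset.mem_product.mp this.1).2, this.2⟩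
  have hzinj : Function.Injective z :=
    Subtype.val_injective.comp T.equivFin.symm.injective
  refine ⟨T.card, fun k => P (z k).1 * Q (z k).2, fun k => (z k).1, fun k => (z k).2,
    ⟨fun k => ?_, fun k => ?_, fun k => (hz k).2.2, fun k X hX => ?_, fun i j hij => ?_, ?_⟩,
    fun k => ?_, hzinj, fun k w => ⟨fun h => ?_, fun h => ?_⟩⟩
  · rw [Matrix.IsHermitian, Matrix.conjTranspose_mul, (hP _).eq, (hQ _).eq, (hPQ _ _).eq]
  · rw [mul_assoc, ← mul_assoc (Q _), ← (hPQ _ _).eq, mul_assoc, hQQ, ← mul_assoc, hPP]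
  · exact (hPc X (hSA X hX) _).mul_left (hQc X (hSB X hX) _)
  · rw [mul_assoc, ← mul_assoc (Q _), ← (hPQ _ _).eq, mul_assoc (P _) (Q _), ← mul_assoc]
    by_cases h1 : (z i).1 = (z j).1
    · have h2 : (z i).2 ≠ (z j).2 := fun h2 => hij (hzinj (Prod.ext h1 h2))
      rw [hQne _ _ h2, mul_zero]
    · rw [hPne _ _ h1, zero_mul]
  · calc ∑ k, P (z k).1 * Q (z k).2 = ∑ t : T, P t.1.1 * Q t.1.2 :=
          T.equivFin.symm.sum_comp fun t : T => P t.1.1 * Q t.1.2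
      _ = ∑ t ∈ T, P t.1 * Q t.2 := Finset.sum_coe_sort T fun t => P t.1 * Q t.2
      _ = ∑ t ∈ Λ ×ˢ Μ, P t.1 * Q t.2 := Finset.sum_filter_ne_zero _
      _ = 1 := by rw [Finset.sum_product, ← Finset.sum_mul_sum, hPsum, hQsum, one_mul]
  · obtain ⟨i, hi⟩ := hΛ _ (hz k).1
    change 0 ≤ (z k).1
    rw [← hi]
    exact hA.eigenvalues_nonneg i
  · have h1 : P (z k).1 *ᵥ w = w := by
      rw [← h, Matrix.mulVec_mulVec, ← mul_assoc, hPP]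
    have h2 : Q (z k).2 *ᵥ w = w := by
      rw [← h, Matrix.mulVec_mulVec, ← mul_assoc, ← (hPQ _ _).eq, mul_assoc, hQQ]
    exact ⟨(hPw _ (hz k).1 w).mp h1, (hQw _ (hz k).2.1 w).mp h2⟩
  · rw [← Matrix.mulVec_mulVec, (hQw _ (hz k).2.1 w).mpr h.2, (hPw _ (hz k).1 w).mpr h.1]

end JointSpectral

/-- Properties of the simultaneous measurement of `J²` and of the component of `J` along `v`. -/
structure IsSpinMeasurement {ℓ : ℕ} (v : EuclideanSpace ℝ (Fin 3)) (K : BlockPOVM 2 ℓ)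
    (j m : Fin K.outcomes → ℝ) : Prop where
  nonneg : ∀ x, 0 ≤ j x
  injective : Function.Injective fun x => (j x, m x)
  mul_self : ∀ x, K.effect x * K.effect x = K.effect x
  ne_zero : ∀ x, K.effect x ≠ 0
  mulVec_iff : ∀ x w, K.effect x *ᵥ w = w ↔
    angMomSq ℓ *ᵥ w = ((j x * (j x + 1) : ℝ) : ℂ) • w ∧ angMomAlong ℓ v *ᵥ w = (m x : ℂ) • w
  outcomes_le : K.outcomes ≤ (ℓ + 1) ^ 4

theorem exists_isSpinMeasurement {v : EuclideanSpace ℝ (Fin 3)} (hv : ‖v‖ = 1) (ℓ : ℕ) :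
    ∃ (K : BlockPOVM 2 ℓ) (j m : Fin K.outcomes → ℝ), IsSpinMeasurement v K j m := by
  obtain ⟨n, E, a, m, hE, ha, hinj, hiff⟩ := exists_jointSpectral
    (S := Set.range (permMatrix (d := 2) (ℓ := ℓ))) (angMomSq_posSemidef (ℓ := ℓ))
    (angMomAlong_isHermitian v) (angMomSq_commute_angMomAlong hv)
    (by
      rintro _ ⟨π, rfl⟩
      exact angMomSq_commute_permMatrix π)
    (by
      rintro _ ⟨π, rfl⟩
      exact angMomAlong_commute_permMatrix v π)
  have hpos : ∀ k, (E k).PosSemidef := fun k => by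
    rw [← hE.mul_self k]
    nth_rw 1 [← (hE.isHermitian k).eq]
    exact Matrix.posSemidef_conjTranspose_mul_self _
  -- The nonnegative root of `j (j + 1) = a k`.
  let j : Fin n → ℝ := fun k => (Real.sqrt (1 + 4 * a k) - 1) / 2
  have hja : ∀ k, j k * (j k + 1) = a k := fun k => by
    have := Real.mul_self_sqrt (by linarith [ha k] : 0 ≤ 1 + 4 * a k)
    simp only [j]
    nlinarith
  refine ⟨⟨n, E, hpos, hE.sum_eq_one⟩, j, m, ⟨fun k => ?_, fun k l h => ?_, hE.mul_self,
    hE.ne_zero, fun k w => ?_, ?_⟩⟩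
  · have : 1 ≤ Real.sqrt (1 + 4 * a k) := Real.one_le_sqrt.mpr (by linarith [ha k])
    simp only [j]
    linarith
  · simp only [Prod.mk.injEq] at h
    exact hinj (Prod.ext (show a k = a l by rw [← hja k, ← hja l, h.1]) h.2)
  · rw [hja]
    exact hiff k w
  · exact card_le_of_linearIndependent_of_commute hE.linearIndependent fun k π =>
      hE.commute k _ ⟨π, rfl⟩

namespace IsSpinMeasurement

variable {ℓ : ℕ} {v : EuclideanSpace ℝ (Fin 3)} {K : BlockPOVM 2 ℓ} {j m : Fin K.outcomes → ℝ}

theorem isAngMomMeasurement (h : IsSpinMeasurement v K j m) : IsAngMomMeasurement v K :=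
  ⟨j, m, h.nonneg, h.injective, fun x => ⟨h.mul_self x, h.mulVec_iff x⟩⟩

theorem angMomSq_mul (h : IsSpinMeasurement v K j m) (x : Fin K.outcomes) :
    angMomSq ℓ * K.effect x = ((j x * (j x + 1) : ℝ) : ℂ) • K.effect x := by
  refine Matrix.mulVec_injective (funext fun w => ?_)
  have h1 : K.effect x *ᵥ (K.effect x *ᵥ w) = K.effect x *ᵥ w := by
    rw [Matrix.mulVec_mulVec, h.mul_self]
  rw [← Matrix.mulVec_mulVec, Matrix.smul_mulVec]
  exact ((h.mulVec_iff x _).mp h1).1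

theorem angMomAlong_mul (h : IsSpinMeasurement v K j m) (x : Fin K.outcomes) :
    angMomAlong ℓ v * K.effect x = (m x : ℂ) • K.effect x := by
  refine Matrix.mulVec_injective (funext fun w => ?_)
  have h1 : K.effect x *ᵥ (K.effect x *ᵥ w) = K.effect x *ᵥ w := by
    rw [Matrix.mulVec_mulVec, h.mul_self]
  rw [← Matrix.mulVec_mulVec, Matrix.smul_mulVec]
  exact ((h.mulVec_iff x _).mp h1).2

end IsSpinMeasurement

/-! ### Ladders of weights -/

section Ladder

variable {ℓ : ℕ}

/-- The number of spins up. -/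
def upCount (x : Fin ℓ → Fin 2) : ℕ := (Finset.univ.filter fun i => x i = 0).card

theorem upCount_le (x : Fin ℓ → Fin 2) : upCount x ≤ ℓ :=
  (Finset.card_le_univ _).trans_eq (Fintype.card_fin ℓ)

theorem prod_eq_upCount {R : Type*} [CommMonoid R] (f : Fin 2 → R) (x : Fin ℓ → Fin 2) :
    ∏ i, f (x i) = f 0 ^ upCount x * f 1 ^ (ℓ - upCount x) := by
  classical
  have h : ∀ i, f (x i) = if x i = 0 then f 0 else f 1 := fun i => by
    split_ifs with h
    · rw [h]
    · rw [Fin.eq_one_of_ne_zero _ h]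
  rw [Finset.prod_congr rfl fun i _ => h i, Finset.prod_ite, Finset.prod_const, Finset.prod_const,
    upCount]
  congr 2
  rw [Finset.filter_not, Finset.card_sdiff_of_subset (Finset.filter_subset _ _), Finset.card_univ,
    Fintype.card_fin]

theorem siteOp_diagonal (i : Fin ℓ) (f : Fin 2 → ℂ) :
    siteOp i (Matrix.diagonal f) = Matrix.diagonal fun x => f (x i) := by
  ext x y
  simp only [siteOp, Matrix.of_apply, Matrix.diagonal_apply]
  by_cases h : x = y
  · subst h
    simp
  · rw [if_neg h]
    split_ifs with h1 h2
    · refine absurd (funext fun j => ?_) h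
      by_cases hj : j = i
      · rw [hj, h2]
      · exact h1 j hj
    · rfl
    · rfl

theorem angMom_two_eq_diagonal :
    angMom ℓ 2 = Matrix.diagonal fun x => (((upCount x : ℝ) - ℓ / 2 : ℝ) : ℂ) := by
  classical
  have hp : pauli 2 = Matrix.diagonal ![1, -1] := by
    ext i j
    fin_cases i <;> fin_cases j <;> simp [pauli]
  rw [angMom_eq, collective, hp]
  simp only [siteOp_diagonal]
  ext x y
  rw [Matrix.smul_apply, Matrix.sum_apply]
  by_cases h : x = y
  · subst h
    simp only [Matrix.diagonal_apply_eq]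
    have h1 : ∀ i, (![1, -1] : Fin 2 → ℂ) (x i) = 2 * (if x i = 0 then 1 else 0) - 1 := by
      intro i
      generalize x i = a
      fin_cases a <;> norm_num
    simp only [h1, Finset.sum_sub_distrib, ← Finset.mul_sum, Finset.sum_boole, upCount]
    simp
    ring
  · simp [h]

variable {Y : Matrix (Fin ℓ → Fin 2) (Fin ℓ → Fin 2) ℂ} {μ : ℝ} {l : ℂ}

theorem upCount_of_ne_zero (hY : angMom ℓ 2 * Y = (μ : ℂ) • Y) {x y : Fin ℓ → Fin 2}
    (hxy : Y x y ≠ 0) : μ = upCount x - ℓ / 2 := by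
  have h := congrFun (congrFun hY x) y
  rw [angMom_two_eq_diagonal, Matrix.diagonal_mul, Matrix.smul_apply, smul_eq_mul] at h
  exact_mod_cast (mul_right_cancel₀ hxy h).symm

theorem exists_upCount_eq (hY : angMom ℓ 2 * Y = (μ : ℂ) • Y) (h : Y ≠ 0) :
    ∃ p : ℕ, p ≤ ℓ ∧ μ = p - ℓ / 2 := by
  by_contra hne
  refine h (Matrix.ext fun x y => ?_)
  by_contra hxy
  exact hne ⟨upCount x, upCount_le x, upCount_of_ne_zero hY hxy⟩

theorem diagonal_tensorPower_mul {p q : ℕ} (hpq : p + q = ℓ)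
    (hY : angMom ℓ 2 * Y = (((p : ℝ) - ℓ / 2 : ℝ) : ℂ) • Y) (f : Fin 2 → ℂ) :
    tensorPower ℓ (Matrix.diagonal f) * Y = (f 0 ^ p * f 1 ^ q) • Y := by
  ext x y
  rw [tensorPower_diagonal, Matrix.diagonal_mul, Matrix.smul_apply, smul_eq_mul]
  by_cases hxy : Y x y = 0
  · rw [hxy, mul_zero, mul_zero]
  · have h : p = upCount x := by
      have := upCount_of_ne_zero hY hxy
      have h' : (p : ℝ) = upCount x := by linarith
      exact_mod_cast h'
    rw [prod_eq_upCount, ← h, show ℓ - p = q by omega]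

theorem angMom_two_mul_raising_mul (hY : angMom ℓ 2 * Y = (μ : ℂ) • Y) :
    angMom ℓ 2 * (raising ℓ * Y) = ((μ + 1 : ℝ) : ℂ) • (raising ℓ * Y) := by
  rw [← mul_assoc, sub_eq_iff_eq_add.mp (angMom_two_mul_raising (ℓ := ℓ)), add_mul, mul_assoc, hY,
    Matrix.mul_smul]
  push_cast
  rw [add_smul, one_smul, add_comm]

theorem angMom_two_mul_lowering_mul (hY : angMom ℓ 2 * Y = (μ : ℂ) • Y) :
    angMom ℓ 2 * (lowering ℓ * Y) = ((μ - 1 : ℝ) : ℂ) • (lowering ℓ * Y) := by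
  rw [← mul_assoc, sub_eq_iff_eq_add.mp (angMom_two_mul_lowering (ℓ := ℓ)), add_mul, mul_assoc, hY,
    Matrix.mul_smul, neg_mul]
  push_cast
  rw [sub_smul, one_smul]
  abel

theorem angMom_two_mul_raising_pow_mul (hY : angMom ℓ 2 * Y = (μ : ℂ) • Y) (k : ℕ) :
    angMom ℓ 2 * (raising ℓ ^ k * Y) = ((μ + k : ℝ) : ℂ) • (raising ℓ ^ k * Y) := by
  induction k with
  | zero => simpa using hY
  | succ k ih =>
    rw [pow_succ', mul_assoc, angMom_two_mul_raising_mul ih]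
    push_cast
    rw [add_assoc]

theorem angMom_two_mul_lowering_pow_mul (hY : angMom ℓ 2 * Y = (μ : ℂ) • Y) (k : ℕ) :
    angMom ℓ 2 * (lowering ℓ ^ k * Y) = ((μ - k : ℝ) : ℂ) • (lowering ℓ ^ k * Y) := by
  induction k with
  | zero => simpa using hY
  | succ k ih =>
    rw [pow_succ', mul_assoc, angMom_two_mul_lowering_mul ih]
    push_cast
    rw [sub_sub]

theorem angMomSq_mul_raising_pow_mul (hY : angMomSq ℓ * Y = l • Y) (k : ℕ) :
    angMomSq ℓ * (raising ℓ ^ k * Y) = l • (raising ℓ ^ k * Y) := by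
  rw [← mul_assoc, (angMomSq_commute_raising.pow_right k).eq, mul_assoc, hY, Matrix.mul_smul]

theorem angMomSq_mul_lowering_pow_mul (hY : angMomSq ℓ * Y = l • Y) (k : ℕ) :
    angMomSq ℓ * (lowering ℓ ^ k * Y) = l • (lowering ℓ ^ k * Y) := by
  rw [← mul_assoc, (angMomSq_commute_lowering.pow_right k).eq, mul_assoc, hY, Matrix.mul_smul]

theorem lowering_mul_raising_mul (hJ : angMomSq ℓ * Y = l • Y)
    (hY : angMom ℓ 2 * Y = (μ : ℂ) • Y) :
    lowering ℓ * (raising ℓ * Y) = (l - μ * (μ + 1)) • Y := by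
  rw [angMomSq_eq, add_mul, add_mul, hY, mul_assoc, mul_assoc, hY, Matrix.mul_smul, hY, smul_smul,
    add_assoc, ← add_smul] at hJ
  rw [eq_sub_of_add_eq hJ, ← sub_smul]
  congr 1
  ring

theorem raising_mul_lowering_mul (hJ : angMomSq ℓ * Y = l • Y)
    (hY : angMom ℓ 2 * Y = (μ : ℂ) • Y) :
    raising ℓ * (lowering ℓ * Y) = (l - μ * (μ - 1)) • Y := by
  rw [angMomSq_eq', add_mul, sub_mul, hY, mul_assoc, mul_assoc, hY, Matrix.mul_smul, hY, smul_smul,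
    sub_add, ← sub_smul] at hJ
  rw [eq_add_of_sub_eq hJ, ← add_smul]
  congr 1
  ring

theorem exists_pow_mul_ne_zero {R Z : Matrix (Fin ℓ → Fin 2) (Fin ℓ → Fin 2) ℂ} (hZ : Z ≠ 0)
    {K : ℕ} (hK : R ^ K * Z = 0) : ∃ n, R ^ n * Z ≠ 0 ∧ R * (R ^ n * Z) = 0 := by
  classical
  have h : ∃ k, R ^ k * Z = 0 := ⟨K, hK⟩
  have h0 : Nat.find h ≠ 0 := fun h0 => hZ (by simpa [h0] using Nat.find_spec h)
  obtain ⟨n, hn⟩ := Nat.exists_eq_succ_of_ne_zero h0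
  refine ⟨n, Nat.find_min h (by omega), ?_⟩
  have := Nat.find_spec h
  rwa [hn, Nat.succ_eq_add_one, pow_succ', mul_assoc] at this

theorem raising_pow_mul_eq_zero (hY : angMom ℓ 2 * Y = (μ : ℂ) • Y) (h : Y ≠ 0) :
    raising ℓ ^ (ℓ + 1) * Y = 0 := by
  by_contra hne
  obtain ⟨p, -, hp⟩ := exists_upCount_eq hY h
  obtain ⟨p', hp', h'⟩ := exists_upCount_eq (angMom_two_mul_raising_pow_mul hY _) hne
  have : (p' : ℝ) ≤ ℓ := by exact_mod_cast hp'
  push_cast at h'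
  have : (0 : ℝ) ≤ p := p.cast_nonneg
  linarith

theorem lowering_pow_mul_eq_zero (hY : angMom ℓ 2 * Y = (μ : ℂ) • Y) (h : Y ≠ 0) :
    lowering ℓ ^ (ℓ + 1) * Y = 0 := by
  by_contra hne
  obtain ⟨p, hp', hp⟩ := exists_upCount_eq hY h
  obtain ⟨p', -, h'⟩ := exists_upCount_eq (angMom_two_mul_lowering_pow_mul hY _) hne
  have : (p : ℝ) ≤ ℓ := by exact_mod_cast hp'
  push_cast at h'
  have : (0 : ℝ) ≤ p' := p'.cast_nonneg
  linarith

/-- The weights `m` of the sector `j` run from `-j` to `j` in integral steps, and `2 j ≤ ℓ`. -/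
theorem exists_weights {j : ℝ} (hj : 0 ≤ j)
    (hJ : angMomSq ℓ * Y = ((j * (j + 1) : ℝ) : ℂ) • Y) (hY : angMom ℓ 2 * Y = (μ : ℂ) • Y)
    (h : Y ≠ 0) :
    ∃ n N p q : ℕ, p + q = ℓ ∧ n ≤ q ∧ N ≤ p ∧ μ = p - ℓ / 2 ∧ j - μ = n ∧ j + μ = N := by
  obtain ⟨n, hn, hn'⟩ := exists_pow_mul_ne_zero h (raising_pow_mul_eq_zero hY h)
  obtain ⟨N, hN, hN'⟩ := exists_pow_mul_ne_zero h (lowering_pow_mul_eq_zero hY h)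
  have h1 : (j - (μ + n)) * (j + (μ + n) + 1) = 0 := by
    have := lowering_mul_raising_mul (angMomSq_mul_raising_pow_mul hJ n)
      (angMom_two_mul_raising_pow_mul hY n)
    rw [hn', mul_zero] at this
    have := (smul_eq_zero.mp this.symm).resolve_right hn
    have : j * (j + 1) - (μ + n) * ((μ + n) + 1) = 0 := by exact_mod_cast this
    linarith
  have h2 : (j + (μ - N)) * (j - (μ - N) + 1) = 0 := by
    have := raising_mul_lowering_mul (angMomSq_mul_lowering_pow_mul hJ N)
      (angMom_two_mul_lowering_pow_mul hY N)
    rw [hN', mul_zero] at this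
    have := (smul_eq_zero.mp this.symm).resolve_right hN
    have : j * (j + 1) - (μ - N) * ((μ - N) - 1) = 0 := by exact_mod_cast this
    linarith
  have hn0 : (0 : ℝ) ≤ n := n.cast_nonneg
  have hN0 : (0 : ℝ) ≤ N := N.cast_nonneg
  -- The vanishing at the two ends of the ladder leaves two roots each. All combinations except `j =
  -- μ + n` and `j = N - μ` contradict the nonnegativity of `j`, `n` and `N`.
  have hjn : j - μ = n := by
    rcases mul_eq_zero.mp h1 with h1 | h1
    · linarith
    · rcases mul_eq_zero.mp h2 with h2 | h2 <;> linarith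
  have hjN : j + μ = N := by
    rcases mul_eq_zero.mp h2 with h2 | h2
    · linarith
    · linarith
  obtain ⟨p, hp, hμ⟩ := exists_upCount_eq hY h
  obtain ⟨p₁, hp₁, hμ₁⟩ := exists_upCount_eq (angMom_two_mul_raising_pow_mul hY n) hn
  obtain ⟨p₂, hp₂, hμ₂⟩ := exists_upCount_eq (angMom_two_mul_lowering_pow_mul hY N) hN
  have e1 : p + n = p₁ := by
    have : ((p + n : ℕ) : ℝ) = p₁ := by
      push_cast
      linarith
    exact_mod_cast this
  have e2 : p₂ + N = p := by
    have : ((p₂ + N : ℕ) : ℝ) = p := by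
      push_cast
      linarith
    exact_mod_cast this
  exact ⟨n, N, p, ℓ - p, by omega, by omega, by omega, hμ, hjn, hjN⟩

/-- The products of ladders of a projector onto a joint eigenspace. -/
theorem raising_pow_mul_conjTranspose_mul {n N : ℕ} {j : ℝ} (hE : Y * Y = Y) (hEh : Yᴴ = Y)
    (hJ : angMomSq ℓ * Y = ((j * (j + 1) : ℝ) : ℂ) • Y) (hY : angMom ℓ 2 * Y = (μ : ℂ) • Y)
    (hn : j - μ = n) (hN : j + μ = N) (k : ℕ) :
    (raising ℓ ^ k * Y)ᴴ * (raising ℓ ^ k * Y) =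
      (((k.factorial ^ 2 * n.choose k * (N + k).choose k : ℕ) : ℝ) : ℂ) • Y := by
  induction k with
  | zero => simp [hEh, hE]
  | succ k ih =>
    have h := lowering_mul_raising_mul (angMomSq_mul_raising_pow_mul hJ k)
      (angMom_two_mul_raising_pow_mul hY k)
    rw [pow_succ', mul_assoc, Matrix.conjTranspose_mul, raising_conjTranspose, mul_assoc, h,
      Matrix.mul_smul, ih, smul_smul]
    congr 1
    rw [← Complex.ofReal_one, ← Complex.ofReal_add, ← Complex.ofReal_mul, ← Complex.ofReal_sub,
      ← Complex.ofReal_mul]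
    congr 1
    -- The factor acquired at the step from `k` to `k + 1`. Its two parts extend the two binomial
    -- coefficients in the claim, each with one factor `k + 1` of the factorial.
    have hj : j * (j + 1) - (μ + k) * (μ + k + 1) = ((n : ℝ) - k) * (N + k + 1) := by
      rw [← hn, ← hN]
      ring
    have h1 : ((n.choose (k + 1) : ℝ)) * (k + 1) = n.choose k * ((n : ℝ) - k) := by
      rcases le_or_gt k n with hk | hk
      · have := Nat.choose_succ_right_eq n k
        rw [← Nat.cast_sub hk]
        exact_mod_cast this
      · rw [Nat.choose_eq_zero_of_lt hk, Nat.choose_eq_zero_of_lt (by omega)]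
        simp
    have h2 : (((N + (k + 1)).choose (k + 1) : ℝ)) * (k + 1) = (N + k + 1) * (N + k).choose k := by
      have := Nat.add_one_mul_choose_eq (N + k) k
      rw [← add_assoc]
      exact_mod_cast this.symm
    rw [hj, Nat.factorial_succ]
    push_cast
    calc ((n : ℝ) - k) * (N + k + 1) * ((k.factorial : ℝ) ^ 2 * n.choose k * (N + k).choose k)
        = (k.factorial : ℝ) ^ 2 * (n.choose k * ((n : ℝ) - k)) *
          ((N + k + 1) * (N + k).choose k) := by ring
      _ = _ := by
        rw [← h1, ← h2]
        ring

theorem conjTranspose_mul_eq_zero {Z : Matrix (Fin ℓ → Fin 2) (Fin ℓ → Fin 2) ℂ} {ν : ℝ}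
    (hY : angMom ℓ 2 * Y = (μ : ℂ) • Y) (hZ : angMom ℓ 2 * Z = (ν : ℂ) • Z) (h : μ ≠ ν) :
    Yᴴ * Z = 0 := by
  have h1 : Yᴴ * (angMom ℓ 2 * Z) = (μ : ℂ) • (Yᴴ * Z) := by
    rw [← mul_assoc, ← (angMom_isHermitian (ℓ := ℓ) 2).eq, ← Matrix.conjTranspose_mul, hY,
      Matrix.conjTranspose_smul, Complex.star_def, Complex.conj_ofReal, Matrix.smul_mul]
  rw [hZ, Matrix.mul_smul, ← sub_eq_zero, ← sub_smul] at h1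
  exact (smul_eq_zero.mp h1).resolve_left
    (sub_ne_zero.mpr fun h' => h (Complex.ofReal_injective h').symm)

end Ladder

/-! ### Triangular tensor powers -/

section Triangular

variable {ℓ : ℕ}

/-- If `X² = 0`, then `1 + X = exp X`. Different sites commute, so the product over the sites is the
exponential of the sum, which is again nilpotent. -/
theorem isNilpotent_and_exp_eq (X : Matrix (Fin 2) (Fin 2) ℂ) (hX : X * X = 0)
    (s : Finset (Fin ℓ)) :
    IsNilpotent (∑ i ∈ s, siteOp i X) ∧ tensorFamily (fun i => if i ∈ s then 1 + X else 1) =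
      IsNilpotent.exp (∑ i ∈ s, siteOp i X) := by
  classical
  induction s using Finset.induction_on with
  | empty => simpa using tensorFamily_one
  | insert i s hi ih =>
    have hsq : siteOp i X ^ 2 = 0 := by
      have h0 : siteOp i (0 : Matrix (Fin 2) (Fin 2) ℂ) = 0 := by
        simpa using siteOp_smul i 0 X
      rw [pow_two, siteOp_mul_self, hX, h0]
    have hc : Commute (siteOp i X) (∑ i ∈ s, siteOp i X) :=
      Commute.sum_right _ _ _ fun j hj =>
        siteOp_commute (fun h : i = j => hi (by rwa [h])) X X
    have hexp : IsNilpotent.exp (siteOp i X) = siteOp i (1 + X) := by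
      have h1 : siteOp i (1 : Matrix (Fin 2) (Fin 2) ℂ) = 1 := by
        rw [siteOp_eq_tensorFamily, ← tensorFamily_one]
        congr 1
        exact Function.update_eq_self i fun _ => 1
      rw [IsNilpotent.exp_eq_sum hsq, siteOp_add, h1]
      simp [Finset.sum_range_succ]
    rw [Finset.sum_insert hi]
    refine ⟨hc.isNilpotent_add ⟨2, hsq⟩ ih.1, ?_⟩
    rw [IsNilpotent.exp_add_of_commute hc ⟨2, hsq⟩ ih.1, ← ih.2, hexp, siteOp_eq_tensorFamily,
      tensorFamily_mul]
    congr 1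
    ext1 j
    by_cases hj : j = i
    · subst hj
      simp [hi]
    · simp [hj]

/-- The exponential series of a nilpotent matrix is a polynomial. The expansion holds at every large
cutoff, so that it can be used with one beyond the length of a given ladder. -/
theorem exists_tensorPower_upper_eq (ℓ : ℕ) (g : ℂ) : ∃ K : ℕ, ∀ k ≥ K,
    tensorPower ℓ !![1, g; 0, 1] =
      ∑ i ∈ Finset.range k, ((i.factorial : ℂ)⁻¹ * g ^ i) • raising ℓ ^ i := by
  have h := isNilpotent_and_exp_eq (ℓ := ℓ) (g • !![0, 1; 0, 0]) (by
    ext i j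
    fin_cases i <;> fin_cases j <;> simp) Finset.univ
  have hX : (1 : Matrix (Fin 2) (Fin 2) ℂ) + g • !![0, 1; 0, 0] = !![1, g; 0, 1] := by
    ext i j
    fin_cases i <;> fin_cases j <;> simp
  simp only [Finset.mem_univ, if_true, hX] at h
  have hc : ∑ i : Fin ℓ, siteOp i (g • !![0, 1; 0, 0]) = g • raising ℓ := collective_smul _ _
  rw [hc] at h
  obtain ⟨⟨K, hK⟩, he⟩ := h
  refine ⟨K, fun k hk => ?_⟩
  change tensorFamily _ = _
  rw [he, IsNilpotent.exp_eq_sum (pow_eq_zero_of_le hk hK)]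
  refine Finset.sum_congr rfl fun i _ => ?_
  rw [smul_pow, mul_smul]
  ext x y
  simp [Rat.smul_def]

end Triangular

/-! ### Compressions of tensor powers to weight spaces -/

/-- The value of the tensor power of `L D Lᴴ`, where `L` is lower unitriangular with entry of
squared modulus `y` and `D = diag (a, d)`, on the weight space with `p` spins up and `q` spins down
that lies `n` steps below the top and `N` steps above the bottom of its ladder. -/
def ladderSum (n N p q : ℕ) (y a d : ℝ) : ℝ :=
  ∑ k ∈ Finset.range (n + 1), (n.choose k * (N + k).choose k : ℕ) * y ^ k * a ^ (p + k) * d ^ (q - k)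

section Compression

variable {ℓ : ℕ}

/-- The upper triangular factor moves the weight space up its ladder, the diagonal factor is a
scalar on each rung, and the lower triangular factor is the adjoint of the first. Different rungs
are orthogonal, so only the diagonal terms survive. Their norms are the products of binomials from
`raising_pow_mul_conjTranspose_mul`. -/
theorem mul_tensorPower_mul_eq_ladderSum {E : Matrix (Fin ℓ → Fin 2) (Fin ℓ → Fin 2) ℂ}
    (hE : E * E = E) (hEh : Eᴴ = E) {j μ : ℝ} {n N p q : ℕ}
    (hJ : angMomSq ℓ * E = ((j * (j + 1) : ℝ) : ℂ) • E) (hY : angMom ℓ 2 * E = (μ : ℂ) • E)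
    (hn : j - μ = n) (hN : j + μ = N) (hμ : μ = p - ℓ / 2) (hpq : p + q = ℓ) (hnq : n ≤ q)
    (g : ℂ) (a d : ℝ) :
    E * tensorPower ℓ (!![1, 0; g, 1] * Matrix.diagonal ![(a : ℂ), d] * !![1, star g; 0, 1]) * E =
      (ladderSum n N p q (Complex.normSq g) a d : ℂ) • E := by
  obtain ⟨K, hK⟩ := exists_tensorPower_upper_eq ℓ (star g)
  set W : ℕ → Matrix (Fin ℓ → Fin 2) (Fin ℓ → Fin 2) ℂ := fun k => raising ℓ ^ k * E with hW
  have hWW : ∀ k, (W k)ᴴ * W k =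
      (((k.factorial ^ 2 * n.choose k * (N + k).choose k : ℕ) : ℝ) : ℂ) • E :=
    raising_pow_mul_conjTranspose_mul hE hEh hJ hY hn hN
  have hW0 : ∀ k, n < k → W k = 0 := fun k hk => by
    have h := hWW k
    rw [Nat.choose_eq_zero_of_lt hk] at h
    simp only [mul_zero, zero_mul, Nat.cast_zero, Complex.ofReal_zero, zero_smul] at h
    exact Matrix.conjTranspose_mul_self_eq_zero.mp h
  have hWZ : ∀ k, angMom ℓ 2 * W k = ((μ + k : ℝ) : ℂ) • W k := angMom_two_mul_raising_pow_mul hY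
  set c : ℕ → ℂ := fun k => (k.factorial : ℂ)⁻¹ * star g ^ k with hc
  set V := tensorPower ℓ !![1, star g; 0, 1] * E with hV
  have hVW : V = ∑ k ∈ Finset.range (n + 1), c k • W k := by
    rw [hV, hK (max K (n + 1)) (le_max_left _ _), Finset.sum_mul]
    simp only [Matrix.smul_mul]
    refine (Finset.sum_subset (Finset.range_mono (le_max_right _ _)) fun k _ hk => ?_).symm
    have : W k = 0 := hW0 k (by simpa using hk)
    change c k • W k = 0
    rw [this, smul_zero]
  have hVh : E * tensorPower ℓ !![1, 0; g, 1] = Vᴴ := by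
    rw [hV, Matrix.conjTranspose_mul, hEh, ← tensorPower_conjTranspose]
    congr 2
    ext i j
    fin_cases i <;> fin_cases j <;> simp [Matrix.conjTranspose_apply]
  have hDW : ∀ k ∈ Finset.range (n + 1), tensorPower ℓ (Matrix.diagonal ![(a : ℂ), d]) * W k =
      ((a : ℂ) ^ (p + k) * (d : ℂ) ^ (q - k)) • W k := by
    intro k hk
    have hk' : k ≤ n := Nat.lt_succ_iff.mp (Finset.mem_range.mp hk)
    refine diagonal_tensorPower_mul (by omega) ?_ _
    have e : μ + k = ((p + k : ℕ) : ℝ) - ℓ / 2 := by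
      push_cast
      linarith
    rw [hWZ, e]
  have hDV : tensorPower ℓ (Matrix.diagonal ![(a : ℂ), d]) * V =
      ∑ k ∈ Finset.range (n + 1), (c k * ((a : ℂ) ^ (p + k) * (d : ℂ) ^ (q - k))) • W k := by
    rw [hVW, Finset.mul_sum]
    refine Finset.sum_congr rfl fun k hk => ?_
    rw [Matrix.mul_smul, hDW k hk, smul_smul]
  calc E * tensorPower ℓ (!![1, 0; g, 1] * Matrix.diagonal ![(a : ℂ), d] *
          !![1, star g; 0, 1]) * E
      = Vᴴ * (tensorPower ℓ (Matrix.diagonal ![(a : ℂ), d]) * V) := by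
        rw [tensorPower_mul, tensorPower_mul, ← hVh, hV]
        simp only [mul_assoc]
    _ = ∑ i ∈ Finset.range (n + 1), ∑ k ∈ Finset.range (n + 1),
          (star (c i) * (c k * ((a : ℂ) ^ (p + k) * (d : ℂ) ^ (q - k)))) • ((W i)ᴴ * W k) := by
        rw [hDV, hVW, Matrix.conjTranspose_sum, Finset.sum_mul_sum]
        refine Finset.sum_congr rfl fun i _ => Finset.sum_congr rfl fun k _ => ?_
        rw [Matrix.conjTranspose_smul, Matrix.smul_mul, Matrix.mul_smul, smul_smul]
    _ = ∑ k ∈ Finset.range (n + 1),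
          (star (c k) * (c k * ((a : ℂ) ^ (p + k) * (d : ℂ) ^ (q - k)))) • ((W k)ᴴ * W k) := by
        refine Finset.sum_congr rfl fun i hi => Finset.sum_eq_single_of_mem i hi fun k _ hk => ?_
        rw [conjTranspose_mul_eq_zero (hWZ i) (hWZ k) fun h => hk ?_, smul_zero]
        have : (i : ℝ) = k := by linarith
        exact_mod_cast this.symm
    _ = _ := by
        simp only [hWW, smul_smul]
        rw [← Finset.sum_smul, ladderSum, Complex.ofReal_sum]
        congr 1
        refine Finset.sum_congr rfl fun k _ => ?_
        have hk : (k.factorial : ℂ) ≠ 0 := Nat.cast_ne_zero.mpr k.factorial_ne_zero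
        have hcc : star (c k) * c k * (k.factorial : ℂ) ^ 2 = (Complex.normSq g : ℂ) ^ k := by
          simp only [hc, star_mul', star_pow, star_star, star_inv₀, star_natCast]
          rw [Complex.normSq_eq_conj_mul_self, mul_pow, Complex.star_def]
          field_simp
        push_cast
        rw [← hcc]
        ring

end Compression

section LadderSum

variable {n N p q : ℕ} {y a d : ℝ}

/-- The right side contains the left as its term `k = 0`, the contribution without any raising. -/
theorem le_ladderSum (hy : 0 ≤ y) (ha : 0 ≤ a) (hd : 0 ≤ d) :
    a ^ p * d ^ q ≤ ladderSum n N p q y a d := by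
  have h := Finset.single_le_sum (s := Finset.range (n + 1))
    (f := fun k => ((n.choose k * (N + k).choose k : ℕ) : ℝ) * y ^ k * a ^ (p + k) * d ^ (q - k))
    (fun k _ => by positivity) (Finset.mem_range.mpr (Nat.succ_pos n))
  refine le_trans (le_of_eq ?_) h
  simp

/-- The binomial theorem is used twice: `(N + k).choose k * t ^ k` is one term of `(1 + t)^(N + k)`,
and what remains sums to a power with exponent `n`. For small `t` the first factor grows slowly with
`ℓ`, and the second is harmless because `n` is small on average. For `d = 0` only `n = 0` is
allowed, where the sum has a single term. -/
theorem ladderSum_le {t : ℝ} (hy : 0 ≤ y) (ha : 0 ≤ a) (hd : 0 ≤ d) (ht : 0 < t) (hnq : n ≤ q)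
    (hNp : N ≤ p) (h : 0 < d ∨ n = 0) :
    ladderSum n N p q y a d ≤
      a ^ p * d ^ q * ((1 + t) ^ (p + q) * (1 + y * a / d / t) ^ n) := by
  have h1 : 1 ≤ (1 + t) ^ (p + q) := one_le_pow₀ (by linarith)
  rcases h with hd' | rfl
  · have hz : (1 + y * a / d / t) ^ n =
        ∑ k ∈ Finset.range (n + 1), (y * a / d / t) ^ k * 1 ^ (n - k) * (n.choose k : ℝ) := by
      rw [add_comm, add_pow]
    rw [hz, Finset.mul_sum, Finset.mul_sum, ladderSum]
    refine Finset.sum_le_sum fun k hk => ?_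
    have hk' : k ≤ n := Nat.lt_succ_iff.mp (Finset.mem_range.mp hk)
    have h2 : ((N + k).choose k : ℝ) * t ^ k ≤ (1 + t) ^ (p + q) := by
      calc ((N + k).choose k : ℝ) * t ^ k
          ≤ ∑ i ∈ Finset.range (N + k + 1), t ^ i * 1 ^ (N + k - i) * ((N + k).choose i : ℝ) := by
            refine le_trans (le_of_eq ?_) (Finset.single_le_sum
              (f := fun i => t ^ i * 1 ^ (N + k - i) * ((N + k).choose i : ℝ))
              (fun i _ => by positivity) (Finset.mem_range.mpr (show k < N + k + 1 by omega)))
            simp [mul_comm]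
        _ = (1 + t) ^ (N + k) := by rw [← add_pow, add_comm]
        _ ≤ (1 + t) ^ (p + q) := pow_le_pow_right₀ (by linarith) (by omega)
    have hdk : d ^ q = d ^ (q - k) * d ^ k := by rw [← pow_add, Nat.sub_add_cancel (hk'.trans hnq)]
    calc ((n.choose k * (N + k).choose k : ℕ) : ℝ) * y ^ k * a ^ (p + k) * d ^ (q - k)
        = (a ^ p * d ^ q * (n.choose k * (y * a / d / t) ^ k)) *
            (((N + k).choose k : ℝ) * t ^ k) := by
          rw [hdk, div_pow, div_pow, mul_pow, pow_add]
          push_cast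
          field_simp
      _ ≤ (a ^ p * d ^ q * (n.choose k * (y * a / d / t) ^ k)) * (1 + t) ^ (p + q) := by
          gcongr
      _ = _ := by
          rw [one_pow]
          ring
  · rw [ladderSum, pow_zero]
    simp only [zero_add, Finset.range_one, Finset.sum_singleton]
    have : 0 ≤ a ^ p * d ^ q := by positivity
    simp
    exact le_mul_of_one_le_right this h1

theorem ladderSum_eq_zero_of_left (hp : p ≠ 0) : ladderSum n N p q y 0 d = 0 :=
  Finset.sum_eq_zero fun k _ => by rw [zero_pow (by omega), mul_zero, zero_mul]

theorem ladderSum_eq_zero_of_right (hnq : n < q) : ladderSum n N p q y a 0 = 0 :=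
  Finset.sum_eq_zero fun k hk => by
    have := Finset.mem_range.mp hk
    rw [zero_pow (by omega), mul_zero]

end LadderSum

/-- Gaussian elimination with pivots `a` and `d`, so that `a d` is the determinant. If `a = 0`,
positivity forces the off-diagonal entry to vanish, and nothing has to be eliminated. -/
theorem exists_eq_lower_mul_diagonal_mul_aux {a e : ℝ} {b : ℂ} (ha : 0 ≤ a) (he : 0 ≤ e)
    (h : Complex.normSq b ≤ a * e) :
    ∃ (g : ℂ) (d : ℝ), 0 ≤ d ∧ a * d = a * e - Complex.normSq b ∧
      !![(a : ℂ), star b; b, (e : ℂ)] =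
        !![1, 0; g, 1] * Matrix.diagonal ![(a : ℂ), (d : ℂ)] * !![1, star g; 0, 1] := by
  have hmul : ∀ (g x d : ℂ), !![1, 0; g, 1] * Matrix.diagonal ![x, d] * !![1, star g; 0, 1] =
      !![x, x * star g; g * x, g * x * star g + d] := by
    intro g x d
    have : Matrix.diagonal ![x, d] = !![x, 0; 0, d] := by
      ext i j
      fin_cases i <;> fin_cases j <;> simp
    rw [this, Matrix.mul_fin_two, Matrix.mul_fin_two]
    simp
  rcases ha.eq_or_lt with rfl | ha
  · have hb : b = 0 := Complex.normSq_eq_zero.mp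
      (le_antisymm (by linarith) (Complex.normSq_nonneg b))
    refine ⟨0, e, he, ?_, ?_⟩
    · simp [hb]
    · rw [hmul, hb]
      simp
  · have ha' : (a : ℂ) ≠ 0 := Complex.ofReal_ne_zero.mpr ha.ne'
    have hs : star (b / (a : ℂ)) = star b / a := by simp
    refine ⟨b / a, (a * e - Complex.normSq b) / a, div_nonneg (by linarith) ha.le, ?_, ?_⟩
    · field_simp
    · rw [hmul, hs, mul_div_cancel₀ _ ha', div_mul_cancel₀ _ ha']
      congr
      push_cast
      rw [Complex.normSq_eq_conj_mul_self, Complex.star_def]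
      field_simp
      ring

theorem exists_eq_lower_mul_diagonal_mul {X : Matrix (Fin 2) (Fin 2) ℂ} (hX : X.PosSemidef) :
    ∃ (g : ℂ) (d : ℝ), 0 ≤ d ∧ (X 0 0).re * d = X.det.re ∧
      X = !![1, 0; g, 1] * Matrix.diagonal ![((X 0 0).re : ℂ), (d : ℂ)] * !![1, star g; 0, 1] := by
  have h00 := Complex.le_def.mp (hX.diag_nonneg (i := 0))
  have h11 := Complex.le_def.mp (hX.diag_nonneg (i := 1))
  have hdet := Complex.le_def.mp hX.det_nonneg
  have e00 : X 0 0 = ((X 0 0).re : ℂ) := Complex.ext rfl h00.2.symm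
  have e11 : X 1 1 = ((X 1 1).re : ℂ) := Complex.ext rfl h11.2.symm
  have e01 : X 0 1 = star (X 1 0) := (hX.1.apply 0 1).symm
  have hD : X.det.re = (X 0 0).re * (X 1 1).re - Complex.normSq (X 1 0) := by
    rw [Matrix.det_fin_two, e00, e11, e01, Complex.sub_re, ← Complex.ofReal_mul,
      Complex.ofReal_re, Complex.star_def, ← Complex.normSq_eq_conj_mul_self]
    simp
  obtain ⟨g, d, hd, h1, h2⟩ := exists_eq_lower_mul_diagonal_mul_aux (b := X 1 0) h00.1 h11.1
    (by
      have := hdet.1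
      rw [hD, Complex.zero_re] at this
      linarith)
  refine ⟨g, d, hd, h1.trans hD.symm, ?_⟩
  rw [← h2, ← e00, ← e01, ← e11]
  exact Matrix.eta_fin_two X

namespace IsSpinMeasurement

variable {ℓ : ℕ} {v : EuclideanSpace ℝ (Fin 3)} {K : BlockPOVM 2 ℓ} {j m : Fin K.outcomes → ℝ}

/-- Each outcome of the spin measurement is a weight space of a ladder of integral length. -/
theorem exists_counts (h : IsSpinMeasurement v K j m) {U : Matrix (Fin 2) (Fin 2) ℂ}
    (hU : Uᴴ * U = 1) (hUv : U * pauli 2 * Uᴴ = ∑ a, (v a : ℂ) • pauli a) :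
    ∃ n N p q : Fin K.outcomes → ℕ, ∀ x, p x + q x = ℓ ∧ n x ≤ q x ∧ N x ≤ p x ∧
      m x = p x - ℓ / 2 ∧ j x - m x = n x ∧
      (∀ (g : ℂ) (a d : ℝ), K.effect x * tensorPower ℓ (U * (!![1, 0; g, 1] *
        Matrix.diagonal ![(a : ℂ), d] * !![1, star g; 0, 1]) * Uᴴ) * K.effect x =
        (ladderSum (n x) (N x) (p x) (q x) (Complex.normSq g) a d : ℂ) • K.effect x) ∧
      ∀ a d : ℝ, tensorPower ℓ (U * Matrix.diagonal ![(a : ℂ), d] * Uᴴ) * K.effect x =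
        ((a ^ p x * d ^ q x : ℝ) : ℂ) • K.effect x := by
  have hU' : U * Uᴴ = 1 := mul_eq_one_comm.mp hU
  set T := tensorPower ℓ U with hT
  set S := tensorPower ℓ Uᴴ with hS
  have hTS : T * S = 1 := by rw [hT, hS, ← tensorPower_mul, hU', tensorPower_one]
  have hST : S * T = 1 := by rw [hT, hS, ← tensorPower_mul, hU, tensorPower_one]
  have hSh : Sᴴ = T := by rw [hS, ← tensorPower_conjTranspose, Matrix.conjTranspose_conjTranspose]
  have hTh : Tᴴ = S := by rw [hT, ← tensorPower_conjTranspose]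
  have hJ : angMomSq ℓ * S = S * angMomSq ℓ := by
    have := angMomSq_invariant (ℓ := ℓ) hU
    calc angMomSq ℓ * S = S * (T * angMomSq ℓ * S) := by
          rw [← mul_assoc, ← mul_assoc, hST, one_mul]
      _ = _ := by rw [this]
  have hZ : angMom ℓ 2 * S = S * angMomAlong ℓ v := by
    rw [← angMom_two_conj hU' hUv, ← mul_assoc, ← mul_assoc, hST, one_mul]
  have key : ∀ x, ∃ n N p q : ℕ, p + q = ℓ ∧ n ≤ q ∧ N ≤ p ∧
      m x = p - ℓ / 2 ∧ j x - m x = n ∧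
      (∀ (g : ℂ) (a d : ℝ), K.effect x * tensorPower ℓ (U * (!![1, 0; g, 1] *
        Matrix.diagonal ![(a : ℂ), d] * !![1, star g; 0, 1]) * Uᴴ) * K.effect x =
        (ladderSum n N p q (Complex.normSq g) a d : ℂ) • K.effect x) ∧
      ∀ a d : ℝ, tensorPower ℓ (U * Matrix.diagonal ![(a : ℂ), d] * Uᴴ) * K.effect x =
        ((a ^ p * d ^ q : ℝ) : ℂ) • K.effect x := by
    intro x
    set E := K.effect x with hE
    -- Rotating the measured axis to the third one turns the effect into a weight space of `angMom ℓ
    -- 2`, to which the ladder computations apply. `J²` is not affected.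
    set F := S * E * T with hF
    have hEF : E = T * F * S := by
      rw [hF, ← mul_assoc, ← mul_assoc, hTS, one_mul, mul_assoc, hTS, mul_one]
    have hFF : F * F = F := by
      calc F * F = S * (E * (T * S) * E) * T := by
            rw [hF]
            simp only [mul_assoc]
        _ = F := by rw [hTS, mul_one, hE, h.mul_self]
    have hFh : Fᴴ = F := by
      rw [hF, Matrix.conjTranspose_mul, Matrix.conjTranspose_mul, hSh, hTh,
        (K.posSemidef x).1.eq, mul_assoc]
    have hF0 : F ≠ 0 := by
      intro h0
      rw [h0, mul_zero, zero_mul] at hEF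
      exact h.ne_zero x hEF
    have hFJ : angMomSq ℓ * F = ((j x * (j x + 1) : ℝ) : ℂ) • F := by
      rw [hF, ← mul_assoc, ← mul_assoc, hJ, mul_assoc S, h.angMomSq_mul, Matrix.mul_smul,
        Matrix.smul_mul]
    have hFZ : angMom ℓ 2 * F = (m x : ℂ) • F := by
      rw [hF, ← mul_assoc, ← mul_assoc, hZ, mul_assoc S, h.angMomAlong_mul, Matrix.mul_smul,
        Matrix.smul_mul]
    obtain ⟨n, N, p, q, hpq, hnq, hNp, hm, hn, hN⟩ := exists_weights (h.nonneg x) hFJ hFZ hF0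
    refine ⟨n, N, p, q, hpq, hnq, hNp, hm, hn, fun g a d => ?_, fun a d => ?_⟩
    · rw [tensorPower_mul, tensorPower_mul, ← hT, ← hS]
      calc E * (T * _ * S) * E = T * (F * tensorPower ℓ (!![1, 0; g, 1] *
            Matrix.diagonal ![(a : ℂ), d] * !![1, star g; 0, 1]) * F) * S := by
            generalize tensorPower ℓ (!![1, 0; g, 1] *
              Matrix.diagonal ![(a : ℂ), d] * !![1, star g; 0, 1]) = X
            rw [hF]
            calc E * (T * X * S) * E = 1 * E * T * X * S * E * 1 := by
                  rw [one_mul, mul_one]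
                  simp only [mul_assoc]
              _ = _ := by
                  rw [← hTS]
                  simp only [mul_assoc]
        _ = _ := by
            rw [mul_tensorPower_mul_eq_ladderSum hFF hFh hFJ hFZ hn hN hm hpq hnq, Matrix.mul_smul,
              Matrix.smul_mul, ← hEF]
    · rw [hm] at hFZ
      have h1 := diagonal_tensorPower_mul hpq hFZ ![(a : ℂ), d]
      rw [tensorPower_mul, tensorPower_mul, ← hT, ← hS, hEF, mul_assoc T F S,
        mul_assoc (T * _) S, ← mul_assoc S T, hST, one_mul, mul_assoc T, ← mul_assoc _ F, h1]
      simp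
  choose n N p q hk using key
  exact ⟨n, N, p, q, hk⟩

theorem sum_prob_mul_proj (h : IsSpinMeasurement v K j m) (σ : State 2) :
    ∑ x, K.prob σ x * m x = (angMomAlong ℓ v * tensorPower ℓ σ.mat).trace.re := by
  have h1 : angMomAlong ℓ v = ∑ x, (m x : ℂ) • K.effect x := by
    rw [← mul_one (angMomAlong ℓ v), ← K.sum_effect, Finset.mul_sum]
    exact Finset.sum_congr rfl fun x _ => h.angMomAlong_mul x
  rw [h1, Finset.sum_mul, Matrix.trace_sum, Complex.re_sum]
  refine Finset.sum_congr rfl fun x _ => ?_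
  rw [Matrix.smul_mul, Matrix.trace_smul, smul_eq_mul, Complex.re_ofReal_mul, BlockPOVM.prob,
    mul_comm]

theorem sum_prob_mul_sq (h : IsSpinMeasurement v K j m) (σ : State 2) :
    ∑ x, K.prob σ x * (j x * (j x + 1)) = (angMomSq ℓ * tensorPower ℓ σ.mat).trace.re := by
  have h1 : angMomSq ℓ = ∑ x, ((j x * (j x + 1) : ℝ) : ℂ) • K.effect x := by
    rw [← mul_one (angMomSq ℓ), ← K.sum_effect, Finset.mul_sum]
    exact Finset.sum_congr rfl fun x _ => h.angMomSq_mul x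
  rw [h1, Finset.sum_mul, Matrix.trace_sum, Complex.re_sum]
  refine Finset.sum_congr rfl fun x _ => ?_
  rw [Matrix.smul_mul, Matrix.trace_smul, smul_eq_mul, Complex.re_ofReal_mul, BlockPOVM.prob,
    mul_comm]

end IsSpinMeasurement

/-! ### Bloch vectors -/

section Bloch

variable {ρ : State 2} {r : ℝ} {u : EuclideanSpace ℝ (Fin 3)}

theorem trace_pauli (a : Fin 3) : (pauli a).trace = 0 := by
  fin_cases a <;> simp [pauli, Matrix.trace_fin_two]

theorem trace_sum_pauli_mul_sum_pauli (u v : EuclideanSpace ℝ (Fin 3)) :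
    ((∑ a, (v a : ℂ) • pauli a) * ∑ a, (u a : ℂ) • pauli a).trace = 2 * (inner ℝ u v : ℝ) := by
  rw [Finset.sum_mul_sum, Matrix.trace_sum, PiLp.inner_apply, Complex.ofReal_sum, Finset.mul_sum]
  refine Finset.sum_congr rfl fun a _ => ?_
  rw [Matrix.trace_sum, Finset.sum_eq_single_of_mem a (Finset.mem_univ a)]
  · rw [Matrix.smul_mul, Matrix.mul_smul, smul_smul, Matrix.trace_smul, trace_pauli_mul_pauli,
      if_pos rfl]
    simp
    ring
  · intro b _ hb
    rw [Matrix.smul_mul, Matrix.mul_smul, smul_smul, Matrix.trace_smul, trace_pauli_mul_pauli,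
      if_neg hb.symm, smul_zero]

namespace IsBloch

theorem trace_sum_pauli_mul (h : IsBloch ρ r u) (v : EuclideanSpace ℝ (Fin 3)) :
    ((∑ a, (v a : ℂ) • pauli a) * ρ.mat).trace = (r * inner ℝ u v : ℝ) := by
  rw [h, Matrix.mul_smul, Matrix.trace_smul, mul_add, mul_one, Matrix.trace_add, Matrix.mul_smul,
    Matrix.trace_smul, trace_sum_pauli_mul_sum_pauli, Matrix.trace_sum]
  simp only [Matrix.trace_smul, trace_pauli, smul_eq_mul, mul_zero, Finset.sum_const_zero, zero_add]
  push_cast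
  ring

theorem trace_pauli_mul (h : IsBloch ρ r u) (a : Fin 3) :
    (pauli a * ρ.mat).trace = (r * u a : ℝ) := by
  have h1 := h.trace_sum_pauli_mul (EuclideanSpace.single a 1)
  rw [Finset.sum_eq_single_of_mem a (Finset.mem_univ a)
    (fun b _ hb => by simp [hb])] at h1
  simpa [EuclideanSpace.inner_single_right] using h1

theorem det_eq (h : IsBloch ρ r u) (hu : ‖u‖ = 1) : ρ.mat.det = ((1 - r ^ 2) / 4 : ℝ) := by
  have hsum : u 0 ^ 2 + u 1 ^ 2 + u 2 ^ 2 = 1 := by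
    have := EuclideanSpace.real_norm_sq_eq u
    rw [hu, Fin.sum_univ_three] at this
    linarith
  have hc : (u 0 : ℂ) ^ 2 + (u 1 : ℂ) ^ 2 + (u 2 : ℂ) ^ 2 = 1 := by
    rw [← Complex.ofReal_one, ← hsum]
    push_cast
    rfl
  have hI : Complex.I ^ 2 = -1 := Complex.I_sq
  rw [h, Matrix.det_fin_two, Fin.sum_univ_three]
  simp [pauli]
  linear_combination (-(r : ℂ) ^ 2 / 4) * hc + (r : ℂ) ^ 2 * (u 1 : ℂ) ^ 2 / 4 * hI

theorem trace_angMomAlong_mul (h : IsBloch ρ r u) (hu : ‖u‖ = 1) (ℓ : ℕ) :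
    (angMomAlong ℓ u * tensorPower ℓ ρ.mat).trace.re = ℓ * r / 2 := by
  rw [angMomAlong_eq, Matrix.smul_mul, Matrix.trace_smul,
    trace_collective_mul_tensorPower ρ.trace_eq_one, h.trace_sum_pauli_mul,
    real_inner_self_eq_norm_sq, hu]
  have : (1 / 2 : ℂ) • ((ℓ : ℂ) * ((r * 1 ^ 2 : ℝ) : ℂ)) = ((ℓ * r / 2 : ℝ) : ℂ) := by
    push_cast
    rw [smul_eq_mul]
    ring
  rw [this, Complex.ofReal_re]

theorem trace_angMomSq_mul (h : IsBloch ρ r u) (hu : ‖u‖ = 1) (ℓ : ℕ) :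
    (angMomSq ℓ * tensorPower ℓ ρ.mat).trace.re = (3 * ℓ + ℓ * (ℓ - 1) * r ^ 2) / 4 := by
  have hsq : ∀ a, pauli a * pauli a = 1 := by
    intro a
    fin_cases a <;> ext i j <;> fin_cases i <;> fin_cases j <;> simp [pauli]
  have hsum : u 0 ^ 2 + u 1 ^ 2 + u 2 ^ 2 = 1 := by
    have := EuclideanSpace.real_norm_sq_eq u
    rw [hu, Fin.sum_univ_three] at this
    linarith
  have h1 : ∀ a, (angMom ℓ a * angMom ℓ a * tensorPower ℓ ρ.mat).trace =
      ((ℓ + ℓ * (ℓ - 1) * (r * u a) ^ 2 : ℝ) : ℂ) / 4 := by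
    intro a
    rw [angMom_eq, Matrix.smul_mul, Matrix.mul_smul, smul_smul, Matrix.smul_mul, Matrix.trace_smul,
      trace_collective_sq_mul_tensorPower ρ.trace_eq_one, hsq, one_mul, ρ.trace_eq_one,
      h.trace_pauli_mul, smul_eq_mul]
    push_cast
    ring
  rw [angMomSq, Finset.sum_mul, Matrix.trace_sum, Finset.sum_congr rfl fun a _ => h1 a,
    Fin.sum_univ_three]
  have h2 : ∀ x : ℝ, ((x : ℂ) / 4).re = x / 4 := fun x => by
    rw [show ((x : ℂ) / 4) = ((x / 4 : ℝ) : ℂ) by push_cast; rfl, Complex.ofReal_re]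
  rw [Complex.add_re, Complex.add_re, h2, h2, h2]
  linear_combination (ℓ * (ℓ - 1) * r ^ 2 / 4 : ℝ) * hsum

theorem eq_conj_diagonal (h : IsBloch ρ r u) {U : Matrix (Fin 2) (Fin 2) ℂ} (hU : U * Uᴴ = 1)
    (hUu : U * pauli 2 * Uᴴ = ∑ a, (u a : ℂ) • pauli a) :
    ρ.mat = U * Matrix.diagonal ![(((1 + r) / 2 : ℝ) : ℂ), (((1 - r) / 2 : ℝ) : ℂ)] * Uᴴ := by
  have h1 : Matrix.diagonal ![(((1 + r) / 2 : ℝ) : ℂ), (((1 - r) / 2 : ℝ) : ℂ)] =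
      (1 / 2 : ℂ) • (1 + (r : ℂ) • pauli 2) := by
    ext i j
    fin_cases i <;> fin_cases j <;> simp [pauli] <;> ring
  rw [h, h1, Matrix.mul_smul, Matrix.smul_mul, mul_add, add_mul, mul_one, hU, Matrix.mul_smul,
    Matrix.smul_mul, hUu]

theorem conj_zero_zero (h : IsBloch ρ r u) {v : EuclideanSpace ℝ (Fin 3)}
    {U : Matrix (Fin 2) (Fin 2) ℂ} (hU : U * Uᴴ = 1)
    (hUv : U * pauli 2 * Uᴴ = ∑ a, (v a : ℂ) • pauli a) :
    ((Uᴴ * ρ.mat * U) 0 0).re = (1 + r * inner ℝ u v) / 2 := by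
  have h1 : ∀ X : Matrix (Fin 2) (Fin 2) ℂ, X 0 0 = (X.trace + (pauli 2 * X).trace) / 2 := by
    intro X
    simp [pauli, Matrix.trace_fin_two, Matrix.vecMul, dotProduct, Fin.sum_univ_two]
    ring
  have h2 : (Uᴴ * ρ.mat * U).trace = 1 := by
    rw [Matrix.trace_mul_comm, ← mul_assoc, hU, one_mul, ρ.trace_eq_one]
  have h3 : (pauli 2 * (Uᴴ * ρ.mat * U)).trace = (r * inner ℝ u v : ℝ) := by
    rw [← h.trace_sum_pauli_mul v, ← hUv, ← mul_assoc, Matrix.trace_mul_comm]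
    simp only [mul_assoc]
  have h4 := h1 (Uᴴ * ρ.mat * U)
  rw [h2, h3] at h4
  have h5 : (1 + ((r * inner ℝ u v : ℝ) : ℂ)) / 2 = (((1 + r * inner ℝ u v) / 2 : ℝ) : ℂ) := by
    push_cast
    ring
  rw [h5] at h4
  exact congrArg Complex.re h4

end IsBloch

end Bloch

/-! ### Statistics of the spin measurement -/

/-- The outcome distributions `P` (for a qubit state of purity `r` along the measured axis) and `Q`
(for another state) of the spin measurement on `ℓ` copies: an outcome has `p` spins up, `q` spins
down, and lies `n` steps below the top and `N` steps above the bottom of its ladder. -/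
structure IsSpinLaw {ι : Type*} [Fintype ι] (ℓ : ℕ) (r y a d : ℝ) (P Q : ι → ℝ)
    (n N p q : ι → ℕ) (τ : ι → ℝ) : Prop where
  add_eq : ∀ x, p x + q x = ℓ
  le_down : ∀ x, n x ≤ q x
  le_up : ∀ x, N x ≤ p x
  spin_nonneg : ∀ x, 0 ≤ (n x + p x - ℓ / 2 : ℝ)
  dim_nonneg : ∀ x, 0 ≤ τ x
  left_eq : ∀ x, P x = ((1 + r) / 2) ^ p x * ((1 - r) / 2) ^ q x * τ x
  right_eq : ∀ x, Q x = ladderSum (n x) (N x) (p x) (q x) y a d * τ x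
  sum_eq_one : ∑ x, P x = 1
  sum_up : ∑ x, P x * p x = ℓ * ((1 + r) / 2)
  sum_sq : ∑ x, P x * ((n x + p x - ℓ / 2) * (n x + p x - ℓ / 2 + 1)) =
    (3 * ℓ + ℓ * (ℓ - 1) * r ^ 2) / 4

namespace IsSpinLaw

variable {ι : Type*} [Fintype ι] {ℓ : ℕ} {r y a d : ℝ} {P Q : ι → ℝ} {n N p q : ι → ℕ} {τ : ι → ℝ}

theorem left_nonneg (h : IsSpinLaw ℓ r y a d P Q n N p q τ) (hr0 : 0 ≤ r) (hr1 : r ≤ 1) (x : ι) :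
    0 ≤ P x := by
  have h1 : 0 ≤ (1 - r) / 2 := by linarith
  have h2 := h.dim_nonneg x
  rw [h.left_eq]
  positivity

theorem sum_down (h : IsSpinLaw ℓ r y a d P Q n N p q τ) :
    ∑ x, P x * q x = ℓ * ((1 - r) / 2) := by
  have h1 : ∑ x, P x * p x + ∑ x, P x * q x = ℓ := by
    rw [← Finset.sum_add_distrib]
    calc ∑ x, (P x * p x + P x * q x) = ∑ x, P x * ℓ := by
          refine Finset.sum_congr rfl fun x _ => ?_
          rw [← mul_add, ← Nat.cast_add, h.add_eq]
      _ = ℓ := by rw [← Finset.sum_mul, h.sum_eq_one, one_mul]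
  rw [h.sum_up] at h1
  linarith

/-- The depth `n` is `j - m`, and `m` has mean `ℓ r / 2`. The mean of `j` is estimated through `j (j
+ 1)` by `2 T j ≤ j² + T²`. The value `T = ℓ r / 2 + √ℓ` turns the known second moment into a mean
of `j` that is at most `T`. -/
theorem sum_depth_le (h : IsSpinLaw ℓ r y a d P Q n N p q τ) (hr0 : 0 ≤ r) (hr1 : r ≤ 1)
    (hℓ : 0 < ℓ) : ∑ x, P x * n x ≤ Real.sqrt ℓ := by
  have hℓ' : (0 : ℝ) < ℓ := Nat.cast_pos.mpr hℓ
  set S : ℝ := ℓ * r / 2 with hS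
  have hS0 : 0 ≤ S := by positivity
  have hw : 0 < Real.sqrt ℓ := Real.sqrt_pos.mpr hℓ'
  have hww : Real.sqrt ℓ * Real.sqrt ℓ = ℓ := Real.mul_self_sqrt hℓ'.le
  set T : ℝ := S + Real.sqrt ℓ with hT
  have hT0 : 0 < T := by positivity
  have h1 : ∀ x, P x * (2 * T * (n x + p x - ℓ / 2)) ≤
      P x * ((n x + p x - ℓ / 2) * (n x + p x - ℓ / 2 + 1)) + P x * T ^ 2 := by
    intro x
    rw [← mul_add]
    refine mul_le_mul_of_nonneg_left ?_ (h.left_nonneg hr0 hr1 x)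
    nlinarith [sq_nonneg ((n x + p x - ℓ / 2 : ℝ) - T), h.spin_nonneg x]
  have h2 := Finset.sum_le_sum fun x (_ : x ∈ Finset.univ) => h1 x
  rw [Finset.sum_add_distrib, h.sum_sq, ← Finset.sum_mul, h.sum_eq_one, one_mul] at h2
  have h3 : ∑ x, P x * (2 * T * (n x + p x - ℓ / 2)) = 2 * T * (∑ x, P x * n x + S) := by
    have : ∑ x, P x * (2 * T * (n x + p x - ℓ / 2)) =
        2 * T * (∑ x, P x * n x + ∑ x, P x * p x - (∑ x, P x) * (ℓ / 2)) := by
      rw [Finset.sum_mul, ← Finset.sum_add_distrib, ← Finset.sum_sub_distrib, Finset.mul_sum]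
      exact Finset.sum_congr rfl fun x _ => by ring
    rw [this, h.sum_up, h.sum_eq_one, hS]
    ring
  rw [h3] at h2
  have h4 : 2 * T * (∑ x, P x * n x + S) ≤ 2 * T * T := by
    refine h2.trans ?_
    have : (3 * ℓ + ℓ * (ℓ - 1) * r ^ 2) / 4 = 3 * ℓ / 4 + S ^ 2 - ℓ * r ^ 2 / 4 := by
      rw [hS]
      ring
    rw [this]
    have h5 : T * T = S ^ 2 + 2 * S * Real.sqrt ℓ + ℓ := by
      rw [hT]
      linear_combination hww
    have h6 : 0 ≤ S * Real.sqrt ℓ := by positivity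
    have h7 : 0 ≤ ℓ * r ^ 2 := by positivity
    nlinarith
  have := le_of_mul_le_mul_left h4 (by positivity : 0 < 2 * T)
  linarith

/-- The rate at which the relative entropy of the outcome distributions grows. -/
theorem sum_log_ratio (h : IsSpinLaw ℓ r y a d P Q n N p q τ) :
    ∑ x, P x * (p x * (Real.log ((1 + r) / 2) - Real.log a) +
      q x * (Real.log ((1 - r) / 2) - Real.log d)) =
    ℓ * ((1 + r) / 2 * (Real.log ((1 + r) / 2) - Real.log a) +
      (1 - r) / 2 * (Real.log ((1 - r) / 2) - Real.log d)) := by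
  have : ∀ x, P x * (p x * (Real.log ((1 + r) / 2) - Real.log a) +
      q x * (Real.log ((1 - r) / 2) - Real.log d)) =
      P x * p x * (Real.log ((1 + r) / 2) - Real.log a) +
        P x * q x * (Real.log ((1 - r) / 2) - Real.log d) := fun x => by ring
  rw [Finset.sum_congr rfl fun x _ => this x, Finset.sum_add_distrib, ← Finset.sum_mul,
    ← Finset.sum_mul, h.sum_up, h.sum_down]
  ring

theorem pos_of_left_ne_zero (h : IsSpinLaw ℓ r y a d P Q n N p q τ) (hr0 : 0 ≤ r) (hr1 : r ≤ 1)
    (hdr : 0 < d ∨ r = 1) {x : ι} (hx : P x ≠ 0) :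
    0 < ((1 + r) / 2) ^ p x ∧ 0 < ((1 - r) / 2) ^ q x ∧ 0 < τ x ∧ 0 < d ^ q x ∧
      (0 < d ∨ n x = 0) := by
  have hx' := hx
  rw [h.left_eq] at hx'
  have h1 : 0 ≤ (1 - r) / 2 := by linarith
  have hq : ((1 - r) / 2) ^ q x ≠ 0 := right_ne_zero_of_mul (left_ne_zero_of_mul hx')
  refine ⟨by positivity, lt_of_le_of_ne (by positivity) hq.symm,
    lt_of_le_of_ne (h.dim_nonneg x) (right_ne_zero_of_mul hx').symm, ?_⟩
  rcases hdr with hd | rfl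
  · exact ⟨by positivity, Or.inl hd⟩
  · have hq0 : q x = 0 := by
      by_contra h0
      exact hq (by rw [sub_self, zero_div, zero_pow h0])
    have := h.le_down x
    exact ⟨by rw [hq0, pow_zero]; exact one_pos, Or.inr (by omega)⟩

theorem log_ratio (h : IsSpinLaw ℓ r y a d P Q n N p q τ) (hr0 : 0 ≤ r) (hr1 : r ≤ 1)
    (hy : 0 ≤ y) (ha : 0 < a) (hd : 0 ≤ d) (hdr : 0 < d ∨ r = 1)
    {x : ι} (hx : P x ≠ 0) : 0 < Q x ∧
    Real.log (P x / Q x) = p x * Real.log ((1 + r) / 2) + q x * Real.log ((1 - r) / 2) -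
      Real.log (ladderSum (n x) (N x) (p x) (q x) y a d) := by
  obtain ⟨h1, h2, h3, h4, -⟩ := h.pos_of_left_ne_zero hr0 hr1 hdr hx
  have hc : 0 < ladderSum (n x) (N x) (p x) (q x) y a d :=
    (mul_pos (pow_pos ha _) h4).trans_le (le_ladderSum hy ha.le hd)
  rw [h.left_eq, h.right_eq]
  refine ⟨mul_pos hc h3, ?_⟩
  rw [mul_div_mul_right _ _ h3.ne', Real.log_div (mul_pos h1 h2).ne' hc.ne',
    Real.log_mul h1.ne' h2.ne', Real.log_pow, Real.log_pow]

theorem right_ne_zero (h : IsSpinLaw ℓ r y a d P Q n N p q τ) (hr0 : 0 ≤ r) (hr1 : r ≤ 1)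
    (hy : 0 ≤ y) (ha : 0 < a) (hd : 0 ≤ d) (hdr : 0 < d ∨ r = 1) :
    ∀ x, Q x = 0 → P x = 0 := fun x hx => by
  by_contra hP
  exact (h.log_ratio hr0 hr1 hy ha hd hdr hP).1.ne' hx

theorem klSum_le (h : IsSpinLaw ℓ r y a d P Q n N p q τ) (hr0 : 0 ≤ r) (hr1 : r ≤ 1)
    (hy : 0 ≤ y) (ha : 0 < a) (hd : 0 ≤ d) (hdr : 0 < d ∨ r = 1) :
    klSum P Q ≤
    ℓ * ((1 + r) / 2 * (Real.log ((1 + r) / 2) - Real.log a) +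
      (1 - r) / 2 * (Real.log ((1 - r) / 2) - Real.log d)) := by
  rw [← h.sum_log_ratio, klSum]
  refine Finset.sum_le_sum fun x _ => ?_
  by_cases hx : P x = 0
  · simp [hx]
  refine mul_le_mul_of_nonneg_left ?_ (h.left_nonneg hr0 hr1 x)
  obtain ⟨-, -, -, h4, -⟩ := h.pos_of_left_ne_zero hr0 hr1 hdr hx
  rw [(h.log_ratio hr0 hr1 hy ha hd hdr hx).2]
  have := Real.log_le_log (mul_pos (pow_pos ha _) h4)
    (le_ladderSum (n := n x) (N := N x) (p := p x) (q := q x) hy ha.le hd)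
  rw [Real.log_mul (pow_pos ha _).ne' h4.ne', Real.log_pow, Real.log_pow] at this
  linarith

/-- The logarithm of the bound in `ladderSum_le`, with `log (1 + x) ≤ x` for both correction
factors. The parameter `t` remains free, to be balanced against `√ℓ`. -/
theorem le_klSum (h : IsSpinLaw ℓ r y a d P Q n N p q τ) (hr0 : 0 ≤ r) (hr1 : r ≤ 1)
    (hy : 0 ≤ y) (ha : 0 < a) (hd : 0 ≤ d) (hdr : 0 < d ∨ r = 1)
    {t : ℝ} (ht : 0 < t) (hℓ : 0 < ℓ) :
    ℓ * ((1 + r) / 2 * (Real.log ((1 + r) / 2) - Real.log a) +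
      (1 - r) / 2 * (Real.log ((1 - r) / 2) - Real.log d)) - ℓ * t -
        y * a / d / t * Real.sqrt ℓ ≤ klSum P Q := by
  -- If `d = 0`, this quotient is `0`. That is consistent, since then `r = 1` and outcomes of
  -- positive probability have depth zero.
  have hz : 0 ≤ y * a / d / t := by positivity
  have hdepth := mul_le_mul_of_nonneg_left (h.sum_depth_le hr0 hr1 hℓ) hz
  suffices hs : ∑ x, P x * (p x * (Real.log ((1 + r) / 2) - Real.log a) +
      q x * (Real.log ((1 - r) / 2) - Real.log d)) - (∑ x, P x) * (ℓ * t) -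
      y * a / d / t * ∑ x, P x * n x ≤ klSum P Q by
    rw [h.sum_log_ratio, h.sum_eq_one, one_mul] at hs
    linarith
  rw [Finset.sum_mul, Finset.mul_sum, ← Finset.sum_sub_distrib, ← Finset.sum_sub_distrib, klSum]
  refine Finset.sum_le_sum fun x _ => ?_
  by_cases hx : P x = 0
  · simp [hx]
  obtain ⟨-, -, -, h4, h5⟩ := h.pos_of_left_ne_zero hr0 hr1 hdr hx
  rw [(h.log_ratio hr0 hr1 hy ha hd hdr hx).2]
  have hf : 0 < a ^ p x * d ^ q x := mul_pos (pow_pos ha _) h4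
  have h6 : 0 < (1 + t) ^ (p x + q x) := by positivity
  have h7 : 0 < (1 + y * a / d / t) ^ n x := by positivity
  have := Real.log_le_log (hf.trans_le (le_ladderSum (n := n x) (N := N x) hy ha.le hd))
    (ladderSum_le hy ha.le hd ht (h.le_down x) (h.le_up x) h5)
  rw [Real.log_mul hf.ne' (mul_pos h6 h7).ne', Real.log_mul h6.ne' h7.ne',
    Real.log_mul (pow_pos ha _).ne' h4.ne', Real.log_pow, Real.log_pow, Real.log_pow,
    Real.log_pow, h.add_eq] at this
  have l1 : Real.log (1 + t) ≤ t := by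
    have := Real.log_le_sub_one_of_pos (by linarith : 0 < 1 + t)
    linarith
  have l2 : Real.log (1 + y * a / d / t) ≤ y * a / d / t := by
    have := Real.log_le_sub_one_of_pos (by linarith : 0 < 1 + y * a / d / t)
    linarith
  have l3 := mul_le_mul_of_nonneg_left l1 (Nat.cast_nonneg (α := ℝ) ℓ)
  have l4 := mul_le_mul_of_nonneg_left l2 (Nat.cast_nonneg (α := ℝ) (n x))
  have l5 : P x * (p x * (Real.log ((1 + r) / 2) - Real.log a) +
      q x * (Real.log ((1 - r) / 2) - Real.log d)) - P x * (ℓ * t) -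
      y * a / d / t * (P x * n x) = P x * (p x * (Real.log ((1 + r) / 2) - Real.log a) +
      q x * (Real.log ((1 - r) / 2) - Real.log d) - ℓ * t - n x * (y * a / d / t)) := by ring
  rw [l5]
  refine mul_le_mul_of_nonneg_left ?_ (h.left_nonneg hr0 hr1 x)
  linarith

/-- An exponential bound on likelihood ratios that does not need nested supports: two distinct pure
states can have a finite rate under this measurement. If `d = 0`, then `log d = 0`, and only
outcomes without spins down occur. -/
theorem left_le (h : IsSpinLaw ℓ r y a d P Q n N p q τ) (hr0 : 0 ≤ r) (hr1 : r ≤ 1)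
    (hy : 0 ≤ y) (ha : 0 < a) (hd : 0 ≤ d) (hdr : 0 < d ∨ r = 1)
    (x : ι) : P x ≤ Real.exp ((|Real.log a| + |Real.log d|) * ℓ) * Q x := by
  have hQ : 0 ≤ Q x := by
    rw [h.right_eq]
    exact mul_nonneg ((by positivity : 0 ≤ a ^ p x * d ^ q x).trans (le_ladderSum hy ha.le hd))
      (h.dim_nonneg x)
  by_cases hx : P x = 0
  · rw [hx]
    positivity
  obtain ⟨-, -, h3, h4, -⟩ := h.pos_of_left_ne_zero hr0 hr1 hdr hx
  have hf : 0 < a ^ p x * d ^ q x := mul_pos (pow_pos ha _) h4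
  have h1 : ((1 + r) / 2) ^ p x * ((1 - r) / 2) ^ q x ≤ 1 :=
    mul_le_one₀ (pow_le_one₀ (by linarith) (by linarith)) (pow_nonneg (by linarith) _)
      (pow_le_one₀ (by linarith) (by linarith))
  have h2 : 1 ≤ Real.exp ((|Real.log a| + |Real.log d|) * ℓ) * (a ^ p x * d ^ q x) := by
    rw [← Real.exp_log hf, ← Real.exp_add, Real.one_le_exp_iff,
      Real.log_mul (pow_pos ha _).ne' h4.ne', Real.log_pow, Real.log_pow, ← h.add_eq x]
    push_cast
    have e1 := neg_abs_le (Real.log a)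
    have e2 := neg_abs_le (Real.log d)
    have e3 := abs_nonneg (Real.log a)
    have e4 := abs_nonneg (Real.log d)
    have p0 : (0 : ℝ) ≤ p x := Nat.cast_nonneg _
    have q0 : (0 : ℝ) ≤ q x := Nat.cast_nonneg _
    nlinarith [mul_nonneg p0 e4, mul_nonneg q0 e3]
  rw [h.left_eq, h.right_eq, ← mul_assoc]
  refine mul_le_mul_of_nonneg_right (h1.trans (h2.trans ?_)) h3.le
  exact mul_le_mul_of_nonneg_left (le_ladderSum hy ha.le hd) (Real.exp_nonneg _)

-- If `a = 0`, the other state produces only outcomes without spins up. The number of spins up is at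
-- most `ℓ` and has mean at least `ℓ / 2`, so excluding outcomes have probability at least one half.
open scoped Classical in
theorem hit_of_left (h : IsSpinLaw ℓ r y 0 d P Q n N p q τ) (hr0 : 0 ≤ r) (hr1 : r ≤ 1)
    (hℓ : 0 < ℓ) : 1 / 2 ≤ ∑ x, if Q x = 0 then P x else 0 := by
  have hℓ' : (0 : ℝ) < ℓ := Nat.cast_pos.mpr hℓ
  have h1 : ∀ x, P x * p x ≤ ℓ * if Q x = 0 then P x else 0 := by
    intro x
    have hP := h.left_nonneg hr0 hr1 x
    split_ifs with hQ
    · rw [mul_comm]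
      refine mul_le_mul_of_nonneg_right ?_ hP
      have := h.add_eq x
      exact_mod_cast (by omega : p x ≤ ℓ)
    · have hp : p x = 0 := by
        by_contra hp
        exact hQ (by rw [h.right_eq, ladderSum_eq_zero_of_left hp, zero_mul])
      simp [hp]
  have h2 := Finset.sum_le_sum fun x (_ : x ∈ Finset.univ) => h1 x
  rw [h.sum_up, ← Finset.mul_sum] at h2
  have := le_of_mul_le_mul_left h2 hℓ'
  linarith

-- If `d = 0`, the other state can produce only the maximal spin `j = ℓ / 2`. The mean of `j (j +
-- 1)` falls short of its maximal value by a fixed fraction when `r < 1`, and a Markov estimate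
-- bounds the probability of smaller spins from below. One qubit always has spin one half, hence `2
-- ≤ ℓ`.
open scoped Classical in
theorem hit_of_right (h : IsSpinLaw ℓ r y a 0 P Q n N p q τ) (hr0 : 0 ≤ r) (hr1 : r ≤ 1)
    (hℓ : 2 ≤ ℓ) : (1 - r ^ 2) / 4 ≤ ∑ x, if Q x = 0 then P x else 0 := by
  have hℓ' : (2 : ℝ) ≤ ℓ := by exact_mod_cast hℓ
  have h1 : ∀ x, (P x - if Q x = 0 then P x else 0) * (ℓ / 2 * (ℓ / 2 + 1)) ≤
      P x * ((n x + p x - ℓ / 2) * (n x + p x - ℓ / 2 + 1)) := by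
    intro x
    have hP := h.left_nonneg hr0 hr1 x
    have hJ := h.spin_nonneg x
    split_ifs with hQ
    · rw [sub_self, zero_mul]
      exact mul_nonneg hP (mul_nonneg hJ (by linarith))
    · have hn : n x = q x := by
        by_contra hn
        exact hQ (by rw [h.right_eq, ladderSum_eq_zero_of_right
          (lt_of_le_of_ne (h.le_down x) hn), zero_mul])
      have : (n x + p x - ℓ / 2 : ℝ) = ℓ / 2 := by
        rw [hn, ← h.add_eq x]
        push_cast
        ring
      rw [this, sub_zero]
  have h2 := Finset.sum_le_sum fun x (_ : x ∈ Finset.univ) => h1 x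
  rw [h.sum_sq, ← Finset.sum_mul, Finset.sum_sub_distrib, h.sum_eq_one] at h2
  set H := ∑ x, if Q x = 0 then P x else 0
  have hr2 : r ^ 2 ≤ 1 := pow_le_one₀ hr0 hr1
  by_contra hH
  push Not at hH
  nlinarith [mul_nonneg (sub_nonneg.mpr hr2) (sub_nonneg.mpr hℓ'),
    mul_nonneg (mul_nonneg (sub_nonneg.mpr hr2) (sub_nonneg.mpr hℓ')) (by linarith : (0 : ℝ) ≤ ℓ),
    mul_pos (sub_pos.mpr hH) (by nlinarith : (0 : ℝ) < ℓ * (ℓ + 2))]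

end IsSpinLaw

/-! ### Rates of the spin measurement -/

theorem exists_conj_eq (ρ : State 2) {U : Matrix (Fin 2) (Fin 2) ℂ} (hU : Uᴴ * U = 1) :
    ∃ (g : ℂ) (d : ℝ), 0 ≤ d ∧ 0 ≤ ((Uᴴ * ρ.mat * U) 0 0).re ∧
      ((Uᴴ * ρ.mat * U) 0 0).re * d = ρ.mat.det.re ∧
      ρ.mat = U * (!![1, 0; g, 1] *
        Matrix.diagonal ![((((Uᴴ * ρ.mat * U) 0 0).re : ℝ) : ℂ), (d : ℂ)] *
          !![1, star g; 0, 1]) * Uᴴ := by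
  have hU' : U * Uᴴ = 1 := mul_eq_one_comm.mp hU
  have hpos : (Uᴴ * ρ.mat * U).PosSemidef := ρ.posSemidef.conjTranspose_mul_mul_same U
  obtain ⟨g, d, hd, h1, h2⟩ := exists_eq_lower_mul_diagonal_mul hpos
  refine ⟨g, d, hd, (Complex.le_def.mp (hpos.diag_nonneg (i := 0))).1, ?_, ?_⟩
  · rw [h1, Matrix.det_mul, Matrix.det_mul, mul_right_comm, ← Matrix.det_mul, hU, Matrix.det_one,
      one_mul]
  · rw [← h2, ← mul_assoc, ← mul_assoc, hU', one_mul, mul_assoc, hU', mul_one]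

namespace IsSpinMeasurement

variable {ℓ : ℕ} {v : EuclideanSpace ℝ (Fin 3)} {K : BlockPOVM 2 ℓ} {j m : Fin K.outcomes → ℝ}
  {σ : State 2} {r : ℝ}

/-- Every qubit state has a triangular factorization in the rotated basis, so its compressions are
the explicit scalars `ladderSum`. No maximality argument is needed here. -/
theorem isSharp (h : IsSpinMeasurement v K j m) (hv : ‖v‖ = 1) (hσ : IsBloch σ r v) :
    K.IsSharp σ := by
  obtain ⟨U, hU, hU', hUv⟩ := exists_rotation hv
  obtain ⟨n, N, p, q, hc⟩ := h.exists_counts hU hUv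
  refine ⟨h.mul_self, fun x => ⟨((1 + r) / 2) ^ p x * ((1 - r) / 2) ^ q x, ?_⟩,
    fun x ρ => ?_⟩
  · rw [hσ.eq_conj_diagonal hU' hUv]
    exact (hc x).2.2.2.2.2.2 _ _
  · obtain ⟨g, d, -, -, -, hρ⟩ := exists_conj_eq ρ hU
    exact ⟨_, by rw [hρ]; exact (hc x).2.2.2.2.2.1 g _ d⟩

theorem exists_isSpinLaw (h : IsSpinMeasurement v K j m) (hv : ‖v‖ = 1) (hσ : IsBloch σ r v)
    {U : Matrix (Fin 2) (Fin 2) ℂ} (hU : Uᴴ * U = 1)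
    (hUv : U * pauli 2 * Uᴴ = ∑ a, (v a : ℂ) • pauli a) {ρ : State 2} {g : ℂ} {a d : ℝ}
    (hρ : ρ.mat = U * (!![1, 0; g, 1] * Matrix.diagonal ![(a : ℂ), (d : ℂ)] *
      !![1, star g; 0, 1]) * Uᴴ) :
    ∃ n N p q : Fin K.outcomes → ℕ, IsSpinLaw ℓ r (Complex.normSq g) a d (K.prob σ) (K.prob ρ)
      n N p q fun x => (K.effect x).trace.re := by
  have hU' : U * Uᴴ = 1 := mul_eq_one_comm.mp hU
  obtain ⟨n, N, p, q, hc⟩ := h.exists_counts hU hUv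
  have hj : ∀ x, j x = n x + p x - ℓ / 2 := fun x => by
    obtain ⟨-, -, -, h1, h2, -⟩ := hc x
    linarith
  refine ⟨n, N, p, q, fun x => (hc x).1, fun x => (hc x).2.1, fun x => (hc x).2.2.1, fun x => ?_,
    fun x => ?_, fun x => ?_, fun x => ?_, K.sum_prob σ, ?_, ?_⟩
  · rw [← hj]
    exact h.nonneg x
  · exact (Complex.le_def.mp (K.posSemidef x).trace_nonneg).1
  · refine BlockPOVM.IsSharp.prob_eq_of_eigenvalue ?_
    rw [hσ.eq_conj_diagonal hU' hUv]
    exact (hc x).2.2.2.2.2.2 _ _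
  · refine (h.isSharp hv hσ).prob_eq_of_compression ?_
    rw [hρ]
    exact (hc x).2.2.2.2.2.1 g a d
  · have h1 : ∑ x, K.prob σ x * p x = ∑ x, K.prob σ x * m x + (∑ x, K.prob σ x) * (ℓ / 2) := by
      rw [Finset.sum_mul, ← Finset.sum_add_distrib]
      refine Finset.sum_congr rfl fun x _ => ?_
      rw [(hc x).2.2.2.1]
      ring
    rw [h1, h.sum_prob_mul_proj, hσ.trace_angMomAlong_mul hv, K.sum_prob]
    ring
  · simp only [← hj]
    rw [h.sum_prob_mul_sq, hσ.trace_angMomSq_mul hv]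

end IsSpinMeasurement

theorem tendsto_inv_sqrt_sqrt :
    Tendsto (fun ℓ : ℕ => (Real.sqrt (Real.sqrt ℓ))⁻¹) atTop (𝓝 0) :=
  tendsto_inv_atTop_zero.comp (Real.tendsto_sqrt_atTop.comp
    (Real.tendsto_sqrt_atTop.comp tendsto_natCast_atTop_atTop))

/-- The pivots satisfy `a d = det ρ = (1 - r₀²) / 4`. Eliminating `d` leaves the angle only in the
term with coefficient `r₁`. -/
theorem qubitRate_eq {r₀ r₁ θ d : ℝ} (h1 : r₁ ∈ Set.Icc (0 : ℝ) 1)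
    (ha : 0 < (1 + r₀ * Real.cos θ) / 2)
    (had : (1 + r₀ * Real.cos θ) / 2 * d = (1 - r₀ ^ 2) / 4) (hr₀ : r₀ ∈ Set.Icc (0 : ℝ) 1)
    (h : r₀ < 1 ∨ r₁ = 1) :
    qubitRate r₀ r₁ θ = ENNReal.ofReal
      ((1 + r₁) / 2 * (Real.log ((1 + r₁) / 2) - Real.log ((1 + r₀ * Real.cos θ) / 2)) +
        (1 - r₁) / 2 * (Real.log ((1 - r₁) / 2) - Real.log d)) := by
  rw [qubitRate, if_pos ⟨h, by linarith⟩]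
  congr 1
  have hp : (0 : ℝ) < 1 + r₁ := by linarith [h1.1]
  have hA : (0 : ℝ) < 1 + r₀ * Real.cos θ := by linarith
  have e1 : Real.log ((1 + r₁) / (1 + r₀ * Real.cos θ)) =
      Real.log ((1 + r₁) / 2) - Real.log ((1 + r₀ * Real.cos θ) / 2) := by
    rw [← Real.log_div (by positivity) (by positivity)]
    congr 1
    field_simp
  rw [e1]
  rcases h1.2.eq_or_lt with rfl | hlt
  · ring
  · have hr : r₀ < 1 := h.resolve_right hlt.ne
    have hm : 0 < 1 - r₁ := by linarith
    have hδ : 0 < 1 - r₀ ^ 2 := by nlinarith [hr₀.1]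
    have hd : 0 < d := by
      by_contra hd
      push Not at hd
      nlinarith
    have e2 : Real.log ((1 - r₁ ^ 2) / (1 - r₀ ^ 2)) = Real.log ((1 + r₁) / 2) +
        Real.log ((1 - r₁) / 2) - (Real.log ((1 + r₀ * Real.cos θ) / 2) + Real.log d) := by
      rw [← Real.log_mul (by positivity) (by positivity), ← Real.log_mul ha.ne' hd.ne', had,
        ← Real.log_div (by positivity) (by positivity)]
      congr 1
      field_simp
      ring
    rw [e2]
    ring

theorem qubitRate_eq_spectralEntropy {r₀ r₁ θ : ℝ} (hr₀ : r₀ ∈ Set.Icc (0 : ℝ) 1)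
    (hr₁ : r₁ ∈ Set.Icc (0 : ℝ) 1) (h : r₀ < 1) :
    qubitRate r₀ r₁ θ = ENNReal.ofReal (spectralEntropy r₁ r₀ +
      r₁ * Real.log ((1 + r₀) / (1 + r₀ * Real.cos θ))) := by
  have hcos : -1 < r₀ * Real.cos θ := by
    have h1 := Real.neg_one_le_cos θ
    nlinarith [hr₀.1]
  rw [qubitRate, if_pos ⟨Or.inl h, hcos⟩, spectralEntropy]
  congr 1
  have hp : (0 : ℝ) < 1 + r₁ := by linarith [hr₁.1]
  have hA : (0 : ℝ) < 1 + r₀ * Real.cos θ := by linarith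
  have hp0 : (0 : ℝ) < 1 + r₀ := by linarith [hr₀.1]
  have hm0 : (0 : ℝ) < 1 - r₀ := by linarith
  rw [Real.log_div hp.ne' hA.ne', Real.log_div hp0.ne' hA.ne', Real.log_div hp.ne' hp0.ne']
  rcases hr₁.2.eq_or_lt with rfl | hlt
  · ring
  · have hm : 0 < 1 - r₁ := by linarith
    have e1 : 1 - r₁ ^ 2 = (1 + r₁) * (1 - r₁) := by ring
    have e0 : 1 - r₀ ^ 2 = (1 + r₀) * (1 - r₀) := by ring
    rw [e1, e0, Real.log_div (by positivity) (by positivity), Real.log_mul hp.ne' hm.ne',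
      Real.log_mul hp0.ne' hm0.ne', Real.log_div hm.ne' hm0.ne']
    ring

theorem tendsto_relEntropy_top {d : ℕ} {K : ∀ ℓ, BlockPOVM d ℓ} {ρ σ : State d} {κ : ℝ}
    (hκ : 0 < κ) (hK : ∀ᶠ ℓ in atTop, κ ≤ (K ℓ).hitProb ρ σ) :
    Tendsto (fun ℓ : ℕ => (K ℓ).relEntropy ρ σ / ℓ) atTop (𝓝 ∞) := by
  refine tendsto_const_nhds.congr' ?_
  filter_upwards [hK] with ℓ h
  rw [(K ℓ).relEntropy_eq_top_iff.mpr (hκ.trans_le h),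
    ENNReal.top_div_of_ne_top (ENNReal.natCast_ne_top ℓ)]

section SpinRate

variable {v u : EuclideanSpace ℝ (Fin 3)} {M : ∀ ℓ, BlockPOVM 2 ℓ}
  {j m : ∀ ℓ, Fin (M ℓ).outcomes → ℝ} {s : Fin 2 → State 2} {r₀ r₁ : ℝ}

/-- The rate of the spin measurement along the axis of the state `s 1` under this state. -/
theorem tendsto_and_attainsRate_qubitRate (hM : ∀ ℓ, IsSpinMeasurement v (M ℓ) (j ℓ) (m ℓ))
    (hv : ‖v‖ = 1) (hu : ‖u‖ = 1) (hr₀ : r₀ ∈ Set.Icc (0 : ℝ) 1) (hr₁ : r₁ ∈ Set.Icc (0 : ℝ) 1)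
    (h₀ : IsBloch (s 0) r₀ u) (h₁ : IsBloch (s 1) r₁ v) :
    Tendsto (fun ℓ : ℕ => (M ℓ).relEntropy (s 1) (s 0) / ℓ) atTop
        (𝓝 (qubitRate r₀ r₁ (InnerProductGeometry.angle u v))) ∧
      AttainsRate s (fun ℓ => blockSampling (M ℓ)) 1
        (qubitRate r₀ r₁ (InnerProductGeometry.angle u v)) := by
  obtain ⟨U, hU, hU', hUv⟩ := exists_rotation hv
  obtain ⟨g, d, hd, ha, had, hρ⟩ := exists_conj_eq (s 0) hU
  have hcos : Real.cos (InnerProductGeometry.angle u v) = inner ℝ u v := by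
    rw [InnerProductGeometry.cos_angle, hu, hv]
    simp
  rw [h₀.det_eq hu, Complex.ofReal_re] at had
  rw [h₀.conj_zero_zero hU' hUv, ← hcos] at ha had hρ
  set θ := InnerProductGeometry.angle u v
  set a : ℝ := (1 + r₀ * Real.cos θ) / 2 with hadef
  have law := fun ℓ => (hM ℓ).exists_isSpinLaw hv h₁ hU hUv hρ
  have htop : ∀ κ : ℝ, 0 < κ → (∀ᶠ ℓ in atTop, κ ≤ (M ℓ).hitProb (s 1) (s 0)) →
      ¬ ((r₀ < 1 ∨ r₁ = 1) ∧ -1 < r₀ * Real.cos θ) →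
      Tendsto (fun ℓ : ℕ => (M ℓ).relEntropy (s 1) (s 0) / ℓ) atTop (𝓝 (qubitRate r₀ r₁ θ)) ∧
        AttainsRate s (fun ℓ => blockSampling (M ℓ)) 1 (qubitRate r₀ r₁ θ) := by
    intro κ hκ hhit hne
    rw [qubitRate, if_neg hne]
    exact ⟨tendsto_relEntropy_top hκ hhit, attainsRate_blockSampling_top hκ hhit⟩
  rcases ha.eq_or_lt with ha0 | ha0
  -- The first pivot vanishes exactly when `r₀ cos θ = -1`: the other state is pure and opposite to
  -- the measured axis.
  · refine htop (1 / 2) (by norm_num) ?_ fun h => by linarith [h.2]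
    filter_upwards [eventually_gt_atTop 0] with ℓ hℓ
    obtain ⟨n, N, p, q, h⟩ := law ℓ
    rw [← ha0] at h
    exact h.hit_of_left hr₁.1 hr₁.2 hℓ
  by_cases hcase : r₀ < 1 ∨ r₁ = 1
  · have hdr : 0 < d ∨ r₁ = 1 := by
      refine hcase.imp (fun hr => ?_) id
      by_contra hd'
      have : d = 0 := le_antisymm (not_lt.mp hd') hd
      rw [this, mul_zero] at had
      nlinarith [hr₀.1]
    set y := Complex.normSq g
    have hy : 0 ≤ y := Complex.normSq_nonneg g
    rw [qubitRate_eq hr₁ ha0 had hr₀ hcase, ← hadef]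
    set R : ℝ := (1 + r₁) / 2 * (Real.log ((1 + r₁) / 2) - Real.log a) +
      (1 - r₁) / 2 * (Real.log ((1 - r₁) / 2) - Real.log d) with hR
    have hlim : Tendsto (fun ℓ : ℕ => klSum ((M ℓ).prob (s 1)) ((M ℓ).prob (s 0)) / ℓ) atTop
        (𝓝 R) := by
      -- The parameter of `le_klSum` is taken as `t = ℓ^(-1/4)`, which balances the two errors: `ℓ
      -- t` and `√ℓ / t` are both of order `ℓ^(3/4)`.
      have hlow : Tendsto (fun ℓ : ℕ => R - (1 + y * a / d) * (Real.sqrt (Real.sqrt ℓ))⁻¹) atTop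
          (𝓝 R) := by
        simpa using tendsto_const_nhds.sub (tendsto_inv_sqrt_sqrt.const_mul (1 + y * a / d))
      refine tendsto_of_tendsto_of_tendsto_of_le_of_le' hlow tendsto_const_nhds ?_ ?_
      · filter_upwards [eventually_gt_atTop 0] with ℓ hℓ
        obtain ⟨n, N, p, q, h⟩ := law ℓ
        have hℓ' : (0 : ℝ) < ℓ := Nat.cast_pos.mpr hℓ
        set w := Real.sqrt (Real.sqrt ℓ) with hw
        have hw0 : 0 < w := Real.sqrt_pos.mpr (Real.sqrt_pos.mpr hℓ')
        have hww : Real.sqrt ℓ = w * w := (Real.mul_self_sqrt (Real.sqrt_nonneg _)).symm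
        have hℓw : (ℓ : ℝ) = w * w * (w * w) := by
          rw [← hww, Real.mul_self_sqrt hℓ'.le]
        have := h.le_klSum hr₁.1 hr₁.2 hy ha0 hd hdr (inv_pos.mpr hw0) hℓ
        rw [le_div_iff₀ hℓ']
        refine le_trans (le_of_eq ?_) this
        rw [hww, ← hR, hℓw]
        generalize y * a / d = z
        field_simp
        ring
      · filter_upwards [eventually_gt_atTop 0] with ℓ hℓ
        obtain ⟨n, N, p, q, h⟩ := law ℓ
        rw [div_le_iff₀ (Nat.cast_pos.mpr hℓ), mul_comm]
        exact h.klSum_le hr₁.1 hr₁.2 hy ha0 hd hdr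
    have hlim' : Tendsto (fun ℓ : ℕ => (M ℓ).relEntropy (s 1) (s 0) / ℓ) atTop
        (𝓝 (ENNReal.ofReal R)) := by
      refine ((ENNReal.continuous_ofReal.tendsto R).comp hlim).congr' ?_
      filter_upwards [eventually_gt_atTop 0] with ℓ hℓ
      obtain ⟨n, N, p, q, h⟩ := law ℓ
      rw [(M ℓ).relEntropy_eq (h.right_ne_zero hr₁.1 hr₁.2 hy ha0 hd hdr), Function.comp_apply,
        ENNReal.ofReal_div_of_pos (Nat.cast_pos.mpr hℓ), ENNReal.ofReal_natCast]
    refine ⟨hlim', attainsRate_blockSampling (B := |Real.log a| + |Real.log d|)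
      ENNReal.ofReal_ne_top hlim' (by positivity) (Eventually.of_forall fun ℓ x => ?_)⟩
    obtain ⟨n, N, p, q, h⟩ := law ℓ
    exact h.left_le hr₁.1 hr₁.2 hy ha0 hd hdr x
  · have hr : r₀ = 1 := le_antisymm hr₀.2 (not_lt.mp fun h => hcase (Or.inl h))
    have hr' : r₁ < 1 := lt_of_le_of_ne hr₁.2 fun h => hcase (Or.inr h)
    -- A pure state has determinant zero, and the first pivot is positive, so the second one
    -- vanishes.
    have hd0 : d = 0 := by
      rw [hr] at had
      exact (mul_eq_zero.mp (had.trans (by norm_num))).resolve_left ha0.ne'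
    refine htop ((1 - r₁ ^ 2) / 4) (by nlinarith [hr₁.1]) ?_ fun h => hcase h.1
    filter_upwards [eventually_ge_atTop 2] with ℓ hℓ
    obtain ⟨n, N, p, q, h⟩ := law ℓ
    rw [hd0] at h
    exact h.hit_of_right hr₁.1 hr₁.2 hℓ

end SpinRate

end

end SeqQHT

/-! ### The complete theorem, with `optimalRate` as the function `G` of the Bayesian part -/

theorem mainTheorem4 :
    -- the tests for the weak criterion respect the prescribed error bounds, for every schedule
    (∀ (d : ℕ) (s : Fin 2 → State d) (η e : Fin 2 → ℝ) (S : Schedule d) (ν : Fin 2),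
      (∀ i, 0 < e i) →
      (SPRT.mk s η .weak e S).errorProb ν ≤ ENNReal.ofReal (e ν)) ∧
    -- block-sampling with a fixed measurement on blocks of fixed length
    (∀ (d : ℕ) (s : Fin 2 → State d) (c : Criterion) (η : Fin 2 → ℝ) (ν : Fin 2)
      (ℓ : ℕ), IsPrior η → 1 ≤ ℓ →
      (∀ K : BlockPOVM d ℓ,
        Tendsto (fun e => (SPRT.mk s η c e (blockSampling K)).meanCopies ν /
            negLog (e ν)) smallErrors
          (𝓝 (ℓ / K.relEntropy (s ν) (s (1 - ν))))) ∧
      Tendsto (fun e => (⨅ K : BlockPOVM d ℓ,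
            (SPRT.mk s η c e (blockSampling K)).meanCopies ν) /
            negLog (e ν)) smallErrors
          (𝓝 (⨅ K : BlockPOVM d ℓ, ℓ / K.relEntropy (s ν) (s (1 - ν))))) ∧
    -- long blocks
    (∀ (d : ℕ) (s : Fin 2 → State d) (ν : Fin 2),
      Tendsto (fun ℓ : ℕ => ⨅ K : BlockPOVM d ℓ, ℓ / K.relEntropy (s ν) (s (1 - ν))) atTop
        (𝓝 (relEntropy (s ν) (s (1 - ν)))⁻¹) ∧
      ∀ (c : Criterion) (η : Fin 2 → ℝ), IsPrior η →
        Tendsto (fun e => (⨅ (ℓ : ℕ) (_ : 1 ≤ ℓ) (K : BlockPOVM d ℓ),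
            (SPRT.mk s η c e (blockSampling K)).meanCopies ν) /
            negLog (e ν)) smallErrors
          (𝓝 (relEntropy (s ν) (s (1 - ν)))⁻¹)) ∧
    -- one hypothesis: a measurement that depends only on the state of the other hypothesis
    (∀ d : ℕ, ∃ F : State d → ∀ ℓ, BlockPOVM d ℓ,
      ∀ (s : Fin 2 → State d) (ν : Fin 2),
        AttainsRate s (fun ℓ => blockSampling (F (s (1 - ν)) ℓ)) ν
          (relEntropy (s ν) (s (1 - ν)))) ∧
    -- the Bayesian mean
    (∀ (d : ℕ) (s : Fin 2 → State d) (c : Criterion) (η : Fin 2 → ℝ),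
      IsPrior η → s 0 ≠ s 1 →
      (relEntropy (s 0) (s 1) ≠ ∞ ∨ relEntropy (s 1) (s 0) ≠ ∞) →
      ∃ G : (Fin 2 → ℝ) → ℝ≥0∞,
        (∀ e, (∀ ν, 0 < e ν ∧ e ν < 1) →
          Tendsto (fun ℓ => blockRate s η e ℓ) atTop (𝓝 (G e))) ∧
        ∀ ℓ₀ : ℕ, 1 ≤ ℓ₀ →
          Tendsto (fun e => (⨅ (ℓ : ℕ) (_ : ℓ₀ ≤ ℓ) (K : BlockPOVM d ℓ),
              (SPRT.mk s η c e (blockSampling K)).bayesMean) / G e)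
            smallErrors (𝓝 1)) ∧
    -- commuting states: both means
    (∀ (d : ℕ) (s : Fin 2 → State d), Commute (s 0).mat (s 1).mat →
      ∃ K : ∀ ℓ, BlockPOVM d ℓ, ∀ ν,
        AttainsRate s (fun ℓ => blockSampling (K ℓ)) ν
          (relEntropy (s ν) (s (1 - ν)))) ∧
    -- one support not contained in the other: both means
    (∀ (d : ℕ) (s : Fin 2 → State d) (ν : Fin 2), ¬ (s (1 - ν)).supp ≤ (s ν).supp →
      relEntropy (s (1 - ν)) (s ν) = ∞ ∧
      ∃ (E : BlockPOVM d 1) (K : ∀ ℓ, BlockPOVM d ℓ) (C : ℝ≥0),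
        (AttainsRate s (fun ℓ => blockSampling (K ℓ)) ν
            (relEntropy (s ν) (s (1 - ν))) ∧
          ∀ (c : Criterion) (η e : Fin 2 → ℝ) (ℓ : ℕ), IsPrior η → (∀ i, 0 < e i) →
            (SPRT.mk s η c e (blockSampling (K ℓ))).meanCopies (1 - ν) ≤ C * ℓ) ∧
        (AttainsRate s (fun ℓ => prefixedSampling ℓ E (K ℓ)) ν
            (relEntropy (s ν) (s (1 - ν))) ∧
          ∀ (c : Criterion) (η e : Fin 2 → ℝ) (ℓ : ℕ), IsPrior η → (∀ i, 0 < e i) →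
            (SPRT.mk s η c e
              (prefixedSampling ℓ E (K ℓ))).meanCopies (1 - ν) ≤ C)) ∧
    -- qubits: simultaneous measurement of `J²` and of the component along the axis of `s 1`
    (∀ v : EuclideanSpace ℝ (Fin 3), ‖v‖ = 1 →
      ∃ M : ∀ ℓ, BlockPOVM 2 ℓ, (∀ ℓ, IsAngMomMeasurement v (M ℓ)) ∧
        ∀ (u : EuclideanSpace ℝ (Fin 3)) (r₀ r₁ θ : ℝ) (s : Fin 2 → State 2),
          ‖u‖ = 1 → θ = InnerProductGeometry.angle u v → r₀ ∈ Set.Icc (0 : ℝ) 1 →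
          r₁ ∈ Set.Icc (0 : ℝ) 1 → IsBloch (s 0) r₀ u → IsBloch (s 1) r₁ v →
          Tendsto (fun ℓ : ℕ => (M ℓ).relEntropy (s 0) (s 1) / ℓ) atTop
              (𝓝 (relEntropy (s 0) (s 1))) ∧
          Tendsto (fun ℓ : ℕ => (M ℓ).relEntropy (s 1) (s 0) / ℓ) atTop
              (𝓝 (qubitRate r₀ r₁ θ)) ∧
          (r₀ < 1 → qubitRate r₀ r₁ θ = ENNReal.ofReal (spectralEntropy r₁ r₀ +
            r₁ * Real.log ((1 + r₀) / (1 + r₀ * Real.cos θ)))) ∧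
          AttainsRate s (fun ℓ => blockSampling (M ℓ)) 0
            (relEntropy (s 0) (s 1)) ∧
          AttainsRate s (fun ℓ => blockSampling (M ℓ)) 1
            (qubitRate r₀ r₁ θ)) := by
  refine ⟨fun d s η e S ν _ => SPRT.errorProb_le s η e S ν, fun d s c η ν ℓ hη hℓ =>
    ⟨fun K => tendsto_meanCopies_blockSampling s c hη.1 ν hℓ K,
      tendsto_iInf_meanCopies_blockSampling s c hη.1 ν hℓ⟩,
    fun d s ν => ⟨tendsto_iInf_div_relEntropy _ _, fun c η hη =>
      tendsto_iInf_iInf_meanCopies_relEntropy s c hη.1 ν⟩, exists_attainsRate,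
    fun d s c η hη hs hD => ⟨_, fun e _ => tendsto_blockRate e, fun ℓ₀ hℓ₀ =>
      tendsto_iInf_bayesMean hη hs c hD hℓ₀⟩,
    fun d s => exists_attainsRate_of_commute s, fun d s ν h => ⟨relEntropy_eq_top_iff.mpr h, ?_⟩,
    ?_⟩
  · obtain ⟨E, K, C, ⟨h1, -, -, h2⟩, h3⟩ := exists_attainsRate_of_not_supp_le s ν h
    exact ⟨E, K, C, ⟨h1, h2⟩, h3⟩
  · intro v hv
    choose M j m hM using exists_isSpinMeasurement hv
    refine ⟨M, fun ℓ => (hM ℓ).isAngMomMeasurement, ?_⟩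
    rintro u r₀ r₁ θ s hu rfl hr₀ hr₁ h₀ h₁
    have hS : ∀ ℓ, (M ℓ).IsSharp (s 1) := fun ℓ => (hM ℓ).isSharp hv h₁
    have hn : ∀ ℓ, (M ℓ).outcomes ≤ (ℓ + 1) ^ 4 := fun ℓ => (hM ℓ).outcomes_le
    have hrate := tendsto_and_attainsRate_qubitRate hM hv hu hr₀ hr₁ h₀ h₁
    exact ⟨tendsto_relEntropy_of_isSharp hS hn _, hrate.1,
      qubitRate_eq_spectralEntropy hr₀ hr₁, attainsRate_of_isSharp (ν := 0) hS hn rfl, hrate.2⟩
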